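/- Let $p$ be an odd prime, $\mathbb F_p=\mathbb Z/p$, $\mathcal H_p=\mathbb C^p$ with orthonormal basis $\{|x\rangle : x\in\mathbb F_p\}$, $\xi(a)=e^{2\pi i a/p}$, $X|x\rangle=|x+1\rangle$, $Z|x\rangle=\xi(x)|x\rangle$. The $n$-qupit Pauli group is $\mathcal P_p^{\otimes n}=\{\xi(y)\bigotimes_j X^{x_j}Z^{z_j}\}$ and the Clifford group is its unitary normaliser. A stabiliser state is a unit vector fixed by a subgroup of $\mathcal P_p^{\otimes n}$ that is maximal among the abelian subgroups containing no phase $\xi(a)1$ with $a\neq 0$. **The category $\mathsf{StabChan}_p$.** $\mathsf{Stab}_p$ consists of the linear maps between spaces $\mathcal H_p^{\otimes n}$ generated by stabiliser states, Clifford operators and the scalars $\sqrt p,1/\sqrt p$ under composition, tensor product and adjoint. $\mathsf{CPM}(\mathsf{Stab}_p)$ consists of the maps $\rho\mapsto\sum_s f_s\,\rho\, f_s^\dagger$, where $f:\mathcal H\otimes\mathcal H_p^{\otimes k}\to\mathcal K$ is in $\mathsf{Stab}_p$, $s$ ranges over the basis of $\mathcal H_p^{\otimes k}$ and $f_s=f(-\otimes|s\rangle)$.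 An object of $\mathsf{StabChan}_p$ is a pair $(\mathcal H,x)$ with $x:\mathcal H\to\mathcal H$ in $\mathsf{CPM}(\mathsf{Stab}_p)$, $x\circ x=x$ and $x^\dagger=x$ (Hilbert–Schmidt adjoint). A morphism (stabiliser quantum channel) $(\mathcal H,x)\to(\mathcal K,y)$ is a $\Phi$ in $\mathsf{CPM}(\mathsf{Stab}_p)$ with $y\circ\Phi\circ x=\Phi$ and $\mathrm{Tr}\circ\Phi=\mathrm{Tr}\circ x$. Composition is composition of maps and the identity of $(\mathcal H,x)$ is $x$. **The language SPL.** Fix an infinite set $\mathsf{Reg}$ of registers. A typed environment is a partial function $\Gamma:\mathsf{Reg}\rightharpoonup\{\mathtt{pit},\mathtt{qpit}\}$ with finite domain. Let $\langle\Gamma\rangle=\bigotimes_{r\in\mathrm{dom}\,\Gamma}\langle\Gamma(r)\rangle$, with $\langle\mathtt{qpit}\rangle=(\mathcal H_p,1)$ and $\langle\mathtt{pit}\rangle=(\mathcal H_p,\mathcal E_Z)$, where $\mathcal E_Z(\rho)=\sum_j|j\rangle\langle j|\rho|j\rangle\langle j|$. Let $\mathcal D(\Gamma)$ be the set of density operators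 on $\langle\Gamma\rangle$, that is, the density matrices fixed by the idempotent of $\langle\Gamma\rangle$. Atomic terms $a$, with typing $\Gamma\vdash a\triangleright\Delta$ and interpretation $\langle a\rangle$ (acting trivially on registers not mentioned), are as follows; the registers in a list are distinct, lists are nonempty, and newly bound registers are fresh. - $\mathbf{skip}$: $\Gamma\vdash\mathbf{skip}\triangleright\Gamma$, the identity. - $\mathbf{init}\,r$ and $\mathbf{qinit}\,r$: $\Delta=\Gamma,r:\mathtt{pit}$, respectively $\Delta=\Gamma,r:\mathtt{qpit}$; prepares $|0\rangle\langle 0|$ on $r$. - $\vec y=A*\vec x$, for $A:\mathbb F_p^n\to\mathbb F_p^m$ affine: $\vec x$ are pits of $\Gamma$ and $\Delta=\Gamma,\vec y:\mathtt{pit}^m$; applies $\rho\mapsto\sum_{w}|w,A(w)\rangle\langle w|\rho|w\rangle\langle w,A(w)|$. - $\mathbf{disc}\,r$: a pit $r$ is traced out and removed from $\Gamma$. - $\vec x\mathrel{*}=U$, for $U$ an $n$-qupit Clifford operator and $\vec x$ qpits of $\Gamma=\Delta$: conjugation by $U$. - $\mathbf{meas}\,r$: a qpit $r$ becomes a pit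 by applying $\mathcal E_Z$. - $\mathbf{ctrl}_P\,r\,s$, for $P\in\mathcal P_p$, $r$ a pit and $s$ a qpit of $\Gamma=\Delta$: $\rho\mapsto\sum_j(|j\rangle\langle j|\otimes P^j)\rho(|j\rangle\langle j|\otimes P^j)^\dagger$. Terms are built from atomic terms by sequential composition $c;d$ (read up to associativity), with $\Gamma\vdash c;d\triangleright\Sigma$ whenever $\Gamma\vdash c\triangleright\Delta$ and $\Delta\vdash d\triangleright\Sigma$. A term is well-formed if it has such a typing. A configuration $[\Gamma\vdash t\triangleright\Delta\,|\,\rho]$ is a well-formed $t$ with $\rho\in\mathcal D(\Gamma)$. The small-step semantics is $[a\,|\,\rho]\rightsquigarrow[\mathbf{skip}\,|\,\langle a\rangle\rho]$ and $[a;c\,|\,\rho]\rightsquigarrow[c\,|\,\langle a\rangle\rho]$ for atomic $a$ (the latter provided that $[c\,|\,\langle a\rangle\rho]$ can itself make a step), and $\rightsquigarrow^*$ is its transitive closure. Well-formed $\Sigma\vdash c\triangleright\Delta$ and $\Sigma\vdash d\triangleright\Delta$ are observationally equivalent if for all well-formed $\Gamma\vdash a\triangleright\Sigma$ and $\Delta\vdash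 b\triangleright\Theta$ and all $\rho\in\mathcal D(\Gamma)$, $\rho'\in\mathcal D(\Theta)$: $[a;c;b\,|\,\rho]\rightsquigarrow^*[\mathbf{skip}\,|\,\rho']$ if and only if $[a;d;b\,|\,\rho]\rightsquigarrow^*[\mathbf{skip}\,|\,\rho']$. **Theorem.** The operational semantics $\rightsquigarrow^*$ of SPL is sound, complete and universal for $\mathsf{StabChan}_p$: 1. (Soundness.) Every $\langle\Gamma\rangle$ is an object of $\mathsf{StabChan}_p$. For every well-formed $\Gamma\vdash t\triangleright\Delta$ there is a unique morphism $[t\,|\,-]:\langle\Gamma\rangle\to\langle\Delta\rangle$ of $\mathsf{StabChan}_p$ such that for each $\rho\in\mathcal D(\Gamma)$ the state $[t\,|\,-](\rho)$ is the one and only $\rho'\in\mathcal D(\Delta)$ with $[t\,|\,\rho]\rightsquigarrow^*[\mathbf{skip}\,|\,\rho']$. Moreover $[\mathbf{skip}\,|\,-]$ is the identity and $[c;d\,|\,-]=[d\,|\,-]\circ[c\,|\,-]$. 2. (Soundness and completeness for observational equivalence.) Well-formed $\Gamma\vdash c\triangleright\Delta$ and $\Gamma\vdash d\triangleright\Delta$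 are observationally equivalent if and only if $[c\,|\,-]=[d\,|\,-]$. 3. (Universality.) For all typed environments $\Gamma,\Delta$, every morphism $\langle\Gamma\rangle\to\langle\Delta\rangle$ of $\mathsf{StabChan}_p$ equals $[t\,|\,-]$ for some well-formed $\Gamma\vdash t\triangleright\Delta$; and every object $(\mathcal H,x)$ of $\mathsf{StabChan}_p$ with $x\neq 0$ is isomorphic in $\mathsf{StabChan}_p$ to some $\langle\Gamma\rangle$. -/

import Mathlib

universe u

open scoped Matrix ComplexOrder

namespace SPL

/-! ### Pure stabiliser maps

For a finite type `ι`, the Hilbert space of a family of qupits indexed by `ι` is the space with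
orthonormal basis `ι → ZMod p`; linear maps between such spaces are matrices. -/

/-- Operators from the qupits indexed by `ι` to the qupits indexed by `κ`. -/
abbrev Op (p : ℕ) (κ ι : Type*) := Matrix (κ → ZMod p) (ι → ZMod p) ℂ

section Pure

variable (p : ℕ) [Fact p.Prime]

/-- The Pauli operator `ξ(y) ⨂ᵢ X^{xᵢ} Z^{zᵢ}`, that is `|u⟩ ↦ ξ(y + z ⬝ u) |u + x⟩`, where
`ξ(a) = exp(2πi a / p)`. -/
noncomputable def pauli {ι : Type*} [Fintype ι] (y : ZMod p) (x z : ι → ZMod p) : Op p ι ι :=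
  open Classical in
  Matrix.of fun v u => if v = u + x then ZMod.stdAddChar (y + z ⬝ᵥ u) else 0

/-- The Pauli group on the qupits indexed by `ι`. -/
def pauliGroup (ι : Type*) [Fintype ι] : Set (Op p ι ι) :=
  {P | ∃ y x z, P = pauli p y x z}

/-- The Clifford group: unitaries normalising the Pauli group. -/
def cliffordGroup (ι : Type*) [Fintype ι] [DecidableEq ι] : Set (Op p ι ι) :=
  {U | U * Uᴴ = 1 ∧ Uᴴ * U = 1 ∧ ∀ P ∈ pauliGroup p ι, U * P * Uᴴ ∈ pauliGroup p ι}

/-- Abelian subgroups of the Pauli group whose only phase is the identity. -/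
structure IsStabCode {ι : Type*} [Fintype ι] [DecidableEq ι] (S : Set (Op p ι ι)) : Prop where
  subset : S ⊆ pauliGroup p ι
  one_mem : 1 ∈ S
  mul_mem : ∀ a ∈ S, ∀ b ∈ S, a * b ∈ S
  inv_mem : ∀ a ∈ S, aᴴ ∈ S
  comm : ∀ a ∈ S, ∀ b ∈ S, a * b = b * a
  phase : ∀ a : ZMod p, (ZMod.stdAddChar a : ℂ) • (1 : Op p ι ι) ∈ S → a = 0

/-- Stabiliser states: unit vectors fixed by a stabiliser group, i.e. by a maximal abelian
subgroup of the Pauli group among those containing no nontrivial phase. -/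
def IsStabState {ι : Type*} [Fintype ι] [DecidableEq ι] (ψ : (ι → ZMod p) → ℂ) : Prop :=
  ∑ u, ‖ψ u‖ ^ 2 = 1 ∧ ∃ S : Set (Op p ι ι), Maximal (IsStabCode p) S ∧ ∀ s ∈ S, s *ᵥ ψ = ψ

/-- Tensor product of operators; the qupits of a tensor product are indexed by the disjoint
union. -/
def tensor {p : ℕ} {ι κ ι' κ' : Type*} (f : Op p κ ι) (g : Op p κ' ι') :
    Op p (κ ⊕ κ') (ι ⊕ ι') :=
  Matrix.of fun v u =>
    f (v ∘ Sum.inl) (u ∘ Sum.inl) * g (v ∘ Sum.inr) (u ∘ Sum.inr)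

/-- The morphisms of `Stab_p`: maps generated by stabiliser states, Clifford operators and the
scalars `√p`, `1/√p` under composition, tensor product and adjoint. The constructor `relabel`
is closure under the coherence isomorphisms of the tensor product (renaming tensor factors). -/
inductive IsStab : {ι κ : Type u} → Op p κ ι → Prop
  | state {ι : Type u} [Fintype ι] [DecidableEq ι] (ψ : (ι → ZMod p) → ℂ)
      (h : IsStabState p ψ) :
      IsStab (Matrix.of fun (v : ι → ZMod p) (_ : PEmpty.{u + 1} → ZMod p) => ψ v)
  | clifford {ι : Type u} [Fintype ι] [DecidableEq ι] (U : Op p ι ι)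
      (h : U ∈ cliffordGroup p ι) : IsStab U
  | sqrt : IsStab (Matrix.of fun (_ _ : PEmpty.{u + 1} → ZMod p) => ((Real.sqrt p : ℝ) : ℂ))
  | invSqrt :
      IsStab (Matrix.of fun (_ _ : PEmpty.{u + 1} → ZMod p) => (((Real.sqrt p)⁻¹ : ℝ) : ℂ))
  | comp {ι κ μ : Type u} [Fintype κ] [DecidableEq κ] (g : Op p μ κ) (f : Op p κ ι) :
      IsStab g → IsStab f → IsStab (g * f)
  | tensor {ι κ ι' κ' : Type u} (f : Op p κ ι) (g : Op p κ' ι') :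
      IsStab f → IsStab g → IsStab (tensor f g)
  | adjoint {ι κ : Type u} (f : Op p κ ι) : IsStab f → IsStab fᴴ
  | relabel {ι κ ι' κ' : Type u} (e : ι ≃ ι') (e' : κ ≃ κ') (f : Op p κ ι) :
      IsStab f →
        IsStab (Matrix.of fun (v : κ' → ZMod p) (u : ι' → ZMod p) => f (v ∘ e') (u ∘ e))

end Pure

/-! ### Stabiliser channels -/

/-- The completely positive map `ρ ↦ ∑ₖ Kₖ ρ Kₖ†`. -/
def krausMap {k μ ν : Type*} [Fintype k] [Fintype ν] (K : k → Matrix μ ν ℂ) :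
    Matrix ν ν ℂ →ₗ[ℂ] Matrix μ μ ℂ where
  toFun ρ := ∑ i, K i * ρ * (K i)ᴴ
  map_add' ρ σ := by simp [Matrix.mul_add, Matrix.add_mul, Finset.sum_add_distrib]
  map_smul' c ρ := by simp [Finset.smul_sum]

/-- Linear maps from operators on the qupits `ι` to operators on the qupits `κ`. -/
abbrev SuperOp (p : ℕ) [Fact p.Prime] (ι κ : Type*) := Op p ι ι →ₗ[ℂ] Op p κ κ

section Channels

variable (p : ℕ) [Fact p.Prime]

/-- `Φ` is a morphism of `CPM(Stab_p)`: it is represented by a stabiliser map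
`f : H_ι ⊗ H_σ → H_κ`, the environment `σ` connecting `f` and its conjugate. Two pairs `(f, σ)`
are equal in `CPM(Stab_p)` exactly when they induce the same linear map, so morphisms are taken
to be the induced linear maps. -/
def IsCPMStab {ι κ : Type u} [Fintype ι] [DecidableEq ι] (Φ : SuperOp p ι κ) : Prop :=
  ∃ (σ : Type u) (_ : Fintype σ) (_ : DecidableEq σ) (f : Op p κ (ι ⊕ σ)),
    IsStab p f ∧
    Φ = krausMap fun s : σ → ZMod p =>
      (Matrix.of fun (v : κ → ZMod p) (u : ι → ZMod p) => f v (Sum.elim u s))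

/-- `(H_ι, x)` is an object of the dagger-idempotent completion of `CPM(Stab_p)`. The dagger of a
completely positive map is its Hilbert-Schmidt adjoint. -/
structure IsStabObj {ι : Type u} [Fintype ι] [DecidableEq ι] (x : SuperOp p ι ι) : Prop where
  cpm : IsCPMStab p x
  selfAdjoint : ∀ ρ σ, ((x ρ)ᴴ * σ).trace = (ρᴴ * x σ).trace
  idem : x ∘ₗ x = x

/-- `Φ` is a stabiliser quantum channel `(H_ι, x) ⟶ (H_κ, y)`, i.e. a morphism of
`StabChan_p = Caus(Split†(CPM(Stab_p)))`. The identity on `(H_ι, x)` is `x`, its trace is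
`Tr ∘ x`, and composition is composition of linear maps. -/
structure IsStabChan {ι κ : Type u} [Fintype ι] [DecidableEq ι] [Fintype κ] [DecidableEq κ]
    (x : SuperOp p ι ι) (y : SuperOp p κ κ) (Φ : SuperOp p ι κ) : Prop where
  cpm : IsCPMStab p Φ
  split : y ∘ₗ Φ ∘ₗ x = Φ
  causal : ∀ ρ, (Φ ρ).trace = (x ρ).trace

end Channels

/-! ### Syntax and typing -/

inductive Ty
  | pit
  | qpit

/-- Typed environments: partial functions from registers to types with finite domain. -/
structure Env (Reg : Type u) where
  ty : Reg → Option Ty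
  dom : Finset Reg
  mem_dom : ∀ r, r ∈ dom ↔ ty r ≠ none

namespace Env

variable {Reg : Type u} [DecidableEq Reg]

/-- `{s : τ, Γ}`: bind all the registers in `s` to `τ`. -/
def bind (Γ : Env Reg) (s : Finset Reg) (τ : Ty) : Env Reg where
  ty r := if r ∈ s then some τ else Γ.ty r
  dom := s ∪ Γ.dom
  mem_dom r := by by_cases h : r ∈ s <;> simp [h, Γ.mem_dom]

/-- Remove a register. -/
def erase (Γ : Env Reg) (x : Reg) : Env Reg where
  ty r := if r = x then none else Γ.ty r
  dom := Γ.dom.erase x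
  mem_dom r := by by_cases h : r = x <;> simp [h, Γ.mem_dom]

end Env

/-- Atomic terms of the language; `F_p`-affine maps, Clifford operators and single-qupit Paulis are
parameters. -/
inductive Atom (p : ℕ) [Fact p.Prime] (Reg : Type u) : Type u
  | skip
  | init (x : Reg)
  | affine {n m : ℕ} (y : Fin m → Reg)
      (A : (Fin n → ZMod p) →ᵃ[ZMod p] (Fin m → ZMod p)) (x : Fin n → Reg)
  | disc (x : Reg)
  | qinit (x : Reg)
  | gate {n : ℕ} (x : Fin n → Reg) (U : cliffordGroup p (Fin n))
  | meas (x : Reg)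
  | ctrl (P : pauliGroup p (Fin 1)) (x y : Reg)

inductive Term (p : ℕ) [Fact p.Prime] (Reg : Type u) : Type u
  | atom (a : Atom p Reg)
  | seq (c d : Term p Reg)

section Typing

variable {p : ℕ} [Fact p.Prime] {Reg : Type u} [DecidableEq Reg]

/-- Formation rules for atomic terms. -/
inductive Atom.Typed : Env Reg → Atom p Reg → Env Reg → Prop
  | skip (Γ : Env Reg) : Typed Γ .skip Γ
  | init (Γ : Env Reg) (x : Reg) (hx : Γ.ty x = none) : Typed Γ (.init x) (Γ.bind {x} .pit)
  | qinit (Γ : Env Reg) (x : Reg) (hx : Γ.ty x = none) : Typed Γ (.qinit x) (Γ.bind {x} .qpit)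
  | affine (Γ : Env Reg) {n m : ℕ} (hn : 0 < n) (hm : 0 < m) (y : Fin m → Reg)
      (A : (Fin n → ZMod p) →ᵃ[ZMod p] (Fin m → ZMod p)) (x : Fin n → Reg)
      (hxi : Function.Injective x) (hyi : Function.Injective y)
      (hx : ∀ i, Γ.ty (x i) = some .pit) (hy : ∀ j, Γ.ty (y j) = none) :
      Typed Γ (.affine y A x) (Γ.bind (Finset.univ.image y) .pit)
  | meas (Γ : Env Reg) (x : Reg) (hx : Γ.ty x = some .qpit) :
      Typed Γ (.meas x) (Γ.bind {x} .pit)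
  | disc (Γ : Env Reg) (x : Reg) (hx : Γ.ty x = some .pit) : Typed Γ (.disc x) (Γ.erase x)
  | gate (Γ : Env Reg) {n : ℕ} (hn : 0 < n) (x : Fin n → Reg) (U : cliffordGroup p (Fin n))
      (hxi : Function.Injective x) (hx : ∀ i, Γ.ty (x i) = some .qpit) : Typed Γ (.gate x U) Γ
  | ctrl (Γ : Env Reg) (P : pauliGroup p (Fin 1)) (x y : Reg)
      (hx : Γ.ty x = some .pit) (hy : Γ.ty y = some .qpit) : Typed Γ (.ctrl P x y) Γ

/-- `WF Γ t Δ`: the judgement `Γ ⊢ t ▷ Δ` is well-formed. -/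
inductive WF : Env Reg → Term p Reg → Env Reg → Prop
  | atom {Γ Δ : Env Reg} {a : Atom p Reg} (h : a.Typed Γ Δ) : WF Γ (.atom a) Δ
  | seq {Γ Δ Θ : Env Reg} {c d : Term p Reg} (hc : WF Γ c Δ) (hd : WF Δ d Θ) :
      WF Γ (.seq c d) Θ

end Typing

/-! ### Operational semantics -/

section Semantics

variable (p : ℕ) [Fact p.Prime] {Reg : Type u} [DecidableEq Reg]

/-- The idempotent of the object `⟨Γ⟩ = ⨂_{r ∈ dom Γ} ⟨Γ(r)⟩`: decoherence in the computational
basis on each register of type `pit`, and the identity on each register of type `qpit`. The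
underlying Hilbert space is that of the qupits indexed by `dom Γ`. -/
noncomputable def Env.interp (Γ : Env Reg) : SuperOp p Γ.dom Γ.dom :=
  open Classical in
  { toFun := fun ρ => Matrix.of fun v u =>
      if ∀ r : Γ.dom, Γ.ty r = some .pit → v r = u r then ρ v u else 0
    map_add' := fun ρ σ => by ext v u; simp only [Matrix.of_apply, Matrix.add_apply]; split <;> simp
    map_smul' := fun c ρ => by
      ext v u; simp only [Matrix.of_apply, Matrix.smul_apply, RingHom.id_apply]; split <;> simp }

/-- `𝒟(Γ)`: the density operators on `⟨Γ⟩`. -/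
def Density (Γ : Env Reg) : Type u :=
  {ρ : Op p Γ.dom Γ.dom // ρ.PosSemidef ∧ ρ.trace = 1 ∧ Γ.interp p ρ = ρ}

variable {p}

/-- Value of a basis vector at a register (`0` outside the domain). -/
def Env.val (Γ : Env Reg) (u : Γ.dom → ZMod p) (r : Reg) : ZMod p :=
  if h : r ∈ Γ.dom then u ⟨r, h⟩ else 0

/-- The operator acting as `K` from the registers `x` to the registers `y`, and trivially on the
other registers (used when `dom Γ ∖ x = dom Δ ∖ y`). -/
noncomputable def localOp (Γ Δ : Env Reg) {n m : ℕ} (x : Fin n → Reg) (y : Fin m → Reg)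
    (K : Op p (Fin m) (Fin n)) : Op p Δ.dom Γ.dom :=
  open Classical in
  Matrix.of fun v u =>
    if ∀ r ∈ Γ.dom \ Finset.univ.image x, Δ.val v r = Γ.val u r then
      K (fun j => Δ.val v (y j)) (fun i => Γ.val u (x i)) else 0

/-- The interpretation of atomic terms. `Matrix.single v u 1` is `|v⟩⟨u|`. -/
noncomputable def aden (Γ Δ : Env Reg) : Atom p Reg → SuperOp p Γ.dom Δ.dom
  | .skip => krausMap fun _ : Unit => localOp Γ Δ ![] ![] 1
  | .init x => krausMap fun _ : Unit => localOp Γ Δ ![] ![x] (Matrix.single 0 0 1)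
  | .qinit x => krausMap fun _ : Unit => localOp Γ Δ ![] ![x] (Matrix.single 0 0 1)
  | .meas x => krausMap fun j : Fin 1 → ZMod p => localOp Γ Δ ![x] ![x] (Matrix.single j j 1)
  | .disc x => krausMap fun j : Fin 1 → ZMod p => localOp Γ Δ ![x] ![] (Matrix.single 0 j 1)
  | .affine (n := n) y A x => krausMap fun w : Fin n → ZMod p =>
      localOp Γ Δ x (Fin.append x y) (Matrix.single (Fin.append w (A w)) w 1)
  | .gate x U => krausMap fun _ : Unit => localOp Γ Δ x x U.1
  | .ctrl P x y => krausMap fun j : ZMod p => localOp Γ Δ ![x, y] ![x, y]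
      -- `|j⟩⟨j| ⊗ P ^ j`
      (Matrix.of fun v u =>
        if v 0 = j ∧ u 0 = j then (P.1 ^ j.val) (fun _ => v 1) (fun _ => u 1) else 0)

variable (p Reg) in
/-- Configurations `[Γ ⊢ t ▷ Δ | ρ ∈ 𝒟(Γ)]`. -/
structure Config where
  src : Env Reg
  term : Term p Reg
  tgt : Env Reg
  wf : WF src term tgt
  state : Density p src

/-- Small-step operational semantics. The rule `assoc` says that sequential composition is read
up to associativity. -/
inductive Step : Config p Reg → Config p Reg → Prop
  | atom {Γ Δ : Env Reg} {a : Atom p Reg} (ha : a.Typed Γ Δ) (ρ : Density p Γ) (ρ' : Density p Δ)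
      (h : ρ'.1 = aden Γ Δ a ρ.1) :
      Step ⟨Γ, .atom a, Δ, .atom ha, ρ⟩ ⟨Δ, .atom .skip, Δ, .atom (.skip Δ), ρ'⟩
  | seq {Γ Δ Θ Ξ : Env Reg} {a : Atom p Reg} {c c' : Term p Reg} (ha : a.Typed Γ Δ)
      (hc : WF Δ c Θ) (hc' : WF Ξ c' Θ)
      (ρ : Density p Γ) (ρ' : Density p Δ) (ρ'' : Density p Ξ) (h : ρ'.1 = aden Γ Δ a ρ.1)
      (hs : Step ⟨Δ, c, Θ, hc, ρ'⟩ ⟨Ξ, c', Θ, hc', ρ''⟩) :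
      Step ⟨Γ, .seq (.atom a) c, Θ, .seq (.atom ha) hc, ρ⟩ ⟨Δ, c, Θ, hc, ρ'⟩
  | assoc {Γ Δ : Env Reg} {c d e : Term p Reg} (h : WF Γ (.seq (.seq c d) e) Δ)
      (h' : WF Γ (.seq c (.seq d e)) Δ) (ρ : Density p Γ) (X : Config p Reg)
      (hs : Step ⟨Γ, .seq c (.seq d e), Δ, h', ρ⟩ X) :
      Step ⟨Γ, .seq (.seq c d) e, Δ, h, ρ⟩ X

/-- `[t | ρ] ⇝* [skip | ρ']`, where `⇝*` is the transitive closure of the small-step semantics. -/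
def Evals {Γ Δ : Env Reg} {t : Term p Reg} (h : WF Γ t Δ) (ρ : Density p Γ) (ρ' : Density p Δ) :
    Prop :=
  Relation.TransGen Step ⟨Γ, t, Δ, h, ρ⟩ ⟨Δ, .atom .skip, Δ, .atom (.skip Δ), ρ'⟩

/-- The map `[t | -]` is `Φ`: every `ρ ∈ 𝒟(Γ)` evaluates to exactly one state, namely `Φ ρ`. -/
def Denotes {Γ Δ : Env Reg} {t : Term p Reg} (h : WF Γ t Δ) (Φ : SuperOp p Γ.dom Δ.dom) : Prop :=
  ∀ ρ : Density p Γ, ∃ ρ' : Density p Δ,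
    ρ'.1 = Φ ρ.1 ∧ ∀ ρ'' : Density p Δ, Evals h ρ ρ'' ↔ ρ'' = ρ'

/-- Observational equivalence of well-formed terms of the same type. -/
def ObsEquiv {Γ Δ : Env Reg} {c d : Term p Reg} (hc : WF Γ c Δ) (hd : WF Γ d Δ) : Prop :=
  ∀ (Γ' Δ' : Env Reg) (a b : Term p Reg) (ha : WF Γ' a Γ) (hb : WF Δ b Δ')
    (ρ : Density p Γ') (ρ' : Density p Δ'),
    Evals (WF.seq ha (WF.seq hc hb)) ρ ρ' ↔ Evals (WF.seq ha (WF.seq hd hb)) ρ ρ'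

end Semantics

end SPL

/-! The Weyl operators W(a), with a in the symplectic space F_p^(2n), form a basis of all operators.
Since 2 is invertible mod p, they can be normalised so that W(a)W(b) = ξ(ω(a,b)/2) W(a+b). A
stabiliser map f is then controlled by linear algebra over F_p. The pairs (b,a) for which W(b)f and
fW(a) agree up to a phase form a subspace `stabRel f`. It is isotropic when f ≠ 0
(`symp_eq_of_mem_stabRel`), and it contains its own symplectic complement (`IsStab.coisotropic`), so
it is a Lagrangian relation. The second property passes through every generating operation of
`IsStab`, and it is all that is used later to take stabiliser maps apart.

Soundness. The copying and routing parts of the atoms are zero-one matrices of linear relations,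
which are stabiliser maps (`isStab_rel`); the rest are Pauli and Clifford operators. The
compositional interpretation of a term is invariant under small steps (`Step.hasValue`), and every
well-formed term can step (`Step.exists`), so evaluation computes exactly this interpretation.
Density operators on ⟨Γ⟩ span the range of its idempotent (`eq_of_density`). Hence a channel is
determined by its values on states, and trivial contexts already separate distinct channels.

Universality for channels. A channel has a Stinespring isometry V that is itself a stabiliser map
(`IsCPMStab.exists_stinespring`). The relation of V gives a partial symplectic basis, which a
Witt-type extension completes; the resulting symplectic map is implemented by a unitary
(`exists_metaplectic`). Up to a global phase, |0⟩ ⊗ V is therefore a Clifford operator applied to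
the input with ancillas in |0⟩ (`exists_clifford_dilation`). This is a program: route the input to
fresh qpits, initialise ancillas, apply the gate, measure and discard the environment, and route the
rest to the output registers (`exists_denotes`).

Universality for objects. For a nonzero object x, let N be the labels a with x(W(a)ρ) = W(a)x(ρ),
and K the labels acting by a phase on the range of x. Coisotropy of a map representing x,
self-adjointness and idempotence give x(W(a)) = W(a)x(1) for a in N and x(W(a)) = 0 otherwise, while
x(1) is the projection onto a stabiliser code with labels K (`IsStabObj.exists_apply_one`). A
symplectic basis adapted to K ≤ N (`exists_adapted_frame`) turns x, up to a Clifford unitary, into a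
product in which each qupit is kept, dephased, projected to |0⟩ or depolarised. Omitting the last
two kinds leaves qpits and pits, that is, an environment (`IsStabObj.exists_iso_interp`). -/

namespace SPL

/-! ### Weyl operators -/

section Weyl

set_option linter.unusedSectionVars false

variable {p : ℕ} [Fact p.Prime]

/-- Labels of Pauli operators up to phase. -/
abbrev Label (p : ℕ) (ι : Type*) := (ι → ZMod p) × (ι → ZMod p)

theorem norm_char (a : ZMod p) : ‖(ZMod.stdAddChar a : ℂ)‖ = 1 := by
  rw [ZMod.stdAddChar_apply]; exact Circle.norm_coe _

theorem star_char (a : ZMod p) : star (ZMod.stdAddChar a : ℂ) = ZMod.stdAddChar (-a) := by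
  rw [AddChar.map_neg_eq_inv, Complex.inv_eq_conj (norm_char a)]; rfl

theorem char_ne_zero (a : ZMod p) : (ZMod.stdAddChar a : ℂ) ≠ 0 := by
  rw [← norm_ne_zero_iff, norm_char]; exact one_ne_zero

theorem char_mul_neg (a : ZMod p) :
    (ZMod.stdAddChar a : ℂ) * ZMod.stdAddChar (-a) = 1 := by
  rw [← AddChar.map_add_eq_mul]; simp

theorem char_inj {a b : ZMod p} :
    (ZMod.stdAddChar a : ℂ) = ZMod.stdAddChar b ↔ a = b :=
  ZMod.injective_stdAddChar.eq_iff

theorem char_eq_one_iff {a : ZMod p} : (ZMod.stdAddChar a : ℂ) = 1 ↔ a = 0 := by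
  rw [← char_inj, AddChar.map_zero_eq_one]

/-- Every `p`-th root of unity is a value of the standard character. -/
theorem exists_char_eq_of_pow_eq_one {c : ℂ} (hc : c ^ p = 1) :
    ∃ y : ZMod p, c = ZMod.stdAddChar y := by
  have hp0 : p ≠ 0 := (Fact.out : p.Prime).ne_zero
  have h := Complex.isPrimitiveRoot_exp p hp0
  obtain ⟨i, -, hi⟩ := h.eq_pow_of_pow_eq_one hc
  refine ⟨(i : ℤ), ?_⟩
  rw [ZMod.stdAddChar_coe, ← hi, ← Complex.exp_nat_mul]
  congr 1; push_cast; ring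

section Symp

variable {ι : Type*} [Fintype ι]

/-- The symplectic form. -/
def symp : Label p ι →ₗ[ZMod p] Label p ι →ₗ[ZMod p] ZMod p :=
  LinearMap.mk₂ (ZMod p) (fun a b => a.2 ⬝ᵥ b.1 - b.2 ⬝ᵥ a.1)
    (fun a b c => by simp [add_dotProduct, dotProduct_add]; ring)
    (fun r a b => by simp [smul_dotProduct, dotProduct_smul]; ring)
    (fun a b c => by simp [add_dotProduct, dotProduct_add]; ring)
    (fun r a b => by simp [smul_dotProduct, dotProduct_smul]; ring)

theorem symp_apply (a b : Label p ι) : symp a b = a.2 ⬝ᵥ b.1 - b.2 ⬝ᵥ a.1 := rfl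

theorem symp_swap (a b : Label p ι) : symp a b = -symp b a := by
  rw [symp_apply, symp_apply]; ring

@[simp] theorem symp_self (a : Label p ι) : symp a a = 0 := by
  rw [symp_apply]; ring

/-- Nondegeneracy of the symplectic form: the coordinates of `b` are the values of `φ` on the
standard basis, with the two halves exchanged and one sign. -/
theorem exists_symp_eq [DecidableEq ι] (φ : Label p ι →ₗ[ZMod p] ZMod p) :
    ∃ b : Label p ι, ∀ a, symp b a = φ a := by
  refine ⟨(fun i => -φ (0, Pi.single i 1), fun i => φ (Pi.single i 1, 0)), fun a => ?_⟩
  have h1 : a = (∑ i, a.1 i • ((Pi.single i 1 : ι → ZMod p), (0 : ι → ZMod p))) +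
      ∑ i, a.2 i • ((0 : ι → ZMod p), (Pi.single i 1 : ι → ZMod p)) := by
    ext j <;> simp [Prod.fst_sum, Prod.snd_sum, Finset.sum_apply, Pi.single_apply]
  conv_rhs => rw [h1]
  simp only [map_add, map_sum, map_smul, symp_apply, dotProduct, smul_eq_mul]
  rw [sub_eq_add_neg, ← Finset.sum_neg_distrib]
  congr 1 <;> refine Finset.sum_congr rfl fun i _ => ?_ <;> ring

theorem eq_zero_of_symp [DecidableEq ι] {b : Label p ι} (h : ∀ a, symp b a = 0) : b = 0 := by
  ext i
  · have := h (0, Pi.single i 1); simpa [symp_apply] using this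
  · have := h (Pi.single i 1, 0); simpa [symp_apply] using this

end Symp

variable {ι : Type*} [Fintype ι]

/-- The Weyl operator: the symmetrically ordered Pauli operator with label `a`. -/
noncomputable def weyl (a : Label p ι) : Op p ι ι := pauli p (2⁻¹ * (a.2 ⬝ᵥ a.1)) a.1 a.2

theorem weyl_apply [DecidableEq ι] (a : Label p ι) (v u : ι → ZMod p) :
    weyl a v u =
      if v = u + a.1 then (ZMod.stdAddChar (2⁻¹ * (a.2 ⬝ᵥ a.1) + a.2 ⬝ᵥ u) : ℂ) else 0 := by
  simp [weyl, pauli]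

theorem pauli_mul [DecidableEq ι] (y y' : ZMod p) (x x' z z' : ι → ZMod p) :
    pauli p y x z * pauli p y' x' z' = pauli p (y + y' + z ⬝ᵥ x') (x + x') (z + z') := by
  ext v u
  simp only [Matrix.mul_apply, pauli, Matrix.of_apply]
  rw [Finset.sum_eq_single (u + x')]
  · by_cases h : v = u + x' + x
    · have h' : v = u + (x + x') := by rw [h]; abel
      rw [if_pos h, if_pos rfl, if_pos h', ← AddChar.map_add_eq_mul]
      congr 1; simp [dotProduct_add, add_dotProduct]; ring
    · have h' : ¬ v = u + (x + x') := fun h' => h (by rw [h']; abel)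
      rw [if_neg h, if_neg h', zero_mul]
  · intro w _ hw; rw [if_neg hw, mul_zero]
  · intro h; exact absurd (Finset.mem_univ _) h

theorem pauli_phase [DecidableEq ι] (y y' : ZMod p) (x z : ι → ZMod p) :
    pauli p (y + y') x z = (ZMod.stdAddChar y : ℂ) • pauli p y' x z := by
  ext v u
  simp only [pauli, Matrix.of_apply, Matrix.smul_apply, smul_eq_mul, mul_ite, mul_zero]
  split_ifs
  · rw [← AddChar.map_add_eq_mul, add_assoc]
  · rfl

variable [DecidableEq ι]

theorem pauli_eq_smul_weyl (y : ZMod p) (x z : ι → ZMod p) :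
    pauli p y x z = (ZMod.stdAddChar (y - 2⁻¹ * (z ⬝ᵥ x)) : ℂ) • weyl (x, z) := by
  rw [weyl, ← pauli_phase]; congr 1; ring

theorem smul_weyl_eq_pauli (y : ZMod p) (a : Label p ι) :
    (ZMod.stdAddChar y : ℂ) • weyl a = pauli p (y + 2⁻¹ * (a.2 ⬝ᵥ a.1)) a.1 a.2 := by
  rw [weyl, ← pauli_phase]

theorem mem_pauliGroup_iff {P : Op p ι ι} :
    P ∈ pauliGroup p ι ↔ ∃ (y : ZMod p) (a : Label p ι), P = (ZMod.stdAddChar y : ℂ) • weyl a := by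
  constructor
  · rintro ⟨y, x, z, rfl⟩; exact ⟨_, (x, z), pauli_eq_smul_weyl y x z⟩
  · rintro ⟨y, a, rfl⟩; exact ⟨_, _, _, smul_weyl_eq_pauli y a⟩

@[simp] theorem weyl_zero : weyl (0 : Label p ι) = 1 := by
  ext v u; simp [weyl_apply, Matrix.one_apply]

theorem weyl_add_phase (y : ZMod p) (a : Label p ι) (v u : ι → ZMod p) :
    (ZMod.stdAddChar y : ℂ) * weyl a v u =
      if v = u + a.1 then (ZMod.stdAddChar (y + (2⁻¹ * (a.2 ⬝ᵥ a.1) + a.2 ⬝ᵥ u)) : ℂ) else 0 := by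
  rw [weyl_apply, mul_ite, mul_zero, ← AddChar.map_add_eq_mul]

theorem two_ne_zero_zmod [Fact (p ≠ 2)] : (2 : ZMod p) ≠ 0 := by
  have h : p ≠ 2 := Fact.out
  intro h0
  have : (p : ℕ) ∣ 2 := (ZMod.natCast_eq_zero_iff 2 p).1 (by exact_mod_cast h0)
  exact h ((Nat.prime_dvd_prime_iff_eq Fact.out Nat.prime_two).1 this)

/-- Every use of the oddness of `p` passes through this identity. -/
theorem half_add_half [Fact (p ≠ 2)] (a : ZMod p) : 2⁻¹ * a + 2⁻¹ * a = a := by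
  have := two_ne_zero_zmod (p := p)
  field_simp; ring

variable [Fact (p ≠ 2)]

theorem weyl_conjTranspose (a : Label p ι) : (weyl a)ᴴ = weyl (-a) := by
  ext v u
  simp only [Matrix.conjTranspose_apply, weyl_apply, Prod.fst_neg, Prod.snd_neg]
  by_cases h : u = v + a.1
  · rw [if_pos h, if_pos (by rw [h]; abel), star_char, h]
    congr 1; simp only [neg_dotProduct, dotProduct_neg, dotProduct_add]
    linear_combination -half_add_half (a.2 ⬝ᵥ a.1)
  · rw [if_neg h, if_neg (fun h' => h (by rw [h']; abel)), star_zero]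

theorem weyl_mul (a b : Label p ι) :
    weyl a * weyl b = (ZMod.stdAddChar (2⁻¹ * symp a b) : ℂ) • weyl (a + b) := by
  rw [smul_weyl_eq_pauli, weyl, weyl, pauli_mul, symp_apply]
  congr 1
  simp only [Prod.fst_add, Prod.snd_add, dotProduct_add, add_dotProduct]
  linear_combination -half_add_half (a.2 ⬝ᵥ b.1)

theorem weyl_add (a b : Label p ι) :
    weyl (a + b) = (ZMod.stdAddChar (-(2⁻¹ * symp a b)) : ℂ) • (weyl a * weyl b) := by
  rw [weyl_mul, smul_smul, mul_comm, char_mul_neg, one_smul]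

theorem weyl_mul_of_symp_eq_zero {a b : Label p ι} (h : symp a b = 0) :
    weyl a * weyl b = weyl (a + b) := by
  rw [weyl_mul, h]; simp

theorem weyl_comm (a b : Label p ι) :
    weyl a * weyl b = (ZMod.stdAddChar (symp a b) : ℂ) • (weyl b * weyl a) := by
  rw [weyl_mul, weyl_mul, smul_smul, ← AddChar.map_add_eq_mul, add_comm b a, symp_swap b a]
  congr 2
  linear_combination half_add_half (symp a b)

theorem weyl_mul_weyl_neg (a : Label p ι) : weyl a * weyl (-a) = 1 := by
  rw [weyl_mul_of_symp_eq_zero (by simp)]; simp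

theorem weyl_neg_mul_weyl (a : Label p ι) : weyl (-a) * weyl a = 1 := by
  rw [weyl_mul_of_symp_eq_zero (by simp)]; simp

/-- Conjugation by a Weyl operator is diagonal in the Weyl basis, with characters as eigenvalues.
The averaging and eigenvalue arguments below rest on this. -/
theorem weyl_conj_weyl (a b : Label p ι) :
    weyl a * weyl b * weyl (-a) = (ZMod.stdAddChar (symp a b) : ℂ) • weyl b := by
  rw [weyl_comm, Matrix.smul_mul, Matrix.mul_assoc, weyl_mul_weyl_neg, Matrix.mul_one]

theorem weyl_nsmul (a : Label p ι) (n : ℕ) : weyl (n • a) = weyl a ^ n := by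
  induction n with
  | zero => simp
  | succ n ih =>
    rw [pow_succ, ← ih, weyl_mul_of_symp_eq_zero (by rw [map_nsmul]; simp), succ_nsmul]

theorem weyl_ne_zero (a : Label p ι) : weyl a ≠ 0 := by
  intro h
  have := weyl_mul_weyl_neg a
  rw [h, zero_mul] at this
  exact zero_ne_one this

theorem weyl_comm_iff (a b : Label p ι) : weyl a * weyl b = weyl b * weyl a ↔ symp a b = 0 := by
  constructor
  · intro h
    have h1 := weyl_comm a b
    rw [h] at h1
    have h2 : ((ZMod.stdAddChar (symp a b) : ℂ) - 1) • (weyl b * weyl a) = 0 := by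
      rw [sub_smul, ← h1, one_smul, sub_self]
    rcases smul_eq_zero.1 h2 with h3 | h3
    · exact char_eq_one_iff.1 (sub_eq_zero.1 h3)
    · rw [weyl_mul] at h3
      exact absurd h3 (smul_ne_zero (char_ne_zero _) (weyl_ne_zero _))
  · intro h; rw [weyl_comm, h]; simp

theorem char_sum_linear {A : Type*} [AddCommGroup A] [Module (ZMod p) A] [Fintype A]
    (φ : A →ₗ[ZMod p] ZMod p) [Decidable (φ = 0)] :
    ∑ a, (ZMod.stdAddChar (φ a) : ℂ) = if φ = 0 then (Fintype.card A : ℂ) else 0 := by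
  classical
  have h := AddChar.sum_eq_ite
    ((ZMod.stdAddChar (N := p) : AddChar (ZMod p) ℂ).compAddMonoidHom φ.toAddMonoidHom)
  simp only [AddChar.compAddMonoidHom_apply, LinearMap.toAddMonoidHom_coe] at h
  rw [h]
  congr 1
  rw [eq_iff_iff]
  constructor
  · intro h; ext a
    have := DFunLike.congr_fun h a
    simpa [char_eq_one_iff] using this
  · rintro rfl; ext a; simp

theorem char_sum_dotProduct (w : ι → ZMod p) :
    ∑ z : ι → ZMod p, (ZMod.stdAddChar (z ⬝ᵥ w) : ℂ) =
      if w = 0 then (p : ℂ) ^ Fintype.card ι else 0 := by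
  classical
  have h := char_sum_linear ((dotProductBilin (ZMod p) (ZMod p) (A := ZMod p) (m := ι)).flip w)
  simp only [LinearMap.flip_apply, dotProductBilin_apply_apply] at h
  rw [h]
  simp only [Fintype.card_fun, ZMod.card, Nat.cast_pow]
  congr 1
  rw [eq_iff_iff]
  constructor
  · intro h; ext i
    have := LinearMap.congr_fun h (Pi.single i 1)
    simpa using this
  · rintro rfl; ext a; simp

theorem char_sum_symp (b : Label p ι) :
    ∑ a : Label p ι, (ZMod.stdAddChar (symp a b) : ℂ) =
      if b = 0 then (Fintype.card (Label p ι) : ℂ) else 0 := by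
  classical
  have h := char_sum_linear (symp.flip b)
  simp only [LinearMap.flip_apply] at h
  rw [h]
  congr 1
  rw [eq_iff_iff]
  constructor
  · intro h; apply eq_zero_of_symp; intro a
    rw [symp_swap, ← LinearMap.flip_apply, h]; simp
  · rintro rfl; ext a <;> simp

/-- Fourier inversion in the Z component: with the shift fixed at `v - u`, averaging against the
conjugate phase over all `z` isolates one matrix unit. -/
theorem single_eq_sum_weyl (v u : ι → ZMod p) :
    Matrix.single v u (1 : ℂ) = ((p : ℂ) ^ Fintype.card ι)⁻¹ • ∑ z : ι → ZMod p,
      (ZMod.stdAddChar (-(2⁻¹ * (z ⬝ᵥ (v - u)) + z ⬝ᵥ u)) : ℂ) • weyl (v - u, z) := by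
  have hp0 : (p : ℂ) ^ Fintype.card ι ≠ 0 :=
    pow_ne_zero _ (Nat.cast_ne_zero.2 (Fact.out : p.Prime).ne_zero)
  ext v' u'
  simp only [Matrix.single_apply, Matrix.smul_apply, Matrix.sum_apply, weyl_add_phase, smul_eq_mul]
  by_cases h : v' = u' + (v - u)
  · simp only [if_pos h]
    have : ∀ z : ι → ZMod p, -(2⁻¹ * (z ⬝ᵥ (v - u)) + z ⬝ᵥ u) +
        (2⁻¹ * (z ⬝ᵥ (v - u)) + z ⬝ᵥ u') = z ⬝ᵥ (u' - u) := by
      intro z; rw [dotProduct_sub z u']; ring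
    simp only [this, char_sum_dotProduct, sub_eq_zero]
    by_cases h' : u' = u
    · rw [if_pos h', if_pos ⟨by rw [h, h']; abel, h'.symm⟩, inv_mul_cancel₀ hp0]
    · rw [if_neg h', if_neg (fun h'' => h' h''.2.symm), mul_zero]
  · simp only [if_neg h, Finset.sum_const_zero, mul_zero]
    rw [if_neg]; rintro ⟨rfl, rfl⟩; exact h (by abel)

theorem span_weyl : Submodule.span ℂ (Set.range (weyl : Label p ι → Op p ι ι)) = ⊤ := by
  rw [eq_top_iff]
  intro M _
  rw [Matrix.matrix_eq_sum_single M]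
  refine Submodule.sum_mem _ fun v _ => Submodule.sum_mem _ fun u _ => ?_
  have : Matrix.single v u (M v u) = M v u • Matrix.single v u (1 : ℂ) := by simp
  rw [this, single_eq_sum_weyl]
  refine Submodule.smul_mem _ _ (Submodule.smul_mem _ _ (Submodule.sum_mem _ fun z _ =>
    Submodule.smul_mem _ _ (Submodule.subset_span ⟨_, rfl⟩)))

theorem exists_weyl_expansion (M : Op p ι ι) :
    ∃ c : Label p ι → ℂ, M = ∑ a, c a • weyl a := by
  have h : M ∈ Submodule.span ℂ (Set.range (weyl : Label p ι → Op p ι ι)) := by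
    rw [span_weyl]; trivial
  obtain ⟨c, hc⟩ := (Submodule.mem_span_range_iff_exists_fun ℂ).1 h
  exact ⟨c, hc.symm⟩

theorem linearMap_ext_weyl {E : Type*} [AddCommGroup E] [Module ℂ E]
    {f g : Op p ι ι →ₗ[ℂ] E} (h : ∀ a, f (weyl a) = g (weyl a)) : f = g :=
  LinearMap.ext_on span_weyl (by rintro _ ⟨a, rfl⟩; exact h a)

theorem card_label_ne_zero : (Fintype.card (Label p ι) : ℂ) ≠ 0 :=
  Nat.cast_ne_zero.2 Fintype.card_ne_zero

/-- Twirling over all labels: by orthogonality of characters only the identity component of `M`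
survives. -/
theorem sum_weyl_conj (M : Op p ι ι) :
    ∃ c : ℂ, ∑ a : Label p ι, weyl a * M * weyl (-a) = c • 1 := by
  obtain ⟨c, rfl⟩ := exists_weyl_expansion M
  refine ⟨c 0 * Fintype.card (Label p ι), ?_⟩
  simp only [Matrix.mul_sum, Matrix.sum_mul, Matrix.mul_smul, Matrix.smul_mul, weyl_conj_weyl]
  rw [Finset.sum_comm]
  simp only [smul_comm (c _), ← Finset.sum_smul, char_sum_symp]
  rw [Finset.sum_eq_single 0]
  · rw [if_pos rfl, weyl_zero, smul_smul, mul_comm]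
  · intro b _ hb; rw [if_neg hb, zero_smul]
  · intro h; exact absurd (Finset.mem_univ _) h

/-- Schur's lemma for the Pauli group. -/
theorem eq_smul_one_of_comm {M : Op p ι ι} (h : ∀ a, weyl a * M = M * weyl a) :
    ∃ c : ℂ, M = c • 1 := by
  obtain ⟨c, hc⟩ := sum_weyl_conj M
  have : ∀ a : Label p ι, weyl a * M * weyl (-a) = M := fun a => by
    rw [h, Matrix.mul_assoc, weyl_mul_weyl_neg, Matrix.mul_one]
  simp only [this, Finset.sum_const, Finset.card_univ] at hc
  refine ⟨(Fintype.card (Label p ι) : ℂ)⁻¹ * c, ?_⟩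
  rw [mul_smul, ← hc, ← Nat.cast_smul_eq_nsmul ℂ, smul_smul,
    inv_mul_cancel₀ card_label_ne_zero, one_smul]

theorem eq_zero_of_weyl_eq_smul_one {a : Label p ι} {c : ℂ} (h : weyl a = c • 1) : a = 0 := by
  apply eq_zero_of_symp
  intro b
  rw [← weyl_comm_iff, h]; simp

theorem weyl_eq_smul_weyl {a b : Label p ι} {c : ℂ} (h : weyl a = c • weyl b) : a = b := by
  have : weyl (a - b) = (ZMod.stdAddChar (-(2⁻¹ * symp a (-b))) * c : ℂ) • 1 := by
    rw [sub_eq_add_neg, weyl_add, h, Matrix.smul_mul, weyl_mul_weyl_neg, smul_smul]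
  exact sub_eq_zero.1 (eq_zero_of_weyl_eq_smul_one this)

theorem exists_symp_eq_on (A : Submodule (ZMod p) (Label p ι)) (φ : A →ₗ[ZMod p] ZMod p) :
    ∃ b : Label p ι, ∀ a : A, symp b a = φ a := by
  obtain ⟨ψ, hψ⟩ := LinearMap.exists_extend φ
  obtain ⟨b, hb⟩ := exists_symp_eq ψ
  exact ⟨b, fun a => by rw [hb, ← hψ]; rfl⟩

/-- Multiplicative functions on a space of labels are symplectic characters. -/
theorem exists_char_symp_eq (A : Submodule (ZMod p) (Label p ι)) (c : A → ℂ)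
    (h0 : c 0 = 1) (hadd : ∀ a b, c (a + b) = c a * c b) :
    ∃ t : Label p ι, ∀ a : A, c a = ZMod.stdAddChar (symp t a) := by
  have hpow : ∀ (n : ℕ) a, c (n • a) = c a ^ n := by
    intro n a
    induction n with
    | zero => simp [h0]
    | succ n ih => rw [succ_nsmul, hadd, ih, pow_succ]
  -- Multiplicativity and `p • a = 0` give `c a ^ p = 1`.
  have hroot : ∀ a, ∃ y : ZMod p, c a = ZMod.stdAddChar y := by
    intro a
    apply exists_char_eq_of_pow_eq_one
    rw [← hpow, ← Nat.cast_smul_eq_nsmul (ZMod p)]; simp [h0]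
  choose y hy using hroot
  let φ : A →+ ZMod p := AddMonoidHom.mk' y (fun a b => by
    rw [← char_inj, AddChar.map_add_eq_mul, ← hy, ← hy, ← hy, hadd])
  obtain ⟨t, ht⟩ := exists_symp_eq_on A (φ.toZModLinearMap p)
  exact ⟨t, fun a => by rw [ht, hy]; rfl⟩

theorem trace_weyl (a : Label p ι) :
    (weyl a).trace = if a = 0 then (p : ℂ) ^ Fintype.card ι else 0 := by
  split_ifs with h
  · rw [h, weyl_zero, Matrix.trace_one]; simp
  · have : ∃ b, symp b a ≠ 0 := by
      by_contra! hb
      exact h (eq_zero_of_symp fun b => by rw [symp_swap, hb, neg_zero])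
    obtain ⟨b, hb⟩ := this
    -- Conjugation preserves the trace but multiplies it by a phase different from 1, so the trace
    -- vanishes.
    have h1 : (weyl b * weyl a * weyl (-b)).trace = (weyl a).trace := by
      rw [Matrix.trace_mul_comm, ← Matrix.mul_assoc, weyl_neg_mul_weyl, Matrix.one_mul]
    rw [weyl_conj_weyl, Matrix.trace_smul, smul_eq_mul] at h1
    by_contra h2
    exact hb (char_eq_one_iff.1 (mul_right_cancel₀ h2 (h1.trans (one_mul _).symm)))

end Weyl

/-! ### Stabiliser maps intertwine a coisotropic relation -/

section StabRel

set_option linter.unusedSectionVars false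

variable {p : ℕ} [Fact p.Prime] [Fact (p ≠ 2)]
variable {ι κ μ ι' κ' : Type*} [Fintype ι] [DecidableEq ι] [Fintype κ] [DecidableEq κ]
  [Fintype μ] [DecidableEq μ] [Fintype ι'] [DecidableEq ι'] [Fintype κ'] [DecidableEq κ']

/-- Pairs of labels `(b, a)` such that `W(b) f` and `f W(a)` agree up to a phase. -/
def stabRel (f : Op p κ ι) : Submodule (ZMod p) (Label p κ × Label p ι) :=
  AddSubgroup.toZModSubmodule p
    { carrier := {x | ∃ c : ℂ, ‖c‖ = 1 ∧ weyl x.1 * f = c • (f * weyl x.2)}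
      zero_mem' := ⟨1, norm_one, by simp⟩
      add_mem' := by
        rintro ⟨b, a⟩ ⟨b', a'⟩ ⟨c, hc, h⟩ ⟨c', hc', h'⟩
        refine ⟨ZMod.stdAddChar (-(2⁻¹ * symp b b')) * c * c' *
          ZMod.stdAddChar (2⁻¹ * symp a a'), by simp [hc, hc'], ?_⟩
        dsimp only at h h' ⊢
        rw [Prod.mk_add_mk, weyl_add, Matrix.smul_mul, Matrix.mul_assoc, h', Matrix.mul_smul,
          ← Matrix.mul_assoc, h, Matrix.smul_mul, Matrix.mul_assoc, weyl_mul, Matrix.mul_smul]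
        simp only [smul_smul]
        congr 1; ring
      neg_mem' := by
        rintro ⟨b, a⟩ ⟨c, hc, h⟩
        have hc0 : c ≠ 0 := by rw [← norm_ne_zero_iff, hc]; exact one_ne_zero
        refine ⟨c⁻¹, by simp [hc], ?_⟩
        dsimp only at h ⊢
        have : f * weyl (-a) = c • (weyl (-b) * f) := by
          calc f * weyl (-a) = weyl (-b) * (weyl b * f) * weyl (-a) := by
                rw [← Matrix.mul_assoc, weyl_neg_mul_weyl, Matrix.one_mul]
            _ = c • (weyl (-b) * f) := by
                rw [h, Matrix.mul_smul, Matrix.smul_mul, Matrix.mul_assoc, Matrix.mul_assoc,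
                  weyl_mul_weyl_neg, Matrix.mul_one]
        rw [Prod.neg_mk, this, smul_smul, inv_mul_cancel₀ hc0, one_smul] }

theorem mem_stabRel {f : Op p κ ι} {b : Label p κ} {a : Label p ι} :
    (b, a) ∈ stabRel f ↔ ∃ c : ℂ, ‖c‖ = 1 ∧ weyl b * f = c • (f * weyl a) := Iff.rfl

/-- A relation between labels is coisotropic if it contains its symplectic complement. -/
def Coisotropic (L : Submodule (ZMod p) (Label p κ × Label p ι)) : Prop :=
  ∀ b a, (∀ x ∈ L, symp b x.1 = symp a x.2) → (b, a) ∈ L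

/-- Moving `weyl b` and `weyl b'` past `f` in the two possible orders produces the commutator phase
on either side, and `f ≠ 0` allows these to be compared. Thus the relation is isotropic for the
difference of the two forms. -/
theorem symp_eq_of_mem_stabRel {f : Op p κ ι} (hf : f ≠ 0) {b b' : Label p κ} {a a' : Label p ι}
    (h : (b, a) ∈ stabRel f) (h' : (b', a') ∈ stabRel f) : symp b b' = symp a a' := by
  obtain ⟨c, hc, h⟩ := mem_stabRel.1 h
  obtain ⟨c', hc', h'⟩ := mem_stabRel.1 h'
  have hc0 : c ≠ 0 := by rw [← norm_ne_zero_iff, hc]; exact one_ne_zero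
  have hc0' : c' ≠ 0 := by rw [← norm_ne_zero_iff, hc']; exact one_ne_zero
  have h1 : weyl b * weyl b' * f = (c' * c) • (f * (weyl a * weyl a')) := by
    rw [Matrix.mul_assoc, h', Matrix.mul_smul, ← Matrix.mul_assoc, h, Matrix.smul_mul, smul_smul,
      Matrix.mul_assoc]
  have h2 : weyl b' * weyl b * f = (c' * c) • (f * (weyl a' * weyl a)) := by
    rw [Matrix.mul_assoc, h, Matrix.mul_smul, ← Matrix.mul_assoc, h', Matrix.smul_mul, smul_smul,
      Matrix.mul_assoc, mul_comm c]
  rw [weyl_comm, Matrix.smul_mul, h2, weyl_comm a a', Matrix.mul_smul] at h1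
  have h3 : (((ZMod.stdAddChar (symp b b') : ℂ) - ZMod.stdAddChar (symp a a')) * (c' * c)) •
      (f * (weyl a' * weyl a)) = 0 := by
    rw [sub_mul, sub_smul, mul_smul, h1, sub_eq_zero, smul_smul, mul_comm]
  rcases smul_eq_zero.1 h3 with h4 | h4
  · rcases mul_eq_zero.1 h4 with h5 | h5
    · exact char_inj.1 (sub_eq_zero.1 h5)
    · exact absurd h5 (mul_ne_zero hc0' hc0)
  · exfalso; apply hf
    calc f = f * (weyl a' * weyl a) * (weyl (-a) * weyl (-a')) := by
          rw [Matrix.mul_assoc, Matrix.mul_assoc, ← Matrix.mul_assoc (weyl a), weyl_mul_weyl_neg,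
            Matrix.one_mul, weyl_mul_weyl_neg, Matrix.mul_one]
      _ = 0 := by rw [h4, Matrix.zero_mul]

/-- The content is the choice of an intermediate label `b`. It must have prescribed pairings with
both relations, and these prescriptions are consistent precisely because `(d, a)` is orthogonal to
every composable pair. -/
theorem coisotropic_comp {g : Op p μ κ} {f : Op p κ ι} (hg : Coisotropic (stabRel g))
    (hf : Coisotropic (stabRel f)) : Coisotropic (stabRel (g * f)) := by
  intro d a h
  have hmem : ∀ c b e, (c, b) ∈ stabRel g → (b, e) ∈ stabRel f → (c, e) ∈ stabRel (g * f) := by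
    intro c b e h1 h2
    obtain ⟨r, hr, h1⟩ := mem_stabRel.1 h1
    obtain ⟨s, hs, h2⟩ := mem_stabRel.1 h2
    refine mem_stabRel.2 ⟨r * s, by rw [norm_mul, hr, hs, one_mul], ?_⟩
    rw [← Matrix.mul_assoc, h1, Matrix.smul_mul, Matrix.mul_assoc, h2, Matrix.mul_smul, smul_smul,
      Matrix.mul_assoc]
  let δ : (stabRel g × stabRel f) →ₗ[ZMod p] Label p κ :=
    (LinearMap.snd _ _ _ ∘ₗ (stabRel g).subtype) ∘ₗ LinearMap.fst _ _ _ -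
    (LinearMap.fst _ _ _ ∘ₗ (stabRel f).subtype) ∘ₗ LinearMap.snd _ _ _
  let φ : (stabRel g × stabRel f) →ₗ[ZMod p] ZMod p :=
    symp d ∘ₗ (LinearMap.fst _ _ _ ∘ₗ (stabRel g).subtype) ∘ₗ LinearMap.fst _ _ _ -
    symp a ∘ₗ (LinearMap.snd _ _ _ ∘ₗ (stabRel f).subtype) ∘ₗ LinearMap.snd _ _ _
  -- `φ` vanishes on the kernel of `δ`, which consists of the composable pairs; hence it factors
  -- through `δ`, and the factor is pairing with some `b`.
  have hφ : φ ∈ LinearMap.range δ.dualMap := by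
    rw [LinearMap.range_dualMap_eq_dualAnnihilator_ker, Submodule.mem_dualAnnihilator]
    rintro ⟨⟨⟨c, b⟩, h1⟩, ⟨⟨b', e⟩, h2⟩⟩ hk
    have hb : b = b' := sub_eq_zero.1 hk
    subst hb
    exact sub_eq_zero.2 (h (c, e) (hmem c b e h1 h2))
  obtain ⟨ψ, hψ⟩ := hφ
  obtain ⟨b, hb⟩ := exists_symp_eq ψ
  have key : ∀ x, symp b (δ x) = φ x := fun x => by rw [hb, ← hψ]; rfl
  refine hmem d b a (hg d b fun x hx => ?_) (hf b a fun x hx => ?_)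
  · have := key (⟨x, hx⟩, 0)
    simpa [δ, φ] using this.symm
  · have := key (0, ⟨x, hx⟩)
    simpa [δ, φ] using this

theorem coisotropic_conjTranspose {f : Op p κ ι} (hf : Coisotropic (stabRel f)) :
    Coisotropic (stabRel fᴴ) := by
  have hmem : ∀ b a, (b, a) ∈ stabRel f → (a, b) ∈ stabRel fᴴ := by
    intro b a h
    obtain ⟨c, hc, h⟩ := mem_stabRel.1 (neg_mem h : -(b, a) ∈ stabRel f)
    have hc0 : star c ≠ 0 := by
      rw [← norm_ne_zero_iff, norm_star, hc]; exact one_ne_zero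
    have h' := congrArg Matrix.conjTranspose h
    simp only [Matrix.conjTranspose_smul, Matrix.conjTranspose_mul, weyl_conjTranspose,
      neg_neg] at h'
    refine mem_stabRel.2 ⟨(star c)⁻¹, by rw [norm_inv, norm_star, hc, inv_one], ?_⟩
    rw [h', smul_smul, inv_mul_cancel₀ hc0, one_smul]
  intro a b h
  exact hmem b a (hf b a fun x hx => (h (x.2, x.1) (hmem _ _ hx)).symm)

/-- If `(b, a)` is orthogonal to the graph of the action of `U` on labels, then `Uᴴ W(b) U W(-a)`
commutes with every Weyl operator. By Schur's lemma it is a scalar, and unitarity makes the scalar a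
phase. -/
theorem coisotropic_clifford {U : Op p ι ι} (hU : U ∈ cliffordGroup p ι) :
    Coisotropic (stabRel U) := by
  obtain ⟨h1, h2, h3⟩ := hU
  have hg : ∀ a, ∃ (y : ZMod p) (b : Label p ι), U * weyl a = (ZMod.stdAddChar y : ℂ) • (weyl b * U) := by
    intro a
    obtain ⟨y, b, h⟩ := mem_pauliGroup_iff.1
      (h3 (weyl a) (mem_pauliGroup_iff.2 ⟨0, a, by simp⟩))
    refine ⟨y, b, ?_⟩
    rw [← Matrix.smul_mul, ← h, Matrix.mul_assoc, h2, Matrix.mul_one]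
  choose y g hg using hg
  have hmem : ∀ a, (g a, a) ∈ stabRel U := fun a =>
    mem_stabRel.2 ⟨ZMod.stdAddChar (-y a), norm_char _, by
      rw [hg, smul_smul, mul_comm, char_mul_neg, one_smul]⟩
  intro b a h
  have hcomm : ∀ a', weyl a' * (Uᴴ * weyl b * U * weyl (-a)) =
      Uᴴ * weyl b * U * weyl (-a) * weyl a' := by
    intro a'
    have hg' : weyl a' * Uᴴ = (ZMod.stdAddChar (y a') : ℂ) • (Uᴴ * weyl (g a')) := by
      calc weyl a' * Uᴴ = Uᴴ * (U * weyl a') * Uᴴ := by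
            rw [← Matrix.mul_assoc, h2, Matrix.one_mul]
        _ = _ := by rw [hg, Matrix.mul_smul, Matrix.smul_mul, Matrix.mul_assoc, Matrix.mul_assoc,
            h1, Matrix.mul_one]
    have h4 : symp b (g a') = symp a a' := h _ (hmem a')
    calc weyl a' * (Uᴴ * weyl b * U * weyl (-a))
        = (weyl a' * Uᴴ) * weyl b * U * weyl (-a) := by simp only [Matrix.mul_assoc]
      _ = (ZMod.stdAddChar (y a') : ℂ) • (Uᴴ * (weyl (g a') * weyl b) * U * weyl (-a)) := by
          rw [hg']; simp only [Matrix.smul_mul, Matrix.mul_assoc]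
      _ = (ZMod.stdAddChar (symp (g a') b) : ℂ) •
            (Uᴴ * weyl b * ((ZMod.stdAddChar (y a') : ℂ) • (weyl (g a') * U)) * weyl (-a)) := by
          rw [weyl_comm (g a')]
          simp only [Matrix.smul_mul, Matrix.mul_smul, Matrix.mul_assoc]
          rw [smul_comm]
      _ = (ZMod.stdAddChar (symp (g a') b) : ℂ) •
            (Uᴴ * weyl b * U * (weyl a' * weyl (-a))) := by
          rw [← hg]; simp only [Matrix.mul_assoc]
      _ = _ := by
          rw [weyl_comm a', Matrix.mul_smul, smul_smul, ← AddChar.map_add_eq_mul, symp_swap _ b, h4,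
            map_neg, symp_swap a' a]
          simp [Matrix.mul_assoc]
  obtain ⟨c, hc⟩ := eq_smul_one_of_comm hcomm
  have hbU : weyl b * U = c • (U * weyl a) := by
    calc weyl b * U = (U * Uᴴ) * weyl b * U * (weyl (-a) * weyl a) := by
          rw [h1, weyl_neg_mul_weyl, Matrix.one_mul, Matrix.mul_one]
      _ = U * (Uᴴ * weyl b * U * weyl (-a)) * weyl a := by simp only [Matrix.mul_assoc]
      _ = _ := by rw [hc]; simp
  refine mem_stabRel.2 ⟨c, ?_, hbU⟩
  have h5 : (Uᴴ * weyl b * U * weyl (-a)) * (Uᴴ * weyl b * U * weyl (-a))ᴴ = 1 := by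
    simp only [Matrix.conjTranspose_mul, weyl_conjTranspose, Matrix.conjTranspose_conjTranspose,
      neg_neg]
    calc _ = Uᴴ * (weyl b * (U * (weyl (-a) * weyl a) * Uᴴ) * weyl (-b)) * U := by
          simp only [Matrix.mul_assoc]
      _ = 1 := by
          rw [weyl_neg_mul_weyl, Matrix.mul_one, h1, Matrix.mul_one, weyl_mul_weyl_neg,
            Matrix.mul_one, h2]
  rw [hc] at h5
  have h6 := congrFun (congrFun h5 0) 0
  simp only [Matrix.conjTranspose_smul, Matrix.conjTranspose_one, Matrix.mul_smul,
    Matrix.smul_apply, Matrix.one_apply_eq, smul_eq_mul, mul_one] at h6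
  have h7 : ‖c‖ * ‖c‖ = 1 := by
    have := congrArg norm h6
    simpa [norm_mul] using this
  nlinarith [norm_nonneg c]

theorem label_subsingleton [IsEmpty ι] (a : Label p ι) : a = 0 := Subsingleton.elim _ _

/-- This is where maximality of the stabiliser group is used: a label commuting with the whole group
but missing from the relation could be adjoined to give a strictly larger code. -/
theorem coisotropic_state [IsEmpty κ] {ψ : (ι → ZMod p) → ℂ} (hψ : IsStabState p ψ) :
    Coisotropic (stabRel (Matrix.of fun (v : ι → ZMod p) (_ : κ → ZMod p) => ψ v)) := by
  obtain ⟨-, S, hS, hfix⟩ := hψ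
  have hmem : ∀ (y : ZMod p) (b : Label p ι) (a : Label p κ),
      (ZMod.stdAddChar y : ℂ) • weyl b ∈ S →
      (b, a) ∈ stabRel (Matrix.of fun (v : ι → ZMod p) (_ : κ → ZMod p) => ψ v) := by
    intro y b a hb
    rw [label_subsingleton a]
    refine mem_stabRel.2 ⟨ZMod.stdAddChar (-y), norm_char _, ?_⟩
    have h1 := hfix _ hb
    rw [weyl_zero, Matrix.mul_one]
    ext v w
    have h2 := congrFun h1 v
    rw [Matrix.smul_mulVec, Pi.smul_apply, smul_eq_mul] at h2
    simp only [Matrix.smul_apply, Matrix.of_apply, smul_eq_mul]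
    rw [← h2, ← mul_assoc, mul_comm (ZMod.stdAddChar (-y) : ℂ), char_mul_neg, one_mul]
    rfl
  intro b a h
  have hcomm : ∀ s ∈ S, weyl b * s = s * weyl b := by
    intro s hs
    obtain ⟨y, b', rfl⟩ := mem_pauliGroup_iff.1 (hS.1.subset hs)
    have := h _ (hmem y b' 0 hs)
    rw [Matrix.mul_smul, Matrix.smul_mul, (weyl_comm_iff b b').2 (by rw [this]; simp)]
  by_contra hba
  -- The group generated by `S` and `weyl b`.
  let S' : Set (Op p ι ι) := {P | ∃ s ∈ S, ∃ k : ZMod p, P = s * weyl (k • b)}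
  have hcommk : ∀ s ∈ S, ∀ k : ZMod p, weyl (k • b) * s = s * weyl (k • b) := by
    intro s hs k
    rw [← ZMod.natCast_zmod_val k, Nat.cast_smul_eq_nsmul, weyl_nsmul]
    exact ((show Commute (weyl b) s from hcomm s hs).pow_left _)
  have hadd : ∀ k l : ZMod p, weyl (k • b) * weyl (l • b) = weyl ((k + l) • b) := by
    intro k l; rw [weyl_mul_of_symp_eq_zero (by simp), add_smul]
  have hS' : IsStabCode p S' := by
    refine ⟨?_, ⟨1, hS.1.one_mem, 0, by simp⟩, ?_, ?_, ?_, ?_⟩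
    · rintro _ ⟨s, hs, k, rfl⟩
      obtain ⟨y, b', rfl⟩ := mem_pauliGroup_iff.1 (hS.1.subset hs)
      rw [Matrix.smul_mul, weyl_mul, smul_smul, ← AddChar.map_add_eq_mul]
      exact mem_pauliGroup_iff.2 ⟨_, _, rfl⟩
    · rintro _ ⟨s, hs, k, rfl⟩ _ ⟨t, ht, l, rfl⟩
      refine ⟨s * t, hS.1.mul_mem s hs t ht, k + l, ?_⟩
      rw [← hadd, Matrix.mul_assoc, ← Matrix.mul_assoc _ t, hcommk t ht]
      simp only [Matrix.mul_assoc]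
    · rintro _ ⟨s, hs, k, rfl⟩
      refine ⟨sᴴ, hS.1.inv_mem s hs, -k, ?_⟩
      rw [Matrix.conjTranspose_mul, weyl_conjTranspose, ← neg_smul, hcommk _ (hS.1.inv_mem s hs)]
    · rintro _ ⟨s, hs, k, rfl⟩ _ ⟨t, ht, l, rfl⟩
      calc s * weyl (k • b) * (t * weyl (l • b))
          = s * (weyl (k • b) * t) * weyl (l • b) := by simp only [Matrix.mul_assoc]
        _ = (s * t) * (weyl (k • b) * weyl (l • b)) := by
            rw [hcommk t ht]; simp only [Matrix.mul_assoc]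
        _ = (t * s) * (weyl (l • b) * weyl (k • b)) := by
            rw [hS.1.comm s hs t ht, hadd, hadd, add_comm]
        _ = t * (s * weyl (l • b)) * weyl (k • b) := by simp only [Matrix.mul_assoc]
        _ = _ := by rw [← hcommk s hs]; simp only [Matrix.mul_assoc]
    -- A phase in `S'` either lies in `S` already (`k = 0`), or puts a phase multiple of `weyl (k •
    -- b)` into `S`. In the latter case dividing by `k` puts `b` into the relation, against `hba`.
    · rintro y ⟨s, hs, k, hy⟩
      have h1 : weyl (k • b) = (ZMod.stdAddChar y : ℂ) • sᴴ := by
        obtain ⟨y', b', rfl⟩ := mem_pauliGroup_iff.1 (hS.1.subset hs)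
        rw [Matrix.conjTranspose_smul, weyl_conjTranspose, star_char]
        have h2 : weyl (-b') * (((ZMod.stdAddChar y : ℂ) • (1 : Op p ι ι))) =
            (ZMod.stdAddChar y' : ℂ) • weyl (k • b) := by
          rw [hy, Matrix.smul_mul, Matrix.mul_smul, ← Matrix.mul_assoc, weyl_neg_mul_weyl,
            Matrix.one_mul]
        rw [Matrix.mul_smul, Matrix.mul_one] at h2
        rw [smul_comm, h2, smul_smul, mul_comm, char_mul_neg, one_smul]
      by_cases hk : k = 0
      · subst hk
        rw [zero_smul, weyl_zero, Matrix.mul_one] at hy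
        exact hS.1.phase y (hy ▸ hs)
      · exfalso
        apply hba
        have h3 : (ZMod.stdAddChar (-y) : ℂ) • weyl (k • b) ∈ S := by
          rw [h1, smul_smul, mul_comm, char_mul_neg, one_smul]; exact hS.1.inv_mem s hs
        have h4 := Submodule.smul_mem _ k⁻¹ (hmem _ _ (0 : Label p κ) h3)
        rw [label_subsingleton a]
        simpa [smul_smul, inv_mul_cancel₀ hk] using h4
  have hSS' : S ⊆ S' := fun s hs => ⟨s, hs, 0, by simp⟩
  have hbS : weyl b ∈ S := hS.2 hS' hSS' ⟨1, hS.1.one_mem, 1, by simp⟩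
  exact hba (hmem 0 b a (by simpa using hbS))

/-- The label on a sum type with the given components. -/
def Label.sum (a : Label p ι) (b : Label p κ) : Label p (ι ⊕ κ) :=
  (Sum.elim a.1 b.1, Sum.elim a.2 b.2)

/-- Pullback of a label along a map of index types. -/
def Label.comap {ι κ : Type*} (e : ι → κ) (a : Label p κ) : Label p ι := (a.1 ∘ e, a.2 ∘ e)

theorem Label.sum_comap (a : Label p (ι ⊕ κ)) :
    Label.sum (a.comap Sum.inl) (a.comap Sum.inr) = a := by
  ext i <;> cases i <;> rfl

theorem symp_sum (a : Label p (ι ⊕ κ)) (b : Label p ι) (c : Label p κ) :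
    symp a (b.sum c) = symp (a.comap Sum.inl) b + symp (a.comap Sum.inr) c := by
  simp only [symp_apply, dotProduct, Fintype.sum_sum_type, Label.sum, Label.comap, Sum.elim_inl,
    Sum.elim_inr, Function.comp]
  ring

@[simp] theorem Label.comap_inr_sum (a : Label p ι) (b : Label p κ) :
    (a.sum b).comap Sum.inr = b := rfl

@[simp] theorem Label.comap_inl_sum (a : Label p ι) (b : Label p κ) :
    (a.sum b).comap Sum.inl = a := rfl

theorem weyl_sum (a : Label p ι) (b : Label p κ) :
    weyl (a.sum b) = tensor (weyl a) (weyl b) := by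
  ext v u
  simp only [tensor, Matrix.of_apply, weyl_apply, ite_mul, mul_ite, zero_mul, mul_zero,
    ← AddChar.map_add_eq_mul]
  have h : v = u + (a.sum b).1 ↔ v ∘ Sum.inl = u ∘ Sum.inl + a.1 ∧
      v ∘ Sum.inr = u ∘ Sum.inr + b.1 := by
    simp only [funext_iff, Sum.forall]; rfl
  by_cases h1 : v ∘ Sum.inl = u ∘ Sum.inl + a.1
  · by_cases h2 : v ∘ Sum.inr = u ∘ Sum.inr + b.1
    · rw [if_pos (h.2 ⟨h1, h2⟩), if_pos h2, if_pos h1]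
      congr 1
      simp only [dotProduct, Fintype.sum_sum_type, Label.sum, Sum.elim_inl, Sum.elim_inr,
        Function.comp]
      ring
    · rw [if_neg h2, if_neg (fun h' => h2 (h.1 h').2)]
  · rw [if_neg (fun h' => h1 (h.1 h').1)]; simp [h1]

theorem tensor_mul_tensor (g : Op p μ κ) (f : Op p κ ι) {μ'' : Type*} (g' : Op p μ'' κ')
    (f' : Op p κ' ι') : tensor g g' * tensor f f' = tensor (g * f) (g' * f') := by
  ext v u
  simp only [tensor, Matrix.mul_apply, Matrix.of_apply, Finset.sum_mul_sum, ← Finset.sum_product']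
  refine Fintype.sum_equiv (Equiv.sumArrowEquivProdArrow κ κ' (ZMod p)) _ _ fun w => ?_
  simp only [Equiv.sumArrowEquivProdArrow, Equiv.coe_fn_mk]
  ring

theorem tensor_smul_smul (c d : ℂ) (f : Op p κ ι) (g : Op p κ' ι') :
    tensor (c • f) (d • g) = (c * d) • tensor f g := by
  ext v u; simp only [tensor, Matrix.of_apply, Matrix.smul_apply, smul_eq_mul]; ring

theorem coisotropic_tensor {f : Op p κ ι} {g : Op p κ' ι'} (hf : Coisotropic (stabRel f))
    (hg : Coisotropic (stabRel g)) : Coisotropic (stabRel (tensor f g)) := by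
  have hmem : ∀ b a b' a', (b, a) ∈ stabRel f → (b', a') ∈ stabRel g →
      (b.sum b', a.sum a') ∈ stabRel (tensor f g) := by
    intro b a b' a' h1 h2
    obtain ⟨c, hc, h1⟩ := mem_stabRel.1 h1
    obtain ⟨d, hd, h2⟩ := mem_stabRel.1 h2
    refine mem_stabRel.2 ⟨c * d, by rw [norm_mul, hc, hd, one_mul], ?_⟩
    rw [weyl_sum, weyl_sum, tensor_mul_tensor, h1, h2, tensor_smul_smul, tensor_mul_tensor]
  intro b a h
  rw [← b.sum_comap, ← a.sum_comap]
  apply hmem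
  · refine hf _ _ fun x hx => ?_
    have := h _ (hmem x.1 x.2 0 0 hx (zero_mem _))
    simpa [symp_sum] using this
  · refine hg _ _ fun x hx => ?_
    have := h _ (hmem 0 0 x.1 x.2 (zero_mem _) hx)
    simpa [symp_sum] using this

theorem symp_comap_equiv (e : ι ≃ κ) (a b : Label p κ) :
    symp (a.comap e) (b.comap e) = symp a b := by
  simp only [symp_apply, Label.comap]
  rw [comp_equiv_dotProduct_comp_equiv, comp_equiv_dotProduct_comp_equiv]

theorem weyl_comap_equiv (e : ι ≃ κ) (a : Label p κ) (v u : κ → ZMod p) :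
    weyl (a.comap e) (v ∘ e) (u ∘ e) = weyl a v u := by
  simp only [weyl_apply, Label.comap]
  rw [comp_equiv_dotProduct_comp_equiv, comp_equiv_dotProduct_comp_equiv]
  have : v ∘ e = u ∘ e + a.1 ∘ e ↔ v = u + a.1 := by
    rw [← e.surjective.injective_comp_right.eq_iff (a := v)]; rfl
  simp only [this]

theorem sum_comp_equiv {M : Type*} [AddCommMonoid M] (e : ι ≃ κ) (F : (ι → ZMod p) → M) :
    ∑ w : κ → ZMod p, F (w ∘ e) = ∑ w, F w :=
  Fintype.sum_equiv (e.symm.arrowCongr (Equiv.refl _)) _ _ fun _ => rfl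

theorem coisotropic_relabel (e : ι ≃ ι') (e' : κ ≃ κ') {f : Op p κ ι}
    (hf : Coisotropic (stabRel f)) :
    Coisotropic (stabRel
      (Matrix.of fun (v : κ' → ZMod p) (u : ι' → ZMod p) => f (v ∘ e') (u ∘ e))) := by
  have hmem : ∀ (b : Label p κ') (a : Label p ι'), (b.comap e', a.comap e) ∈ stabRel f →
      (b, a) ∈ stabRel
        (Matrix.of fun (v : κ' → ZMod p) (u : ι' → ZMod p) => f (v ∘ e') (u ∘ e)) := by
    intro b a h
    obtain ⟨c, hc, h⟩ := mem_stabRel.1 h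
    refine mem_stabRel.2 ⟨c, hc, ?_⟩
    ext v u
    have h1 := congrFun (congrFun h (v ∘ e')) (u ∘ e)
    simp only [Matrix.smul_apply, Matrix.mul_apply, Matrix.of_apply] at h1 ⊢
    rw [← sum_comp_equiv e', ← sum_comp_equiv e] at h1
    simpa only [weyl_comap_equiv] using h1
  intro b a h
  refine hmem b a (hf _ _ fun x hx => ?_)
  have h2 : (x.1.comap e'.symm).comap e' = x.1 := by simp [Label.comap, Function.comp_assoc]
  have h3 : (x.2.comap e.symm).comap e = x.2 := by simp [Label.comap, Function.comp_assoc]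
  have := h (x.1.comap e'.symm, x.2.comap e.symm) (hmem _ _ (by rw [h2, h3]; exact hx))
  rw [← symp_comap_equiv e', h2, ← symp_comap_equiv e, h3] at this
  exact this

theorem coisotropic_of_subsingleton [IsEmpty ι] [IsEmpty κ] (f : Op p κ ι) :
    Coisotropic (stabRel f) := by
  intro b a _
  rw [label_subsingleton a, label_subsingleton b]; exact zero_mem _

end StabRel

section

variable {p : ℕ} [Fact p.Prime] [Fact (p ≠ 2)]

/-- The finiteness and decidability instances are introduced after the induction because `IsStab`
itself fixes none on its index types; in the tensor case finiteness of the summands is recovered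
from that of the sum. -/
theorem IsStab.coisotropic {ι κ : Type u} {f : Op p κ ι} (hf : IsStab p f) :
    ∀ [Fintype ι] [DecidableEq ι] [Fintype κ] [DecidableEq κ], Coisotropic (stabRel f) := by
  induction hf with
  | @state ι i1 i2 ψ h =>
    intro _ _ j1 j2
    obtain rfl := Subsingleton.elim i1 j1
    obtain rfl := Subsingleton.elim i2 j2
    exact coisotropic_state h
  | @clifford ι i1 i2 U h =>
    intro j1 j2 k1 k2
    obtain rfl := Subsingleton.elim i1 j1
    obtain rfl := Subsingleton.elim i2 j2
    obtain rfl := Subsingleton.elim i1 k1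
    obtain rfl := Subsingleton.elim i2 k2
    exact coisotropic_clifford h
  | sqrt =>
    intro i1 i2 i3 i4
    exact @coisotropic_of_subsingleton p _ _ _ _ i1 i2 i3 i4 _ _ _
  | invSqrt =>
    intro i1 i2 i3 i4
    exact @coisotropic_of_subsingleton p _ _ _ _ i1 i2 i3 i4 _ _ _
  | comp g f _ _ hg hf => intros; exact coisotropic_comp hg hf
  | @tensor ι κ ι' κ' f g _ _ hf hg =>
    intro i1 i2 i3 i4
    classical
    have : Finite (ι ⊕ ι') := inferInstance
    have : Finite (κ ⊕ κ') := inferInstance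
    have : Fintype ι := @Fintype.ofFinite _ (Finite.sum_left ι')
    have : Fintype ι' := @Fintype.ofFinite _ (Finite.sum_right ι)
    have : Fintype κ := @Fintype.ofFinite _ (Finite.sum_left κ')
    have : Fintype κ' := @Fintype.ofFinite _ (Finite.sum_right κ)
    convert coisotropic_tensor hf hg
  | adjoint f _ hf => intros; exact coisotropic_conjTranspose hf
  | @relabel ι κ ι' κ' e e' f _ hf =>
    intro i1 i2 i3 i4
    classical
    have : Fintype ι := Fintype.ofEquiv _ e.symm
    have : Fintype κ := Fintype.ofEquiv _ e'.symm
    exact coisotropic_relabel e e' hf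

end

/-! ### Symplectic frames -/

section Frame

set_option linter.unusedSectionVars false

variable {p : ℕ} [Fact p.Prime] [Fact (p ≠ 2)] {T : Type*} [Fintype T] [DecidableEq T]

/-- The standard symplectic basis; `inl` is the `X` half and `inr` the `Z` half. -/
def stdLabel (p : ℕ) {T : Type*} [DecidableEq T] : T ⊕ T → Label p T :=
  Sum.elim (fun i => (Pi.single i 1, 0)) (fun i => (0, Pi.single i 1))

/-- The symplectic form of the standard symplectic basis. -/
def stdForm (p : ℕ) [Fact p.Prime] (k l : T ⊕ T) : ZMod p := symp (stdLabel p k) (stdLabel p l)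

theorem stdForm_of_ne {k l : T ⊕ T} (h : l ≠ k.swap) : stdForm p k l = 0 := by
  rcases k with i | i <;> rcases l with j | j <;>
    simp_all [stdForm, stdLabel, symp_apply]

theorem stdForm_swap_ne_zero (k : T ⊕ T) : stdForm p k k.swap ≠ 0 := by
  rcases k with i | i <;> simp [stdForm, stdLabel, symp_apply]

@[simp] theorem stdForm_self (k : T ⊕ T) : stdForm p k k = 0 := symp_self _

/-- A partial symplectic basis, indexed by `s`. -/
structure IsFrame (s : Finset (T ⊕ T)) (v : T ⊕ T → Label p T) : Prop where
  indep : LinearIndepOn (ZMod p) v (s : Set (T ⊕ T))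
  form : ∀ k ∈ s, ∀ l ∈ s, symp (v k) (v l) = stdForm p k l

theorem symp_eq_zero_of_mem_span {S : Set (Label p T)} {w x : Label p T}
    (h : ∀ y ∈ S, symp w y = 0) (hx : x ∈ Submodule.span (ZMod p) S) : symp w x = 0 := by
  have : Submodule.span (ZMod p) S ≤ LinearMap.ker (symp w) := Submodule.span_le.2 h
  exact this hx

theorem IsFrame.insert {s : Finset (T ⊕ T)} {v : T ⊕ T → Label p T} (hv : IsFrame s v)
    {k : T ⊕ T} (hk : k ∉ s) {w : Label p T} (hw : ∀ l ∈ s, symp (v l) w = stdForm p l k)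
    (hspan : w ∉ Submodule.span (ZMod p) (v '' s)) :
    IsFrame (insert k s) (Function.update v k w) := by
  have heq : Set.EqOn (Function.update v k w) v (s : Set (T ⊕ T)) := fun l hl =>
    Function.update_of_ne (by rintro rfl; exact hk hl) _ _
  refine ⟨?_, ?_⟩
  · rw [Finset.coe_insert]
    refine LinearIndepOn.insert ((linearIndepOn_congr heq).2 hv.indep) ?_
    rw [Function.update_self, heq.image_eq]
    exact hspan
  · intro l hl m hm
    rcases Finset.mem_insert.1 hl with rfl | hl' <;> rcases Finset.mem_insert.1 hm with rfl | hm'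
    · simp
    · rw [Function.update_self, heq hm', symp_swap, hw m hm', stdForm, symp_swap, neg_neg]; rfl
    · rw [Function.update_self, heq hl', hw l hl']
    · rw [heq hl', heq hm', hv.form l hl' m hm']

/-- Independent vectors can have their pairings with one unknown vector prescribed freely: a
functional on their span extends to the whole space and is represented by the form. The sign in the
proof comes from swapping its arguments. -/
theorem LinearIndepOn.exists_symp_eq {s : Finset (T ⊕ T)} {v : T ⊕ T → Label p T}
    (hv : LinearIndepOn (ZMod p) v (s : Set (T ⊕ T))) (c : T ⊕ T → ZMod p) :
    ∃ w, ∀ k ∈ s, symp (v k) w = c k := by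
  let b := Module.Basis.span hv
  obtain ⟨w, hw⟩ := exists_symp_eq_on _ (b.constr (ZMod p) fun k => -c k)
  refine ⟨w, fun k hk => ?_⟩
  have h1 := hw (b ⟨k, hk⟩)
  rw [Module.Basis.constr_basis] at h1
  have h2 : ((b ⟨k, hk⟩ : _) : Label p T) = v k :=
    congrArg Subtype.val (Module.Basis.span_apply hv ⟨k, hk⟩)
  rw [h2] at h1
  rw [symp_swap, h1, neg_neg]

theorem finrank_label : Module.finrank (ZMod p) (Label p T) = Fintype.card (T ⊕ T) := by
  simp [Module.finrank_prod]

/-- Projection to the symplectic complement of a symplectic subspace. -/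
theorem IsFrame.exists_proj {s : Finset (T ⊕ T)} {v : T ⊕ T → Label p T} (hv : IsFrame s v)
    (hs : ∀ k ∈ s, k.swap ∈ s) (x : Label p T) :
    ∃ y ∈ Submodule.span (ZMod p) (v '' s), ∀ l ∈ s, symp (v l) (x - y) = 0 := by
  -- Symplectic Gram–Schmidt: the coefficient of `v k` is detected by pairing with its partner `v
  -- k.swap`.
  refine ⟨∑ k ∈ s, ((stdForm p k.swap k)⁻¹ * symp (v k.swap) x) • v k,
    Submodule.sum_mem _ fun k hk => Submodule.smul_mem _ _ (Submodule.subset_span ⟨k, hk, rfl⟩),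
    fun l hl => ?_⟩
  rw [map_sub, map_sum, Finset.sum_eq_single l.swap]
  · have h1 := stdForm_swap_ne_zero (p := p) l
    rw [map_smul, hv.form l hl _ (hs l hl), Sum.swap_swap, smul_eq_mul]
    field_simp; ring
  · intro k hk hkl
    rw [map_smul, hv.form l hl k hk, stdForm_of_ne hkl, smul_zero]
  · intro h; exact absurd (hs l hl) h

/-- Witt-type extension, one vector at a time. A missing partner is found by prescribing its
pairings; when no partner is missing, the frame spans a symplectic subspace, and any vector outside
it can be projected to the complement to open a new pair. -/
theorem IsFrame.complete {s : Finset (T ⊕ T)} {v : T ⊕ T → Label p T} (hv : IsFrame s v) :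
    ∃ v', Set.EqOn v v' (s : Set (T ⊕ T)) ∧ IsFrame Finset.univ v' := by
  induction hn : sᶜ.card generalizing s v with
  | zero =>
    have : s = Finset.univ := by
      rw [Finset.card_eq_zero] at hn; simpa using hn
    exact ⟨v, fun _ _ => rfl, this ▸ hv⟩
  | succ n ih =>
    have key : ∃ k, k ∉ s ∧ ∃ w, (∀ l ∈ s, symp (v l) w = stdForm p l k) ∧
        w ∉ Submodule.span (ZMod p) (v '' s) := by
      by_cases hs : ∃ k, k ∉ s ∧ k.swap ∈ s
      · obtain ⟨k, hk, hks⟩ := hs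
        obtain ⟨w, hw⟩ := LinearIndepOn.exists_symp_eq hv.indep (fun l => stdForm p l k)
        refine ⟨k, hk, w, hw, fun hmem => ?_⟩
        -- `v k.swap` is orthogonal to the present frame, since `k` is missing, but pairs
        -- nontrivially with `w`; so `w` is outside the span.
        have h1 := symp_eq_zero_of_mem_span (w := v k.swap) (x := w) ?_ hmem
        · rw [hw _ hks] at h1
          have h2 := stdForm_swap_ne_zero (p := p) k.swap
          rw [Sum.swap_swap] at h2
          exact h2 h1
        · rintro _ ⟨l, hl, rfl⟩
          rw [hv.form _ hks l hl, stdForm_of_ne]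
          rw [Sum.swap_swap]; rintro rfl; exact hk hl
      · push Not at hs
        have hs' : ∀ k ∈ s, k.swap ∈ s := fun k hk => by
          by_contra h; exact hs _ h (by rwa [Sum.swap_swap])
        obtain ⟨k, hk⟩ : ∃ k, k ∉ s := by
          by_contra! h
          have : sᶜ = ∅ := by ext k; simp [h k]
          rw [this] at hn; simp at hn
        have hlt : Submodule.span (ZMod p) (v '' s) ≠ ⊤ := by
          intro h
          have h1 : Module.finrank (ZMod p) (Submodule.span (ZMod p) (v '' s)) =
              Module.finrank (ZMod p) (⊤ : Submodule (ZMod p) (Label p T)) := by rw [h]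
          rw [finrank_top, finrank_label] at h1
          have h2 : Module.finrank (ZMod p) (Submodule.span (ZMod p) (v '' s)) ≤ s.card := by
            classical
            rw [← Finset.coe_image]
            exact (finrank_span_finset_le_card _).trans Finset.card_image_le
          have h3 : s.card < Fintype.card (T ⊕ T) := by
            rw [← Finset.card_univ]
            exact Finset.card_lt_card (Finset.ssubset_univ_iff.2 (fun h => hk (h ▸ Finset.mem_univ k)))
          omega
        obtain ⟨x, hx⟩ : ∃ x, x ∉ Submodule.span (ZMod p) (v '' s) := by
          by_contra! h; exact hlt (eq_top_iff.2 fun x _ => h x)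
        obtain ⟨y, hy, hxy⟩ := hv.exists_proj hs' x
        refine ⟨k, hk, x - y, fun l hl => ?_, fun h => hx ?_⟩
        · rw [hxy l hl, stdForm_of_ne]
          rintro rfl; exact hk (hs' l hl)
        · simpa using add_mem h hy
    obtain ⟨k, hk, w, hw, hspan⟩ := key
    obtain ⟨v', h1, h2⟩ := ih (hv.insert hk hw hspan) (by
      rw [Finset.compl_insert, Finset.card_erase_of_mem (by simpa using hk), hn]; rfl)
    refine ⟨v', fun l hl => ?_, h2⟩
    rw [← h1 (by simp only [Finset.coe_insert]; exact Set.mem_insert_of_mem _ hl),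
      Function.update_of_ne (by rintro rfl; exact hk hl)]

theorem IsFrame.eq_sum {v : T ⊕ T → Label p T} (hv : IsFrame Finset.univ v) (x : Label p T) :
    x = ∑ k, ((stdForm p k.swap k)⁻¹ * symp (v k.swap) x) • v k := by
  have hsp : Submodule.span (ZMod p) (Set.range v) = ⊤ := by
    have h := hv.indep
    rw [Finset.coe_univ, linearIndepOn_univ_iff] at h
    exact h.span_eq_top_of_card_eq_finrank' finrank_label.symm
  rw [← sub_eq_zero]
  apply eq_zero_of_symp
  intro a
  have ha : a ∈ Submodule.span (ZMod p) (Set.range v) := hsp ▸ Submodule.mem_top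
  refine symp_eq_zero_of_mem_span ?_ ha
  rintro _ ⟨l, rfl⟩
  rw [symp_swap, neg_eq_zero, map_sub, map_sum, Finset.sum_eq_single l.swap]
  · have h1 := stdForm_swap_ne_zero (p := p) l
    rw [map_smul, hv.form l (Finset.mem_univ _) _ (Finset.mem_univ _), Sum.swap_swap, smul_eq_mul]
    field_simp; ring
  · intro k hk hkl
    rw [map_smul, hv.form l (Finset.mem_univ _) _ (Finset.mem_univ _), stdForm_of_ne hkl, smul_zero]
  · intro h; exact absurd (Finset.mem_univ _) h

/-- An isotropic subspace orthogonal to a partial frame can be absorbed by adding `Z` labels. -/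
theorem IsFrame.exists_isotropic {s : Finset (T ⊕ T)} {v : T ⊕ T → Label p T} (hv : IsFrame s v)
    (hs : ∀ i, Sum.inl i ∈ s → Sum.inr i ∈ s) (M : Submodule (ZMod p) (Label p T))
    (hM : ∀ x ∈ M, ∀ y ∈ M, symp x y = 0) (hMs : ∀ x ∈ M, ∀ k ∈ s, symp (v k) x = 0) :
    ∃ s' v', s ⊆ s' ∧ Set.EqOn v v' (s : Set (T ⊕ T)) ∧ IsFrame s' v' ∧
      (∀ i, Sum.inl i ∈ s' → Sum.inl i ∈ s) ∧ (∀ k ∈ s', k ∉ s → v' k ∈ M) ∧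
      M ≤ Submodule.span (ZMod p) (v' '' s') := by
  induction hn : sᶜ.card generalizing s v with
  | zero =>
    have : s = Finset.univ := by
      rw [Finset.card_eq_zero] at hn; simpa using hn
    subst this
    refine ⟨_, v, subset_rfl, fun _ _ => rfl, hv, fun _ _ => Finset.mem_univ _,
      fun k _ h => absurd (Finset.mem_univ k) h, fun x hx => ?_⟩
    rw [hv.eq_sum x]
    exact Submodule.sum_mem _ fun k _ => Submodule.smul_mem _ _ (Submodule.subset_span ⟨k, by simp⟩)
  | succ n ih =>
    by_cases hle : M ≤ Submodule.span (ZMod p) (v '' s)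
    · exact ⟨s, v, subset_rfl, fun _ _ => rfl, hv, fun _ h => h, fun k h h' => absurd h h', hle⟩
    obtain ⟨x, hx, hxs⟩ := SetLike.not_le_iff_exists.1 hle
    -- A free Z slot exists. If all were taken, expand `x` in a completed frame: the coefficient at
    -- any slot outside `s` is a pairing with a partner in `s`, hence zero, so `x` would lie in the
    -- span.
    obtain ⟨i, hi⟩ : ∃ i, Sum.inr i ∉ s := by
      by_contra! h
      obtain ⟨v', h1, h2⟩ := hv.complete
      apply hxs
      rw [h2.eq_sum x]
      refine Submodule.sum_mem _ fun k _ => ?_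
      by_cases hk : k ∈ s
      · rw [← h1 hk]; exact Submodule.smul_mem _ _ (Submodule.subset_span ⟨k, hk, rfl⟩)
      · have hk' : k.swap ∈ s := by
          rcases k with j | j
          · exact h j
          · exact absurd (h j) hk
        rw [← h1 hk', hMs x hx _ hk', mul_zero, zero_smul]
        exact zero_mem _
    have hi' : Sum.inl i ∉ s := fun h => hi (hs i h)
    have hins := hv.insert hi (w := x) (fun l hl => by
      rw [hMs x hx l hl, stdForm_of_ne]
      intro h
      have := congrArg Sum.swap h
      rw [Sum.swap_swap] at this
      exact hi' (by rw [Sum.swap_inr] at this; rwa [this])) hxs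
    have hup : ∀ k ∈ s, Function.update v (Sum.inr i) x k = v k := fun k hk =>
      Function.update_of_ne (by rintro rfl; exact hi hk) _ _
    obtain ⟨s', v', h1, h2, h3, h4, h5, h6⟩ := ih hins
      (by
        intro j hj
        rcases Finset.mem_insert.1 hj with h | h
        · cases h
        · exact Finset.mem_insert_of_mem (hs j h))
      (by
        intro y hy k hk
        rcases Finset.mem_insert.1 hk with rfl | h
        · rw [Function.update_self, hM x hx y hy]
        · rw [hup k h, hMs y hy k h])
      (by rw [Finset.compl_insert, Finset.card_erase_of_mem (by simpa using hi), hn]; rfl)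
    refine ⟨s', v', (Finset.subset_insert _ _).trans h1, fun k hk => ?_, h3, fun j hj => ?_,
      fun k hk hks => ?_, h6⟩
    · rw [← h2 (Finset.mem_coe.2 (Finset.mem_insert_of_mem hk)), hup k hk]
    · rcases Finset.mem_insert.1 (h4 j hj) with h | h
      · cases h
      · exact h
    · by_cases hki : k = Sum.inr i
      · subst hki
        rw [← h2 (Finset.mem_coe.2 (Finset.mem_insert_self _ _)), Function.update_self]; exact hx
      · exact h5 k hk (fun h => (Finset.mem_insert.1 h).elim hki hks)

/-- A maximal symplectic frame inside a subspace. -/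
theorem exists_frame_subspace (N : Submodule (ZMod p) (Label p T)) :
    ∃ (s : Finset (T ⊕ T)) (v : T ⊕ T → Label p T), IsFrame s v ∧ (∀ k ∈ s, k.swap ∈ s) ∧
      (∀ k ∈ s, v k ∈ N) ∧
      ∀ x ∈ N, ∀ y ∈ N, (∀ k ∈ s, symp (v k) x = 0) → (∀ k ∈ s, symp (v k) y = 0) →
        symp x y = 0 := by
  -- Enlarge the frame until no hyperbolic pair remains in its complement within `N`; the number of
  -- free slots bounds the process.
  suffices H : ∀ (n : ℕ) (s : Finset (T ⊕ T)) (v : T ⊕ T → Label p T), IsFrame s v →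
      (∀ k ∈ s, k.swap ∈ s) → (∀ k ∈ s, v k ∈ N) → sᶜ.card < n →
      ∃ (s : Finset (T ⊕ T)) (v : T ⊕ T → Label p T), IsFrame s v ∧ (∀ k ∈ s, k.swap ∈ s) ∧
      (∀ k ∈ s, v k ∈ N) ∧
      ∀ x ∈ N, ∀ y ∈ N, (∀ k ∈ s, symp (v k) x = 0) → (∀ k ∈ s, symp (v k) y = 0) →
        symp x y = 0 from
    H _ ∅ 0 ⟨by simp, by simp⟩ (by simp) (by simp) (Nat.lt_succ_self _)
  intro n
  induction n with
  | zero => intro s v _ _ _ h; exact absurd h (Nat.not_lt_zero _)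
  | succ n ih =>
    intro s v hv hs hN hn
    by_cases hdone : ∀ x ∈ N, ∀ y ∈ N, (∀ k ∈ s, symp (v k) x = 0) →
        (∀ k ∈ s, symp (v k) y = 0) → symp x y = 0
    · exact ⟨s, v, hv, hs, hN, hdone⟩
    push Not at hdone
    obtain ⟨x, hx, y, hy, hxs, hys, hxy⟩ := hdone
    obtain ⟨k, hk⟩ : ∃ k, k ∉ s := by
      by_contra! h
      have : s = Finset.univ := by ext k; simp [h k]
      subst this
      apply hxy
      rw [hv.eq_sum x]
      simp [hxs]
    have hk' : k.swap ∉ s := fun h => hk (by simpa using hs _ h)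
    have hks : k.swap ≠ k := by rcases k with i | i <;> simp
    have h1 := hv.insert hk (w := x) (fun l hl => by
      rw [hxs l hl, stdForm_of_ne]; rintro rfl; exact hk (hs l hl)) (fun h => by
      have := symp_eq_zero_of_mem_span (w := y) (x := x) ?_ h
      · exact hxy (by rw [symp_swap, this, neg_zero])
      · rintro _ ⟨l, hl, rfl⟩; rw [symp_swap, hys l hl, neg_zero])
    have hup : ∀ l ∈ s, Function.update v k x l = v l := fun l hl =>
      Function.update_of_ne (by rintro rfl; exact hk hl) _ _
    -- Rescaling `y` by this constant gives the pair `x, y` the standard pairing of the slots `k`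
    -- and `k.swap`.
    have hc : stdForm p k k.swap * (symp x y)⁻¹ ≠ 0 :=
      mul_ne_zero (stdForm_swap_ne_zero k) (inv_ne_zero hxy)
    have h2 := h1.insert (k := k.swap) (w := (stdForm p k k.swap * (symp x y)⁻¹) • y)
      (by simp [hks, hk']) (fun l hl => by
        rcases Finset.mem_insert.1 hl with rfl | hl
        · rw [Function.update_self, map_smul, smul_eq_mul]; field_simp
        · rw [hup l hl, map_smul, hys l hl, smul_zero, stdForm_of_ne]
          intro h; rw [Sum.swap_leftInverse.injective h] at hk; exact hk hl) (fun h => by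
        have := symp_eq_zero_of_mem_span (w := x) ?_ h
        · rw [map_smul] at this; exact (smul_ne_zero hc hxy) this
        · rintro _ ⟨l, hl, rfl⟩
          rcases Finset.mem_insert.1 hl with rfl | hl
          · rw [Function.update_self, symp_self]
          · rw [hup l hl, symp_swap, hxs l hl, neg_zero])
    refine ih _ _ h2 ?_ ?_ ?_
    · intro l hl
      simp only [Finset.mem_insert] at hl ⊢
      rcases hl with rfl | rfl | hl
      · simp
      · simp
      · exact Or.inr (Or.inr (hs l hl))
    · intro l hl
      rcases Finset.mem_insert.1 hl with rfl | hl
      · rw [Function.update_self]; exact N.smul_mem _ hy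
      · rw [Function.update_of_ne (by
          rintro rfl
          rcases Finset.mem_insert.1 hl with h | h
          · exact hks h
          · exact hk' h)]
        rcases Finset.mem_insert.1 hl with rfl | hl
        · rw [Function.update_self]; exact hx
        · rw [hup l hl]; exact hN l hl
    · have : (insert k.swap (insert k s))ᶜ.card < sᶜ.card := by
        apply Finset.card_lt_card
        refine ⟨fun l hl => ?_, fun h => ?_⟩
        · simp only [Finset.mem_compl, Finset.mem_insert, not_or] at hl ⊢; exact hl.2.2
        · have := h (Finset.mem_compl.2 hk); simp at this
      omega

/-- The linear map taking the standard symplectic basis to the family `v`. -/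
def frameMap (v : T ⊕ T → Label p T) : Label p T →ₗ[ZMod p] Label p T where
  toFun a := ∑ k, Sum.elim a.1 a.2 k • v k
  map_add' a b := by
    rw [← Finset.sum_add_distrib]
    refine Finset.sum_congr rfl fun k _ => ?_
    rcases k with i | i <;> simp [add_smul]
  map_smul' c a := by
    rw [RingHom.id_apply, Finset.smul_sum]
    refine Finset.sum_congr rfl fun k _ => ?_
    rcases k with i | i <;> simp [mul_smul]

theorem frameMap_apply (v : T ⊕ T → Label p T) (a : Label p T) :
    frameMap v a = ∑ k, Sum.elim a.1 a.2 k • v k := rfl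

theorem frameMap_std (a : Label p T) : frameMap (stdLabel p) a = a := by
  rw [frameMap_apply, Fintype.sum_sum_type]
  ext j <;> simp [stdLabel, Prod.fst_sum, Prod.snd_sum, Finset.sum_apply, Pi.single_apply]

theorem frameMap_stdLabel (v : T ⊕ T → Label p T) (k : T ⊕ T) :
    frameMap v (stdLabel p k) = v k := by
  rw [frameMap_apply, Fintype.sum_sum_type]
  rcases k with i | i <;> simp [stdLabel, Pi.single_apply]

theorem symp_frameMap (v : T ⊕ T → Label p T) (a b : Label p T) :
    symp (frameMap v a) (frameMap v b) =
      ∑ k, ∑ l, Sum.elim a.1 a.2 k * (Sum.elim b.1 b.2 l * symp (v k) (v l)) := by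
  simp only [frameMap_apply, map_sum, map_smul, LinearMap.sum_apply, LinearMap.smul_apply,
    smul_eq_mul, Finset.mul_sum]
  rw [Finset.sum_comm]
  refine Finset.sum_congr rfl fun k _ => Finset.sum_congr rfl fun l _ => ?_
  ring

theorem IsFrame.symp_frameMap {v : T ⊕ T → Label p T} (hv : IsFrame Finset.univ v)
    (a b : Label p T) : symp (frameMap v a) (frameMap v b) = symp a b := by
  conv_rhs => rw [← frameMap_std a, ← frameMap_std b]
  rw [SPL.symp_frameMap, SPL.symp_frameMap]
  simp only [hv.form _ (Finset.mem_univ _) _ (Finset.mem_univ _)]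
  rfl

theorem IsFrame.frameMap_injective {v : T ⊕ T → Label p T} (hv : IsFrame Finset.univ v) :
    Function.Injective (frameMap v) := by
  rw [← LinearMap.ker_eq_bot, LinearMap.ker_eq_bot']
  intro a ha
  apply eq_zero_of_symp
  intro b
  rw [← hv.symp_frameMap, ha]; simp

theorem IsFrame.frameMap_surjective {v : T ⊕ T → Label p T} (hv : IsFrame Finset.univ v) :
    Function.Surjective (frameMap v) :=
  LinearMap.injective_iff_surjective.1 hv.frameMap_injective

end Frame

/-! ### Clifford operators from symplectic maps -/

section Metaplectic

set_option linter.unusedSectionVars false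

variable {p : ℕ} [Fact p.Prime] [Fact (p ≠ 2)] {T : Type*} [Fintype T] [DecidableEq T]

theorem mem_cliffordGroup_of {U : Op p T T} (h1 : U * Uᴴ = 1) (h2 : Uᴴ * U = 1)
    (h : ∀ a, ∃ (y : ZMod p) (b : Label p T),
      U * weyl a = (ZMod.stdAddChar y : ℂ) • (weyl b * U)) : U ∈ cliffordGroup p T := by
  refine ⟨h1, h2, fun P hP => ?_⟩
  obtain ⟨y, a, rfl⟩ := mem_pauliGroup_iff.1 hP
  obtain ⟨y', b, hb⟩ := h a
  refine mem_pauliGroup_iff.2 ⟨y + y', b, ?_⟩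
  rw [Matrix.mul_smul, hb, Matrix.smul_mul, Matrix.smul_mul, Matrix.mul_assoc, h1, Matrix.mul_one,
    smul_smul, ← AddChar.map_add_eq_mul]

theorem weyl_unitary (a : Label p T) :
    weyl a * (weyl a)ᴴ = 1 ∧ (weyl a)ᴴ * weyl a = 1 := by
  rw [weyl_conjTranspose]; exact ⟨weyl_mul_weyl_neg a, weyl_neg_mul_weyl a⟩

theorem weyl_mem_cliffordGroup (a : Label p T) : weyl a ∈ cliffordGroup p T :=
  mem_cliffordGroup_of (weyl_unitary a).1 (weyl_unitary a).2 fun b => ⟨_, _, weyl_comm a b⟩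

theorem mul_mem_cliffordGroup {U V : Op p T T} (hU : U ∈ cliffordGroup p T)
    (hV : V ∈ cliffordGroup p T) : U * V ∈ cliffordGroup p T := by
  obtain ⟨h1, h2, h3⟩ := hU
  obtain ⟨k1, k2, k3⟩ := hV
  refine ⟨?_, ?_, fun P hP => ?_⟩
  · rw [Matrix.conjTranspose_mul, Matrix.mul_assoc, ← Matrix.mul_assoc V, k1, Matrix.one_mul, h1]
  · rw [Matrix.conjTranspose_mul, Matrix.mul_assoc, ← Matrix.mul_assoc Uᴴ, h2, Matrix.one_mul, k2]
  · have := h3 _ (k3 P hP)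
    rw [Matrix.conjTranspose_mul]
    simpa only [Matrix.mul_assoc] using this

/-- A nonzero operator `U₀` for which `U₀ᴴ U₀` is a scalar can be normalised. -/
theorem exists_unitary_smul {U₀ : Op p T T} (h0 : U₀ ≠ 0) {c : ℂ} (h : U₀ᴴ * U₀ = c • 1) :
    ∃ r : ℝ, ((r : ℂ) • U₀) * ((r : ℂ) • U₀)ᴴ = 1 ∧ ((r : ℂ) • U₀)ᴴ * ((r : ℂ) • U₀) = 1 := by
  have hc : 0 ≤ c := by
    have := (Matrix.posSemidef_conjTranspose_mul_self U₀).diag_nonneg (i := 0)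
    simpa [h] using this
  obtain ⟨hre, him⟩ := Complex.nonneg_iff.1 hc
  have hcr : c = ((c.re : ℝ) : ℂ) := Complex.ext rfl (by simp [← him])
  have hc0 : c.re ≠ 0 := by
    intro hr
    rw [hcr, hr] at h
    exact h0 (Matrix.conjTranspose_mul_self_eq_zero.1 (by simpa using h))
  refine ⟨(Real.sqrt c.re)⁻¹, ?_⟩
  have key : ((((Real.sqrt c.re)⁻¹ : ℝ) : ℂ) • U₀)ᴴ * ((((Real.sqrt c.re)⁻¹ : ℝ) : ℂ) • U₀) = 1 := by
    have hstar : (star (((Real.sqrt c.re)⁻¹ : ℝ) : ℂ)) = (((Real.sqrt c.re)⁻¹ : ℝ) : ℂ) :=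
      Complex.conj_ofReal _
    have hmul : (((Real.sqrt c.re)⁻¹ : ℝ) : ℂ) * ((((Real.sqrt c.re)⁻¹ : ℝ) : ℂ) * c) = 1 := by
      rw [hcr, ← Complex.ofReal_mul, ← Complex.ofReal_mul, Complex.ofReal_re, ← mul_assoc,
        ← mul_inv, Real.mul_self_sqrt hre, inv_mul_cancel₀ hc0, Complex.ofReal_one]
    rw [Matrix.conjTranspose_smul, Matrix.smul_mul, Matrix.mul_smul, h, smul_smul, smul_smul,
      hstar, mul_assoc, hmul, one_smul]
  exact ⟨mul_eq_one_comm.1 key, key⟩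

/-- Every linear symplectic map is implemented by a unitary. -/
theorem exists_metaplectic (g : Label p T →ₗ[ZMod p] Label p T)
    (hg : ∀ a b, symp (g a) (g b) = symp a b) :
    ∃ U : Op p T T, U * Uᴴ = 1 ∧ Uᴴ * U = 1 ∧ ∀ a, U * weyl a = weyl (g a) * U := by
  -- Averaging over the group makes `A M` an intertwiner from `weyl a` to `weyl (g a)`. The cocycle
  -- phases on the two sides cancel because `g` is symplectic.
  let A : Op p T T → Op p T T := fun M => ∑ a, weyl (g a) * M * weyl (-a)
  have hA : ∀ M b, weyl (g b) * A M * weyl (-b) = A M := by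
    intro M b
    simp only [A, Matrix.mul_sum, Matrix.sum_mul]
    refine Fintype.sum_equiv (Equiv.addLeft b) _ _ fun a => ?_
    rw [Equiv.coe_addLeft, map_add, neg_add_rev, weyl_add, weyl_add, hg]
    simp only [Matrix.smul_mul, Matrix.mul_smul, smul_smul, ← AddChar.map_add_eq_mul,
      Matrix.mul_assoc]
    have : -(2⁻¹ * symp b a) + -(2⁻¹ * symp (-a) (-b)) = (0 : ZMod p) := by
      rw [map_neg, map_neg, LinearMap.neg_apply, neg_neg, symp_swap a b]; ring
    rw [add_comm, this]; simp
  have hginj : ∀ a, g a = 0 ↔ a = 0 := fun a =>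
    ⟨fun h => eq_zero_of_symp fun b => by rw [← hg, h]; simp, fun h => by rw [h, map_zero]⟩
  -- Some average is nonzero: summing one entry of `A` over the matrix units `|i⟩⟨0|` gives a sum of
  -- traces of `weyl (g a)`, in which only `a = 0` contributes.
  obtain ⟨M, hM⟩ : ∃ M, A M ≠ 0 := by
    by_contra! h
    have h1 : ∑ i, A (Matrix.single i 0 1) i 0 = (p : ℂ) ^ Fintype.card T := by
      have : ∀ i, A (Matrix.single i 0 1) i 0 =
          ∑ a, (weyl (g a)) i i * weyl (-a) 0 0 := by
        intro i
        simp only [A, Matrix.sum_apply]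
        refine Finset.sum_congr rfl fun a _ => ?_
        rw [Matrix.mul_assoc, Matrix.mul_apply, Finset.sum_eq_single i]
        · rw [Matrix.single_mul_apply_same, one_mul]
        · intro j _ hj
          rw [Matrix.single_mul_apply_of_ne (h := hj), mul_zero]
        · intro h; exact absurd (Finset.mem_univ _) h
      simp only [this]
      rw [Finset.sum_comm]
      simp only [← Finset.sum_mul]
      have h2 : ∀ a : Label p T, ∑ i, weyl (g a) i i =
          if a = 0 then (p : ℂ) ^ Fintype.card T else 0 := by
        intro a
        have := trace_weyl (g a)
        simp only [hginj] at this
        exact this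
      simp only [h2, ite_mul, zero_mul]
      rw [Finset.sum_ite_eq' Finset.univ (0 : Label p T)]
      simp
    simp only [h, Matrix.zero_apply, Finset.sum_const_zero] at h1
    exact (pow_ne_zero _ (Nat.cast_ne_zero.2 (Fact.out : p.Prime).ne_zero)) h1.symm
  have hint : ∀ a, A M * weyl a = weyl (g a) * A M := fun a => by
    conv_lhs => rw [← hA M a]
    rw [Matrix.mul_assoc, weyl_neg_mul_weyl, Matrix.mul_one]
  have hint' : ∀ a, weyl a * (A M)ᴴ = (A M)ᴴ * weyl (g a) := fun a => by
    have := congrArg Matrix.conjTranspose (hint (-a))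
    simpa [Matrix.conjTranspose_mul, weyl_conjTranspose] using this
  -- `(A M)ᴴ * A M` commutes with all Weyl operators, so by Schur's lemma the intertwiner is unitary
  -- up to scale.
  obtain ⟨c, hc⟩ := eq_smul_one_of_comm (M := (A M)ᴴ * A M) fun a => by
    rw [← Matrix.mul_assoc, hint', Matrix.mul_assoc, ← hint, Matrix.mul_assoc]
  obtain ⟨r, hr1, hr2⟩ := exists_unitary_smul hM hc
  exact ⟨_, hr1, hr2, fun a => by rw [Matrix.smul_mul, hint, Matrix.mul_smul]⟩

/-- Independence is automatic when every vector has its partner: pairing a linear relation with `v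
k.swap` extracts the coefficient of `v k`. -/
theorem IsFrame.of_form {s : Finset (T ⊕ T)} {v : T ⊕ T → Label p T}
    (hs : ∀ k ∈ s, k.swap ∈ s) (h : ∀ k ∈ s, ∀ l ∈ s, symp (v k) (v l) = stdForm p k l) :
    IsFrame s v := by
  refine ⟨?_, h⟩
  rw [linearIndepOn_finset_iff]
  intro c hc k hk
  have h1 := congrArg (symp (v k.swap)) hc
  rw [map_sum, Finset.sum_eq_single k, map_smul, h _ (hs k hk) _ hk, map_zero] at h1
  · have h2 := stdForm_swap_ne_zero (p := p) k.swap
    rw [Sum.swap_swap] at h2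
    exact (mul_eq_zero.1 h1).resolve_right h2
  · intro l hl hlk
    rw [map_smul, h _ (hs k hk) _ hl, stdForm_of_ne (by rwa [Sum.swap_swap]), smul_zero]
  · intro h; exact absurd hk h

end Metaplectic

/-! ### Isometries that append qupits in the state |0⟩. -/

section Isometry

set_option linter.unusedSectionVars false

variable {p : ℕ} [Fact p.Prime] [Fact (p ≠ 2)]
  {ι μ : Type*} [Fintype ι] [DecidableEq ι] [Fintype μ] [DecidableEq μ]

/-- The isometry `|a⟩ ↦ |a⟩|0⟩`. -/
def inlOp (p : ℕ) (ι μ : Type*) [Fintype ι] [Fintype μ] [DecidableEq ι] [DecidableEq μ] :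
    Op p (ι ⊕ μ) ι :=
  Matrix.of fun w a => if w = Sum.elim a 0 then 1 else 0

/-- The operator `|0⟩ ⊗ V`. -/
def zeroTensor (V : Op p μ ι) : Op p (ι ⊕ μ) ι :=
  Matrix.of fun w a => if w ∘ Sum.inl = 0 then V (w ∘ Sum.inr) a else 0

theorem mul_inlOp {κ : Type*} (M : Op p κ (ι ⊕ μ)) (v : κ → ZMod p) (a : ι → ZMod p) :
    (M * inlOp p ι μ) v a = M v (Sum.elim a 0) := by
  simp [Matrix.mul_apply, inlOp]

theorem tensor_mul_zeroTensor (A : Op p ι ι) (B : Op p μ μ) (V : Op p μ ι)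
    (w : ι ⊕ μ → ZMod p) (a : ι → ZMod p) :
    (tensor A B * zeroTensor V) w a = A (w ∘ Sum.inl) 0 * (B * V) (w ∘ Sum.inr) a := by
  simp only [Matrix.mul_apply, tensor, zeroTensor, Matrix.of_apply]
  rw [← (Equiv.sumArrowEquivProdArrow ι μ (ZMod p)).symm.sum_comp, Fintype.sum_prod_type]
  simp only [Equiv.sumArrowEquivProdArrow, Equiv.coe_fn_symm_mk, Sum.elim_comp_inl,
    Sum.elim_comp_inr]
  rw [Finset.sum_eq_single 0]
  · simp [Finset.mul_sum, mul_assoc]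
  · intro b _ hb; simp [hb]
  · intro h; exact absurd (Finset.mem_univ _) h

/-- A Z-type Weyl operator fixes |0⟩, so it can be added on the `ι` factor of the output without
changing the phase. -/
theorem sum_mem_stabRel_zeroTensor {V : Op p μ ι} {a : Label p ι} {b : Label p μ}
    (h : (b, a) ∈ stabRel V) {z : Label p ι} (hz : z.1 = 0) :
    (z.sum b, a) ∈ stabRel (zeroTensor V) := by
  obtain ⟨c, hc, h⟩ := mem_stabRel.1 h
  refine mem_stabRel.2 ⟨c, hc, ?_⟩
  ext w u
  rw [weyl_sum, tensor_mul_zeroTensor, h, weyl_apply, hz]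
  simp only [Matrix.smul_apply, Matrix.mul_apply, zeroTensor, Matrix.of_apply, smul_eq_mul]
  by_cases h0 : w ∘ Sum.inl = 0 <;> simp [h0]

/-- An X component on the ancilla would move |0⟩ and is excluded; a Z component on the ancilla acts
trivially on |0⟩. -/
theorem weyl_mul_inlOp {α : Label p (ι ⊕ μ)} (hα : α.1 ∘ Sum.inr = 0) :
    weyl α * inlOp p ι μ = inlOp p ι μ * weyl (α.comap Sum.inl) := by
  ext w a
  rw [mul_inlOp]
  simp only [Matrix.mul_apply, inlOp, Matrix.of_apply, weyl_apply, Label.comap]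
  have hα' : ∀ j, α.1 (Sum.inr j) = 0 := congrFun hα
  have h1 : ∀ b : ι → ZMod p, Sum.elim a 0 + α.1 = Sum.elim b 0 ↔ b = a + α.1 ∘ Sum.inl := by
    intro b
    simp only [funext_iff, Sum.forall, Pi.add_apply, Sum.elim_inl, Sum.elim_inr, hα',
      Function.comp, Pi.zero_apply, add_zero, implies_true, and_true]
    exact ⟨fun h i => (h i).symm, fun h i => (h i).symm⟩
  by_cases hw : w = Sum.elim a 0 + α.1
  · subst hw
    simp only [if_true, h1]
    rw [Finset.sum_eq_single (a + α.1 ∘ Sum.inl)]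
    · simp [dotProduct, hα']
    · intro b _ hb; simp [hb]
    · intro h; exact absurd (Finset.mem_univ _) h
  · rw [if_neg hw, Finset.sum_eq_zero]
    intro b _
    by_cases hb : b = a + α.1 ∘ Sum.inl
    · rw [if_neg, zero_mul]; rw [← (h1 b).2 hb]; exact hw
    · simp [hb]

theorem inlOp_isometry : (inlOp p ι μ)ᴴ * inlOp p ι μ = 1 := by
  ext a b
  rw [mul_inlOp]
  simp only [Matrix.conjTranspose_apply, inlOp, Matrix.of_apply, Matrix.one_apply]
  have : Sum.elim b (0 : μ → ZMod p) = Sum.elim a 0 ↔ a = b :=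
    ⟨fun h => (congrArg (fun f => f ∘ Sum.inl) h).symm, fun h => by rw [h]⟩
  by_cases h : a = b <;> simp [this, h]

theorem zeroTensor_isometry {V : Op p μ ι} (hV : Vᴴ * V = 1) :
    (zeroTensor V)ᴴ * zeroTensor V = 1 := by
  rw [← hV]
  ext a b
  simp only [Matrix.mul_apply, Matrix.conjTranspose_apply, zeroTensor, Matrix.of_apply]
  rw [← (Equiv.sumArrowEquivProdArrow ι μ (ZMod p)).symm.sum_comp, Fintype.sum_prod_type,
    Finset.sum_eq_single 0]
  · simp [Equiv.sumArrowEquivProdArrow]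
  · intro b _ hb; simp [Equiv.sumArrowEquivProdArrow, hb]
  · intro h; exact absurd (Finset.mem_univ _) h

end Isometry

/-! ### Clifford dilations of stabiliser isometries. -/

section Dilation

set_option linter.unusedSectionVars false

variable {p : ℕ} [Fact p.Prime] [Fact (p ≠ 2)]
  {ι μ : Type*} [Fintype ι] [DecidableEq ι] [Fintype μ] [DecidableEq μ]

/-- Pullback of labels as a linear map. -/
def Label.comapₗ {ι κ : Type*} (e : ι → κ) : Label p κ →ₗ[ZMod p] Label p ι where
  toFun := Label.comap e
  map_add' _ _ := rfl
  map_smul' _ _ := rfl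

/-- If `a` did not lift, some `d` with `symp d a ≠ 0` would be orthogonal to all labels that do.
Coisotropy then gives `V = c V W(d)`; cancelling the isometry makes `W(d)` a scalar, so `d = 0`, a
contradiction. -/
theorem exists_lift_of_isometry {V : Op p μ ι} (hV : Vᴴ * V = 1) (hc : Coisotropic (stabRel V))
    (a : Label p ι) : ∃ b, (b, a) ∈ stabRel V := by
  by_contra hcon
  have hlt : a ∉ (stabRel V).map (LinearMap.snd _ _ _) := by
    rintro ⟨⟨b, a'⟩, h, rfl⟩; exact hcon ⟨b, h⟩
  obtain ⟨φ, hφ, hle⟩ := Submodule.exists_le_ker_of_notMem hlt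
  obtain ⟨d, hd⟩ := exists_symp_eq φ
  have h0 : (0, d) ∈ stabRel V := hc 0 d fun x hx => by
    rw [hd]
    have : x.2 ∈ LinearMap.ker φ := hle ⟨x, hx, rfl⟩
    rw [LinearMap.mem_ker.1 this]; simp
  obtain ⟨c, hc1, h1⟩ := mem_stabRel.1 h0
  rw [weyl_zero, Matrix.one_mul] at h1
  have h2 : (1 : Op p ι ι) = c • weyl d := by
    rw [← hV]; nth_rewrite 2 [h1]
    rw [Matrix.mul_smul, ← Matrix.mul_assoc, hV, Matrix.one_mul]
  have h3 : (0 : Label p ι) = d := weyl_eq_smul_weyl (by rw [weyl_zero, ← h2])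
  apply hφ
  rw [← hd, ← h3]; simp

theorem symp_sum_sum (a a' : Label p ι) (b b' : Label p μ) :
    symp (a.sum b) (a'.sum b') = symp a a' + symp b b' := by
  rw [symp_sum]; simp

theorem ne_zero_of_isometry {κ : Type*} [Fintype κ] [DecidableEq κ] {V : Op p κ ι}
    (hV : Vᴴ * V = 1) : V ≠ 0 := by
  rintro rfl
  rw [Matrix.mul_zero] at hV
  exact zero_ne_one hV

/-- A frame adapted to a stabiliser isometry: `X` and `Z` labels on the input are lifted along `V`,
and the labels `Z` on the output stabilise `V`. -/
theorem exists_frame_of_isometry {V : Op p μ ι} (hV : Vᴴ * V = 1)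
    (hc : Coisotropic (stabRel V)) :
    ∃ v : (ι ⊕ μ) ⊕ (ι ⊕ μ) → Label p (ι ⊕ μ), IsFrame Finset.univ v ∧
      (∀ k : ι ⊕ ι, (v (Sum.map Sum.inl Sum.inl k), stdLabel p k) ∈ stabRel (zeroTensor V)) ∧
      ∀ j : μ, (v (Sum.inr (Sum.inr j)), 0) ∈ stabRel (zeroTensor V) := by
  have hV0 : V ≠ 0 := ne_zero_of_isometry hV
  choose L hL using fun k => exists_lift_of_isometry hV hc (stdLabel p k)
  let e : ι ⊕ ι → (ι ⊕ μ) ⊕ (ι ⊕ μ) := Sum.map Sum.inl Sum.inl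
  have he : Function.Injective e := Sum.inl_injective.sumMap Sum.inl_injective
  let s₀ : Finset ((ι ⊕ μ) ⊕ (ι ⊕ μ)) := Finset.univ.image e
  let v₀ : (ι ⊕ μ) ⊕ (ι ⊕ μ) → Label p (ι ⊕ μ) :=
    Function.extend e (fun k => Label.sum 0 (L k)) 0
  have hv₀ : ∀ k, v₀ (e k) = Label.sum 0 (L k) := fun k => he.extend_apply _ _ _
  have hes : ∀ k, (e k).swap = e k.swap := by rintro (i | i) <;> rfl
  have hform : ∀ k l, stdForm p (e k) (e l) = stdForm p k l := by
    rintro (i | i) (j | j) <;> simp [stdForm, stdLabel, e, symp_apply, Pi.single_apply]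
  have hfr : IsFrame s₀ v₀ := by
    refine IsFrame.of_form ?_ ?_
    · intro k hk
      obtain ⟨k, -, rfl⟩ := Finset.mem_image.1 hk
      rw [hes]; exact Finset.mem_image_of_mem _ (Finset.mem_univ _)
    · intro k hk l hl
      obtain ⟨k, -, rfl⟩ := Finset.mem_image.1 hk
      obtain ⟨l, -, rfl⟩ := Finset.mem_image.1 hl
      rw [hv₀, hv₀, symp_sum_sum, hform, symp_eq_of_mem_stabRel hV0 (hL k) (hL l)]
      simp [stdForm]
  -- Labels that stabilise `zeroTensor V` up to phase: Z-type on the `ι` factor and a stabiliser of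
  -- `V` on the `μ` factor.
  let M : Submodule (ZMod p) (Label p (ι ⊕ μ)) :=
    { carrier := {x | (x.comap Sum.inl).1 = 0 ∧ (x.comap Sum.inr, (0 : Label p ι)) ∈ stabRel V}
      zero_mem' := ⟨rfl, zero_mem _⟩
      add_mem' := by
        rintro x y ⟨h1, h2⟩ ⟨k1, k2⟩
        refine ⟨?_, by
          have := add_mem h2 k2
          rw [Prod.mk_add_mk, add_zero] at this
          exact this⟩
        change (x.comap Sum.inl).1 + (y.comap Sum.inl).1 = 0
        rw [h1, k1, add_zero]
      smul_mem' := by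
        rintro c x ⟨h1, h2⟩
        refine ⟨?_, by
          have := Submodule.smul_mem _ c h2
          rw [Prod.smul_mk, smul_zero] at this
          exact this⟩
        change c • (x.comap Sum.inl).1 = 0
        rw [h1, smul_zero] }
  have hM : ∀ x, x ∈ M ↔
    ((x.comap Sum.inl).1 = 0 ∧ (x.comap Sum.inr, (0 : Label p ι)) ∈ stabRel V) := fun x => Iff.rfl
  obtain ⟨s, v, hss, heq, hfr', hinl, hnew, hMle⟩ := hfr.exists_isotropic
    (by
      intro i hi
      obtain ⟨k, -, hk⟩ := Finset.mem_image.1 hi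
      rcases k with j | j
      · cases hk
        exact Finset.mem_image.2 ⟨Sum.inr j, Finset.mem_univ _, rfl⟩
      · cases hk) M
    (by
      intro x hx y hy
      rw [← x.sum_comap, ← y.sum_comap, symp_sum_sum,
        symp_eq_of_mem_stabRel hV0 ((hM x).1 hx).2 ((hM y).1 hy).2, symp_apply,
        ((hM x).1 hx).1, ((hM y).1 hy).1]
      simp)
    (by
      intro x hx k hk
      obtain ⟨k, -, rfl⟩ := Finset.mem_image.1 hk
      rw [hv₀, ← x.sum_comap, symp_sum_sum, symp_eq_of_mem_stabRel hV0 (hL k) ((hM x).1 hx).2]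
      simp)
  obtain ⟨w, hvw, hw⟩ := hfr'.complete
  have hwk : ∀ k, w (e k) = Label.sum 0 (L k) := fun k => by
    have hk : e k ∈ s₀ := Finset.mem_image_of_mem _ (Finset.mem_univ _)
    rw [← hvw (hss hk), ← heq hk, hv₀]
  have hinl' : ∀ j, Sum.inl (Sum.inr j) ∉ s := by
    intro j hj
    obtain ⟨k, -, hk⟩ := Finset.mem_image.1 (hinl _ hj)
    rcases k with i | i <;> simp [e] at hk
  -- `M` is large enough to fill all Z slots of `μ`. At an unfilled slot, the frame vector would be
  -- orthogonal to `M` and to all the lifts, so coisotropy would place it in `M`. But the span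
  -- containing `M` is orthogonal to the partner of that vector.
  have hall : ∀ j, Sum.inr (Sum.inr j) ∈ s := by
    intro j
    by_contra hj
    have hy : ∀ k ∈ s, symp (w (Sum.inr (Sum.inr j))) (w k) = 0 := by
      intro k hk
      rw [hw.form _ (Finset.mem_univ _) _ (Finset.mem_univ _), stdForm_of_ne]
      rintro rfl; exact hinl' j hk
    have hMle' : M ≤ Submodule.span (ZMod p) (w '' s) := by rwa [hvw.image_eq] at hMle
    have hyM : ∀ x ∈ M, symp (w (Sum.inr (Sum.inr j))) x = 0 := fun x hx =>
      symp_eq_zero_of_mem_span (by rintro _ ⟨k, hk, rfl⟩; exact hy k hk) (hMle' hx)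
    have hmem : w (Sum.inr (Sum.inr j)) ∈ M := by
      refine (hM _).2 ⟨?_, hc _ _ fun x hx => ?_⟩
      · ext i
        have h1 := hyM (Label.sum (0, Pi.single i 1) 0) ((hM _).2 ⟨rfl, zero_mem _⟩)
        rw [symp_sum, symp_apply] at h1
        simpa using h1
      -- Subtracting the lifts of the coordinates of `x.2` reduces a general element of `stabRel V`
      -- to one with trivial input label, which `M` sees.
      · have h1 : (x.1 - ∑ k, Sum.elim x.2.1 x.2.2 k • L k, (0 : Label p ι)) ∈ stabRel V := by
          have h2 : ∑ k, Sum.elim x.2.1 x.2.2 k • (L k, stdLabel p k) ∈ stabRel V :=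
            Submodule.sum_mem _ fun k _ => Submodule.smul_mem _ _ (hL k)
          have h3 := sub_mem hx h2
          have h4 : ∑ k, Sum.elim x.2.1 x.2.2 k • (L k, stdLabel p k) =
              (∑ k, Sum.elim x.2.1 x.2.2 k • L k, x.2) := by
            ext1
            · simp [Prod.fst_sum]
            · rw [Prod.snd_sum]; exact frameMap_std x.2
          have h5 : x - (∑ k, Sum.elim x.2.1 x.2.2 k • L k, x.2) =
              (x.1 - ∑ k, Sum.elim x.2.1 x.2.2 k • L k, 0) := Prod.ext rfl (sub_self _)
          rwa [h4, h5] at h3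
        have h5 := hyM (Label.sum 0 (x.1 - ∑ k, Sum.elim x.2.1 x.2.2 k • L k)) ((hM _).2 ⟨rfl, h1⟩)
        have h6 : ∀ k, symp ((w (Sum.inr (Sum.inr j))).comap Sum.inr) (L k) = 0 := fun k => by
          have := hy (e k) (hss (Finset.mem_image_of_mem _ (Finset.mem_univ _)))
          rw [hwk, symp_sum] at this
          simpa using this
        rw [symp_sum, map_sub, map_sum] at h5
        simp only [map_smul, h6] at h5
        simpa using h5
    have h7 := symp_eq_zero_of_mem_span (w := w (Sum.inl (Sum.inr j))) ?_ (hMle' hmem)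
    · rw [hw.form _ (Finset.mem_univ _) _ (Finset.mem_univ _)] at h7
      exact stdForm_swap_ne_zero (p := p) (Sum.inl (Sum.inr j)) h7
    · rintro _ ⟨k, hk, rfl⟩
      rw [hw.form _ (Finset.mem_univ _) _ (Finset.mem_univ _), stdForm_of_ne]
      rintro rfl; exact hj hk
  refine ⟨w, hw, fun k => ?_, fun j => ?_⟩
  · rw [show Sum.map Sum.inl Sum.inl k = e k from rfl, hwk]
    exact sum_mem_stabRel_zeroTensor (hL k) rfl
  · have h1 : w (Sum.inr (Sum.inr j)) ∈ M := by
      rw [← hvw (hall j)]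
      refine hnew _ (hall j) fun h => ?_
      obtain ⟨k, -, hk⟩ := Finset.mem_image.1 h
      rcases k with i | i <;> simp [e] at hk
    rw [← Label.sum_comap (w _)]
    exact sum_mem_stabRel_zeroTensor ((hM _).1 h1).2 ((hM _).1 h1).1

/-- A stabiliser isometry extends to a Clifford operator. -/
theorem exists_clifford_dilation {V : Op p μ ι} (hV : Vᴴ * V = 1)
    (hc : Coisotropic (stabRel V)) :
    ∃ U ∈ cliffordGroup p (ι ⊕ μ), ∃ c : ℂ, ‖c‖ = 1 ∧ U * inlOp p ι μ = c • zeroTensor V := by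
  obtain ⟨v, hv, hv1, hv2⟩ := exists_frame_of_isometry hV hc
  -- The labels without X component on `μ`: exactly those to which `weyl_mul_inlOp` applies.
  let A : Submodule (ZMod p) (Label p (ι ⊕ μ)) :=
    LinearMap.ker (LinearMap.funLeft (ZMod p) (ZMod p) (Sum.inr : μ → ι ⊕ μ) ∘ₗ
      LinearMap.fst _ _ _)
  have hA : ∀ α, α ∈ A ↔ α.1 ∘ Sum.inr = 0 := fun α => Iff.rfl
  have hmem : ∀ α ∈ A, (frameMap v α, α.comap Sum.inl) ∈ stabRel (zeroTensor V) := by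
    intro α hα
    have hα' : ∀ j, α.1 (Sum.inr j) = 0 := congrFun ((hA α).1 hα)
    have h1 : (frameMap v α, α.comap Sum.inl) =
        ∑ k, Sum.elim α.1 α.2 k • (v k, (stdLabel p k).comap Sum.inl) := by
      ext1
      · rw [Prod.fst_sum]; rfl
      · rw [Prod.snd_sum]
        have := congrArg (Label.comapₗ (p := p) (Sum.inl : ι → ι ⊕ μ)) (frameMap_std α)
        rw [frameMap_apply, map_sum] at this
        simp only [map_smul] at this
        exact this.symm
    rw [h1]
    refine Submodule.sum_mem _ fun k _ => ?_
    have hs : ∀ k : ι ⊕ ι, (stdLabel p (Sum.map Sum.inl Sum.inl k : (ι ⊕ μ) ⊕ (ι ⊕ μ))).comap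
        Sum.inl = stdLabel p k := by
      rintro (i | i) <;> ext j <;> simp [stdLabel, Label.comap, Pi.single_apply]
    rcases k with (i | j) | (i | j)
    · refine Submodule.smul_mem _ _ ?_
      have := hv1 (Sum.inl i); rwa [← hs] at this
    · rw [Sum.elim_inl, hα', zero_smul]; exact zero_mem _
    · refine Submodule.smul_mem _ _ ?_
      have := hv1 (Sum.inr i); rwa [← hs] at this
    · refine Submodule.smul_mem _ _ ?_
      have h2 : (stdLabel p (Sum.inr (Sum.inr j) : (ι ⊕ μ) ⊕ (ι ⊕ μ))).comap Sum.inl =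
          (0 : Label p ι) := by
        ext i <;> simp [stdLabel, Label.comap]
      rw [h2]; exact hv2 j
  have hsymp : ∀ α ∈ A, ∀ β ∈ A, symp (frameMap v α) (frameMap v β) =
      symp (α.comap Sum.inl) (β.comap Sum.inl) := by
    intro α hα β hβ
    exact symp_eq_of_mem_stabRel (ne_zero_of_isometry (zeroTensor_isometry hV))
      (hmem α hα) (hmem β hβ)
  choose! c hc1 hc2 using fun α hα => mem_stabRel.1 (hmem α hα)
  have hinj : ∀ (a : Label p ι) (r s : ℂ), r • (zeroTensor V * weyl a) = s • (zeroTensor V * weyl a)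
      → r = s := by
    intro a r s h
    rw [← sub_eq_zero, ← sub_smul, smul_eq_zero] at h
    rcases h with h | h
    · exact sub_eq_zero.1 h
    · exfalso
      have h' := congrArg (fun X => (zeroTensor V)ᴴ * X * weyl (-a)) h
      simp only [Matrix.mul_zero, Matrix.zero_mul] at h'
      rw [← Matrix.mul_assoc, zeroTensor_isometry hV, Matrix.one_mul, weyl_mul_weyl_neg] at h'
      exact one_ne_zero h'
  -- The symplectic map is only matched with `V` up to phases `c α`. These are multiplicative on
  -- `A`, hence equal to ξ(ω(t,α)), and composing with `weyl (-t)` absorbs them.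
  obtain ⟨t, ht⟩ := exists_char_symp_eq A (fun α => c α)
    (by
      apply hinj 0
      have := hc2 0 (zero_mem A)
      rw [map_zero, weyl_zero, Matrix.one_mul] at this
      rw [weyl_zero, one_smul, Matrix.mul_one]
      conv_rhs => rw [this]
      rw [show (0 : Label p (ι ⊕ μ)).comap Sum.inl = (0 : Label p ι) from rfl, weyl_zero,
        Matrix.mul_one]; rfl)
    (by
      rintro ⟨α, hα⟩ ⟨β, hβ⟩
      have h1 := hc2 (α + β) (add_mem hα hβ)
      rw [map_add, weyl_add, Matrix.smul_mul, Matrix.mul_assoc, hc2 β hβ, Matrix.mul_smul,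
        ← Matrix.mul_assoc, hc2 α hα, Matrix.smul_mul, Matrix.mul_assoc, weyl_mul, hsymp α hα β hβ,
        Matrix.mul_smul, smul_smul, smul_smul, smul_smul] at h1
      have h2 := hinj _ _ _ h1
      dsimp only
      change c (α + β) = _
      rw [← h2]
      have h3 := char_mul_neg (2⁻¹ * symp (α.comap Sum.inl) (β.comap Sum.inl) : ZMod p)
      linear_combination (c α * c β) * h3)
  obtain ⟨U₀, hU1, hU2, hU3⟩ := exists_metaplectic (frameMap v) hv.symp_frameMap
  let U := U₀ * weyl (-t)
  have hU : U ∈ cliffordGroup p (ι ⊕ μ) := mul_mem_cliffordGroup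
    (mem_cliffordGroup_of hU1 hU2 fun a => ⟨0, frameMap v a, by rw [hU3]; simp⟩)
    (weyl_mem_cliffordGroup _)
  obtain ⟨hUU, hUU', -⟩ := id hU
  have hUα : ∀ α ∈ A, weyl (frameMap v α) * U = c α • (U * weyl α) := by
    intro α hα
    have h1 := ht ⟨α, hα⟩
    dsimp only at h1
    have h2 : symp α (-t) = symp t α := by rw [map_neg, symp_swap, neg_neg]
    rw [h1]
    simp only [U]
    rw [← Matrix.mul_assoc, ← hU3, Matrix.mul_assoc, Matrix.mul_assoc, weyl_comm α, Matrix.mul_smul,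
      h2]
  -- It remains to see that `Q` is a multiple of `inlOp`. Both intertwine the labels in `A` in the
  -- same way: the Z labels on `μ` force the support of `Q` into |0⟩, and Schur's lemma on `ι`
  -- leaves one scalar `r`.
  let Q : Op p (ι ⊕ μ) ι := Uᴴ * zeroTensor V
  have hQ : ∀ α ∈ A, weyl α * Q = Q * weyl (α.comap Sum.inl) := by
    intro α hα
    have hcα : c α ≠ 0 := by rw [← norm_ne_zero_iff, hc1 α hα]; exact one_ne_zero
    have h1 : Uᴴ * weyl (frameMap v α) = c α • (weyl α * Uᴴ) := by
      calc Uᴴ * weyl (frameMap v α) = Uᴴ * (weyl (frameMap v α) * U) * Uᴴ := by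
            rw [Matrix.mul_assoc, Matrix.mul_assoc, hUU, Matrix.mul_one]
        _ = _ := by
            rw [hUα α hα, Matrix.mul_smul, ← Matrix.mul_assoc, hUU', Matrix.one_mul,
              Matrix.smul_mul]
    have h2 : c α • (weyl α * Q) = c α • (Q * weyl (α.comap Sum.inl)) := by
      rw [← Matrix.mul_assoc, ← Matrix.smul_mul, ← h1, Matrix.mul_assoc, hc2 α hα, Matrix.mul_smul,
        Matrix.mul_assoc]
    exact smul_right_injective _ hcα h2
  have hJ : ∀ a : Label p ι, weyl a * (inlOp p ι μ)ᴴ =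
      (inlOp p ι μ)ᴴ * weyl (a.sum (0 : Label p μ)) := by
    intro a
    have h1 := weyl_mul_inlOp (p := p) (α := (-a).sum (0 : Label p μ)) rfl
    have h2 := congrArg Matrix.conjTranspose h1
    have h3 : -((-a).sum (0 : Label p μ)) = a.sum 0 := by
      ext i <;> rcases i with i | i <;> simp [Label.sum]
    rw [Matrix.conjTranspose_mul, Matrix.conjTranspose_mul, weyl_conjTranspose, weyl_conjTranspose,
      h3, Label.comap_inl_sum, neg_neg] at h2
    exact h2.symm
  obtain ⟨r, hr⟩ := eq_smul_one_of_comm (M := (inlOp p ι μ)ᴴ * Q) fun a => by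
    rw [← Matrix.mul_assoc, hJ, Matrix.mul_assoc, hQ _ ((hA _).2 rfl), Label.comap_inl_sum]
    exact (Matrix.mul_assoc _ _ _).symm
  -- A Z label at `j` stabilises `Q` but multiplies its row `w` by ξ(w j), so rows with `w j ≠ 0`
  -- vanish.
  have hQ0 : ∀ (w : ι ⊕ μ → ZMod p) (a : ι → ZMod p), w ∘ Sum.inr ≠ 0 → Q w a = 0 := by
    intro w a hw
    obtain ⟨j, hj⟩ := Function.ne_iff.1 hw
    let α : Label p (ι ⊕ μ) := (0, Pi.single (Sum.inr j) 1)
    have h1 := congrFun (congrFun (hQ α ((hA _).2 rfl)) w) a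
    have h2 : α.comap Sum.inl = (0 : Label p ι) := by
      ext i <;> simp [α, Label.comap]
    rw [h2, weyl_zero, Matrix.mul_one, Matrix.mul_apply, Finset.sum_eq_single w] at h1
    · rw [weyl_apply] at h1
      simp only [α, add_zero, if_true, dotProduct_zero, mul_zero, zero_add, single_dotProduct,
        one_mul] at h1
      by_contra h
      have h3 := mul_right_cancel₀ h (h1.trans (one_mul _).symm)
      exact hj (char_eq_one_iff.1 h3)
    · intro b _ hb
      rw [weyl_apply, if_neg, zero_mul]
      simpa [α] using hb.symm
    · intro h; exact absurd (Finset.mem_univ _) h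
  have hQJ : Q = r • inlOp p ι μ := by
    ext w a
    by_cases hw : w ∘ Sum.inr = 0
    · have h1 := congrFun (congrFun hr (w ∘ Sum.inl)) a
      have h2 : w = Sum.elim (w ∘ Sum.inl) 0 := by
        conv_lhs => rw [← Sum.elim_comp_inl_inr w, hw]
      have h3 : ((inlOp p ι μ)ᴴ * Q) (w ∘ Sum.inl) a = Q w a := by
        simp only [Matrix.mul_apply, Matrix.conjTranspose_apply, inlOp, Matrix.of_apply, ← h2]
        simp
      rw [← h3, h1]
      simp only [Matrix.smul_apply, Matrix.one_apply, inlOp, Matrix.of_apply]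
      congr 1
      have : w ∘ Sum.inl = a ↔ w = Sum.elim a 0 :=
        ⟨fun h => by rw [h2, h], fun h => by rw [h]; rfl⟩
      simp only [this]
    · rw [hQ0 w a hw, Matrix.smul_apply, inlOp, Matrix.of_apply, if_neg, smul_zero]
      rintro rfl; exact hw rfl
  have hUQ : zeroTensor V = r • (U * inlOp p ι μ) := by
    rw [← Matrix.mul_smul, ← hQJ, ← Matrix.mul_assoc, hUU, Matrix.one_mul]
  have hrn : star r * r = 1 := by
    have h1 := zeroTensor_isometry hV
    rw [hUQ, Matrix.conjTranspose_smul, Matrix.conjTranspose_mul, Matrix.smul_mul, Matrix.mul_smul,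
      smul_smul, Matrix.mul_assoc, ← Matrix.mul_assoc Uᴴ, hUU', Matrix.one_mul,
      inlOp_isometry] at h1
    have h2 := congrFun (congrFun h1 0) 0
    simpa using h2
  refine ⟨U, hU, star r, ?_, ?_⟩
  · have h1 := congrArg norm hrn
    rw [norm_mul, norm_star, norm_one] at h1
    rw [norm_star]
    nlinarith [norm_nonneg r]
  · rw [hUQ, smul_smul, hrn, one_smul]

end Dilation

/-! ### Stabiliser maps given by linear relations -/

section Relations

set_option linter.unusedSectionVars false

variable {p : ℕ} [Fact p.Prime] [Fact (p ≠ 2)]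

section

variable {ι : Type*} [Fintype ι] [DecidableEq ι]

theorem exists_dotProduct_eq (φ : (ι → ZMod p) →ₗ[ZMod p] ZMod p) :
    ∃ z : ι → ZMod p, ∀ x, z ⬝ᵥ x = φ x := by
  obtain ⟨b, hb⟩ := exists_symp_eq (φ ∘ₗ LinearMap.fst (ZMod p) (ι → ZMod p) (ι → ZMod p))
  refine ⟨b.2, fun x => ?_⟩
  have := hb (x, 0)
  simpa [symp_apply] using this

/-- The labels stabilising the uniform superposition of a subspace. -/
def subspaceLabels (D : Submodule (ZMod p) (ι → ZMod p)) : Set (Label p ι) :=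
  {a | a.1 ∈ D ∧ ∀ d ∈ D, a.2 ⬝ᵥ d = 0}

theorem symp_eq_zero_of_mem_subspaceLabels {D : Submodule (ZMod p) (ι → ZMod p)} {a b : Label p ι}
    (ha : a ∈ subspaceLabels D) (hb : b ∈ subspaceLabels D) : symp a b = 0 := by
  rw [symp_apply, ha.2 _ hb.1, hb.2 _ ha.1, sub_zero]

/-- The labels form the Lagrangian subspace `D ⊕ D^⊥`. A vector outside `D` is separated from it by
a functional, which is itself a Z label orthogonal to `D`. -/
theorem mem_subspaceLabels_of_symp {D : Submodule (ZMod p) (ι → ZMod p)} {b : Label p ι}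
    (h : ∀ a ∈ subspaceLabels D, symp b a = 0) : b ∈ subspaceLabels D := by
  refine ⟨?_, fun d hd => ?_⟩
  · by_contra hb
    obtain ⟨φ, hφ, hle⟩ := Submodule.exists_le_ker_of_notMem hb
    obtain ⟨z, hz⟩ := exists_dotProduct_eq φ
    have := h (0, z) ⟨D.zero_mem, fun d hd => by rw [hz]; exact hle hd⟩
    rw [symp_apply] at this
    apply hφ
    rw [← hz]
    simpa using this
  · have := h (d, 0) ⟨hd, fun _ _ => zero_dotProduct _⟩
    simpa [symp_apply] using this

theorem isStabCode_subspace (D : Submodule (ZMod p) (ι → ZMod p)) :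
    IsStabCode p {P | ∃ a ∈ subspaceLabels D, P = weyl a} where
  subset := by rintro _ ⟨a, -, rfl⟩; exact mem_pauliGroup_iff.2 ⟨0, a, by simp⟩
  one_mem := ⟨0, ⟨D.zero_mem, fun _ _ => zero_dotProduct _⟩, by simp⟩
  mul_mem := by
    rintro _ ⟨a, ha, rfl⟩ _ ⟨b, hb, rfl⟩
    refine ⟨a + b, ⟨D.add_mem ha.1 hb.1, fun d hd => ?_⟩,
      weyl_mul_of_symp_eq_zero (symp_eq_zero_of_mem_subspaceLabels ha hb)⟩
    rw [Prod.snd_add, add_dotProduct, ha.2 d hd, hb.2 d hd, add_zero]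
  inv_mem := by
    rintro _ ⟨a, ha, rfl⟩
    refine ⟨-a, ⟨D.neg_mem ha.1, fun d hd => ?_⟩, weyl_conjTranspose a⟩
    rw [Prod.snd_neg, neg_dotProduct, ha.2 d hd, neg_zero]
  comm := by
    rintro _ ⟨a, ha, rfl⟩ _ ⟨b, hb, rfl⟩
    exact (weyl_comm_iff a b).2 (symp_eq_zero_of_mem_subspaceLabels ha hb)
  phase := by
    rintro y ⟨a, -, h⟩
    have h0 := eq_zero_of_weyl_eq_smul_one h.symm
    rw [h0, weyl_zero] at h
    have := congrFun (congrFun h 0) 0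
    rw [← char_eq_one_iff]
    simpa using this

/-- In a larger code, an element commutes with these operators, so its label is already present;
dividing by the Weyl operator of that label leaves a bare phase, which a code forbids unless it is
trivial. -/
theorem maximal_subspace (D : Submodule (ZMod p) (ι → ZMod p)) :
    Maximal (IsStabCode p) {P | ∃ a ∈ subspaceLabels D, P = weyl a} := by
  refine ⟨isStabCode_subspace D, fun S hS hle P hP => ?_⟩
  obtain ⟨y, b, rfl⟩ := mem_pauliGroup_iff.1 (hS.subset hP)
  have hb : b ∈ subspaceLabels D := mem_subspaceLabels_of_symp fun a ha => by
    have h := hS.comm _ hP _ (hle ⟨a, ha, rfl⟩)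
    rw [Matrix.smul_mul, Matrix.mul_smul] at h
    exact (weyl_comm_iff b a).1 (smul_right_injective _ (char_ne_zero y) h)
  have h1 := hS.mul_mem _ hP _ (hS.inv_mem _ (hle ⟨b, hb, rfl⟩))
  rw [Matrix.smul_mul, (weyl_unitary b).1] at h1
  rw [hS.phase y h1]
  exact ⟨b, hb, by simp⟩

/-- The amplitude is fixed by `|D| = p ^ finrank D`. Labels in `subspaceLabels D` translate `D` into
itself and have trivial phases on it. -/
theorem isStabState_subspace (D : Submodule (ZMod p) (ι → ZMod p)) [DecidablePred (· ∈ D)] :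
    IsStabState p fun v => if v ∈ D then
      (((Real.sqrt p)⁻¹ ^ Module.finrank (ZMod p) D : ℝ) : ℂ) else 0 := by
  have hp : (0 : ℝ) < p := Nat.cast_pos.2 (Fact.out : p.Prime).pos
  refine ⟨?_, _, maximal_subspace D, ?_⟩
  · have h1 : ∀ v, ‖(if v ∈ D then (((Real.sqrt p)⁻¹ ^ Module.finrank (ZMod p) D : ℝ) : ℂ)
        else 0)‖ ^ 2 = if v ∈ D then ((p : ℝ) ^ Module.finrank (ZMod p) D)⁻¹ else 0 := by
      intro v
      split_ifs
      · rw [Complex.norm_real, Real.norm_eq_abs, sq_abs, ← pow_mul, mul_comm, pow_mul, inv_pow,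
          Real.sq_sqrt hp.le, inv_pow]
      · simp
    simp only [h1]
    rw [← Finset.sum_filter, Finset.sum_const, ← Fintype.card_subtype, nsmul_eq_mul]
    have h2 : Fintype.card {x // x ∈ D} = p ^ Module.finrank (ZMod p) D := by
      have := Module.card_eq_pow_finrank (K := ZMod p) (V := D)
      rw [ZMod.card] at this
      convert this
    rw [h2, Nat.cast_pow, mul_inv_cancel₀ (pow_ne_zero _ hp.ne')]
  · rintro _ ⟨a, ha, rfl⟩
    ext v
    rw [Matrix.mulVec, dotProduct, Finset.sum_eq_single (v - a.1)]
    · have h3 : v - a.1 ∈ D ↔ v ∈ D :=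
        ⟨fun h => by simpa using D.add_mem h ha.1, fun h => D.sub_mem h ha.1⟩
      rw [weyl_apply, if_pos (by abel), ha.2 _ ha.1]
      simp only [h3]
      split_ifs with hv
      · rw [ha.2 _ (h3.2 hv)]; simp
      · rw [mul_zero]
    · intro u _ hu
      rw [weyl_apply, if_neg, zero_mul]
      rintro rfl; exact hu (by abel)
    · intro h; exact absurd (Finset.mem_univ _) h

end

variable {ι κ μ σ : Type u}

theorem IsStab.congr {f g : Op p κ ι} (hf : IsStab p f) (h : ∀ v u, f v u = g v u) :
    IsStab p g := by
  have : f = g := by ext v u; exact h v u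
  exact this ▸ hf

theorem isStab_one [Fintype ι] [DecidableEq ι] : IsStab p (1 : Op p ι ι) :=
  .clifford 1 (by simpa using weyl_mem_cliffordGroup (0 : Label p ι))

theorem IsStab.scalar {f : Op p κ ι} (hf : IsStab p f) {c : ℂ}
    (hc : IsStab p (Matrix.of fun (_ _ : PEmpty.{u + 1} → ZMod p) => c)) : IsStab p (c • f) :=
  (IsStab.relabel (Equiv.emptySum PEmpty ι) (Equiv.emptySum PEmpty κ) _ (hc.tensor _ _ hf)).congr
    fun v u => by simp [SPL.tensor, Function.comp_def]

theorem IsStab.sqrt_pow_smul {f : Op p κ ι} (hf : IsStab p f) (n : ℕ) :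
    IsStab p (((Real.sqrt p ^ n : ℝ) : ℂ) • f) := by
  induction n with
  | zero => simpa using hf
  | succ n ih =>
    have := ih.scalar IsStab.sqrt
    rw [smul_smul] at this
    rwa [pow_succ', Complex.ofReal_mul]

theorem IsStab.invSqrt_pow_smul {f : Op p κ ι} (hf : IsStab p f) (n : ℕ) :
    IsStab p ((((Real.sqrt p)⁻¹ ^ n : ℝ) : ℂ) • f) := by
  induction n with
  | zero => simpa using hf
  | succ n ih =>
    have := ih.scalar IsStab.invSqrt
    rw [smul_smul] at this
    rwa [pow_succ', Complex.ofReal_mul]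

/-- The scalar generator `√p` removes the normalisation of the uniform superposition. -/
theorem isStab_subspace [Fintype ι] [DecidableEq ι] (D : Submodule (ZMod p) (ι → ZMod p))
    [DecidablePred (· ∈ D)] :
    IsStab p (Matrix.of fun (v : ι → ZMod p) (_ : PEmpty.{u + 1} → ZMod p) =>
      if v ∈ D then (1 : ℂ) else 0) := by
  have hp : (0 : ℝ) < p := Nat.cast_pos.2 (Fact.out : p.Prime).pos
  refine ((IsStab.state _ (isStabState_subspace D)).sqrt_pow_smul
    (Module.finrank (ZMod p) D)).congr fun v u => ?_
  simp only [Matrix.smul_apply, Matrix.of_apply, smul_eq_mul, mul_ite, mul_zero]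
  congr 1
  rw [← Complex.ofReal_mul, ← mul_pow, mul_inv_cancel₀ (Real.sqrt_pos.2 hp).ne', one_pow,
    Complex.ofReal_one]

/-- Map-state duality: a stabiliser state on `κ ⊕ ι` is a stabiliser map from `ι` to `κ`. -/
theorem IsStab.bend [Fintype ι] [DecidableEq ι] [Fintype κ] [DecidableEq κ]
    {f : Op p (κ ⊕ ι) PEmpty.{u + 1}} (hf : IsStab p f) :
    IsStab p (Matrix.of fun (v : κ → ZMod p) (u : ι → ZMod p) => f (Sum.elim v u) 0) := by
  -- The diagonal: its indicator is the unnormalised Bell state, whose adjoint bends an output wire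
  -- back to an input.
  let D : Submodule (ZMod p) (ι ⊕ ι → ZMod p) :=
    LinearMap.eqLocus (LinearMap.funLeft (ZMod p) (ZMod p) Sum.inl)
      (LinearMap.funLeft (ZMod p) (ZMod p) Sum.inr)
  classical
  have hbell := isStab_subspace D
  have h1 := IsStab.relabel (Equiv.emptySum PEmpty ι) (Equiv.sumAssoc κ ι ι) _
    (hf.tensor _ _ (isStab_one (p := p) (ι := ι)))
  have h2 := IsStab.relabel (Equiv.refl _) (Equiv.sumEmpty κ PEmpty) _
    ((isStab_one (p := p) (ι := κ)).tensor _ _ hbell.adjoint)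
  refine (h2.comp _ _ h1).congr fun v u => ?_
  simp only [Matrix.mul_apply, Matrix.of_apply, SPL.tensor, Matrix.conjTranspose_apply,
    Matrix.one_apply]
  rw [Finset.sum_eq_single (Sum.elim v (Sum.elim u u))]
  · have hD : (Sum.elim v (Sum.elim u u) ∘ (Equiv.refl (κ ⊕ ι ⊕ ι))) ∘ Sum.inr ∈ D := by
      ext i; rfl
    have e1 : (Sum.elim v (Sum.elim u u) ∘ (Equiv.sumAssoc κ ι ι)) ∘ Sum.inl = Sum.elim v u := by
      ext (i | i) <;> rfl
    have e2 : (Sum.elim v (Sum.elim u u) ∘ (Equiv.sumAssoc κ ι ι)) ∘ Sum.inr =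
        (u ∘ Equiv.emptySum PEmpty ι) ∘ Sum.inr := by
      ext i; rfl
    have e3 : (v ∘ Equiv.sumEmpty κ PEmpty) ∘ Sum.inl =
        (Sum.elim v (Sum.elim u u) ∘ (Equiv.refl (κ ⊕ ι ⊕ ι))) ∘ Sum.inl := by
      ext i; rfl
    rw [if_pos hD, if_pos e2, if_pos e3, e1]
    simp only [star_one, one_mul, mul_one]
    congr 1
    exact Subsingleton.elim _ _
  · intro w _ hw
    by_cases h3 : (v ∘ Equiv.sumEmpty κ PEmpty) ∘ Sum.inl = (w ∘ Equiv.refl (κ ⊕ ι ⊕ ι)) ∘ Sum.inl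
    · by_cases h4 : (w ∘ Equiv.sumAssoc κ ι ι) ∘ Sum.inr = (u ∘ Equiv.emptySum PEmpty ι) ∘ Sum.inr
      · by_cases h5 : (w ∘ Equiv.refl (κ ⊕ ι ⊕ ι)) ∘ Sum.inr ∈ D
        · exfalso
          apply hw
          ext (i | i | i)
          · exact (congrFun h3 i).symm
          · exact (congrFun h5 i).trans (congrFun h4 i)
          · exact congrFun h4 i
        · rw [if_neg h5]; simp
      · rw [if_neg h4]; simp
    · rw [if_neg h3]; simp
  · intro h; exact absurd (Finset.mem_univ _) h

/-- The zero-one matrix of a linear relation is a stabiliser map. -/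
theorem isStab_rel [Fintype ι] [DecidableEq ι] [Fintype κ] [DecidableEq κ]
    (R : (κ → ZMod p) → (ι → ZMod p) → Prop) [∀ v u, Decidable (R v u)] (h0 : R 0 0)
    (hadd : ∀ v u v' u', R v u → R v' u' → R (v + v') (u + u'))
    (hsmul : ∀ (c : ZMod p) v u, R v u → R (c • v) (c • u)) :
    IsStab p (Matrix.of fun v u => if R v u then (1 : ℂ) else 0) := by
  let D : Submodule (ZMod p) (κ ⊕ ι → ZMod p) :=
    { carrier := {w | R (w ∘ Sum.inl) (w ∘ Sum.inr)}
      zero_mem' := h0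
      add_mem' := fun h h' => hadd _ _ _ _ h h'
      smul_mem' := fun c _ h => hsmul c _ _ h }
  classical
  exact (isStab_subspace D).bend.congr fun v u => by
    simp only [Matrix.of_apply]
    have : Sum.elim v u ∈ D ↔ R v u := Iff.rfl
    simp only [this]

end Relations

/-! ### Completely positive stabiliser maps -/

section CPM

set_option linter.unusedSectionVars false

variable {p : ℕ} [Fact p.Prime] [Fact (p ≠ 2)]

theorem krausMap_apply {k μ ν : Type*} [Fintype k] [Fintype ν] (K : k → Matrix μ ν ℂ)
    (ρ : Matrix ν ν ℂ) : krausMap K ρ = ∑ i, K i * ρ * (K i)ᴴ := rfl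

theorem krausMap_reindex {k l μ ν : Type*} [Fintype k] [Fintype l] [Fintype ν] (e : l ≃ k)
    (K : k → Matrix μ ν ℂ) : krausMap K = krausMap fun i => K (e i) := by
  ext1 ρ
  rw [krausMap_apply, krausMap_apply, ← e.sum_comp]

theorem krausMap_comp {k l μ ν η : Type*} [Fintype k] [Fintype l] [Fintype ν] [Fintype μ]
    (L : l → Matrix η μ ℂ) (K : k → Matrix μ ν ℂ) :
    krausMap L ∘ₗ krausMap K = krausMap fun i : k × l => L i.2 * K i.1 := by
  ext1 ρ
  rw [LinearMap.comp_apply, krausMap_apply, krausMap_apply, krausMap_apply, Fintype.sum_prod_type,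
    Finset.sum_comm]
  refine Finset.sum_congr rfl fun i _ => ?_
  rw [Matrix.mul_sum, Matrix.sum_mul]
  refine Finset.sum_congr rfl fun j _ => ?_
  rw [Matrix.conjTranspose_mul]
  simp only [Matrix.mul_assoc]

theorem krausMap_posSemidef {k μ ν : Type*} [Fintype k] [Fintype ν] [Fintype μ]
    (K : k → Matrix μ ν ℂ) {ρ : Matrix ν ν ℂ} (hρ : ρ.PosSemidef) :
    (krausMap K ρ).PosSemidef := by
  rw [krausMap_apply]
  exact Matrix.posSemidef_sum _ fun i _ => hρ.mul_mul_conjTranspose_same _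

variable {ι κ μ : Type u} [Fintype ι] [DecidableEq ι] [Fintype κ] [DecidableEq κ]
  [Fintype μ] [DecidableEq μ]

theorem isCPMStab_of_kraus {k : Type*} [Fintype k] (σ : Type u) [Fintype σ] [DecidableEq σ]
    (e : (σ → ZMod p) ≃ k) (K : k → Op p κ ι)
    (h : IsStab p (Matrix.of fun (v : κ → ZMod p) (w : ι ⊕ σ → ZMod p) =>
      K (e (w ∘ Sum.inr)) v (w ∘ Sum.inl))) : IsCPMStab p (krausMap K) :=
  ⟨σ, inferInstance, inferInstance, _, h, by rw [krausMap_reindex e]; rfl⟩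

theorem isCPMStab_single {K : Op p κ ι} (hK : IsStab p K) :
    IsCPMStab p (krausMap fun _ : Unit => K) := by
  refine isCPMStab_of_kraus PEmpty.{u + 1} (Equiv.ofUnique _ _) _
    ((IsStab.relabel (Equiv.sumEmpty ι PEmpty).symm (Equiv.refl κ) _ hK).congr fun v u => ?_)
  rfl

theorem IsCPMStab.comp {Ψ : SuperOp p κ μ} {Φ : SuperOp p ι κ} (hΨ : IsCPMStab p Ψ)
    (hΦ : IsCPMStab p Φ) : IsCPMStab p (Ψ ∘ₗ Φ) := by
  obtain ⟨τ, _, _, g, hg, rfl⟩ := hΨ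
  obtain ⟨σ, _, _, f, hf, rfl⟩ := hΦ
  rw [krausMap_comp]
  refine isCPMStab_of_kraus (σ ⊕ τ) (Equiv.sumArrowEquivProdArrow σ τ (ZMod p)) _ ?_
  have h1 := IsStab.relabel (Equiv.sumAssoc ι σ τ) (Equiv.refl _) _
    (hf.tensor _ _ (isStab_one (p := p) (ι := τ)))
  refine (hg.comp _ _ h1).congr fun v w => ?_
  simp only [Matrix.mul_apply, Matrix.of_apply, tensor, Matrix.one_apply]
  rw [← (Equiv.sumArrowEquivProdArrow κ τ (ZMod p)).symm.sum_comp, Fintype.sum_prod_type]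
  refine Finset.sum_congr rfl fun x _ => ?_
  rw [Finset.sum_eq_single (w ∘ Sum.inr ∘ Sum.inr)]
  · have e1 : ((Equiv.sumArrowEquivProdArrow κ τ (ZMod p)).symm (x, w ∘ Sum.inr ∘ Sum.inr) ∘
        Equiv.refl (κ ⊕ τ)) ∘ Sum.inr = (w ∘ Equiv.sumAssoc ι σ τ) ∘ Sum.inr := rfl
    rw [if_pos e1, mul_one]
    congr 2
    ext (i | i) <;> rfl
  · intro y _ hy
    rw [if_neg, mul_zero, mul_zero]
    intro h; exact hy h
  · intro h; exact absurd (Finset.mem_univ _) h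

end CPM

/-! ### Atomic terms are interpreted by stabiliser maps -/

section AtomCPM

set_option linter.unusedSectionVars false

variable {p : ℕ} [Fact p.Prime] [Fact (p ≠ 2)]

theorem reindex_mem_cliffordGroup {ι κ : Type*} [Fintype ι] [DecidableEq ι] [Fintype κ]
    [DecidableEq κ] (e : ι ≃ κ) {U : Op p ι ι} (hU : U ∈ cliffordGroup p ι) :
    (Matrix.of fun v u : κ → ZMod p => U (v ∘ e) (u ∘ e)) ∈ cliffordGroup p κ := by
  obtain ⟨h1, h2, h3⟩ := hU
  let E : (κ → ZMod p) ≃ (ι → ZMod p) := e.symm.arrowCongr (Equiv.refl _)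
  have hE : ∀ M : Op p ι ι, (Matrix.of fun v u : κ → ZMod p => M (v ∘ e) (u ∘ e)) =
      M.submatrix E E := fun M => rfl
  refine ⟨?_, ?_, fun P hP => ?_⟩
  · rw [hE, Matrix.conjTranspose_submatrix, Matrix.submatrix_mul_equiv, h1,
      Matrix.submatrix_one_equiv]
  · rw [hE, Matrix.conjTranspose_submatrix, Matrix.submatrix_mul_equiv, h2,
      Matrix.submatrix_one_equiv]
  · obtain ⟨y, a, rfl⟩ := mem_pauliGroup_iff.1 hP
    have ha : weyl a = (weyl (a.comap e)).submatrix E E := by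
      ext v u; exact (weyl_comap_equiv e a v u).symm
    obtain ⟨y', b, hb⟩ := mem_pauliGroup_iff.1
      (h3 _ (mem_pauliGroup_iff.2 ⟨y, a.comap e, rfl⟩))
    have hb' : weyl b = (weyl (b.comap e.symm)).submatrix E.symm E.symm := by
      ext v u; exact (weyl_comap_equiv e.symm b v u).symm
    refine mem_pauliGroup_iff.2 ⟨y', b.comap e.symm, ?_⟩
    have hs : (ZMod.stdAddChar y : ℂ) • (weyl (a.comap e)).submatrix E E =
        ((ZMod.stdAddChar y : ℂ) • weyl (a.comap e)).submatrix E E := rfl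
    have hb'' : weyl (b.comap e.symm) = (weyl b).submatrix E E := by
      rw [hb', Matrix.submatrix_submatrix]; simp
    rw [hE, Matrix.conjTranspose_submatrix, ha, hs, Matrix.submatrix_mul_equiv,
      Matrix.submatrix_mul_equiv, hb, hb'']
    rfl

variable {Reg : Type u} [DecidableEq Reg]

theorem Env.val_of_mem (Γ : Env Reg) (u : Γ.dom → ZMod p) {r : Reg} (h : r ∈ Γ.dom) :
    Γ.val u r = u ⟨r, h⟩ := dif_pos h

theorem Env.val_zero (Γ : Env Reg) (r : Reg) : Γ.val (0 : Γ.dom → ZMod p) r = 0 := by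
  unfold Env.val; split_ifs <;> rfl

theorem Env.val_add (Γ : Env Reg) (u v : Γ.dom → ZMod p) (r : Reg) :
    Γ.val (u + v) r = Γ.val u r + Γ.val v r := by
  unfold Env.val; split_ifs <;> simp

theorem Env.val_smul (Γ : Env Reg) (c : ZMod p) (u : Γ.dom → ZMod p) (r : Reg) :
    Γ.val (c • u) r = c * Γ.val u r := by
  unfold Env.val; split_ifs <;> simp

/-- The operator factors as a linear relation, `K ⊗ 1`, and another linear relation. The first
relation copies all of `Γ` while reading off the values at `x`; the second writes the values at `y`
and compares the untouched registers. In this relational form the typing conditions on the registers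
play no role. -/
theorem isCPMStab_localOp {Γ Δ : Env Reg} {n m : ℕ} (x : Fin n → Reg) (y : Fin m → Reg)
    {k : Type*} [Fintype k] (σ : Type u) [Fintype σ] [DecidableEq σ] (e : (σ → ZMod p) ≃ k)
    (K : k → Op p (Fin m) (Fin n))
    (hK : IsStab p (Matrix.of fun (v : ULift.{u} (Fin m) → ZMod p)
      (w : ULift.{u} (Fin n) ⊕ σ → ZMod p) =>
      K (e (w ∘ Sum.inr)) (fun i => v ⟨i⟩) (fun i => w (Sum.inl ⟨i⟩)))) :
    IsCPMStab p (krausMap fun i => localOp Γ Δ x y (K i)) := by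
  classical
  refine isCPMStab_of_kraus σ e _ ?_
  have h1 := isStab_rel (p := p) (κ := (ULift.{u} (Fin n) ⊕ σ) ⊕ Γ.dom) (ι := Γ.dom ⊕ σ)
    (fun w u => (∀ i, w (Sum.inl (Sum.inl ⟨i⟩)) = Γ.val (u ∘ Sum.inl) (x i)) ∧
      (∀ s, w (Sum.inl (Sum.inr s)) = u (Sum.inr s)) ∧
      w ∘ Sum.inr = u ∘ Sum.inl)
    ⟨fun i => (Γ.val_zero _).symm, fun s => rfl, rfl⟩
    (fun v u v' u' h h' => ⟨fun i => by
        change v _ + v' _ = Γ.val (u ∘ Sum.inl + u' ∘ Sum.inl) _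
        rw [Γ.val_add, h.1, h'.1],
      fun s => congrArg₂ (· + ·) (h.2.1 s) (h'.2.1 s), congrArg₂ (· + ·) h.2.2 h'.2.2⟩)
    (fun c v u h => ⟨fun i => by
        change c * v _ = Γ.val (c • (u ∘ Sum.inl)) _
        rw [Γ.val_smul, h.1], fun s => congrArg (c • ·) (h.2.1 s), congrArg (c • ·) h.2.2⟩)
  have h2 := isStab_rel (p := p) (κ := Δ.dom) (ι := ULift.{u} (Fin m) ⊕ Γ.dom)
    (fun v w => (∀ j, w (Sum.inl ⟨j⟩) = Δ.val v (y j)) ∧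
      ∀ r ∈ Γ.dom \ Finset.univ.image x, Δ.val v r = Γ.val (w ∘ Sum.inr) r)
    ⟨fun j => (Δ.val_zero _).symm, fun r _ => by
      change _ = Γ.val 0 r; rw [Δ.val_zero, Γ.val_zero]⟩
    (fun v u v' u' h h' => ⟨fun j => by
        rw [Δ.val_add, ← h.1, ← h'.1]; rfl,
      fun r hr => by
        change _ = Γ.val (u ∘ Sum.inr + u' ∘ Sum.inr) r
        rw [Δ.val_add, Γ.val_add, h.2 r hr, h'.2 r hr]⟩)
    (fun c v u h => ⟨fun j => by rw [Δ.val_smul, ← h.1]; rfl,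
      fun r hr => by
        change _ = Γ.val (c • (u ∘ Sum.inr)) r
        rw [Δ.val_smul, Γ.val_smul, h.2 r hr]⟩)
  refine (h2.comp _ _ ((hK.tensor _ _ (isStab_one (p := p) (ι := Γ.dom))).comp _ _ h1)).congr
    fun v u => ?_
  simp only [Matrix.mul_apply, Matrix.of_apply, tensor, Matrix.one_apply]
  rw [Finset.sum_eq_single (Sum.elim (fun j => Δ.val v (y j.down)) (u ∘ Sum.inl)),
    Finset.sum_eq_single (Sum.elim (Sum.elim (fun i => Γ.val (u ∘ Sum.inl) (x i.down))
      (u ∘ Sum.inr)) (u ∘ Sum.inl))]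
  · simp [localOp, Function.comp_def]
  · intro w _ hw
    rw [if_neg (c := _ ∧ _), mul_zero]
    rintro ⟨h3, h4, h5⟩
    apply hw
    ext ((i | s) | r)
    · exact h3 i.down
    · exact h4 s
    · exact congrFun h5 r
  · intro h; exact absurd (Finset.mem_univ _) h
  · intro w _ hw
    by_cases h3 : ∀ j, w (Sum.inl ⟨j⟩) = Δ.val v (y j)
    · rw [Finset.sum_eq_zero, mul_zero]
      intro w' _
      by_cases h4 : w ∘ Sum.inr = w' ∘ Sum.inr
      · rw [if_neg (c := _ ∧ _), mul_zero]
        rintro ⟨-, -, h5⟩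
        apply hw
        ext (j | r)
        · exact h3 j.down
        · exact congrFun (h4.trans h5) r
      · rw [if_neg h4, mul_zero, zero_mul]
    · rw [if_neg (fun h => h3 h.1), zero_mul]
  · intro h; exact absurd (Finset.mem_univ _) h

theorem isCPMStab_localOp_single {Γ Δ : Env Reg} {n m : ℕ} (x : Fin n → Reg) (y : Fin m → Reg)
    (K : Op p (Fin m) (Fin n))
    (hK : IsStab p (Matrix.of fun (v : ULift.{u} (Fin m) → ZMod p)
      (w : ULift.{u} (Fin n) → ZMod p) => K (fun i => v ⟨i⟩) (fun i => w ⟨i⟩))) :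
    IsCPMStab p (krausMap fun _ : Unit => localOp Γ Δ x y K) := by
  refine isCPMStab_localOp x y PEmpty.{u + 1} (Equiv.ofUnique _ _) _
    ((IsStab.relabel (Equiv.sumEmpty _ PEmpty).symm (Equiv.refl _) _ hK).congr fun v u => ?_)
  rfl

/-- The controlled Pauli operator `∑ⱼ |j⟩⟨j| ⊗ P ^ j`. -/
noncomputable def ctrlOp (P : Op p (Fin 1) (Fin 1)) : Op p (Fin 2) (Fin 2) :=
  Matrix.of fun v u => if v 0 = u 0 then (P ^ (u 0).val) (fun _ => v 1) (fun _ => u 1) else 0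

theorem weyl_pow_val (y : ZMod p) (a : Label p (Fin 1)) (j : ZMod p) :
    ((ZMod.stdAddChar y : ℂ) • weyl a) ^ j.val = (ZMod.stdAddChar (j * y) : ℂ) • weyl (j • a) := by
  conv_rhs => rw [← ZMod.natCast_zmod_val j, Nat.cast_smul_eq_nsmul, weyl_nsmul,
    ← nsmul_eq_mul, AddChar.map_nsmul_eq_pow]
  rw [smul_pow]

theorem ctrlOp_weyl_apply (y : ZMod p) (a : Label p (Fin 1)) (v u : Fin 2 → ZMod p) :
    ctrlOp ((ZMod.stdAddChar y : ℂ) • weyl a) v u =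
      if v = u + ![0, u 0 * a.1 0] then
        (ZMod.stdAddChar (u 0 * y + (2⁻¹ * (u 0 * a.2 0 * (u 0 * a.1 0)) + u 0 * a.2 0 * u 1)) : ℂ)
      else 0 := by
  simp only [ctrlOp, Matrix.of_apply, weyl_pow_val, Matrix.smul_apply, smul_eq_mul, weyl_add_phase,
    dotProduct, Finset.univ_unique, Fin.default_eq_zero, Finset.sum_singleton, Prod.smul_fst,
    Prod.smul_snd, Pi.smul_apply, smul_eq_mul]
  have h1 : ((fun _ : Fin 1 => v 1) = (fun _ => u 1) + u 0 • a.1) ↔ v 1 = u 1 + u 0 * a.1 0 := by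
    simp [funext_iff]
  have h2 : v = u + ![0, u 0 * a.1 0] ↔ v 0 = u 0 ∧ v 1 = u 1 + u 0 * a.1 0 := by
    simp only [funext_iff, Fin.forall_fin_two, Pi.add_apply, Matrix.cons_val_zero,
      Matrix.cons_val_one, add_zero]
  simp only [h1, h2, ite_and]

theorem ctrlOp_mem_cliffordGroup {P : Op p (Fin 1) (Fin 1)} (hP : P ∈ pauliGroup p (Fin 1)) :
    ctrlOp P ∈ cliffordGroup p (Fin 2) := by
  obtain ⟨y, a, rfl⟩ := mem_pauliGroup_iff.1 hP
  have hU : (ctrlOp ((ZMod.stdAddChar y : ℂ) • weyl a))ᴴ *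
      ctrlOp ((ZMod.stdAddChar y : ℂ) • weyl a) = 1 := by
    ext v u
    simp only [Matrix.mul_apply, Matrix.conjTranspose_apply, ctrlOp_weyl_apply]
    rw [Finset.sum_eq_single (u + ![0, u 0 * a.1 0]), if_pos rfl, Matrix.one_apply]
    · by_cases h : v = u
      · subst h
        rw [if_pos rfl, if_pos rfl, star_char, mul_comm, char_mul_neg]
      · rw [if_neg h, if_neg, star_zero, zero_mul]
        intro h'
        apply h
        have h0 := congrFun h' 0
        have h1 := congrFun h' 1
        simp only [Pi.add_apply, Matrix.cons_val_zero, Matrix.cons_val_one, add_zero] at h0 h1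
        rw [h0] at h1
        ext i; fin_cases i
        · exact h0.symm
        · exact (add_right_cancel h1).symm
    · intro w _ hw; rw [if_neg hw, mul_zero]
    · intro h; exact absurd (Finset.mem_univ _) h
  refine mem_cliffordGroup_of (mul_eq_one_comm.1 hU) hU fun b => ?_
  -- The symplectic image of `b`: a shift of the control adds that multiple of `a` to the target
  -- label, and the pairing of `a` with the target label is added to the Z component of the control.
  -- The phase below then comes from comparing exponents.
  let c : Label p (Fin 2) := (![b.1 0, b.1 1 + b.1 0 * a.1 0],
    ![b.2 0 + a.2 0 * b.1 1 - b.2 1 * a.1 0, b.2 1 + a.2 0 * b.1 0])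
  refine ⟨2⁻¹ * (b.2 ⬝ᵥ b.1) + b.1 0 * y + 2⁻¹ * (a.2 0 * a.1 0 * b.1 0 * b.1 0) +
    a.2 0 * b.1 0 * b.1 1 - 2⁻¹ * (c.2 ⬝ᵥ c.1), c, ?_⟩
  ext v u
  have hl : (ctrlOp ((ZMod.stdAddChar y : ℂ) • weyl a) * weyl b) v u =
      ctrlOp ((ZMod.stdAddChar y : ℂ) • weyl a) v (u + b.1) * weyl b (u + b.1) u := by
    rw [Matrix.mul_apply, Finset.sum_eq_single (u + b.1)]
    · intro w _ hw; rw [weyl_apply, if_neg hw, mul_zero]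
    · intro h; exact absurd (Finset.mem_univ _) h
  have hr : (weyl c * ctrlOp ((ZMod.stdAddChar y : ℂ) • weyl a)) v u =
      weyl c v (u + ![0, u 0 * a.1 0]) *
        ctrlOp ((ZMod.stdAddChar y : ℂ) • weyl a) (u + ![0, u 0 * a.1 0]) u := by
    rw [Matrix.mul_apply, Finset.sum_eq_single (u + ![0, u 0 * a.1 0])]
    · intro w _ hw; rw [ctrlOp_weyl_apply, if_neg hw, mul_zero]
    · intro h; exact absurd (Finset.mem_univ _) h
  rw [hl, Matrix.smul_apply, hr, ctrlOp_weyl_apply, ctrlOp_weyl_apply, weyl_apply, weyl_apply,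
    if_pos rfl, if_pos rfl]
  have hv : u + b.1 + ![0, (u + b.1) 0 * a.1 0] = u + ![0, u 0 * a.1 0] + c.1 := by
    simp only [funext_iff, Fin.forall_fin_two, c, Pi.add_apply, Matrix.cons_val_zero,
      Matrix.cons_val_one, add_zero]
    exact ⟨trivial, by ring⟩
  rw [hv]
  by_cases h : v = u + ![0, u 0 * a.1 0] + c.1
  · rw [if_pos h, if_pos h, smul_eq_mul, ← AddChar.map_add_eq_mul, ← AddChar.map_add_eq_mul,
      ← AddChar.map_add_eq_mul]
    congr 1
    simp only [dotProduct, Fin.sum_univ_two, c, Pi.add_apply, Matrix.cons_val_zero,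
      Matrix.cons_val_one, add_zero]
    linear_combination (a.2 0 * a.1 0 * b.1 0 * u 0) * (half_add_half (1 : ZMod p))
  · rw [if_neg h, if_neg h]; simp

/-- Interpretations of atomic terms are stabiliser maps. -/
theorem isCPMStab_aden (Γ Δ : Env Reg) (a : Atom p Reg) : IsCPMStab p (aden Γ Δ a) := by
  cases a with
  | skip =>
    refine isCPMStab_localOp_single _ _ _ ((isStab_rel (p := p)
      (κ := ULift.{u} (Fin 0)) (ι := ULift.{u} (Fin 0)) (fun _ _ => True) trivial
      (fun _ _ _ _ _ _ => trivial) (fun _ _ _ _ => trivial)).congr fun v u => ?_)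
    rw [Matrix.of_apply, Matrix.of_apply, if_pos trivial, Matrix.one_apply,
      if_pos (Subsingleton.elim _ _)]
  | init x =>
    refine isCPMStab_localOp_single _ _ _ ((isStab_rel (p := p)
      (κ := ULift.{u} (Fin 1)) (ι := ULift.{u} (Fin 0)) (fun v _ => v = 0) rfl
      (fun _ _ _ _ h h' => by rw [h, h', add_zero])
      (fun _ _ _ h => by rw [h, smul_zero])).congr fun v u => ?_)
    simp only [Matrix.of_apply, Matrix.single_apply]
    congr 1
    simp [funext_iff, eq_comm]
  | qinit x =>
    refine isCPMStab_localOp_single _ _ _ ((isStab_rel (p := p)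
      (κ := ULift.{u} (Fin 1)) (ι := ULift.{u} (Fin 0)) (fun v _ => v = 0) rfl
      (fun _ _ _ _ h h' => by rw [h, h', add_zero])
      (fun _ _ _ h => by rw [h, smul_zero])).congr fun v u => ?_)
    simp only [Matrix.of_apply, Matrix.single_apply]
    congr 1
    simp [funext_iff, eq_comm]
  | meas x =>
    refine isCPMStab_localOp _ _ (ULift.{u} (Fin 1))
      (Equiv.ulift.arrowCongr (Equiv.refl (ZMod p))) _ ((isStab_rel (p := p)
      (κ := ULift.{u} (Fin 1)) (ι := ULift.{u} (Fin 1) ⊕ ULift.{u} (Fin 1))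
      (fun v w => v = w ∘ Sum.inl ∧ v = w ∘ Sum.inr) ⟨rfl, rfl⟩
      (fun _ _ _ _ h h' => ⟨congrArg₂ (· + ·) h.1 h'.1, congrArg₂ (· + ·) h.2 h'.2⟩)
      (fun c _ _ h => ⟨congrArg (c • ·) h.1, congrArg (c • ·) h.2⟩)).congr fun v u => ?_)
    simp only [Matrix.of_apply, Matrix.single_apply]
    congr 1
    simp only [funext_iff, ULift.forall, Equiv.arrowCongr_apply, Function.comp, Equiv.refl_apply,
      Fin.forall_fin_one, eq_iff_iff]
    exact ⟨fun h => ⟨h.2.symm, h.2.symm.trans h.1⟩, fun h => ⟨h.1.symm.trans h.2, h.1.symm⟩⟩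
  | disc x =>
    refine isCPMStab_localOp _ _ (ULift.{u} (Fin 1))
      (Equiv.ulift.arrowCongr (Equiv.refl (ZMod p))) _ ((isStab_rel (p := p)
      (κ := ULift.{u} (Fin 0)) (ι := ULift.{u} (Fin 1) ⊕ ULift.{u} (Fin 1))
      (fun v w => w ∘ Sum.inl = w ∘ Sum.inr) rfl
      (fun _ _ _ _ h h' => congrArg₂ (· + ·) h h')
      (fun c _ _ h => congrArg (c • ·) h)).congr fun v u => ?_)
    simp only [Matrix.of_apply, Matrix.single_apply]
    congr 1
    simp only [funext_iff, ULift.forall, Equiv.arrowCongr_apply, Function.comp, Equiv.refl_apply,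
      Fin.forall_fin_one, eq_iff_iff]
    exact ⟨fun h => ⟨fun i => i.elim0, h.symm⟩, fun h => h.2.symm⟩
  | @affine n m y A x =>
    refine isCPMStab_localOp _ _ (ULift.{u} (Fin n))
      (Equiv.ulift.arrowCongr (Equiv.refl (ZMod p))) _ ?_
    have h1 := isStab_rel (p := p)
      (κ := ULift.{u} (Fin (n + m))) (ι := ULift.{u} (Fin n) ⊕ ULift.{u} (Fin n))
      (fun v w => w ∘ Sum.inl = w ∘ Sum.inr ∧
        (∀ i, v ⟨Fin.castAdd m i⟩ = w (Sum.inl ⟨i⟩)) ∧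
        ∀ j, v ⟨Fin.natAdd n j⟩ = A.linear (fun i => w (Sum.inl ⟨i⟩)) j)
      ⟨rfl, fun _ => rfl, fun j => by
        change 0 = A.linear 0 j
        rw [map_zero]; rfl⟩
      (fun v w v' w' h h' => ⟨congrArg₂ (· + ·) h.1 h'.1,
        fun i => congrArg₂ (· + ·) (h.2.1 i) (h'.2.1 i), fun j => by
          change v _ + v' _ = A.linear ((fun i => w (Sum.inl ⟨i⟩)) + fun i => w' (Sum.inl ⟨i⟩)) j
          rw [map_add, h.2.2, h'.2.2]; rfl⟩)
      (fun c v w h => ⟨congrArg (c • ·) h.1, fun i => congrArg (c • ·) (h.2.1 i), fun j => by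
          change c * v _ = A.linear (c • (fun i => w (Sum.inl ⟨i⟩))) j
          rw [map_smul, h.2.2]; rfl⟩)
    -- The affine map is its linear part followed by the shift by `A 0`, which is a Pauli operator
    -- on the output.
    let s : ULift.{u} (Fin (n + m)) → ZMod p := fun i => Fin.append 0 (A 0) i.down
    refine ((IsStab.clifford _ (weyl_mem_cliffordGroup (p := p) (s, 0))).comp _ _ h1).congr
      fun v w => ?_
    rw [Matrix.mul_apply, Finset.sum_eq_single (v - s)]
    · rw [weyl_apply, if_pos (by simp)]
      simp only [Matrix.of_apply, Matrix.single_apply, zero_dotProduct, mul_zero, add_zero,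
        AddChar.map_zero_eq_one, one_mul]
      congr 1
      have hA : ∀ u j, A u j = A.linear u j + A 0 j := fun u j => by
        simpa using congrFun (A.map_vadd 0 u) j
      simp only [funext_iff, ULift.forall, Equiv.arrowCongr_apply, Function.comp, Equiv.refl_apply,
        Fin.forall_fin_add, Fin.append_left, Fin.append_right, Pi.sub_apply, s, eq_iff_iff,
        Equiv.ulift_symm_apply, Pi.zero_apply, sub_zero]
      constructor
      · rintro ⟨h2, h3, h4⟩
        have h5 : (fun i => w (Sum.inr (ULift.up i))) = fun i => w (Sum.inl (ULift.up i)) :=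
          funext fun i => (h2 i).symm
        refine ⟨⟨fun i => (h2 i).symm.trans (h3 i).symm, fun j => ?_⟩, fun i => (h2 i).symm⟩
        change A (fun i => w (Sum.inr (ULift.up i))) j = _
        rw [hA, h5, ← h4]; ring
      · rintro ⟨⟨h2, h3⟩, h4⟩
        have h5 : (fun i => w (Sum.inr (ULift.up i))) = fun i => w (Sum.inl (ULift.up i)) :=
          funext fun i => h4 i
        refine ⟨fun i => (h4 i).symm, fun i => (h2 i).symm.trans (h4 i), fun j => ?_⟩
        rw [← h3 j]
        change A (fun i => w (Sum.inr (ULift.up i))) j - _ = _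
        rw [hA, h5]; ring
    · intro w' _ hw
      rw [weyl_apply, if_neg, zero_mul]
      rintro rfl
      exact hw (by simp)
    · intro h; exact absurd (Finset.mem_univ _) h
  | gate x U =>
    refine isCPMStab_localOp_single _ _ _ ((IsStab.clifford _
      (reindex_mem_cliffordGroup Equiv.ulift.{u}.symm U.2)).congr fun v u => ?_)
    rfl
  | ctrl P x y =>
    refine isCPMStab_localOp _ _ (ULift.{u} (Fin 1)) (Equiv.funUnique _ _) _ ?_
    -- The value of the control is copied to the environment; the coherent controlled Pauli acts
    -- after that.
    have h1 := isStab_rel (p := p) (κ := ULift.{u} (Fin 2))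
      (ι := ULift.{u} (Fin 2) ⊕ ULift.{u} (Fin 1))
      (fun v w => v = w ∘ Sum.inl ∧ w (Sum.inl ⟨0⟩) = w (Sum.inr default)) ⟨rfl, rfl⟩
      (fun _ _ _ _ h h' => ⟨congrArg₂ (· + ·) h.1 h'.1, congrArg₂ (· + ·) h.2 h'.2⟩)
      (fun c _ _ h => ⟨congrArg (c • ·) h.1, congrArg (c • ·) h.2⟩)
    refine ((IsStab.clifford _ (reindex_mem_cliffordGroup Equiv.ulift.{u}.symm
      (ctrlOp_mem_cliffordGroup P.2))).comp _ _ h1).congr fun v w => ?_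
    rw [Matrix.mul_apply, Finset.sum_eq_single (w ∘ Sum.inl)]
    · simp only [Matrix.of_apply, ctrlOp, true_and, Function.comp, Equiv.funUnique_apply]
      change (if v ⟨0⟩ = w (Sum.inl ⟨0⟩) then _ else _) * _ =
        if v ⟨0⟩ = w (Sum.inr default) ∧ w (Sum.inl ⟨0⟩) = w (Sum.inr default) then _ else _
      by_cases h2 : w (Sum.inl ⟨0⟩) = w (Sum.inr default)
      · rw [if_pos h2, mul_one]
        by_cases h3 : v ⟨0⟩ = w (Sum.inl ⟨0⟩)
        · rw [if_pos h3, if_pos ⟨h3.trans h2, h2⟩]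
          exact congrArg (fun j : ZMod p => (P.1 ^ j.val) (fun _ => v ⟨1⟩)
            fun _ => w (Sum.inl ⟨1⟩)) h2
        · rw [if_neg h3, if_neg fun h => h3 (h.1.trans h2.symm)]
      · rw [if_neg h2, mul_zero, if_neg (fun h => h2 h.2)]
    · intro w' _ hw
      rw [Matrix.of_apply (i := w'), if_neg (fun h => hw h.1), mul_zero]
    · intro h; exact absurd (Finset.mem_univ _) h

/-- The idempotent of an environment is a stabiliser map. -/
theorem isCPMStab_interp (Γ : Env Reg) : IsCPMStab p (Γ.interp p) := by
  classical
  -- Dephasing is realised by copying each pit to an environment qupit of its own.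
  let σ := {r : Γ.dom // Γ.ty r = some .pit}
  have h1 := isStab_rel (p := p) (κ := Γ.dom) (ι := Γ.dom ⊕ σ)
    (fun v w => v = w ∘ Sum.inl ∧ ∀ s : σ, w (Sum.inr s) = v s.1) ⟨rfl, fun _ => rfl⟩
    (fun _ _ _ _ h h' => ⟨congrArg₂ (· + ·) h.1 h'.1, fun s => congrArg₂ (· + ·) (h.2 s) (h'.2 s)⟩)
    (fun c _ _ h => ⟨congrArg (c • ·) h.1, fun s => congrArg (c • ·) (h.2 s)⟩)
  refine ⟨σ, inferInstance, inferInstance, _, h1, ?_⟩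
  ext1 ρ
  ext v u
  rw [krausMap_apply, Matrix.sum_apply]
  have h2 : ∀ (s : σ → ZMod p) (v w : Γ.dom → ZMod p),
      (if v = Sum.elim w s ∘ Sum.inl ∧ ∀ r : σ, Sum.elim w s (Sum.inr r) = v r.1 then (1 : ℂ)
        else 0) = if v = w then (if s = fun r => v r.1 then 1 else 0) else 0 := by
    intro s v w
    simp only [Sum.elim_comp_inl, Sum.elim_inr, ← funext_iff, ite_and]
  have h3 : ∀ K : (σ → ZMod p) → Op p Γ.dom Γ.dom,
      (∀ s v w, K s v w = if v = w then (if s = fun r => v r.1 then 1 else 0) else 0) →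
      ∀ s, (K s * ρ * (K s)ᴴ) v u = (if s = fun r => v r.1 then 1 else 0) * ρ v u *
        (if s = fun r => u r.1 then 1 else 0) := by
    intro K hK s
    rw [Matrix.mul_apply, Finset.sum_eq_single u, Matrix.mul_apply, Finset.sum_eq_single v,
      Matrix.conjTranspose_apply, hK, hK, if_pos rfl, if_pos rfl]
    · split_ifs <;> simp
    · intro w _ hw; rw [hK, if_neg hw.symm, zero_mul]
    · intro h; exact absurd (Finset.mem_univ _) h
    · intro w _ hw; rw [Matrix.conjTranspose_apply, hK, if_neg hw.symm, star_zero, mul_zero]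
    · intro h; exact absurd (Finset.mem_univ _) h
  refine Eq.trans ?_ (Finset.sum_congr rfl fun s _ => (h3 (fun s => Matrix.of fun v w =>
    if v = Sum.elim w s ∘ Sum.inl ∧ ∀ r : σ, Sum.elim w s (Sum.inr r) = v r.1 then 1 else 0)
    h2 s).symm)
  rw [Finset.sum_eq_single fun r => v r.1, if_pos rfl, one_mul]
  · simp only [Env.interp, LinearMap.coe_mk, AddHom.coe_mk, Matrix.of_apply, mul_ite, mul_one,
      mul_zero]
    congr 1
    simp only [funext_iff, σ, Subtype.forall]
  · intro s _ hs; rw [if_neg hs, zero_mul, zero_mul]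
  · intro h; exact absurd (Finset.mem_univ _) h

end AtomCPM

/-! ### Local operators in coordinates independent of the environment. -/

section Local

set_option linter.unusedSectionVars false

variable {p : ℕ} [Fact p.Prime] [Fact (p ≠ 2)] {Reg : Type u} [DecidableEq Reg]

/-- The matrix entries of an operator on `Γ.dom`, as a function of assignments of values to all
registers. -/
def pull (Γ : Env Reg) (ρ : Op p Γ.dom Γ.dom) (v u : Reg → ZMod p) : ℂ :=
  ρ (fun r => v r) (fun r => u r)

theorem Env.val_restrict (Γ : Env Reg) (v : Reg → ZMod p) {r : Reg} (h : r ∈ Γ.dom) :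
    Γ.val (fun r => v r) r = v r := dif_pos h

theorem Env.restrict_val (Γ : Env Reg) (u : Γ.dom → ZMod p) :
    (fun r : Γ.dom => Γ.val u r) = u := funext fun r => Γ.val_of_mem u r.2

theorem pull_val (Γ : Env Reg) (ρ : Op p Γ.dom Γ.dom) (v u : Γ.dom → ZMod p) :
    pull Γ ρ (Γ.val v) (Γ.val u) = ρ v u := by
  rw [pull, Γ.restrict_val, Γ.restrict_val]

theorem pull_injective (Γ : Env Reg) : Function.Injective (pull (p := p) Γ) := by
  intro ρ σ h
  ext v u
  rw [← pull_val Γ ρ, h, pull_val]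

theorem Env.extend_val (Γ : Env Reg) (w : Γ.dom → ZMod p) {n : ℕ} {x : Fin n → Reg}
    (hx : Function.Injective x) (v : Reg → ZMod p) (h : ∀ r ∈ Γ.dom \ Finset.univ.image x, v r = Γ.val w r) :
    (fun r : Γ.dom => Function.extend x (fun i => Γ.val w (x i)) v r) = w := by
  funext r
  by_cases hr : ∃ i, x i = r
  · obtain ⟨i, hi⟩ := hr
    rw [← hi, hx.extend_apply, hi, Γ.val_of_mem w r.2]
  · rw [Function.extend_apply' _ _ _ hr, h r (by simpa using hr), Γ.val_of_mem w r.2]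

/-- The action of a local operator, with `v` an assignment of values to all registers. -/
theorem localOp_sum {Γ Δ : Env Reg} {n m : ℕ} {x : Fin n → Reg} {y : Fin m → Reg}
    (hxi : Function.Injective x) (hx : ∀ i, x i ∈ Γ.dom) (hy : ∀ j, y j ∈ Δ.dom)
    (hΓΔ : Γ.dom \ Finset.univ.image x ⊆ Δ.dom) (K : Op p (Fin m) (Fin n)) (v : Reg → ZMod p)
    (g : (Γ.dom → ZMod p) → ℂ) :
    ∑ w, localOp Γ Δ x y K (fun r => v r) w * g w =
      ∑ a, K (fun j => v (y j)) a * g (fun r => Function.extend x a v r) := by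
  symm
  have hval : ∀ a : Fin n → ZMod p, (fun i => Γ.val (fun r => Function.extend x a v r) (x i)) = a :=
    fun a => funext fun i => by
      rw [Γ.val_restrict (Function.extend x a v) (hx i), hxi.extend_apply]
  refine Fintype.sum_of_injective (fun a => fun r : Γ.dom => Function.extend x a v r) ?_ _ _ ?_ ?_
  · intro a b h
    rw [← hval a, ← hval b]
    simp only at h
    rw [h]
  · intro w hw
    rw [localOp, Matrix.of_apply, if_neg, zero_mul]
    intro h
    exact hw ⟨fun i => Γ.val w (x i), Γ.extend_val w hxi v fun r hr => by
      rw [← h r hr, Δ.val_restrict v (hΓΔ hr)]⟩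
  · intro a
    rw [localOp, Matrix.of_apply, if_pos, hval]
    · congr 2
      exact funext fun j => (Δ.val_restrict v (hy j)).symm
    · intro r hr
      rw [Δ.val_restrict v (hΓΔ hr), Γ.val_restrict (Function.extend x a v) (Finset.mem_sdiff.1 hr).1,
        Function.extend_apply']
      simpa using (Finset.mem_sdiff.1 hr).2

theorem pull_krausMap_localOp {Γ Δ : Env Reg} {n m : ℕ} {x : Fin n → Reg} {y : Fin m → Reg}
    (hxi : Function.Injective x) (hx : ∀ i, x i ∈ Γ.dom) (hy : ∀ j, y j ∈ Δ.dom)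
    (hΓΔ : Γ.dom \ Finset.univ.image x ⊆ Δ.dom) {k : Type*} [Fintype k]
    (K : k → Op p (Fin m) (Fin n)) (ρ : Op p Γ.dom Γ.dom) (v u : Reg → ZMod p) :
    pull Δ (krausMap (fun i => localOp Γ Δ x y (K i)) ρ) v u =
      ∑ i, ∑ a, ∑ b, K i (fun j => v (y j)) a *
        pull Γ ρ (Function.extend x a v) (Function.extend x b u) *
          star (K i (fun j => u (y j)) b) := by
  rw [pull, krausMap_apply, Matrix.sum_apply]
  refine Finset.sum_congr rfl fun i _ => ?_
  rw [Matrix.mul_assoc, Matrix.mul_apply, localOp_sum hxi hx hy hΓΔ]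
  refine Finset.sum_congr rfl fun a _ => ?_
  have h1 : ∀ w, (ρ * (localOp Γ Δ x y (K i))ᴴ) w (fun r => u r) =
      star (∑ a, K i (fun j => u (y j)) a * star (ρ w (fun r => Function.extend x a u r))) := by
    intro w
    rw [← localOp_sum hxi hx hy hΓΔ (K i) u fun w' => star (ρ w w'), star_sum, Matrix.mul_apply]
    refine Finset.sum_congr rfl fun w' _ => ?_
    rw [star_mul', star_star, mul_comm, Matrix.conjTranspose_apply]
  rw [h1, star_sum, Finset.mul_sum]
  refine Finset.sum_congr rfl fun b _ => ?_
  rw [star_mul', star_star, pull]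
  ring

theorem localOp_conjTranspose {Γ Δ : Env Reg} {n m : ℕ} {x : Fin n → Reg} {y : Fin m → Reg}
    (h : Γ.dom \ Finset.univ.image x = Δ.dom \ Finset.univ.image y) (K : Op p (Fin m) (Fin n)) :
    (localOp Γ Δ x y K)ᴴ = localOp Δ Γ y x Kᴴ := by
  ext v u
  simp only [localOp, Matrix.conjTranspose_apply, Matrix.of_apply, apply_ite star, star_zero, h]
  congr 1
  simp only [eq_comm]

theorem localOp_mul {Γ Δ : Env Reg} {n m : ℕ} {x : Fin n → Reg} {y : Fin m → Reg}
    (hyi : Function.Injective y) (hx : ∀ i, x i ∈ Γ.dom)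
    (hy : ∀ j, y j ∈ Δ.dom)
    (h : Γ.dom \ Finset.univ.image x = Δ.dom \ Finset.univ.image y) (L : Op p (Fin n) (Fin m))
    (K : Op p (Fin m) (Fin n)) :
    localOp Δ Γ y x L * localOp Γ Δ x y K = localOp Γ Γ x x (L * K) := by
  ext v w
  obtain ⟨v, rfl⟩ : ∃ v' : Reg → ZMod p, v = fun r : Γ.dom => v' r := ⟨_, (Γ.restrict_val v).symm⟩
  rw [Matrix.mul_apply, localOp_sum hyi hy hx (h ▸ Finset.sdiff_subset)]
  have h1 : ∀ b : Fin m → ZMod p, (fun j => Δ.val (fun r => Function.extend y b v r) (y j)) = b :=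
    fun b => funext fun j => by
      rw [Δ.val_restrict (Function.extend y b v) (hy j), hyi.extend_apply]
  have h2 : ∀ (b : Fin m → ZMod p), ∀ r ∈ Γ.dom \ Finset.univ.image x,
      Δ.val (fun r => Function.extend y b v r) r = Γ.val (fun r => v r) r := fun b r hr => by
    rw [Γ.val_restrict v (Finset.mem_sdiff.1 hr).1]
    rw [h] at hr
    rw [Δ.val_restrict (Function.extend y b v) (Finset.mem_sdiff.1 hr).1, Function.extend_apply']
    simpa using (Finset.mem_sdiff.1 hr).2
  have h3 : (fun j => Γ.val (fun r => v r) (x j)) = fun j => v (x j) :=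
    funext fun j => Γ.val_restrict v (hx j)
  simp only [localOp, Matrix.of_apply, h1, h3]
  by_cases hc : ∀ r ∈ Γ.dom \ Finset.univ.image x, Γ.val (fun r => v r) r = Γ.val w r
  · rw [if_pos hc, Matrix.mul_apply]
    refine Finset.sum_congr rfl fun b _ => ?_
    rw [if_pos fun r hr => (h2 b r hr).trans (hc r hr)]
  · rw [if_neg hc]
    refine Finset.sum_eq_zero fun b _ => ?_
    rw [if_neg fun h' => hc fun r hr => (h2 b r hr).symm.trans (h' r hr), mul_zero]

theorem localOp_one (Γ : Env Reg) {n : ℕ} (x : Fin n → Reg) :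
    localOp Γ Γ x x (1 : Op p (Fin n) (Fin n)) = 1 := by
  ext v u
  simp only [localOp, Matrix.of_apply, Matrix.one_apply, ← ite_and]
  congr 1
  rw [eq_iff_iff]
  constructor
  · rintro ⟨h1, h2⟩
    funext r
    by_cases hr : ∃ i, x i = r
    · obtain ⟨i, hi⟩ := hr
      have := congrFun h2 i
      simp only [hi, Γ.val_of_mem _ r.2] at this
      exact this
    · have := h1 r (by simpa using hr)
      rwa [Γ.val_of_mem _ r.2, Γ.val_of_mem _ r.2] at this
  · rintro rfl
    exact ⟨fun _ _ => rfl, rfl⟩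

theorem localOp_sum_op (Γ Δ : Env Reg) {n m : ℕ} (x : Fin n → Reg) (y : Fin m → Reg) {k : Type*}
    [Fintype k] (K : k → Op p (Fin m) (Fin n)) :
    localOp Γ Δ x y (∑ i, K i) = ∑ i, localOp Γ Δ x y (K i) := by
  ext v u
  simp only [localOp, Matrix.of_apply, Matrix.sum_apply]
  split_ifs <;> simp

theorem krausMap_trace {k μ ν : Type*} [Fintype k] [Fintype ν] [DecidableEq ν] [Fintype μ]
    {K : k → Matrix μ ν ℂ} (h : ∑ i, (K i)ᴴ * K i = 1) (ρ : Matrix ν ν ℂ) :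
    (krausMap K ρ).trace = ρ.trace := by
  rw [krausMap_apply, Matrix.trace_sum]
  calc ∑ i, (K i * ρ * (K i)ᴴ).trace = ∑ i, ((K i)ᴴ * K i * ρ).trace :=
        Finset.sum_congr rfl fun i _ => by rw [Matrix.trace_mul_comm, Matrix.mul_assoc]
    _ = _ := by rw [← Matrix.trace_sum, ← Matrix.sum_mul, h, Matrix.one_mul]

/-- Passing from small operators to local ones respects adjoints, products, sums and the identity,
so the completeness relation of the Kraus operators is inherited. -/
theorem localOp_trace {Γ Δ : Env Reg} {n m : ℕ} {x : Fin n → Reg} {y : Fin m → Reg}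
    (hyi : Function.Injective y) (hx : ∀ i, x i ∈ Γ.dom)
    (hy : ∀ j, y j ∈ Δ.dom)
    (h : Γ.dom \ Finset.univ.image x = Δ.dom \ Finset.univ.image y) {k : Type*} [Fintype k]
    {K : k → Op p (Fin m) (Fin n)} (hK : ∑ i, (K i)ᴴ * K i = 1) (ρ : Op p Γ.dom Γ.dom) :
    (krausMap (fun i => localOp Γ Δ x y (K i)) ρ).trace = ρ.trace := by
  refine krausMap_trace ?_ ρ
  simp only [localOp_conjTranspose h, localOp_mul hyi hx hy h]
  rw [← localOp_sum_op, hK, localOp_one Γ x]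

theorem interp_apply (Γ : Env Reg) (ρ : Op p Γ.dom Γ.dom) (v u : Γ.dom → ZMod p) :
    Γ.interp p ρ v u = open Classical in
      if ∀ r : Γ.dom, Γ.ty r = some .pit → v r = u r then ρ v u else 0 := rfl

theorem interp_eq_self_iff {Γ : Env Reg} {ρ : Op p Γ.dom Γ.dom} :
    Γ.interp p ρ = ρ ↔ ∀ v u r, pull Γ ρ v u ≠ 0 → Γ.ty r = some .pit → v r = u r := by
  classical
  constructor
  · intro h v u r hne hr
    rw [pull, ← h, interp_apply] at hne
    by_contra hvu
    rw [if_neg] at hne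
    · exact hne rfl
    · exact fun h' => hvu (h' ⟨r, (Γ.mem_dom r).2 (by simp [hr])⟩ hr)
  · intro h
    ext v u
    rw [interp_apply, ite_eq_left_iff]
    intro h'
    by_contra hne
    apply h'
    intro r hr
    have := h (Γ.val v) (Γ.val u) r (by rw [pull_val]; exact fun h => hne h.symm) hr
    rwa [Γ.val_of_mem _ r.2, Γ.val_of_mem _ r.2] at this

theorem interp_idem (Γ : Env Reg) (ρ : Op p Γ.dom Γ.dom) :
    Γ.interp p (Γ.interp p ρ) = Γ.interp p ρ := by
  classical
  ext v u
  simp only [interp_apply]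
  split_ifs <;> rfl

theorem interp_trace (Γ : Env Reg) (ρ : Op p Γ.dom Γ.dom) :
    (Γ.interp p ρ).trace = ρ.trace := by
  classical
  simp only [Matrix.trace, Matrix.diag, interp_apply]
  exact Finset.sum_congr rfl fun v _ => if_pos (by simp)

/-- A nonzero output entry comes from a single Kraus index. On a pit among the `y j`, that Kraus
operator forces one value `c`, the same for row and column; on every other pit the agreement is
inherited from `ρ`. -/
theorem interp_localOp {Γ Δ : Env Reg} {n m : ℕ} {x : Fin n → Reg} {y : Fin m → Reg}
    (hxi : Function.Injective x) (hx : ∀ i, x i ∈ Γ.dom) (hy : ∀ j, y j ∈ Δ.dom)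
    (hΓΔ : Γ.dom \ Finset.univ.image x ⊆ Δ.dom) {k : Type*} [Fintype k]
    {K : k → Op p (Fin m) (Fin n)}
    (hty : ∀ r, Δ.ty r = some .pit → (∀ j, y j ≠ r) → Γ.ty r = some .pit ∧ ∀ i, x i ≠ r)
    (hK : ∀ j, Δ.ty (y j) = some .pit → ∀ i, ∃ c, ∀ v a, K i v a ≠ 0 → v j = c)
    {ρ : Op p Γ.dom Γ.dom} (hρ : Γ.interp p ρ = ρ) :
    Δ.interp p (krausMap (fun i => localOp Γ Δ x y (K i)) ρ) =
      krausMap (fun i => localOp Γ Δ x y (K i)) ρ := by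
  rw [interp_eq_self_iff] at hρ ⊢
  intro v u r hne hr
  rw [pull_krausMap_localOp hxi hx hy hΓΔ] at hne
  obtain ⟨i, -, hne⟩ := Finset.exists_ne_zero_of_sum_ne_zero hne
  obtain ⟨a, -, hne⟩ := Finset.exists_ne_zero_of_sum_ne_zero hne
  obtain ⟨b, -, hne⟩ := Finset.exists_ne_zero_of_sum_ne_zero hne
  have h1 := left_ne_zero_of_mul (left_ne_zero_of_mul hne)
  have h2 := right_ne_zero_of_mul (left_ne_zero_of_mul hne)
  have h3 := star_ne_zero.1 (right_ne_zero_of_mul hne)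
  by_cases hyr : ∃ j, y j = r
  · obtain ⟨j, rfl⟩ := hyr
    obtain ⟨c, hc⟩ := hK j hr i
    exact (hc _ _ h1).trans (hc _ _ h3).symm
  · obtain ⟨h4, h5⟩ := hty r hr fun j hj => hyr ⟨j, hj⟩
    have h6 : ¬ ∃ i, x i = r := fun ⟨i, hi⟩ => h5 i hi
    have := hρ _ _ r h2 h4
    rwa [Function.extend_apply' _ _ _ h6, Function.extend_apply' _ _ _ h6] at this

end Local

/-! ### Typed atoms preserve trace and classicality. -/

section Good

set_option linter.unusedSectionVars false

variable {p : ℕ} [Fact p.Prime] [Fact (p ≠ 2)] {Reg : Type u} [DecidableEq Reg]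

/-- Trace preserving stabiliser maps sending `⟨Γ⟩` to `⟨Δ⟩`. -/
structure Good (Γ Δ : Env Reg) (Φ : SuperOp p Γ.dom Δ.dom) : Prop where
  cpm : IsCPMStab p Φ
  trace : ∀ ρ, (Φ ρ).trace = ρ.trace
  interp : ∀ ρ, Γ.interp p ρ = ρ → Δ.interp p (Φ ρ) = Φ ρ

theorem Good.comp {Γ Δ Θ : Env Reg} {Φ : SuperOp p Γ.dom Δ.dom} {Ψ : SuperOp p Δ.dom Θ.dom}
    (hΨ : Good Δ Θ Ψ) (hΦ : Good Γ Δ Φ) : Good Γ Θ (Ψ ∘ₗ Φ) where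
  cpm := hΨ.cpm.comp hΦ.cpm
  trace _ := (hΨ.trace _).trans (hΦ.trace _)
  interp _ hρ := hΨ.interp _ (hΦ.interp _ hρ)

theorem IsCPMStab.posSemidef {ι κ : Type u} [Fintype ι] [DecidableEq ι] [Fintype κ]
    [DecidableEq κ] {Φ : SuperOp p ι κ} (h : IsCPMStab p Φ) {ρ : Op p ι ι} (hρ : ρ.PosSemidef) :
    (Φ ρ).PosSemidef := by
  obtain ⟨σ, _, _, f, -, rfl⟩ := h
  exact krausMap_posSemidef _ hρ

/-- The action of a good map on density operators. -/
def Good.map {Γ Δ : Env Reg} {Φ : SuperOp p Γ.dom Δ.dom} (h : Good Γ Δ Φ) (ρ : Density p Γ) :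
    Density p Δ :=
  ⟨Φ ρ.1, h.cpm.posSemidef ρ.2.1, (h.trace _).trans ρ.2.2.1, h.interp _ ρ.2.2.2⟩

theorem mem_dom_of_ty {Γ : Env Reg} {r : Reg} {τ : Ty} (h : Γ.ty r = some τ) : r ∈ Γ.dom :=
  (Γ.mem_dom r).2 (by simp [h])

theorem notMem_dom_of_ty {Γ : Env Reg} {r : Reg} (h : Γ.ty r = none) : r ∉ Γ.dom :=
  fun h' => (Γ.mem_dom r).1 h' h

theorem sum_single_self (n : ℕ) :
    ∑ j : Fin n → ZMod p, (Matrix.single j j 1 : Op p (Fin n) (Fin n)) = 1 := by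
  ext v u
  simp only [Matrix.sum_apply, Matrix.single_apply, Matrix.one_apply]
  by_cases h : v = u
  · subst h; simp
  · rw [if_neg h]
    exact Finset.sum_eq_zero fun j _ => if_neg fun h' => h (h'.1.symm.trans h'.2)

theorem good_skip (Γ : Env Reg) : Good Γ Γ (aden Γ Γ (.skip : Atom p Reg)) where
  cpm := isCPMStab_aden _ _ _
  trace := localOp_trace (fun i => i.elim0) (fun i => i.elim0) (fun i => i.elim0) rfl (by simp)
  interp _ := interp_localOp (fun i => i.elim0) (fun i => i.elim0) (fun i => i.elim0)
    Finset.sdiff_subset (fun r hr _ => ⟨hr, fun i => i.elim0⟩) (fun i => i.elim0)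

theorem aden_skip (Γ : Env Reg) (ρ : Op p Γ.dom Γ.dom) :
    aden Γ Γ (.skip : Atom p Reg) ρ = ρ := by
  simp only [aden, krausMap_apply, localOp_one]
  simp

theorem conjTranspose_single_mul (n : ℕ) (j : Fin n → ZMod p) {m : ℕ} (i : Fin m → ZMod p) :
    (Matrix.single i j 1 : Op p (Fin m) (Fin n))ᴴ *
      (Matrix.single i j 1 : Op p (Fin m) (Fin n)) = Matrix.single j j 1 := by
  simp [Matrix.conjTranspose_single]

theorem sum_single_zero :
    (Matrix.single 0 0 1 : Op p (Fin 0) (Fin 0)) = 1 := by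
  ext v u
  simp [Matrix.one_apply, Subsingleton.elim v u, Subsingleton.elim 0 u]

theorem good_prepare {Γ : Env Reg} {r : Reg} (hr : Γ.ty r = none) (τ : Ty) :
    Good Γ (Γ.bind {r} τ) (krausMap fun _ : Unit => localOp Γ (Γ.bind {r} τ) ![] ![r]
      (Matrix.single 0 0 1 : Op p (Fin 1) (Fin 0))) where
  -- `init` and `qinit` are interpreted by the same formula, so `.init r` serves for either `τ`.
  cpm := isCPMStab_aden Γ (Γ.bind {r} τ) (.init r)
  trace := localOp_trace (Function.injective_of_subsingleton _) (fun i => i.elim0)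
    (fun j => by simp [Env.bind])
    (by
      have := notMem_dom_of_ty hr
      ext s; simp only [Env.bind, Finset.mem_sdiff]; aesop)
    (by simp only [conjTranspose_single_mul, Finset.univ_unique, Finset.sum_singleton,
          sum_single_zero])
  interp _ := interp_localOp (fun i => i.elim0) (fun i => i.elim0)
    (fun j => by simp [Env.bind])
    (fun s hs => Finset.mem_union_right _ (Finset.mem_sdiff.1 hs).1)
    (fun s hs h => ⟨by
      have : s ≠ r := fun h' => h 0 h'.symm
      simpa [Env.bind, this] using hs, fun i => i.elim0⟩)
    (fun j _ _ => ⟨0, fun v a h => by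
      rw [Matrix.single_apply] at h
      rw [← (ite_ne_right_iff.1 h).1.1]; rfl⟩)

theorem image_append {n m : ℕ} (x : Fin n → Reg) (y : Fin m → Reg) :
    Finset.univ.image (Fin.append x y) = Finset.univ.image x ∪ Finset.univ.image y := by
  ext s
  simp only [Finset.mem_union, Finset.mem_image, Finset.mem_univ, true_and]
  constructor
  · rintro ⟨k, rfl⟩
    induction k using Fin.addCases with
    | left i => exact .inl ⟨i, by simp⟩
    | right j => exact .inr ⟨j, by simp⟩
  · rintro (⟨i, rfl⟩ | ⟨j, rfl⟩)
    · exact ⟨Fin.castAdd m i, by simp⟩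
    · exact ⟨Fin.natAdd n j, by simp⟩

theorem good_affine {Γ : Env Reg} {n m : ℕ} {y : Fin m → Reg}
    (A : (Fin n → ZMod p) →ᵃ[ZMod p] (Fin m → ZMod p)) {x : Fin n → Reg}
    (hxi : Function.Injective x) (hyi : Function.Injective y)
    (hx : ∀ i, Γ.ty (x i) = some .pit) (hy : ∀ j, Γ.ty (y j) = none) :
    Good Γ (Γ.bind (Finset.univ.image y) .pit)
      (aden Γ (Γ.bind (Finset.univ.image y) .pit) (.affine y A x)) where
  cpm := isCPMStab_aden _ _ _
  trace := by
    refine localOp_trace ?_ (fun i => mem_dom_of_ty (hx i)) ?_ ?_ ?_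
    · rw [Fin.append_injective_iff]
      refine ⟨hxi, hyi, fun i j h => ?_⟩
      have := hx i
      rw [h, hy j] at this
      cases this
    · simp only [Fin.forall_fin_add, Fin.append_left, Fin.append_right, Env.bind,
        Finset.mem_union]
      exact ⟨fun i => .inr (mem_dom_of_ty (hx i)), fun j => .inl (by simp)⟩
    · have : ∀ j, y j ∉ Γ.dom := fun j => notMem_dom_of_ty (hy j)
      rw [image_append]
      ext s
      simp only [Env.bind, Finset.mem_sdiff, Finset.mem_union, Finset.mem_image,
        Finset.mem_univ, true_and]
      constructor
      · rintro ⟨h1, h2⟩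
        exact ⟨.inr h1, fun h => h.elim h2 fun ⟨j, hj⟩ => this j (hj ▸ h1)⟩
      · rintro ⟨h1, h2⟩
        exact ⟨h1.resolve_left fun h => h2 (.inr h), fun h => h2 (.inl h)⟩
    · simp only [conjTranspose_single_mul, sum_single_self]
  interp _ := by
    refine interp_localOp hxi (fun i => mem_dom_of_ty (hx i)) ?_ ?_ ?_ ?_
    · simp only [Fin.forall_fin_add, Fin.append_left, Fin.append_right, Env.bind,
        Finset.mem_union]
      exact ⟨fun i => .inr (mem_dom_of_ty (hx i)), fun j => .inl (by simp)⟩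
    · exact fun s hs => Finset.mem_union_right _ (Finset.mem_sdiff.1 hs).1
    · intro r hr h
      simp only [Fin.forall_fin_add, Fin.append_left, Fin.append_right] at h
      refine ⟨?_, h.1⟩
      simpa [Env.bind, h.2] using hr
    · intro j _ w
      refine ⟨Fin.append w (A w) j, fun v a h => ?_⟩
      rw [Matrix.single_apply] at h
      rw [(ite_ne_right_iff.1 h).1.1]

theorem good_disc {Γ : Env Reg} {r : Reg} (hr : Γ.ty r = some .pit) :
    Good Γ (Γ.erase r) (aden Γ (Γ.erase r) (.disc r : Atom p Reg)) where
  cpm := isCPMStab_aden _ _ _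
  trace := localOp_trace (fun i => i.elim0) (fun i => by simpa using mem_dom_of_ty hr)
    (fun i => i.elim0)
    (by ext s; simp only [Env.erase, Finset.mem_sdiff]; aesop)
    (by simp only [conjTranspose_single_mul, sum_single_self])
  interp _ := interp_localOp (Function.injective_of_subsingleton _)
    (fun i => by simpa using mem_dom_of_ty hr) (fun i => i.elim0)
    (by intro s hs; simp only [Env.erase, Finset.mem_sdiff] at hs ⊢; aesop)
    (fun s hs _ => by
      simp only [Env.erase] at hs
      have hne : s ≠ r := fun h => by rw [if_pos h] at hs; cases hs
      rw [if_neg hne] at hs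
      exact ⟨hs, fun i h => hne (by simpa using h.symm)⟩)
    (fun i => i.elim0)

theorem good_meas {Γ : Env Reg} {r : Reg} (hr : Γ.ty r = some .qpit) :
    Good Γ (Γ.bind {r} .pit) (aden Γ (Γ.bind {r} .pit) (.meas r : Atom p Reg)) where
  cpm := isCPMStab_aden _ _ _
  trace := localOp_trace (Function.injective_of_subsingleton _)
    (fun i => by simpa using mem_dom_of_ty hr) (fun j => by simp [Env.bind])
    (by ext s; simp only [Env.bind, Finset.mem_sdiff]; aesop)
    (by simp only [conjTranspose_single_mul, sum_single_self])
  interp _ := interp_localOp (Function.injective_of_subsingleton _)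
    (fun i => by simpa using mem_dom_of_ty hr) (fun j => by simp [Env.bind])
    (fun s hs => Finset.mem_union_right _ (Finset.mem_sdiff.1 hs).1)
    (fun s hs h => by
      have : s ≠ r := fun h' => h 0 h'.symm
      exact ⟨by simpa [Env.bind, this] using hs, fun i h' => h i h'⟩)
    (fun j _ w => ⟨w j, fun v a h => by
      rw [Matrix.single_apply] at h
      rw [(ite_ne_right_iff.1 h).1.1]⟩)

theorem good_gate {Γ : Env Reg} {n : ℕ} {x : Fin n → Reg} (U : cliffordGroup p (Fin n))
    (hxi : Function.Injective x) (hx : ∀ i, Γ.ty (x i) = some .qpit) :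
    Good Γ Γ (aden Γ Γ (.gate x U)) where
  cpm := isCPMStab_aden _ _ _
  trace := localOp_trace hxi (fun i => mem_dom_of_ty (hx i)) (fun i => mem_dom_of_ty (hx i)) rfl
    (by simpa using U.2.2.1)
  interp _ := interp_localOp hxi (fun i => mem_dom_of_ty (hx i)) (fun i => mem_dom_of_ty (hx i))
    Finset.sdiff_subset (fun s hs h => ⟨hs, h⟩)
    (fun j hj => by rw [hx j] at hj; cases hj)

theorem good_ctrl {Γ : Env Reg} {r s : Reg} (P : pauliGroup p (Fin 1))
    (hr : Γ.ty r = some .pit) (hs : Γ.ty s = some .qpit) :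
    Good Γ Γ (aden Γ Γ (.ctrl P r s)) := by
  have hi : Function.Injective ![r, s] := by
    have : r ≠ s := by rintro rfl; rw [hr] at hs; cases hs
    intro i j
    fin_cases i <;> fin_cases j <;> simp [this, this.symm]
  have hd : ∀ i, ![r, s] i ∈ Γ.dom := by
    simp only [Fin.forall_fin_two]
    exact ⟨mem_dom_of_ty hr, mem_dom_of_ty hs⟩
  refine ⟨isCPMStab_aden _ _ _, localOp_trace hi hd hd rfl ?_, fun _ =>
    interp_localOp hi hd hd Finset.sdiff_subset (fun s hs h => ⟨hs, h⟩) ?_⟩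
  -- Splitting the coherent controlled Pauli by the value of its control gives the Kraus operators,
  -- so completeness is the unitarity of `ctrlOp`.
  · have hU := (ctrlOp_mem_cliffordGroup P.2).2.1
    rw [← hU]
    ext v u
    rw [Matrix.sum_apply]
    simp only [Matrix.mul_apply, Matrix.conjTranspose_apply, Matrix.of_apply, ctrlOp]
    rw [Finset.sum_comm]
    refine Finset.sum_congr rfl fun w _ => ?_
    rw [Finset.sum_eq_single (w 0)]
    · simp only [true_and, eq_comm (a := w 0)]
      refine congrArg₂ (· * ·) (congrArg star ?_) ?_
      · split_ifs with h
        · rw [h]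
        · rfl
      · split_ifs with h
        · rw [h]
        · rfl
    · intro j _ hj
      rw [if_neg fun h => hj h.1.symm, star_zero, zero_mul]
    · intro h; exact absurd (Finset.mem_univ _) h
  · rw [Fin.forall_fin_two]
    refine ⟨fun _ i => ⟨i, fun v a h => ?_⟩, fun h => ?_⟩
    · exact (ite_ne_right_iff.1 h).1.1
    · simp only [Matrix.cons_val_one, Matrix.cons_val_zero] at h
      rw [hs] at h; cases h

theorem Atom.Typed.good {Γ Δ : Env Reg} {a : Atom p Reg} (h : a.Typed Γ Δ) :
    Good Γ Δ (aden Γ Δ a) := by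
  cases h with
  | skip => exact good_skip Γ
  | init r hr => exact good_prepare hr .pit
  | qinit r hr => exact good_prepare hr .qpit
  | affine _ _ y A x hxi hyi hx hy => exact good_affine A hxi hyi hx hy
  | meas r hr => exact good_meas hr
  | disc r hr => exact good_disc hr
  | gate _ x U hxi hx => exact good_gate U hxi hx
  | ctrl P r s hr hs => exact good_ctrl P hr hs

end Good

/-! ### Evaluation agrees with the compositional interpretation. -/

section Operational

set_option linter.unusedSectionVars false

variable {p : ℕ} [Fact p.Prime] [Fact (p ≠ 2)] {Reg : Type u} [DecidableEq Reg]

/-- Compositional interpretation of terms. -/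
inductive Den : (Γ : Env Reg) → Term p Reg → (Δ : Env Reg) → SuperOp p Γ.dom Δ.dom → Prop
  | atom {Γ Δ : Env Reg} {a : Atom p Reg} (h : a.Typed Γ Δ) : Den Γ (.atom a) Δ (aden Γ Δ a)
  | seq {Γ Δ Θ : Env Reg} {c d : Term p Reg} {Φ : SuperOp p Γ.dom Δ.dom}
      {Ψ : SuperOp p Δ.dom Θ.dom} (hc : Den Γ c Δ Φ) (hd : Den Δ d Θ Ψ) :
      Den Γ (.seq c d) Θ (Ψ ∘ₗ Φ)

theorem WF.exists_den {Γ Δ : Env Reg} {t : Term p Reg} (h : WF Γ t Δ) : ∃ Φ, Den Γ t Δ Φ := by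
  induction h with
  | atom h => exact ⟨_, .atom h⟩
  | seq _ _ ihc ihd =>
    obtain ⟨Φ, hΦ⟩ := ihc
    obtain ⟨Ψ, hΨ⟩ := ihd
    exact ⟨_, hΦ.seq hΨ⟩

theorem Den.wf {Γ Δ : Env Reg} {t : Term p Reg} {Φ : SuperOp p Γ.dom Δ.dom}
    (h : Den Γ t Δ Φ) : WF Γ t Δ := by
  induction h with
  | atom h => exact .atom h
  | seq _ _ ihc ihd => exact .seq ihc ihd

theorem Den.good {Γ Δ : Env Reg} {t : Term p Reg} {Φ : SuperOp p Γ.dom Δ.dom}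
    (h : Den Γ t Δ Φ) : Good Γ Δ Φ := by
  induction h with
  | atom h => exact h.good
  | seq _ _ ihc ihd => exact ihd.comp ihc

theorem Atom.Typed.unique {Γ Δ Δ' : Env Reg} {a : Atom p Reg} (h : a.Typed Γ Δ)
    (h' : a.Typed Γ Δ') : Δ = Δ' := by
  cases h <;> cases h' <;> rfl

/-- `z` is the value of the configuration `X`. -/
def Config.HasValue (X : Config p Reg) (z : (Reg → ZMod p) → (Reg → ZMod p) → ℂ) : Prop :=
  ∃ Φ, Den X.src X.term X.tgt Φ ∧ z = pull X.tgt (Φ X.state.1)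

/-- The value is the final state predicted by the compositional interpretation, an invariant of
reduction. Recording it through `pull` allows it to be compared between configurations without
transport along equalities of environments. -/
theorem Step.hasValue {X Y : Config p Reg} (h : Step X Y) {z : (Reg → ZMod p) → (Reg → ZMod p) → ℂ}
    (hX : X.HasValue z) : Y.HasValue z := by
  induction h with
  | atom ha ρ ρ' h =>
    obtain ⟨Φ, hΦ, rfl⟩ := hX
    refine ⟨_, .atom (.skip _), ?_⟩
    cases hΦ
    simp only [aden_skip, h]
  | seq ha hc hc' ρ ρ' ρ'' h hs ih =>
    obtain ⟨Φ, hΦ, rfl⟩ := hX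
    cases hΦ with
    | seq h1 h2 =>
      cases h1 with
      | atom hb =>
        obtain rfl := ha.unique hb
        exact ⟨_, h2, by simp only [h, LinearMap.comp_apply]⟩
  | assoc h h' ρ X hs ih =>
    obtain ⟨Φ, hΦ, rfl⟩ := hX
    cases hΦ with
    | seq h1 h2 =>
      cases h1 with
      | seq h3 h4 => exact ih ⟨_, h3.seq (h4.seq h2), rfl⟩

/-- Determinacy: the invariant of the initial configuration is `Φ ρ`, and that of a terminal one is
its own state. -/
theorem Evals.eq {Γ Δ : Env Reg} {t : Term p Reg} {h : WF Γ t Δ} {ρ : Density p Γ}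
    {ρ' : Density p Δ} (he : Evals h ρ ρ') {Φ : SuperOp p Γ.dom Δ.dom} (hΦ : Den Γ t Δ Φ) :
    ρ'.1 = Φ ρ.1 := by
  have key : ∀ {X Y : Config p Reg}, Relation.TransGen Step X Y → ∀ {z}, X.HasValue z →
      Y.HasValue z := by
    intro X Y hXY z hX
    induction hXY with
    | single h => exact h.hasValue hX
    | tail _ h ih => exact h.hasValue ih
  obtain ⟨Ψ, hΨ, hz⟩ := key he ⟨Φ, hΦ, rfl⟩
  cases hΨ
  simp only [aden_skip] at hz
  exact (pull_injective Δ hz).symm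

/-- The rule for `a; c` requires the remainder to be able to step, so progress of `d` has to be
known before that of `c; d`; the induction therefore takes it as the hypothesis `H`. -/
theorem Step.exists_seq {Γ Δ Θ : Env Reg} {c d : Term p Reg} (hc : WF Γ c Δ) (hd : WF Δ d Θ)
    (H : ∀ ρ : Density p Δ, ∃ (Ξ : Env Reg) (t : Term p Reg) (h : WF Ξ t Θ) (σ : Density p Ξ),
      Step ⟨Δ, d, Θ, hd, ρ⟩ ⟨Ξ, t, Θ, h, σ⟩) (ρ : Density p Γ) :
    ∃ (Ξ : Env Reg) (t : Term p Reg) (h : WF Ξ t Θ) (σ : Density p Ξ),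
      Step ⟨Γ, .seq c d, Θ, .seq hc hd, ρ⟩ ⟨Ξ, t, Θ, h, σ⟩ := by
  induction hc generalizing d Θ with
  | atom ha =>
    obtain ⟨Ξ, t, h, σ, hs⟩ := H (ha.good.map ρ)
    exact ⟨_, _, _, _, .seq ha hd h ρ (ha.good.map ρ) σ rfl hs⟩
  | seq h1 h2 ih1 ih2 =>
    obtain ⟨Ξ, t, h, σ, hs⟩ := ih1 (.seq h2 hd) (ih2 hd H) ρ
    exact ⟨Ξ, t, h, σ, .assoc _ _ ρ _ hs⟩

theorem Step.exists {Γ Δ : Env Reg} {t : Term p Reg} (h : WF Γ t Δ) (ρ : Density p Γ) :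
    ∃ (Ξ : Env Reg) (t' : Term p Reg) (h' : WF Ξ t' Δ) (σ : Density p Ξ),
      Step ⟨Γ, t, Δ, h, ρ⟩ ⟨Ξ, t', Δ, h', σ⟩ := by
  induction h with
  | atom ha => exact ⟨_, _, _, _, .atom ha ρ (ha.good.map ρ) rfl⟩
  | seq hc hd _ ihd => exact Step.exists_seq hc hd ihd ρ

theorem Den.transGen_seq {Γ Δ Θ : Env Reg} {c d : Term p Reg} {Φ : SuperOp p Γ.dom Δ.dom}
    (h : Den Γ c Δ Φ) (hc : WF Γ c Δ) (hd : WF Δ d Θ) (ρ : Density p Γ) :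
    Relation.TransGen Step ⟨Γ, .seq c d, Θ, .seq hc hd, ρ⟩ ⟨Δ, d, Θ, hd, h.good.map ρ⟩ := by
  induction h generalizing d Θ with
  | atom ha =>
    obtain ⟨Ξ, t, h, σ, hs⟩ := Step.exists hd (ha.good.map ρ)
    exact .single (.seq ha hd h ρ (ha.good.map ρ) σ rfl hs)
  | seq h1 h2 ih1 ih2 =>
    have h3 := (ih1 h1.wf (.seq h2.wf hd) ρ).trans (ih2 h2.wf hd (h1.good.map ρ))
    -- Only the initial configuration is bracketed differently, so `assoc` has to be applied to the
    -- first step alone.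
    rw [Relation.TransGen.head'_iff] at h3 ⊢
    obtain ⟨X, hX, hX'⟩ := h3
    exact ⟨X, .assoc _ _ ρ X hX, hX'⟩

theorem Den.evals {Γ Δ : Env Reg} {t : Term p Reg} {Φ : SuperOp p Γ.dom Δ.dom}
    (h : Den Γ t Δ Φ) (ht : WF Γ t Δ) (ρ : Density p Γ) : Evals ht ρ (h.good.map ρ) := by
  induction h with
  | atom ha => exact .single (.atom ha ρ (ha.good.map ρ) rfl)
  | seq h1 h2 _ ih2 =>
    exact (h1.transGen_seq h1.wf h2.wf ρ).trans (ih2 h2.wf (h1.good.map ρ))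

theorem Den.evals_iff {Γ Δ : Env Reg} {t : Term p Reg} {Φ : SuperOp p Γ.dom Δ.dom}
    (h : Den Γ t Δ Φ) (ht : WF Γ t Δ) (ρ : Density p Γ) (ρ' : Density p Δ) :
    Evals ht ρ ρ' ↔ ρ'.1 = Φ ρ.1 := by
  refine ⟨fun he => he.eq h, fun he => ?_⟩
  have : ρ' = h.good.map ρ := Subtype.ext he
  exact this ▸ h.evals ht ρ

theorem Den.denotes_iff {Γ Δ : Env Reg} {t : Term p Reg} {Φ Ψ : SuperOp p Γ.dom Δ.dom}
    (h : Den Γ t Δ Φ) (ht : WF Γ t Δ) :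
    Denotes ht Ψ ↔ ∀ ρ : Density p Γ, Ψ ρ.1 = Φ ρ.1 := by
  constructor
  · intro hd ρ
    obtain ⟨ρ', h1, h2⟩ := hd ρ
    rw [← h1]
    exact (h.evals_iff ht ρ ρ').1 ((h2 ρ').2 rfl)
  · intro hd ρ
    refine ⟨h.good.map ρ, (hd ρ).symm, fun ρ'' => (h.evals_iff ht ρ ρ'').trans ?_⟩
    exact ⟨fun h' => Subtype.ext h', fun h' => h' ▸ rfl⟩

/-! ### Density operators determine maps -/

theorem linearMap_ext_posSemidef {ν : Type*} [Fintype ν] [DecidableEq ν] {E : Type*}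
    [AddCommGroup E] [Module ℂ E] {Φ Ψ : Matrix ν ν ℂ →ₗ[ℂ] E}
    (h : ∀ ρ : Matrix ν ν ℂ, ρ.PosSemidef → Φ ρ = Ψ ρ) : Φ = Ψ := by
  ext1 M
  -- Polarisation with the fourth roots of unity writes `M` as a combination of positive
  -- semidefinite matrices.
  have hM : M = (4⁻¹ : ℂ) • ∑ k : Fin 4, (Complex.I ^ k.val) •
      ((M + (Complex.I ^ k.val) • 1) * (M + (Complex.I ^ k.val) • 1)ᴴ) := by
    simp only [Fin.sum_univ_four, Matrix.conjTranspose_add, Matrix.conjTranspose_smul,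
      Matrix.conjTranspose_one, Matrix.add_mul, Matrix.mul_add, Matrix.mul_smul, Matrix.smul_mul,
      Matrix.mul_one, Matrix.one_mul, smul_add, smul_smul]
    ext i j
    simp only [Matrix.add_apply, Matrix.smul_apply, smul_eq_mul]
    simp [pow_succ]
    ring
  rw [hM, map_smul, map_smul, map_sum, map_sum]
  congr 1
  refine Finset.sum_congr rfl fun k _ => ?_
  rw [map_smul, map_smul, h _ (Matrix.posSemidef_self_mul_conjTranspose _)]

/-- A positive operator in the range of the idempotent either has trace zero, and is then zero, or
rescales to a density operator. Positive operators span, so this determines the map on the range. -/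
theorem eq_of_density {Γ : Env Reg} {κ : Type*} {Φ Ψ : SuperOp p Γ.dom κ}
    (h : ∀ ρ : Density p Γ, Φ ρ.1 = Ψ ρ.1) : Φ ∘ₗ Γ.interp p = Ψ ∘ₗ Γ.interp p := by
  refine linearMap_ext_posSemidef fun ρ hρ => ?_
  rw [LinearMap.comp_apply, LinearMap.comp_apply]
  have h1 := (isCPMStab_interp Γ).posSemidef hρ
  by_cases ht : (Γ.interp p ρ).trace = 0
  · rw [h1.trace_eq_zero_iff.1 ht, map_zero, map_zero]
  · have h2 : (Γ.interp p ρ).trace⁻¹ • Γ.interp p ρ = Γ.interp p ((Γ.interp p ρ).trace⁻¹ • ρ) :=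
      (map_smul _ _ _).symm
    have h3 := h ⟨(Γ.interp p ρ).trace⁻¹ • Γ.interp p ρ,
      h1.smul (inv_nonneg.2 h1.trace_nonneg), by
        rw [Matrix.trace_smul, smul_eq_mul, inv_mul_cancel₀ ht],
      by rw [h2, interp_idem]⟩
    simp only [map_smul] at h3
    exact smul_right_injective _ (inv_ne_zero ht) h3

/-! ### Soundness -/

theorem isStabObj_interp (Γ : Env Reg) : IsStabObj p (Γ.interp p) where
  cpm := isCPMStab_interp Γ
  idem := LinearMap.ext (interp_idem Γ)
  selfAdjoint ρ σ := by
    classical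
    simp only [Matrix.trace, Matrix.diag, Matrix.mul_apply, Matrix.conjTranspose_apply,
      interp_apply]
    refine Finset.sum_congr rfl fun u _ => Finset.sum_congr rfl fun v _ => ?_
    split_ifs <;> simp

theorem interp_comp_interp (Γ : Env Reg) : Γ.interp p ∘ₗ Γ.interp p = Γ.interp p :=
  (isStabObj_interp Γ).idem

theorem Good.isStabChan {Γ Δ : Env Reg} {Φ : SuperOp p Γ.dom Δ.dom} (h : Good Γ Δ Φ) :
    IsStabChan p (Γ.interp p) (Δ.interp p) (Φ ∘ₗ Γ.interp p) where
  cpm := h.cpm.comp (isCPMStab_interp Γ)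
  split := by
    rw [LinearMap.comp_assoc, interp_comp_interp]
    ext1 ρ
    exact h.interp _ (interp_idem Γ ρ)
  causal ρ := h.trace _

theorem IsStabChan.comp_interp {Γ : Env Reg} {κ : Type u} [Fintype κ] [DecidableEq κ]
    {y : SuperOp p κ κ} {Φ : SuperOp p Γ.dom κ} (h : IsStabChan p (Γ.interp p) y Φ) :
    Φ ∘ₗ Γ.interp p = Φ := by
  conv_rhs => rw [← h.split]
  conv_lhs => rw [← h.split]
  rw [LinearMap.comp_assoc, LinearMap.comp_assoc, interp_comp_interp]

theorem IsStabChan.eq_of_density {Γ : Env Reg} {κ : Type u} [Fintype κ] [DecidableEq κ]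
    {y : SuperOp p κ κ} {Φ Ψ : SuperOp p Γ.dom κ} (hΦ : IsStabChan p (Γ.interp p) y Φ)
    (hΨ : IsStabChan p (Γ.interp p) y Ψ) (h : ∀ ρ : Density p Γ, Φ ρ.1 = Ψ ρ.1) : Φ = Ψ := by
  rw [← hΦ.comp_interp, ← hΨ.comp_interp, SPL.eq_of_density h]

/-- The compositional interpretation need not absorb the idempotent on its input; precomposing with
it yields a morphism and changes nothing on states of ⟨Γ⟩. -/
theorem exists_unique_denotes {Γ Δ : Env Reg} {t : Term p Reg} (h : WF Γ t Δ) :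
    ∃! Φ : SuperOp p Γ.dom Δ.dom,
      IsStabChan p (Γ.interp p) (Δ.interp p) Φ ∧ Denotes h Φ := by
  obtain ⟨Φ, hΦ⟩ := h.exists_den
  have h1 : Denotes h (Φ ∘ₗ Γ.interp p) := (hΦ.denotes_iff h).2 fun ρ => by
    rw [LinearMap.comp_apply, ρ.2.2.2]
  refine ⟨_, ⟨hΦ.good.isStabChan, h1⟩, fun Ψ hΨ => ?_⟩
  refine hΨ.1.eq_of_density hΦ.good.isStabChan fun ρ => ?_
  rw [(hΦ.denotes_iff h).1 hΨ.2, (hΦ.denotes_iff h).1 h1]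

theorem denotes_skip (Γ : Env Reg) : Denotes (p := p) (WF.atom (.skip Γ)) (Γ.interp p) :=
  ((Den.atom (.skip Γ)).denotes_iff _).2 fun ρ => by rw [aden_skip, ρ.2.2.2]

theorem Denotes.seq {Γ Δ Θ : Env Reg} {c d : Term p Reg} {hc : WF Γ c Δ} {hd : WF Δ d Θ}
    {Φ : SuperOp p Γ.dom Δ.dom} {Ψ : SuperOp p Δ.dom Θ.dom} (hΦ : Denotes hc Φ)
    (hΨ : Denotes hd Ψ) : Denotes (WF.seq hc hd) (Ψ ∘ₗ Φ) := by
  obtain ⟨Φ', hΦ'⟩ := hc.exists_den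
  obtain ⟨Ψ', hΨ'⟩ := hd.exists_den
  refine ((hΦ'.seq hΨ').denotes_iff _).2 fun ρ => ?_
  rw [LinearMap.comp_apply, LinearMap.comp_apply, (hΦ'.denotes_iff hc).1 hΦ]
  exact (hΨ'.denotes_iff hd).1 hΨ (hΦ'.good.map ρ)

theorem obsEquiv_iff {Γ Δ : Env Reg} {c d : Term p Reg} {hc : WF Γ c Δ} {hd : WF Γ d Δ}
    {Φ Ψ : SuperOp p Γ.dom Δ.dom} (hΦ : IsStabChan p (Γ.interp p) (Δ.interp p) Φ)
    (hΦc : Denotes hc Φ) (hΨ : IsStabChan p (Γ.interp p) (Δ.interp p) Ψ) (hΨd : Denotes hd Ψ) :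
    ObsEquiv hc hd ↔ Φ = Ψ := by
  obtain ⟨Φ', hΦ'⟩ := hc.exists_den
  obtain ⟨Ψ', hΨ'⟩ := hd.exists_den
  rw [hΦ'.denotes_iff] at hΦc
  rw [hΨ'.denotes_iff] at hΨd
  constructor
  · intro h
    refine hΦ.eq_of_density hΨ fun ρ => ?_
    -- The contexts `skip; -; skip` already distinguish the two channels on each state.
    have hs : ∀ Γ : Env Reg, Den Γ (.atom (.skip : Atom p Reg)) Γ _ := fun Γ => .atom (.skip Γ)
    have h1 := h Γ Δ _ _ (hs Γ).wf (hs Δ).wf ρ (hΦ'.good.map ρ)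
    rw [((hs Γ).seq (hΦ'.seq (hs Δ))).evals_iff, ((hs Γ).seq (hΨ'.seq (hs Δ))).evals_iff] at h1
    simp only [LinearMap.comp_apply, aden_skip] at h1
    rw [hΦc, hΨd]
    exact h1.1 rfl
  · rintro rfl Γ' Δ' a b ha hb ρ ρ'
    obtain ⟨A, hA⟩ := ha.exists_den
    obtain ⟨B, hB⟩ := hb.exists_den
    rw [(hA.seq (hΦ'.seq hB)).evals_iff, (hA.seq (hΨ'.seq hB)).evals_iff]
    simp only [LinearMap.comp_apply]
    have h1 := (hΦc (hA.good.map ρ)).symm.trans (hΨd (hA.good.map ρ))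
    simp only [Good.map] at h1
    rw [h1]

end Operational

/-! ### Action of the atomic terms on matrix entries -/

section Entries

set_option linter.unusedSectionVars false

variable {p : ℕ} [Fact p.Prime] [Fact (p ≠ 2)] {Reg : Type u} [DecidableEq Reg]

/-- Kraus operators that are partial functions of the output basis vector. -/
theorem pull_of_functional {Γ Δ : Env Reg} {n m : ℕ} {x : Fin n → Reg} {y : Fin m → Reg}
    (hxi : Function.Injective x) (hx : ∀ i, x i ∈ Γ.dom) (hy : ∀ j, y j ∈ Δ.dom)
    (hΓΔ : Γ.dom \ Finset.univ.image x ⊆ Δ.dom) {k : Type*} [Fintype k]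
    {K : k → Op p (Fin m) (Fin n)} {P : k → (Fin m → ZMod p) → Prop} [∀ i v, Decidable (P i v)]
    {g : k → (Fin m → ZMod p) → (Fin n → ZMod p)}
    (hK : ∀ i v a, K i v a = if P i v ∧ a = g i v then 1 else 0)
    (ρ : Op p Γ.dom Γ.dom) (v u : Reg → ZMod p) :
    pull Δ (krausMap (fun i => localOp Γ Δ x y (K i)) ρ) v u =
      ∑ i, if P i (fun j => v (y j)) ∧ P i (fun j => u (y j)) then
        pull Γ ρ (Function.extend x (g i fun j => v (y j)) v)
          (Function.extend x (g i fun j => u (y j)) u) else 0 := by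
  rw [pull_krausMap_localOp hxi hx hy hΓΔ]
  refine Finset.sum_congr rfl fun i _ => ?_
  rw [Finset.sum_eq_single (g i fun j => v (y j)), Finset.sum_eq_single (g i fun j => u (y j)),
    hK, hK, ite_and]
  · by_cases h1 : P i fun j => v (y j)
    · by_cases h2 : P i fun j => u (y j) <;> simp [h1, h2]
    · simp [h1]
  · intro b _ hb; rw [hK i _ b, if_neg fun h => hb h.2, star_zero, mul_zero]
  · intro h; exact absurd (Finset.mem_univ _) h
  · intro a _ ha
    exact Finset.sum_eq_zero fun b _ => by
      rw [hK i _ a, if_neg fun h => ha h.2, zero_mul, zero_mul]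
  · intro h; exact absurd (Finset.mem_univ _) h

theorem extend_fin_zero (x : Fin 0 → Reg) (a : Fin 0 → ZMod p) (v : Reg → ZMod p) :
    Function.extend x a v = v :=
  funext fun _ => Function.extend_apply' _ _ _ fun ⟨i, _⟩ => i.elim0

theorem extend_fin_one (r : Reg) (a : Fin 1 → ZMod p) (v : Reg → ZMod p) :
    Function.extend ![r] a v = Function.update v r (a 0) := by
  funext s
  by_cases h : s = r
  · subst h
    rw [Function.update_self]
    exact (Function.injective_of_subsingleton ![s]).extend_apply a v 0
  · rw [Function.update_of_ne h, Function.extend_apply']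
    rintro ⟨i, hi⟩
    exact h (by simpa using hi.symm)

theorem injective_pair {r s : Reg} (h : r ≠ s) : Function.Injective ![r, s] := by
  intro i j
  fin_cases i <;> fin_cases j <;> simp [h, h.symm]

theorem extend_fin_two {r s : Reg} (h : r ≠ s) (a : Fin 2 → ZMod p) (v : Reg → ZMod p) :
    Function.extend ![r, s] a v = Function.update (Function.update v r (a 0)) s (a 1) := by
  funext t
  by_cases hs : t = s
  · subst hs
    rw [Function.update_self]
    exact (injective_pair h).extend_apply a v 1
  rw [Function.update_of_ne hs]
  by_cases hr : t = r
  · subst hr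
    rw [Function.update_self]
    exact (injective_pair h).extend_apply a v 0
  rw [Function.update_of_ne hr, Function.extend_apply']
  rintro ⟨i, hi⟩
  fin_cases i
  · exact hr hi.symm
  · exact hs hi.symm

theorem pull_prepare (Γ : Env Reg) (r : Reg) (τ : Ty) (ρ : Op p Γ.dom Γ.dom)
    (v u : Reg → ZMod p) :
    pull (Γ.bind {r} τ) (krausMap (fun _ : Unit => localOp Γ (Γ.bind {r} τ) ![] ![r]
      (Matrix.single 0 0 1 : Op p (Fin 1) (Fin 0))) ρ) v u =
      if v r = 0 ∧ u r = 0 then pull Γ ρ v u else 0 := by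
  rw [pull_of_functional (P := fun _ v => v 0 = 0) (g := fun _ _ => 0) (fun i => i.elim0)
    (fun i => i.elim0) (fun i => by simp [Env.bind])
    (fun s hs => Finset.mem_union_right _ (Finset.mem_sdiff.1 hs).1)]
  · simp [extend_fin_zero]
  · intro _ v a
    rw [Matrix.single_apply]
    congr 1
    simp [funext_iff, eq_comm]

theorem pull_disc {Γ : Env Reg} {r : Reg} (hr : r ∈ Γ.dom) (ρ : Op p Γ.dom Γ.dom)
    (v u : Reg → ZMod p) :
    pull (Γ.erase r) (aden Γ (Γ.erase r) (.disc r) ρ) v u =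
      ∑ j, pull Γ ρ (Function.update v r j) (Function.update u r j) := by
  rw [aden, pull_of_functional (P := fun _ _ => True) (g := fun j _ => j)
    (Function.injective_of_subsingleton _) (fun i => by simpa using hr) (fun i => i.elim0)
    (by intro s hs; simp only [Env.erase, Finset.mem_sdiff] at hs ⊢; aesop)]
  · simp only [and_self, if_true, extend_fin_one]
    exact (Equiv.funUnique (Fin 1) (ZMod p)).sum_comp fun j =>
      pull Γ ρ (Function.update v r j) (Function.update u r j)
  · intro j v a
    rw [Matrix.single_apply]
    congr 1
    simp [eq_comm, Subsingleton.elim v 0]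

theorem pull_meas {Γ : Env Reg} {r : Reg} (hr : r ∈ Γ.dom) (ρ : Op p Γ.dom Γ.dom)
    (v u : Reg → ZMod p) :
    pull (Γ.bind {r} .pit) (aden Γ (Γ.bind {r} .pit) (.meas r) ρ) v u =
      if v r = u r then pull Γ ρ v u else 0 := by
  rw [aden, pull_of_functional (P := fun j v => v = j) (g := fun j _ => j)
    (Function.injective_of_subsingleton _) (fun i => by simpa using hr)
    (fun i => by simp [Env.bind])
    (fun s hs => Finset.mem_union_right _ (Finset.mem_sdiff.1 hs).1)]
  · simp only [extend_fin_one]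
    rw [Finset.sum_eq_single fun i => v (![r] i)]
    · by_cases h : v r = u r
      · rw [if_pos h, if_pos]
        · congr 1
          · exact Function.update_eq_self r v
          · exact (congrArg _ h).trans (Function.update_eq_self r u)
        · exact ⟨rfl, funext fun i => by simpa using h.symm⟩
      · rw [if_neg h, if_neg]
        rintro ⟨-, h'⟩
        exact h (congrFun h' 0).symm
    · intro j _ hj
      rw [if_neg fun h => hj h.1.symm]
    · intro h; exact absurd (Finset.mem_univ _) h
  · intro j v a
    rw [Matrix.single_apply]
    congr 1
    simp only [eq_comm]

theorem pull_copy {Γ : Env Reg} {r s : Reg} (hr : r ∈ Γ.dom) (ρ : Op p Γ.dom Γ.dom)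
    (v u : Reg → ZMod p) :
    pull (Γ.bind (Finset.univ.image ![s]) .pit) (aden Γ (Γ.bind (Finset.univ.image ![s]) .pit)
      (.affine ![s] (AffineMap.id (ZMod p) (Fin 1 → ZMod p)) ![r]) ρ) v u =
      if v r = u r ∧ v s = v r ∧ u s = u r then pull Γ ρ v u else 0 := by
  rw [aden, pull_of_functional (P := fun j v => v = Fin.append j j) (g := fun j _ => j)
    (Function.injective_of_subsingleton _) (fun i => by simpa using hr)
    (by
      simp only [Fin.forall_fin_add, Fin.append_left, Fin.append_right, Env.bind,
        Finset.mem_union]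
      exact ⟨fun i => .inr (by simpa using hr), fun j => .inl (by simp)⟩)
    (fun s hs => Finset.mem_union_right _ (Finset.mem_sdiff.1 hs).1)]
  · simp only [extend_fin_one]
    have h1 : ∀ (j : Fin 1 → ZMod p) (v : Reg → ZMod p),
        ((fun i => v (Fin.append ![r] ![s] i)) = Fin.append j j) ↔ v r = j 0 ∧ v s = j 0 := by
      intro j v
      simp only [funext_iff, Fin.forall_fin_add, Fin.append_left, Fin.append_right,
        Fin.forall_fin_one, Matrix.cons_val_zero]
    simp only [h1]
    rw [Finset.sum_eq_single fun _ => v r]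
    · by_cases h : v r = u r
      · by_cases h2 : v s = v r ∧ u s = u r
        · rw [if_pos ⟨⟨rfl, h2.1⟩, h.symm, h2.2.trans h.symm⟩, if_pos ⟨h, h2⟩]
          congr 1
          · exact Function.update_eq_self r v
          · exact (congrArg _ h).trans (Function.update_eq_self r u)
        · rw [if_neg fun h' => h2 ⟨h'.1.2, h'.2.2.trans h⟩, if_neg fun h' => h2 h'.2]
      · rw [if_neg fun h' => h h'.2.1.symm, if_neg fun h' => h h'.1]
    · intro j _ hj
      rw [if_neg]
      rintro ⟨⟨h, -⟩, -⟩
      exact hj (funext fun i => by rw [h, Subsingleton.elim i 0])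
    · intro h; exact absurd (Finset.mem_univ _) h
  · intro j v a
    rw [Matrix.single_apply]
    congr 1
    simp only [eq_comm, AffineMap.id_apply]

theorem pull_gate {Γ : Env Reg} {n : ℕ} {x : Fin n → Reg} (hxi : Function.Injective x)
    (hx : ∀ i, x i ∈ Γ.dom) (U : cliffordGroup p (Fin n)) (ρ : Op p Γ.dom Γ.dom)
    (v u : Reg → ZMod p) :
    pull Γ (aden Γ Γ (.gate x U) ρ) v u =
      ∑ a, ∑ b, U.1 (fun i => v (x i)) a *
        pull Γ ρ (Function.extend x a v) (Function.extend x b u) *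
          star (U.1 (fun i => u (x i)) b) := by
  rw [aden, pull_krausMap_localOp hxi hx hx Finset.sdiff_subset]
  simp

/-- The Pauli operator `X`. -/
noncomputable def pauliX (p : ℕ) [Fact p.Prime] [Fact (p ≠ 2)] : pauliGroup p (Fin 1) :=
  ⟨(ZMod.stdAddChar (0 : ZMod p) : ℂ) • weyl (1, 0), mem_pauliGroup_iff.2 ⟨0, (1, 0), rfl⟩⟩

theorem pull_ctrlX {Γ : Env Reg} {r s : Reg} (hr : r ∈ Γ.dom) (hs : s ∈ Γ.dom) (hrs : r ≠ s)
    (ρ : Op p Γ.dom Γ.dom) (v u : Reg → ZMod p) :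
    pull Γ (aden Γ Γ (.ctrl (pauliX p) r s) ρ) v u =
      if v r = u r then
        pull Γ ρ (Function.update v s (v s - v r)) (Function.update u s (u s - u r)) else 0 := by
  have hd : ∀ i, ![r, s] i ∈ Γ.dom := by
    simp only [Fin.forall_fin_two]
    exact ⟨hr, hs⟩
  rw [aden, pull_of_functional (P := fun j v => v 0 = j) (g := fun j v => ![j, v 1 - j])
    (injective_pair hrs) hd hd Finset.sdiff_subset]
  · simp only [extend_fin_two hrs, Matrix.cons_val_zero, Matrix.cons_val_one]
    rw [Finset.sum_eq_single (v r)]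
    · by_cases h : v r = u r
      · rw [if_pos h, if_pos ⟨rfl, h.symm⟩]
        congr 1
        · rw [Function.update_eq_self]
        · rw [h, Function.update_eq_self]
      · rw [if_neg h, if_neg fun h' => h h'.2.symm]
    · intro j _ hj
      rw [if_neg fun h => hj h.1.symm]
    · intro h; exact absurd (Finset.mem_univ _) h
  · intro j v a
    rw [Matrix.of_apply, pauliX, weyl_pow_val, Matrix.smul_apply, weyl_apply, ite_and, ite_and]
    have h1 : ((fun _ : Fin 1 => v 1) = (fun _ => a 1) + j • (1 : Fin 1 → ZMod p)) ↔
        v 1 = a 1 + j := by simp [funext_iff]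
    have h2 : a = ![j, v 1 - j] ↔ a 0 = j ∧ v 1 = a 1 + j := by
      rw [funext_iff, Fin.forall_fin_two, ← sub_eq_iff_eq_add]
      exact and_congr_right fun _ => eq_comm
    simp only [Prod.smul_fst, h1, h2, ite_and]
    simp

/-- The swap operator. -/
def swapOp (p : ℕ) : Op p (Fin 2) (Fin 2) :=
  Matrix.of fun v u => if u = v ∘ Equiv.swap 0 1 then 1 else 0

theorem swapOp_mem_cliffordGroup : swapOp p ∈ cliffordGroup p (Fin 2) := by
  have hs : ∀ v : Fin 2 → ZMod p, (v ∘ Equiv.swap 0 1) ∘ Equiv.swap 0 1 = v := fun v => by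
    funext i; simp
  have hl : ∀ (M : Op p (Fin 2) (Fin 2)) v u, (swapOp p * M) v u = M (v ∘ Equiv.swap 0 1) u := by
    intro M v u
    simp [Matrix.mul_apply, swapOp]
  have hr : ∀ (M : Op p (Fin 2) (Fin 2)) v u, (M * swapOp p) v u = M v (u ∘ Equiv.swap 0 1) := by
    intro M v u
    rw [Matrix.mul_apply, Finset.sum_eq_single (u ∘ Equiv.swap 0 1)]
    · simp [swapOp, hs]
    · intro w _ hw
      rw [swapOp, Matrix.of_apply, if_neg, mul_zero]
      rintro rfl
      exact hw (hs w).symm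
    · intro h; exact absurd (Finset.mem_univ _) h
  have hh : (swapOp p)ᴴ = swapOp p := by
    ext v u
    simp only [Matrix.conjTranspose_apply, swapOp, Matrix.of_apply, apply_ite star, star_one,
      star_zero]
    congr 1
    rw [eq_iff_iff]
    constructor
    · rintro rfl; exact (hs u).symm
    · rintro rfl; exact (hs v).symm
  have h1 : swapOp p * swapOp p = 1 := by
    ext v u
    rw [hl, swapOp, Matrix.of_apply, hs, Matrix.one_apply]
    simp only [eq_comm]
  refine mem_cliffordGroup_of (by rw [hh, h1]) (by rw [hh, h1]) fun a =>
    ⟨0, a.comap (Equiv.swap 0 1), ?_⟩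
  ext v u
  rw [AddChar.map_zero_eq_one, one_smul, hl, hr]
  have := weyl_comap_equiv (Equiv.swap (0 : Fin 2) 1) a (v ∘ Equiv.swap 0 1) u
  rw [hs] at this
  exact this.symm

theorem pull_swap {Γ : Env Reg} {r s : Reg} (hr : r ∈ Γ.dom) (hs : s ∈ Γ.dom) (hrs : r ≠ s)
    (ρ : Op p Γ.dom Γ.dom) (v u : Reg → ZMod p) :
    pull Γ (aden Γ Γ (.gate ![r, s] ⟨swapOp p, swapOp_mem_cliffordGroup⟩) ρ) v u =
      pull Γ ρ (Function.update (Function.update v r (v s)) s (v r))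
        (Function.update (Function.update u r (u s)) s (u r)) := by
  have hd : ∀ i, ![r, s] i ∈ Γ.dom := by
    simp only [Fin.forall_fin_two]
    exact ⟨hr, hs⟩
  rw [aden, pull_of_functional (P := fun _ _ => True) (g := fun _ v => v ∘ Equiv.swap 0 1)
    (injective_pair hrs) hd hd Finset.sdiff_subset]
  · simp [extend_fin_two hrs]
  · intro _ v a
    simp [swapOp]

end Entries

/-! ### States reachable from a given environment -/

section Reach

set_option linter.unusedSectionVars false

variable {p : ℕ} [Fact p.Prime] [Fact (p ≠ 2)] {Reg : Type u} [DecidableEq Reg]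

/-- Some term takes every state `ρ` of `⟨Γ⟩` to the state with entries `S ρ` in an environment
with types `ty`. -/
def Reach (Γ : Env Reg) (ty : Reg → Option Ty)
    (S : Op p Γ.dom Γ.dom → (Reg → ZMod p) → (Reg → ZMod p) → ℂ) : Prop :=
  ∃ (Δ : Env Reg) (t : Term p Reg) (Φ : SuperOp p Γ.dom Δ.dom), Δ.ty = ty ∧ Den Γ t Δ Φ ∧
    ∀ ρ, Γ.interp p ρ = ρ → ∀ v u, pull Δ (Φ ρ) v u = S ρ v u

variable {Γ : Env Reg} {ty ty' : Reg → Option Ty}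
  {S S' : Op p Γ.dom Γ.dom → (Reg → ZMod p) → (Reg → ZMod p) → ℂ}

theorem Reach.refl (Γ : Env Reg) : Reach (p := p) Γ Γ.ty (pull Γ) :=
  ⟨Γ, _, _, rfl, .atom (.skip Γ), fun ρ _ v u => by rw [aden_skip]⟩

theorem Reach.congr (h : Reach Γ ty S) (hty : ∀ r, ty r = ty' r)
    (hS : ∀ ρ, Γ.interp p ρ = ρ → ∀ v u, S ρ v u = S' ρ v u) : Reach Γ ty' S' := by
  obtain ⟨Δ, t, Φ, h1, h2, h3⟩ := h
  exact ⟨Δ, t, Φ, h1.trans (funext hty), h2, fun ρ hρ v u => (h3 ρ hρ v u).trans (hS ρ hρ v u)⟩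

theorem Reach.step (h : Reach Γ ty S)
    (H : ∀ Δ : Env Reg, Δ.ty = ty → ∃ (a : Atom p Reg) (Δ' : Env Reg), a.Typed Δ Δ' ∧
      Δ'.ty = ty' ∧ ∀ ρ σ, Γ.interp p ρ = ρ → pull Δ σ = S ρ →
        ∀ v u, pull Δ' (aden Δ Δ' a σ) v u = S' ρ v u) : Reach Γ ty' S' := by
  obtain ⟨Δ, t, Φ, h1, h2, h3⟩ := h
  obtain ⟨a, Δ', ha, h4, h5⟩ := H Δ h1
  exact ⟨Δ', _, _, h4, h2.seq (.atom ha), fun ρ hρ v u =>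
    h5 ρ _ hρ (funext fun v => funext fun u => h3 ρ hρ v u) v u⟩

/-- The entries come from an operator on the registers in the domain, so values elsewhere are
invisible; this discards the updates made at a register that is not yet bound. -/
theorem Reach.indep (h : Reach Γ ty S) {ρ : Op p Γ.dom Γ.dom} (hρ : Γ.interp p ρ = ρ)
    {v v' u u' : Reg → ZMod p} (hv : ∀ r, ty r ≠ none → v r = v' r)
    (hu : ∀ r, ty r ≠ none → u r = u' r) : S ρ v u = S ρ v' u' := by
  obtain ⟨Δ, t, Φ, rfl, h2, h3⟩ := h
  rw [← h3 ρ hρ, ← h3 ρ hρ, pull, pull]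
  exact congrArg₂ (fun a b => Φ ρ a b) (funext fun r : Δ.dom => hv r ((Δ.mem_dom r).1 r.2))
    (funext fun r : Δ.dom => hu r ((Δ.mem_dom r).1 r.2))

theorem Reach.diag (h : Reach Γ ty S) {ρ : Op p Γ.dom Γ.dom} (hρ : Γ.interp p ρ = ρ)
    {v u : Reg → ZMod p} {r : Reg} (hr : ty r = some .pit) (hne : S ρ v u ≠ 0) : v r = u r := by
  obtain ⟨Δ, t, Φ, rfl, h2, h3⟩ := h
  rw [← h3 ρ hρ] at hne
  exact interp_eq_self_iff.1 (h2.good.interp ρ hρ) v u r hne hr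

theorem Reach.qinit (h : Reach Γ ty S) {r : Reg} (hr : ty r = none) :
    Reach Γ (Function.update ty r (some .qpit))
      fun ρ v u => if v r = 0 ∧ u r = 0 then S ρ v u else 0 := by
  refine h.step ?_
  rintro Δ rfl
  refine ⟨.qinit r, Δ.bind {r} .qpit, .qinit Δ r hr, ?_, fun ρ σ _ hσ v u => ?_⟩
  · ext1 s; simp [Env.bind, Function.update_apply]
  · rw [← hσ]
    exact pull_prepare Δ r .qpit σ v u

theorem Reach.disc (h : Reach Γ ty S) {r : Reg} (hr : ty r = some .pit) :
    Reach Γ (Function.update ty r none)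
      fun ρ v u => ∑ j, S ρ (Function.update v r j) (Function.update u r j) := by
  refine h.step ?_
  rintro Δ rfl
  refine ⟨.disc r, Δ.erase r, .disc Δ r hr, ?_, fun ρ σ _ hσ v u => ?_⟩
  · ext1 s; simp [Env.erase, Function.update_apply]
  · rw [← hσ]
    exact pull_disc (mem_dom_of_ty hr) σ v u

theorem Reach.meas (h : Reach Γ ty S) {r : Reg} (hr : ty r = some .qpit) :
    Reach Γ (Function.update ty r (some .pit))
      fun ρ v u => if v r = u r then S ρ v u else 0 := by
  refine h.step ?_
  rintro Δ rfl
  refine ⟨.meas r, Δ.bind {r} .pit, .meas Δ r hr, ?_, fun ρ σ _ hσ v u => ?_⟩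
  · ext1 s; simp [Env.bind, Function.update_apply]
  · rw [← hσ]
    exact pull_meas (mem_dom_of_ty hr) σ v u

theorem Reach.copy (h : Reach Γ ty S) {r s : Reg} (hr : ty r = some .pit) (hs : ty s = none) :
    Reach Γ (Function.update ty s (some .pit))
      fun ρ v u => if v r = u r ∧ v s = v r ∧ u s = u r then S ρ v u else 0 := by
  refine h.step ?_
  rintro Δ rfl
  refine ⟨.affine ![s] (AffineMap.id (ZMod p) (Fin 1 → ZMod p)) ![r],
    Δ.bind (Finset.univ.image ![s]) .pit, .affine Δ one_pos one_pos _ _ _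
      (Function.injective_of_subsingleton _) (Function.injective_of_subsingleton _)
      (fun i => by simpa using hr) (fun i => by simpa using hs), ?_, fun ρ σ _ hσ v u => ?_⟩
  · ext1 s; simp [Env.bind, Function.update_apply, eq_comm]
  · rw [← hσ]
    exact pull_copy (mem_dom_of_ty hr) σ v u

theorem Reach.ctrlX (h : Reach Γ ty S) {r s : Reg} (hr : ty r = some .pit)
    (hs : ty s = some .qpit) :
    Reach Γ ty fun ρ v u => if v r = u r then
      S ρ (Function.update v s (v s - v r)) (Function.update u s (u s - u r)) else 0 := by
  refine h.step ?_
  rintro Δ rfl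
  refine ⟨.ctrl (pauliX p) r s, Δ, .ctrl Δ _ r s hr hs, rfl, fun ρ σ _ hσ v u => ?_⟩
  rw [← hσ]
  refine pull_ctrlX (mem_dom_of_ty hr) (mem_dom_of_ty hs) ?_ σ v u
  rintro rfl
  rw [hr] at hs
  cases hs

theorem Reach.gate (h : Reach Γ ty S) {n : ℕ} (hn : 0 < n) {x : Fin n → Reg}
    (hxi : Function.Injective x) (hx : ∀ i, ty (x i) = some .qpit)
    (U : cliffordGroup p (Fin n)) :
    Reach Γ ty fun ρ v u => ∑ a, ∑ b, U.1 (fun i => v (x i)) a *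
      S ρ (Function.extend x a v) (Function.extend x b u) * star (U.1 (fun i => u (x i)) b) := by
  refine h.step ?_
  rintro Δ rfl
  refine ⟨.gate x U, Δ, .gate Δ hn x U hxi hx, rfl, fun ρ σ _ hσ v u => ?_⟩
  rw [← hσ]
  exact pull_gate hxi (fun i => mem_dom_of_ty (hx i)) U σ v u

theorem Reach.swap (h : Reach Γ ty S) {r s : Reg} (hrs : r ≠ s) (hr : ty r = some .qpit)
    (hs : ty s = some .qpit) :
    Reach Γ ty fun ρ v u => S ρ (Function.update (Function.update v r (v s)) s (v r))
      (Function.update (Function.update u r (u s)) s (u r)) := by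
  refine h.step ?_
  rintro Δ rfl
  refine ⟨.gate ![r, s] ⟨swapOp p, swapOp_mem_cliffordGroup⟩, Δ,
    .gate Δ two_pos _ _ (injective_pair hrs) ?_, rfl, fun ρ σ _ hσ v u => ?_⟩
  · simp only [Fin.forall_fin_two]
    exact ⟨hr, hs⟩
  · rw [← hσ]
    exact pull_swap (mem_dom_of_ty hr) (mem_dom_of_ty hs) hrs σ v u

/-- Trace out a register. -/
theorem Reach.trace (h : Reach Γ ty S) {r : Reg} (hr : ty r = some .qpit) :
    Reach Γ (Function.update ty r none)
      fun ρ v u => ∑ j, S ρ (Function.update v r j) (Function.update u r j) := by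
  refine ((h.meas hr).disc (Function.update_self _ _ _)).congr (fun s => ?_) fun ρ _ v u => ?_
  · rw [Function.update_idem]
  · simp

/-- Controlled X copies the value of `r` onto a fresh |0⟩, after which `r` is discarded. No
coherence is lost, because `r` is classical. -/
theorem Reach.move_pit_qpit (h : Reach Γ ty S) {r s : Reg} (hr : ty r = some .pit)
    (hs : ty s = none) :
    Reach Γ (Function.update (Function.update ty r none) s (some .qpit))
      fun ρ v u => S ρ (Function.update v r (v s)) (Function.update u r (u s)) := by
  have hrs : r ≠ s := by rintro rfl; rw [hr] at hs; cases hs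
  have hr' : Function.update ty s (some .qpit) r = some .pit := by
    rw [Function.update_of_ne hrs, hr]
  refine (((h.qinit hs).ctrlX hr' (Function.update_self _ _ _)).disc hr').congr (fun t => ?_)
    fun ρ hρ v u => ?_
  · rw [Function.update_comm hrs]
  · simp only [Function.update_self, if_true, Function.update_of_ne hrs.symm, sub_eq_zero]
    have hi : ∀ j k, S ρ (Function.update (Function.update v r j) s (v s - j))
        (Function.update (Function.update u r k) s (u s - k)) =
        S ρ (Function.update v r j) (Function.update u r k) := fun j k => by
      refine h.indep hρ (fun t ht => ?_) fun t ht => ?_ <;>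
      · rw [Function.update_of_ne]
        rintro rfl
        exact ht hs
    simp only [hi]
    rw [Finset.sum_eq_single (v s)]
    · by_cases h1 : u s = v s
      · rw [if_pos ⟨rfl, h1⟩, h1]
      · rw [if_neg fun h => h1 h.2]
        by_contra hne
        have := h.diag hρ hr (Ne.symm hne)
        rw [Function.update_self, Function.update_self] at this
        exact h1 this.symm
    · intro j _ hj
      rw [if_neg fun h => hj h.1.symm]
    · intro h; exact absurd (Finset.mem_univ _) h

/-- Swap with a fresh |0⟩ and trace out the old register, which then holds |0⟩. -/
theorem Reach.move_qpit_qpit (h : Reach Γ ty S) {r s : Reg} (hr : ty r = some .qpit)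
    (hs : ty s = none) :
    Reach Γ (Function.update (Function.update ty r none) s (some .qpit))
      fun ρ v u => S ρ (Function.update v r (v s)) (Function.update u r (u s)) := by
  have hrs : r ≠ s := by rintro rfl; rw [hr] at hs; cases hs
  have hr' : Function.update ty s (some .qpit) r = some .qpit := by
    rw [Function.update_of_ne hrs, hr]
  refine (((h.qinit hs).swap hrs hr' (Function.update_self _ _ _)).trace hr').congr (fun t => ?_)
    fun ρ hρ v u => ?_
  · rw [Function.update_comm hrs]
  · simp only [Function.update_self, Function.update_of_ne hrs.symm]
    rw [Finset.sum_eq_single 0, if_pos ⟨rfl, rfl⟩]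
    · refine h.indep hρ (fun t ht => ?_) fun t ht => ?_ <;>
      · have : t ≠ s := by rintro rfl; exact ht hs
        simp [Function.update_apply, this]
    · intro j _ hj
      rw [if_neg fun h => hj h.1]
    · intro h; exact absurd (Finset.mem_univ _) h

/-- Measure, copy and discard. By `hd` the register is already diagonal, so the measurement does not
disturb the state. -/
theorem Reach.move_qpit_pit (h : Reach Γ ty S) {r s : Reg} (hr : ty r = some .qpit)
    (hs : ty s = none)
    (hd : ∀ ρ, Γ.interp p ρ = ρ → ∀ v u, S ρ v u ≠ 0 → v r = u r) :
    Reach Γ (Function.update (Function.update ty r none) s (some .pit))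
      fun ρ v u => S ρ (Function.update v r (v s)) (Function.update u r (u s)) := by
  have hrs : r ≠ s := by rintro rfl; rw [hr] at hs; cases hs
  refine (((h.meas hr).copy (r := r) (s := s) (Function.update_self _ _ _) ?_).disc
    (r := r) ?_).congr (fun t => ?_) fun ρ hρ v u => ?_
  · rw [Function.update_of_ne hrs.symm, hs]
  · rw [Function.update_of_ne hrs, Function.update_self]
  · rw [Function.update_comm hrs.symm, Function.update_idem]
  · simp only [Function.update_self, Function.update_of_ne hrs.symm, true_and, if_true]
    rw [Finset.sum_eq_single (v s)]
    · by_cases h1 : u s = v s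
      · rw [if_pos ⟨rfl, h1⟩, h1]
      · rw [if_neg fun h => h1 h.2]
        by_contra hne
        have := hd ρ hρ _ _ (Ne.symm hne)
        rw [Function.update_self, Function.update_self] at this
        exact h1 this.symm
    · intro j _ hj
      rw [if_neg fun h => hj h.1.symm]
    · intro h; exact absurd (Finset.mem_univ _) h

theorem Reach.move (h : Reach Γ ty S) {r s : Reg} (hr : ty r ≠ none) (hs : ty s = none) (τ : Ty)
    (hτ : τ = .pit → ty r = some .qpit ∧
      ∀ ρ, Γ.interp p ρ = ρ → ∀ v u, S ρ v u ≠ 0 → v r = u r) :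
    Reach Γ (Function.update (Function.update ty r none) s (some τ))
      fun ρ v u => S ρ (Function.update v r (v s)) (Function.update u r (u s)) := by
  cases τ with
  | pit => exact h.move_qpit_pit (hτ rfl).1 hs (hτ rfl).2
  | qpit =>
    cases hr' : ty r with
    | none => exact absurd hr' hr
    | some τ' =>
      cases τ' with
      | pit => exact h.move_pit_qpit hr' hs
      | qpit => exact h.move_qpit_qpit hr' hs

end Reach

/-! ### Operations on finite families of registers. -/

section ReachFamilies

set_option linter.unusedSectionVars false

variable {p : ℕ} [Fact p.Prime] [Fact (p ≠ 2)] {Reg : Type u} [DecidableEq Reg]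
variable {Γ : Env Reg} {ty ty' : Reg → Option Ty}
  {S : Op p Γ.dom Γ.dom → (Reg → ZMod p) → (Reg → ZMod p) → ℂ}
variable {α : Type*} [Fintype α] [DecidableEq α]

theorem Reach.move_family (h : Reach Γ ty S) {e w : α → Reg} (he : Function.Injective e)
    (hw : Function.Injective w) (hew : ∀ a b, e a ≠ w b) (hty : ∀ a, ty (e a) ≠ none)
    (htw : ∀ a, ty (w a) = none) (τ : α → Ty)
    (hτ : ∀ a, τ a = .pit → ty (e a) = some .qpit ∧
      ∀ ρ, Γ.interp p ρ = ρ → ∀ v u, S ρ v u ≠ 0 → v (e a) = u (e a))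
    (h1 : ∀ a, ty' (e a) = none) (h2 : ∀ a, ty' (w a) = some (τ a))
    (h3 : ∀ r, (∀ a, r ≠ e a) → (∀ a, r ≠ w a) → ty' r = ty r) :
    Reach Γ ty' fun ρ v u => S ρ (Function.extend e (v ∘ w) v) (Function.extend e (u ∘ w) u) := by
  -- The assignment seen by the original state after the indices in `A` have been moved: their
  -- values are read at the new registers.
  let mv : Finset α → (Reg → ZMod p) → (Reg → ZMod p) := fun A v =>
    Function.extend e (fun a => if a ∈ A then v (w a) else v (e a)) v
  have key : ∀ A : Finset α, ∃ ty'', Reach Γ ty'' (fun ρ v u => S ρ (mv A v) (mv A u)) ∧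
      (∀ a ∈ A, ty'' (e a) = none ∧ ty'' (w a) = some (τ a)) ∧
      ∀ r, (∀ a ∈ A, r ≠ e a ∧ r ≠ w a) → ty'' r = ty r := by
    intro A
    induction A using Finset.induction_on with
    | empty =>
      refine ⟨ty, h.congr (fun _ => rfl) fun ρ _ v u => ?_, by simp, by simp⟩
      have : ∀ v, mv ∅ v = v := fun v => by
        funext r
        by_cases hr : ∃ a, e a = r
        · obtain ⟨a, rfl⟩ := hr
          simp [mv, he.extend_apply]
        · simp only [mv]
          rw [Function.extend_apply' _ _ _ hr]
      simp only [this]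
    | insert a A ha ih =>
      obtain ⟨ty'', hR, hA, hA'⟩ := ih
      have hea : ty'' (e a) = ty (e a) := hA' _ fun b hb =>
        ⟨fun h => ha (he h ▸ hb), hew a b⟩
      have hwa : ty'' (w a) = ty (w a) := hA' _ fun b hb =>
        ⟨(hew b a).symm, fun h => ha (hw h ▸ hb)⟩
      have hma : ∀ v, mv A v (e a) = v (e a) := fun v => by simp [mv, he.extend_apply, ha]
      refine ⟨_, (hR.move (hea ▸ hty a) (hwa.trans (htw a)) (τ a) fun hp =>
        ⟨hea.trans (hτ a hp).1, fun ρ hρ v u hne => ?_⟩).congr (fun _ => rfl)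
          fun ρ _ v u => ?_, ?_, ?_⟩
      · rw [← hma v, ← hma u]
        exact (hτ a hp).2 ρ hρ _ _ hne
      · have : ∀ v, mv A (Function.update v (e a) (v (w a))) = mv (insert a A) v := by
          intro v
          funext r
          by_cases hr : ∃ b, e b = r
          · obtain ⟨b, rfl⟩ := hr
            simp only [mv, he.extend_apply, Finset.mem_insert]
            by_cases hb : b = a
            · subst hb; simp [ha]
            · by_cases hbA : b ∈ A
              · rw [if_pos hbA, if_pos (.inr hbA), Function.update_of_ne (hew a b).symm]
              · rw [if_neg hbA, if_neg (by simp [hb, hbA]),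
                  Function.update_of_ne fun h => hb (he h)]
          · simp only [mv]
            rw [Function.extend_apply' _ _ _ hr, Function.extend_apply' _ _ _ hr,
              Function.update_of_ne fun h => hr ⟨a, h.symm⟩]
        simp only [this]
      · intro b hb
        by_cases hba : b = a
        · subst hba
          rw [Function.update_of_ne (hew b b), Function.update_self, Function.update_self]
          exact ⟨rfl, rfl⟩
        · have hbA := (Finset.mem_insert.1 hb).resolve_left hba
          rw [Function.update_of_ne (hew b a), Function.update_of_ne fun h => hba (he h),
            Function.update_of_ne fun h => hba (hw h), Function.update_of_ne (hew a b).symm]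
          exact hA b hbA
      · intro r hr
        have h5 := hr a (Finset.mem_insert_self a A)
        rw [Function.update_of_ne h5.2, Function.update_of_ne h5.1]
        exact hA' r fun b hb => hr b (Finset.mem_insert_of_mem hb)
  obtain ⟨ty'', hR, hA, hA'⟩ := key Finset.univ
  refine hR.congr (fun r => ?_) fun ρ _ v u => by simp only [mv, Finset.mem_univ, if_true]; rfl
  by_cases hr1 : ∃ a, r = e a
  · obtain ⟨a, rfl⟩ := hr1
    rw [h1, (hA a (Finset.mem_univ _)).1]
  by_cases hr2 : ∃ a, r = w a
  · obtain ⟨a, rfl⟩ := hr2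
    rw [h2, (hA a (Finset.mem_univ _)).2]
  rw [h3 r (fun a h => hr1 ⟨a, h⟩) fun a h => hr2 ⟨a, h⟩,
    hA' r fun a _ => ⟨fun h => hr1 ⟨a, h⟩, fun h => hr2 ⟨a, h⟩⟩]

theorem Reach.qinit_family (h : Reach Γ ty S) {w : α → Reg} (hw : Function.Injective w)
    (htw : ∀ a, ty (w a) = none) (h1 : ∀ a, ty' (w a) = some .qpit)
    (h2 : ∀ r, (∀ a, r ≠ w a) → ty' r = ty r) :
    Reach Γ ty' fun ρ v u => if v ∘ w = 0 ∧ u ∘ w = 0 then S ρ v u else 0 := by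
  have key : ∀ A : Finset α, ∃ ty'', Reach Γ ty'' (fun ρ v u =>
      if (∀ a ∈ A, v (w a) = 0) ∧ (∀ a ∈ A, u (w a) = 0) then S ρ v u else 0) ∧
      (∀ a ∈ A, ty'' (w a) = some .qpit) ∧ ∀ r, (∀ a ∈ A, r ≠ w a) → ty'' r = ty r := by
    intro A
    induction A using Finset.induction_on with
    | empty => exact ⟨ty, h.congr (fun _ => rfl) fun ρ _ v u => by simp, by simp, by simp⟩
    | insert a A ha ih =>
      obtain ⟨ty'', hR, hA, hA'⟩ := ih
      have hwa : ty'' (w a) = none :=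
        (hA' _ fun b hb h => by obtain rfl := hw h; exact ha hb).trans (htw a)
      refine ⟨_, (hR.qinit hwa).congr (fun _ => rfl) fun ρ _ v u => ?_, fun b hb => ?_,
        fun r hr => ?_⟩
      · rw [← ite_and]
        congr 1
        simp only [Finset.forall_mem_insert, eq_iff_iff]
        tauto
      · by_cases hba : b = a
        · subst hba; rw [Function.update_self]
        · rw [Function.update_of_ne fun h => hba (hw h)]
          exact hA b ((Finset.mem_insert.1 hb).resolve_left hba)
      · rw [Function.update_of_ne (hr a (Finset.mem_insert_self a A))]
        exact hA' r fun b hb => hr b (Finset.mem_insert_of_mem hb)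
  obtain ⟨ty'', hR, hA, hA'⟩ := key Finset.univ
  refine hR.congr (fun r => ?_) fun ρ _ v u => ?_
  · by_cases hr : ∃ a, r = w a
    · obtain ⟨a, rfl⟩ := hr
      rw [h1, hA a (Finset.mem_univ _)]
    · rw [h2 r fun a h => hr ⟨a, h⟩, hA' r fun a _ h => hr ⟨a, h⟩]
  · congr 1
    simp [funext_iff]

/-- Indexing by `Fin n` lets the sum over assignments split along `Fin.cons`, one register at a
time. -/
theorem Reach.trace_fin (n : ℕ) : ∀ {ty ty' : Reg → Option Ty}
    {S : Op p Γ.dom Γ.dom → (Reg → ZMod p) → (Reg → ZMod p) → ℂ}, Reach Γ ty S →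
    ∀ {e : Fin n → Reg}, Function.Injective e → (∀ i, ty (e i) = some .qpit) →
    (∀ i, ty' (e i) = none) → (∀ r, (∀ i, r ≠ e i) → ty' r = ty r) →
    Reach Γ ty' fun ρ v u => ∑ j, S ρ (Function.extend e j v) (Function.extend e j u) := by
  induction n with
  | zero =>
    intro ty ty' S h e he h1 h2 h3
    exact h.congr (fun r => (h3 r fun i => i.elim0).symm) fun ρ _ v u => by
      simp [extend_fin_zero]
  | succ n ih =>
    intro ty ty' S h e he h1 h2 h3
    have hne : ∀ i : Fin n, e i.succ ≠ e 0 := fun i h => Fin.succ_ne_zero i (he h)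
    refine (ih (ty' := ty') (h.trace (h1 0)) (e := fun i => e i.succ)
      (he.comp (Fin.succ_injective n)) (fun i => ?_) (fun i => h2 _) fun r hr => ?_).congr
      (fun _ => rfl) fun ρ _ v u => ?_
    · rw [Function.update_of_ne (hne i), h1]
    · by_cases hr0 : r = e 0
      · rw [hr0, h2, Function.update_self]
      · rw [Function.update_of_ne hr0]
        refine h3 r fun i => ?_
        induction i using Fin.cases with
        | zero => exact hr0
        | succ i => exact hr i
    · have hext : ∀ (j : ZMod p) (k : Fin n → ZMod p) (v : Reg → ZMod p),
          Function.update (Function.extend (fun i => e i.succ) k v) (e 0) j =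
            Function.extend e (Fin.cons j k : Fin (n + 1) → ZMod p) v := by
        intro j k v
        funext r
        by_cases hr : ∃ i, e i = r
        · obtain ⟨i, rfl⟩ := hr
          rw [he.extend_apply]
          induction i using Fin.cases with
          | zero => rw [Function.update_self, Fin.cons_zero]
          | succ i =>
            rw [Function.update_of_ne (hne i), Fin.cons_succ]
            exact (he.comp (Fin.succ_injective n)).extend_apply k v i
        · rw [Function.extend_apply' _ _ _ hr, Function.update_of_ne fun h => hr ⟨0, h.symm⟩,
            Function.extend_apply' _ _ _ fun ⟨i, hi⟩ => hr ⟨_, hi⟩]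
      rw [← (Fin.consEquiv fun _ : Fin (n + 1) => ZMod p).sum_comp, Fintype.sum_prod_type,
        Finset.sum_comm]
      simp only [hext]
      rfl

theorem extend_comp_equiv {β : Type*} (e : α → Reg) (f : β ≃ α) (he : Function.Injective e)
    (j : β → ZMod p) (v : Reg → ZMod p) :
    Function.extend (e ∘ f) j v = Function.extend e (j ∘ f.symm) v := by
  funext r
  by_cases hr : ∃ a, e a = r
  · obtain ⟨a, rfl⟩ := hr
    rw [he.extend_apply]
    have := (he.comp f.injective).extend_apply j v (f.symm a)
    simpa using this
  · rw [Function.extend_apply' _ _ _ hr, Function.extend_apply' _ _ _ fun ⟨b, hb⟩ => hr ⟨_, hb⟩]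

theorem Reach.trace_family (h : Reach Γ ty S) {e : α → Reg} (he : Function.Injective e)
    (h1 : ∀ a, ty (e a) = some .qpit) (h2 : ∀ a, ty' (e a) = none)
    (h3 : ∀ r, (∀ a, r ≠ e a) → ty' r = ty r) :
    Reach Γ ty' fun ρ v u => ∑ j, S ρ (Function.extend e j v) (Function.extend e j u) := by
  let f := (Fintype.equivFin α).symm
  refine (Reach.trace_fin _ h (e := e ∘ f) (he.comp f.injective) (fun i => h1 _) (fun i => h2 _)
    fun r hr => h3 r fun a ha => hr (f.symm a) (by simpa using ha)).congr (fun _ => rfl)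
    fun ρ _ v u => ?_
  simp only [extend_comp_equiv e f he]
  exact (f.arrowCongr (Equiv.refl (ZMod p))).sum_comp fun j =>
    S ρ (Function.extend e j v) (Function.extend e j u)

theorem Reach.gate_family (h : Reach Γ ty S) {x : α → Reg} (hx : Function.Injective x)
    (h1 : ∀ a, ty (x a) = some .qpit) {U : Op p α α} (hU : U ∈ cliffordGroup p α) :
    Reach Γ ty fun ρ v u => ∑ a, ∑ b, U (v ∘ x) a *
      S ρ (Function.extend x a v) (Function.extend x b u) * star (U (u ∘ x) b) := by
  let f := (Fintype.equivFin α).symm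
  rcases Nat.eq_zero_or_pos (Fintype.card α) with h0 | h0
  -- A gate must act on a nonempty list. On no qupits a Clifford operator is a global phase, which
  -- conjugation cancels, so no gate is applied.
  · have := Fintype.card_eq_zero_iff.1 h0
    refine h.congr (fun _ => rfl) fun ρ _ v u => ?_
    have he : ∀ (a : α → ZMod p) (v : Reg → ZMod p), Function.extend x a v = v := fun a v =>
      funext fun _ => Function.extend_apply' _ _ _ fun ⟨i, _⟩ => isEmptyElim i
    have h2 := congrFun (congrFun hU.1 default) default
    rw [Matrix.mul_apply, Fintype.sum_unique, Matrix.conjTranspose_apply, Matrix.one_apply_eq]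
      at h2
    rw [Fintype.sum_unique, Fintype.sum_unique, he, he, Subsingleton.elim (v ∘ x) default,
      Subsingleton.elim (u ∘ x) default, mul_right_comm, h2, one_mul]
  · refine (h.gate h0 (x := x ∘ f) (hx.comp f.injective) (fun i => h1 _)
      ⟨_, reindex_mem_cliffordGroup f.symm hU⟩).congr (fun _ => rfl) fun ρ _ v u => ?_
    simp only [extend_comp_equiv x f hx]
    refine Fintype.sum_equiv (f.arrowCongr (Equiv.refl (ZMod p))) _ _ fun a => ?_
    refine Fintype.sum_equiv (f.arrowCongr (Equiv.refl (ZMod p))) _ _ fun b => ?_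
    have hv : ∀ v : Reg → ZMod p, (fun i => v ((x ∘ f) i)) ∘ f.symm = v ∘ x := fun v => by
      funext a; simp
    simp only [Matrix.of_apply, hv]
    rfl

end ReachFamilies

/-! ### Every channel between environments is realised by a term. -/

section Universality

set_option linter.unusedSectionVars false

variable {p : ℕ} [Fact p.Prime] [Fact (p ≠ 2)]

/-- Feeding half of an unnormalised Bell state into the environment input of `f` turns it into an
output, and the sum over Kraus operators becomes a partial trace. -/
theorem IsCPMStab.exists_stinespring {ι κ : Type u} [Fintype ι] [DecidableEq ι] [Fintype κ]
    [DecidableEq κ] {Φ : SuperOp p ι κ} (hΦ : IsCPMStab p Φ) :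
    ∃ (σ : Type u) (_ : Fintype σ) (_ : DecidableEq σ) (V : Op p (κ ⊕ σ) ι), IsStab p V ∧
      ∀ ρ v u, Φ ρ v u = ∑ s, (V * ρ * Vᴴ) (Sum.elim v s) (Sum.elim u s) := by
  obtain ⟨σ, _, _, f, hf, rfl⟩ := hΦ
  refine ⟨σ, inferInstance, inferInstance,
    Matrix.of fun w a => f (w ∘ Sum.inl) (Sum.elim a (w ∘ Sum.inr)), ?_, fun ρ v u => ?_⟩
  · have h1 := isStab_rel (p := p) (κ := (ι ⊕ σ) ⊕ σ) (ι := ι)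
      (fun w a => (w ∘ Sum.inl) ∘ Sum.inl = a ∧ (w ∘ Sum.inl) ∘ Sum.inr = w ∘ Sum.inr)
      ⟨rfl, rfl⟩
      (fun _ _ _ _ h h' => ⟨congrArg₂ (· + ·) h.1 h'.1, congrArg₂ (· + ·) h.2 h'.2⟩)
      (fun c _ _ h => ⟨congrArg (c • ·) h.1, congrArg (c • ·) h.2⟩)
    refine ((hf.tensor _ _ (isStab_one (p := p) (ι := σ))).comp _ _ h1).congr fun w a => ?_
    rw [Matrix.mul_apply,
      Finset.sum_eq_single (Sum.elim (Sum.elim a (w ∘ Sum.inr)) (w ∘ Sum.inr))]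
    · rw [Matrix.of_apply, if_pos ⟨rfl, rfl⟩, mul_one]
      change f (w ∘ Sum.inl) _ * (1 : Op p σ σ) (w ∘ Sum.inr) (w ∘ Sum.inr) = _
      rw [Matrix.one_apply_eq, mul_one]
      rfl
    · intro w' _ hw
      simp only [tensor, Matrix.of_apply, Matrix.one_apply]
      by_cases h2 : w ∘ Sum.inr = w' ∘ Sum.inr
      · rw [if_neg (c := _ ∧ _), mul_zero]
        rintro ⟨h3, h4⟩
        apply hw
        ext ((i | s) | s)
        · exact congrFun h3 i
        · exact congrFun (h4.trans h2.symm) s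
        · exact congrFun h2.symm s
      · rw [if_neg h2, mul_zero, zero_mul]
    · intro h; exact absurd (Finset.mem_univ _) h
  · rw [krausMap_apply, Matrix.sum_apply]
    rfl

/-- The trace of the partial trace is `Tr(Vᴴ V ρ)`, and the trace pairing is nondegenerate. -/
theorem conjTranspose_mul_self_of_trace {ι κ σ : Type*} [Fintype ι] [DecidableEq ι] [Fintype κ]
    [DecidableEq κ] [Fintype σ] [DecidableEq σ] {V : Op p (κ ⊕ σ) ι} {Φ : SuperOp p ι κ}
    (h : ∀ ρ v u, Φ ρ v u = ∑ s, (V * ρ * Vᴴ) (Sum.elim v s) (Sum.elim u s))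
    (ht : ∀ ρ, (Φ ρ).trace = ρ.trace) : Vᴴ * V = 1 := by
  rw [Matrix.ext_iff_trace_mul_right]
  intro ρ
  rw [Matrix.one_mul, ← ht ρ, Matrix.mul_assoc, Matrix.trace_mul_comm]
  simp only [Matrix.trace, Matrix.diag, h]
  rw [← (Equiv.sumArrowEquivProdArrow κ σ (ZMod p)).symm.sum_comp, Fintype.sum_prod_type]
  rfl

theorem exists_fresh {Reg : Type u} [Infinite Reg] (A : Finset Reg) (T : Type*) [Finite T] :
    ∃ w : T → Reg, Function.Injective w ∧ ∀ t, w t ∉ A := by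
  have : Infinite {r // r ∉ A} := A.finite_toSet.infinite_compl.to_subtype
  obtain ⟨n, ⟨e⟩⟩ := Finite.exists_equiv_fin T
  let g := Infinite.natEmbedding {r // r ∉ A}
  exact ⟨fun t => g (e t), fun s t h =>
    e.injective (Fin.val_injective (g.injective (Subtype.val_injective h))), fun t => (g (e t)).2⟩

variable {Reg : Type u} [DecidableEq Reg]

theorem Env.ext_ty {Γ Δ : Env Reg} (h : Γ.ty = Δ.ty) : Γ = Δ := by
  obtain ⟨t, d, hd⟩ := Γ
  obtain ⟨t', d', hd'⟩ := Δ
  obtain rfl : t = t' := h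
  have : d = d' := by ext r; rw [hd, hd']
  subst this
  rfl

theorem Reach.denotes {Γ Δ : Env Reg} {Φ : SuperOp p Γ.dom Δ.dom}
    (h : Reach Γ Δ.ty fun ρ => pull Δ (Φ ρ)) :
    ∃ (t : Term p Reg) (h : WF Γ t Δ), Denotes h Φ := by
  obtain ⟨Δ', t, Ψ, h1, h2, h3⟩ := h
  obtain rfl := Env.ext_ty h1
  refine ⟨t, h2.wf, (h2.denotes_iff _).2 fun ρ => pull_injective _ ?_⟩
  exact funext fun v => funext fun u => (h3 ρ.1 ρ.2.2.2 v u).symm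

theorem extend_comp_self {α : Type*} {e : α → Reg} (he : Function.Injective e) (j : α → ZMod p)
    (v : Reg → ZMod p) : Function.extend e j v ∘ e = j :=
  funext fun a => he.extend_apply j v a

/-- The Clifford dilation of a Stinespring isometry is run on fresh registers, disjoint from both
domains because `Γ` and `Δ` may share registers with different types. -/
theorem exists_denotes [Infinite Reg] {Γ Δ : Env Reg} {Φ : SuperOp p Γ.dom Δ.dom}
    (hΦ : IsStabChan p (Γ.interp p) (Δ.interp p) Φ) :
    ∃ (t : Term p Reg) (h : WF Γ t Δ), Denotes h Φ := by
  classical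
  obtain ⟨σ, _, _, V, hV, hVΦ⟩ := hΦ.cpm.exists_stinespring
  have hVV := conjTranspose_mul_self_of_trace hVΦ fun ρ =>
    (hΦ.causal ρ).trans (interp_trace Γ ρ)
  obtain ⟨U, hU, c, hc, hUV⟩ := exists_clifford_dilation hVV hV.coisotropic
  obtain ⟨w, hw, hwf⟩ := exists_fresh (Γ.dom ∪ Δ.dom) (Γ.dom ⊕ (Δ.dom ⊕ σ))
  have hwΓ : ∀ t, w t ∉ Γ.dom := fun t h => hwf t (Finset.mem_union_left _ h)
  have hwΔ : ∀ t, w t ∉ Δ.dom := fun t h => hwf t (Finset.mem_union_right _ h)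
  have hΓw : ∀ t, Γ.ty (w t) = none := fun t => by
    by_contra h; exact hwΓ t ((Γ.mem_dom _).2 h)
  -- All inputs, pits included, become qpits at fresh registers.
  let ty1 : Reg → Option Ty := fun r => if ∃ i, r = w (Sum.inl i) then some .qpit else none
  have h1 : Reach (p := p) Γ ty1 fun ρ v u => ρ (v ∘ w ∘ Sum.inl) (u ∘ w ∘ Sum.inl) := by
    refine ((Reach.refl Γ).move_family (e := (Subtype.val : Γ.dom → Reg))
      (w := w ∘ Sum.inl) Subtype.val_injective (hw.comp Sum.inl_injective)
      (fun a b h => hwΓ _ (h ▸ a.2)) (fun a => (Γ.mem_dom _).1 a.2) (fun a => hΓw _)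
      (fun _ => .qpit) (fun _ h => by cases h) (ty' := ty1) (fun a => if_neg ?_)
      (fun a => if_pos ⟨a, rfl⟩) (fun r hr hr' => ?_)).congr (fun _ => rfl) fun ρ _ v u => ?_
    · rintro ⟨i, hi⟩
      exact hwΓ _ (hi ▸ a.2)
    · rw [show ty1 r = none from if_neg fun ⟨i, hi⟩ => hr' i hi]
      by_contra h
      exact hr ⟨r, (Γ.mem_dom r).2 (Ne.symm h)⟩ rfl
    · simp only [pull]
      exact congrArg₂ (fun a b => ρ a b) (extend_comp_self Subtype.val_injective _ v)
        (extend_comp_self Subtype.val_injective _ u)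
  -- Ancillas in |0⟩ for the output and the environment, giving the input of the dilation.
  let ty2 : Reg → Option Ty := fun r => if ∃ i, r = w i then some .qpit else none
  have h2 : Reach (p := p) Γ ty2 fun ρ v u =>
      (inlOp p Γ.dom (Δ.dom ⊕ σ) * ρ * (inlOp p Γ.dom (Δ.dom ⊕ σ))ᴴ) (v ∘ w) (u ∘ w) := by
    refine (h1.qinit_family (w := w ∘ Sum.inr) (ty' := ty2) (hw.comp Sum.inr_injective)
      (fun a => if_neg ?_) (fun a => if_pos ⟨_, rfl⟩) fun r hr => ?_).congr (fun _ => rfl)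
      fun ρ _ v u => ?_
    · rintro ⟨i, hi⟩
      cases hw hi
    · simp only [ty1, ty2]
      congr 1
      rw [eq_iff_iff]
      constructor
      · rintro ⟨i | j, hi⟩
        · exact ⟨i, hi⟩
        · exact absurd hi (hr j)
      · rintro ⟨i, hi⟩
        exact ⟨_, hi⟩
    · have hin : ∀ (z : Γ.dom ⊕ (Δ.dom ⊕ σ) → ZMod p) (a : Γ.dom → ZMod p),
          inlOp p Γ.dom (Δ.dom ⊕ σ) z a = if z ∘ Sum.inr = 0 ∧ a = z ∘ Sum.inl then 1 else 0 := by
        intro z a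
        rw [inlOp, Matrix.of_apply]
        congr 1
        rw [eq_iff_iff]
        constructor
        · rintro rfl
          exact ⟨rfl, rfl⟩
        · rintro ⟨h, rfl⟩
          rw [← h, Sum.elim_comp_inl_inr]
      rw [Matrix.mul_apply, Finset.sum_eq_single (u ∘ w ∘ Sum.inl), Matrix.mul_apply,
        Finset.sum_eq_single (v ∘ w ∘ Sum.inl), Matrix.conjTranspose_apply, hin, hin]
      · change _ = (if v ∘ w ∘ Sum.inr = 0 ∧ v ∘ w ∘ Sum.inl = v ∘ w ∘ Sum.inl then (1 : ℂ) else 0) *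
          _ * star (if u ∘ w ∘ Sum.inr = 0 ∧ u ∘ w ∘ Sum.inl = u ∘ w ∘ Sum.inl then (1 : ℂ) else 0)
        simp only [and_true]
        by_cases h3 : v ∘ w ∘ Sum.inr = 0
        · by_cases h4 : u ∘ w ∘ Sum.inr = 0
          · rw [if_pos ⟨h3, h4⟩, if_pos h3, if_pos h4, one_mul, star_one, mul_one]
          · rw [if_neg fun h => h4 h.2, if_neg h4, star_zero, mul_zero]
        · rw [if_neg fun h => h3 h.1, if_neg h3, zero_mul, zero_mul]
      · intro a _ ha
        rw [hin, if_neg fun h => ha h.2, zero_mul]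
      · intro h; exact absurd (Finset.mem_univ _) h
      · intro a _ ha
        rw [Matrix.conjTranspose_apply, hin, if_neg fun h => ha h.2, star_zero, mul_zero]
      · intro h; exact absurd (Finset.mem_univ _) h
  have hcc : c * star c = 1 := by
    rw [← starRingEnd_apply, Complex.mul_conj, Complex.normSq_eq_norm_sq, hc]; simp
  -- Applying the gate; the global phase `c` of the dilation cancels on conjugation.
  have h3 : Reach (p := p) Γ ty2 fun ρ v u =>
      (zeroTensor V * ρ * (zeroTensor V)ᴴ) (v ∘ w) (u ∘ w) := by
    refine (h2.gate_family hw (fun i => if_pos ⟨i, rfl⟩) hU).congr (fun _ => rfl)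
      fun ρ _ v u => ?_
    simp only [extend_comp_self hw]
    have h4 : zeroTensor V * ρ * (zeroTensor V)ᴴ =
        U * (inlOp p Γ.dom (Δ.dom ⊕ σ) * ρ * (inlOp p Γ.dom (Δ.dom ⊕ σ))ᴴ) * Uᴴ := by
      have h5 : U * (inlOp p Γ.dom (Δ.dom ⊕ σ) * ρ * (inlOp p Γ.dom (Δ.dom ⊕ σ))ᴴ) * Uᴴ =
          (U * inlOp p Γ.dom (Δ.dom ⊕ σ)) * ρ * (U * inlOp p Γ.dom (Δ.dom ⊕ σ))ᴴ := by
        rw [Matrix.conjTranspose_mul]; simp only [Matrix.mul_assoc]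
      rw [h5, hUV, Matrix.conjTranspose_smul, Matrix.smul_mul, Matrix.smul_mul, Matrix.mul_smul,
        smul_smul, hcc, one_smul]
    rw [h4, Matrix.mul_apply, Finset.sum_comm]
    refine Finset.sum_congr rfl fun b _ => ?_
    rw [Matrix.mul_apply, Finset.sum_mul]
    rfl
  -- Tracing out the environment and the former input qupits, now in |0⟩, leaves `Φ ρ` on the output
  -- ancillas.
  let ty3 : Reg → Option Ty := fun r => if ∃ i, r = w (Sum.inr (Sum.inl i)) then some .qpit else none
  let e : Γ.dom ⊕ σ → Reg := w ∘ Sum.map id Sum.inr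
  have he : Function.Injective e :=
    hw.comp (Sum.map_injective.2 ⟨Function.injective_id, Sum.inr_injective⟩)
  have hee : ∀ a i, e a ≠ w (Sum.inr (Sum.inl i)) := by
    rintro (a | s) i h <;> cases hw h
  have h4 : Reach (p := p) Γ ty3 fun ρ v u =>
      Φ ρ (v ∘ w ∘ Sum.inr ∘ Sum.inl) (u ∘ w ∘ Sum.inr ∘ Sum.inl) := by
    refine (h3.trace_family (ty' := ty3) he (fun a => if_pos ⟨_, rfl⟩) (fun a => if_neg ?_)
      fun r hr => ?_).congr (fun _ => rfl) fun ρ _ v u => ?_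
    · rintro ⟨i, hi⟩
      exact hee a i hi
    · simp only [ty2, ty3]
      congr 1
      rw [eq_iff_iff]
      constructor
      · rintro ⟨i, hi⟩
        exact ⟨_, hi⟩
      · rintro ⟨i | i | i, hi⟩
        · exact absurd hi (hr (Sum.inl i))
        · exact ⟨i, hi⟩
        · exact absurd hi (hr (Sum.inr i))
    · have hz : ∀ z z' : Γ.dom ⊕ (Δ.dom ⊕ σ) → ZMod p, (zeroTensor V * ρ * (zeroTensor V)ᴴ) z z' =
          if z ∘ Sum.inl = 0 ∧ z' ∘ Sum.inl = 0 then
            (V * ρ * Vᴴ) (z ∘ Sum.inr) (z' ∘ Sum.inr) else 0 := by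
        intro z z'
        simp only [Matrix.mul_apply, Matrix.conjTranspose_apply, zeroTensor, Matrix.of_apply]
        by_cases h5 : z ∘ Sum.inl = 0
        · by_cases h6 : z' ∘ Sum.inl = 0
          · simp only [if_pos h5, if_pos h6, if_pos (And.intro h5 h6)]
          · rw [if_neg fun h => h6 h.2]
            simp only [if_neg h6, star_zero, mul_zero, Finset.sum_const_zero]
        · rw [if_neg fun h => h5 h.1]
          simp only [if_neg h5, zero_mul, Finset.sum_const_zero]
      have hx : ∀ (j : Γ.dom ⊕ σ → ZMod p) (v : Reg → ZMod p),
          Function.extend e j v ∘ w = Sum.elim (j ∘ Sum.inl)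
            (Sum.elim (v ∘ w ∘ Sum.inr ∘ Sum.inl) (j ∘ Sum.inr)) := by
        intro j v
        funext z
        rcases z with a | i | s
        · exact he.extend_apply j v (Sum.inl a)
        · exact Function.extend_apply' _ _ _ fun ⟨a, ha⟩ => hee a i ha
        · exact he.extend_apply j v (Sum.inr s)
      simp only [hx, hz, Sum.elim_comp_inl, Sum.elim_comp_inr, and_self]
      rw [← (Equiv.sumArrowEquivProdArrow Γ.dom σ (ZMod p)).symm.sum_comp, Fintype.sum_prod_type,
        Finset.sum_eq_single 0, hVΦ]
      · exact Finset.sum_congr rfl fun s _ => if_pos rfl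
      · intro j _ hj
        exact Finset.sum_eq_zero fun s _ => if_neg hj
      · intro h; exact absurd (Finset.mem_univ _) h
  choose τ hτ using fun r : Δ.dom => Option.ne_none_iff_exists'.1 ((Δ.mem_dom r).1 r.2)
  refine ((h4.move_family (e := w ∘ Sum.inr ∘ Sum.inl) (w := (Subtype.val : Δ.dom → Reg))
    (hw.comp (Sum.inr_injective.comp Sum.inl_injective)) Subtype.val_injective
    (fun a b h => hwΔ _ (h ▸ b.2)) (fun a h => ?_) (fun a => if_neg ?_) τ (fun a ha => ⟨?_, ?_⟩)
    (ty' := Δ.ty) (fun a => ?_) hτ fun r hr hr' => ?_).congr (fun _ => rfl)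
      fun ρ _ v u => ?_).denotes
  · have := (if_pos ⟨a, rfl⟩ : ty3 (w (Sum.inr (Sum.inl a))) = some .qpit).symm.trans h
    cases this
  · rintro ⟨i, hi⟩
    exact hwΔ _ (hi ▸ a.2)
  · exact if_pos ⟨a, rfl⟩
  -- A qpit may be moved to a pit only if the state is already diagonal there; this holds because
  -- the output of `Φ` is fixed by the idempotent of `Δ`.
  · intro ρ hρ v u hne
    have h5 : Δ.interp p (Φ ρ) = Φ ρ := by
      have := congrArg (fun Ψ => Ψ ρ) hΦ.split
      simp only [LinearMap.comp_apply, hρ] at this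
      exact this
    by_contra hva
    rw [← h5, interp_apply, if_neg] at hne
    · exact hne rfl
    · intro h
      exact hva (h a (by rw [hτ a, ha]))
  · by_contra h
    exact hwΔ _ ((Δ.mem_dom _).2 h)
  · rw [show ty3 r = none from if_neg fun ⟨i, hi⟩ => hr i hi]
    by_contra h
    exact hr' ⟨r, (Δ.mem_dom r).2 h⟩ rfl
  · have := hw.comp (Sum.inr_injective.comp Sum.inl_injective)
    exact congrArg₂ (fun a b => Φ ρ a b) (extend_comp_self this _ v) (extend_comp_self this _ u)

end Universality

/-! ### The structure of the objects of `StabChan_p` -/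

section Objects

set_option linter.unusedSectionVars false

variable {p : ℕ} [Fact p.Prime] [Fact (p ≠ 2)]
variable {ι : Type u} [Fintype ι] [DecidableEq ι]

/-- Pairs of labels such that `x (W(a) ρ)` and `W(b) x(ρ)` are proportional. -/
def leftRel (x : SuperOp p ι ι) : Submodule (ZMod p) (Label p ι × Label p ι) :=
  AddSubgroup.toZModSubmodule p
    { carrier := {y | ∃ c : ℂ, c ≠ 0 ∧ ∀ ρ, x (weyl y.2 * ρ) = c • (weyl y.1 * x ρ)}
      zero_mem' := ⟨1, one_ne_zero, by simp⟩
      add_mem' := by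
        rintro ⟨b, a⟩ ⟨b', a'⟩ ⟨c, hc, h⟩ ⟨c', hc', h'⟩
        dsimp only at h h'
        refine ⟨ZMod.stdAddChar (-(2⁻¹ * symp a a')) * (c * c') *
          ZMod.stdAddChar (2⁻¹ * symp b b'), by simp [hc, hc', char_ne_zero], fun ρ => ?_⟩
        rw [Prod.mk_add_mk]
        simp only
        rw [weyl_add, Matrix.smul_mul, map_smul, Matrix.mul_assoc, h, h', Matrix.mul_smul,
          ← Matrix.mul_assoc, weyl_mul, Matrix.smul_mul]
        simp only [smul_smul]
        congr 1; ring
      neg_mem' := by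
        rintro ⟨b, a⟩ ⟨c, hc, h⟩
        dsimp only at h
        refine ⟨c⁻¹, inv_ne_zero hc, fun ρ => ?_⟩
        have h1 := h (weyl (-a) * ρ)
        rw [← Matrix.mul_assoc, weyl_mul_weyl_neg, Matrix.one_mul] at h1
        change x (weyl (-a) * ρ) = c⁻¹ • (weyl (-b) * x ρ)
        rw [h1, Matrix.mul_smul, smul_smul, inv_mul_cancel₀ hc, one_smul, ← Matrix.mul_assoc,
          weyl_neg_mul_weyl, Matrix.one_mul] }

theorem mem_leftRel {x : SuperOp p ι ι} {b a : Label p ι} :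
    (b, a) ∈ leftRel x ↔ ∃ c : ℂ, c ≠ 0 ∧ ∀ ρ, x (weyl a * ρ) = c • (weyl b * x ρ) := Iff.rfl

theorem weyl_add_conj (a b : Label p ι) (ρ : Op p ι ι) :
    weyl (a + b) * ρ * weyl (-(a + b)) = weyl a * (weyl b * ρ * weyl (-b)) * weyl (-a) := by
  have h : weyl (-(a + b)) = (ZMod.stdAddChar (2⁻¹ * symp a b) : ℂ) • (weyl (-b) * weyl (-a)) := by
    rw [neg_add_rev, weyl_add, symp_swap]
    congr 2
    simp
  rw [h, weyl_add, Matrix.smul_mul, Matrix.smul_mul, Matrix.mul_smul, smul_smul, mul_comm,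
    char_mul_neg, one_smul]
  simp only [Matrix.mul_assoc]

/-- Pairs of labels such that `x (W(a) ρ W(a)†) = W(b) x(ρ) W(b)†`. -/
def conjRel (x : SuperOp p ι ι) : Submodule (ZMod p) (Label p ι × Label p ι) :=
  AddSubgroup.toZModSubmodule p
    { carrier := {y | ∀ ρ, x (weyl y.2 * ρ * weyl (-y.2)) = weyl y.1 * x ρ * weyl (-y.1)}
      zero_mem' := by simp
      add_mem' := by
        rintro ⟨b, a⟩ ⟨b', a'⟩ h h' ρ
        simp only [Set.mem_ofPred_eq, Prod.mk_add_mk] at h h' ⊢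
        rw [weyl_add_conj, h, h', weyl_add_conj]
      neg_mem' := by
        rintro ⟨b, a⟩ h ρ
        simp only [Set.mem_ofPred_eq, Prod.neg_mk, neg_neg] at h ⊢
        have hc : ∀ (a : Label p ι) (ρ : Op p ι ι),
            weyl a * (weyl (-a) * ρ * weyl a) * weyl (-a) = ρ := fun a ρ => by
          simp only [Matrix.mul_assoc]
          rw [weyl_mul_weyl_neg, Matrix.mul_one, ← Matrix.mul_assoc, weyl_mul_weyl_neg,
            Matrix.one_mul]
        have h1 := h (weyl (-a) * ρ * weyl a)
        rw [hc] at h1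
        have h2 := hc (-b) (x (weyl (-a) * ρ * weyl a))
        rw [neg_neg] at h2
        rw [h1, h2] }

theorem mem_conjRel {x : SuperOp p ι ι} {b a : Label p ι} :
    (b, a) ∈ conjRel x ↔ ∀ ρ, x (weyl a * ρ * weyl (-a)) = weyl b * x ρ * weyl (-b) := Iff.rfl

theorem krausMap_eq_tensor {κ σ : Type*} [Fintype κ] [DecidableEq κ] [Fintype σ] [DecidableEq σ]
    (f : Op p κ (ι ⊕ σ)) (ρ : Op p ι ι) :
    krausMap (fun s : σ → ZMod p =>
      (Matrix.of fun (v : κ → ZMod p) (u : ι → ZMod p) => f v (Sum.elim u s))) ρ =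
      f * tensor ρ (1 : Op p σ σ) * fᴴ := by
  ext v u
  rw [krausMap_apply, Matrix.sum_apply]
  simp only [Matrix.mul_apply, Matrix.conjTranspose_apply, Matrix.of_apply, tensor,
    Matrix.one_apply]
  rw [← (Equiv.sumArrowEquivProdArrow ι σ (ZMod p)).symm.sum_comp, Fintype.sum_prod_type,
    Finset.sum_comm]
  refine Finset.sum_congr rfl fun a _ => Finset.sum_congr rfl fun s _ => ?_
  rw [← (Equiv.sumArrowEquivProdArrow ι σ (ZMod p)).symm.sum_comp, Fintype.sum_prod_type]
  simp only [Equiv.sumArrowEquivProdArrow, Equiv.coe_fn_symm_mk, Sum.elim_comp_inl,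
    Sum.elim_comp_inr]
  congr 1
  refine Finset.sum_congr rfl fun b _ => ?_
  rw [Finset.sum_eq_single s]
  · simp
  · intro t _ ht; simp [ht]
  · intro h; exact absurd (Finset.mem_univ _) h

/-- The symplectic complement of `conjRel x` is contained in `leftRel x`. -/
theorem IsCPMStab.mem_leftRel {x : SuperOp p ι ι} (hx : IsCPMStab p x) {b a : Label p ι}
    (h : ∀ y ∈ conjRel x, symp b y.1 = symp a y.2) : (b, a) ∈ leftRel x := by
  obtain ⟨σ, _, _, f, hf, rfl⟩ := hx
  have hco := hf.coisotropic
  -- Any element of `stabRel f` restricts to one of `conjRel`, since conjugation on the environment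
  -- fixes the identity inserted there. So the hypothesis makes the label with zero environment part
  -- orthogonal to `stabRel f`, and coisotropy applies.
  have h1 : (b, a.sum 0) ∈ stabRel f := by
    refine hco _ _ ?_
    rintro ⟨b', y⟩ hy
    obtain ⟨c, hc, hy⟩ := mem_stabRel.1 hy
    have hcc : c * star c = 1 := by
      rw [← starRingEnd_apply, Complex.mul_conj, Complex.normSq_eq_norm_sq, hc]; simp
    have h2 := h (b', y.comap Sum.inl) (mem_conjRel.2 fun ρ => by
      rw [krausMap_eq_tensor, krausMap_eq_tensor]
      have h3 : weyl b' * (f * tensor ρ (1 : Op p σ σ) * fᴴ) * weyl (-b') =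
          (weyl b' * f) * tensor ρ (1 : Op p σ σ) * (weyl b' * f)ᴴ := by
        rw [Matrix.conjTranspose_mul, weyl_conjTranspose]
        simp only [Matrix.mul_assoc]
      rw [h3, hy, Matrix.conjTranspose_smul, Matrix.smul_mul, Matrix.smul_mul, Matrix.mul_smul,
        smul_smul, hcc, one_smul, Matrix.conjTranspose_mul, weyl_conjTranspose]
      have h4 : tensor (weyl (y.comap Sum.inl) * ρ * weyl (-(y.comap Sum.inl))) (1 : Op p σ σ) =
          weyl y * tensor ρ (1 : Op p σ σ) * weyl (-y) := by
        have h5 : -y = (-(y.comap Sum.inl)).sum (-(y.comap Sum.inr)) := by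
          conv_lhs => rw [← Label.sum_comap y]
          ext (i | i) <;> rfl
        have h6 : weyl y = tensor (weyl (y.comap Sum.inl)) (weyl (y.comap Sum.inr)) := by
          rw [← weyl_sum, Label.sum_comap]
        rw [h5, h6, weyl_sum, tensor_mul_tensor, tensor_mul_tensor, Matrix.mul_one,
          weyl_mul_weyl_neg]
      rw [h4]
      simp only [Matrix.mul_assoc])
    simp only at h2 ⊢
    rw [h2, symp_swap (a.sum 0) y, symp_sum, symp_swap _ a, map_zero]
    ring
  obtain ⟨c, hc, h1⟩ := mem_stabRel.1 h1
  have hc0 : c ≠ 0 := by rw [← norm_ne_zero_iff, hc]; exact one_ne_zero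
  refine SPL.mem_leftRel.2 ⟨c⁻¹, inv_ne_zero hc0, fun ρ => ?_⟩
  rw [krausMap_eq_tensor, krausMap_eq_tensor, ← Matrix.mul_assoc, ← Matrix.mul_assoc, h1,
    Matrix.smul_mul, Matrix.smul_mul, smul_smul, inv_mul_cancel₀ hc0, one_smul, weyl_sum,
    weyl_zero, Matrix.mul_assoc f (tensor _ _) (tensor _ _), tensor_mul_tensor, Matrix.one_mul]

theorem weyl_mul_ne_zero (a : Label p ι) {M : Op p ι ι} (h : M ≠ 0) : weyl a * M ≠ 0 := by
  intro h1
  apply h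
  rw [← Matrix.one_mul M, ← weyl_neg_mul_weyl a, Matrix.mul_assoc, h1, Matrix.mul_zero]

theorem eq_of_trace_conjTranspose_mul {ν : Type*} [Fintype ν] {A B : Matrix ν ν ℂ}
    (h : ∀ ρ : Matrix ν ν ℂ, (ρᴴ * A).trace = (ρᴴ * B).trace) : A = B := by
  classical
  rw [Matrix.ext_iff_trace_mul_left]
  intro ρ
  have := h ρᴴ
  rwa [Matrix.conjTranspose_conjTranspose] at this

namespace IsStabObj

variable {x : SuperOp p ι ι}

theorem apply_apply (hx : IsStabObj p x) (ρ : Op p ι ι) : x (x ρ) = x ρ :=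
  congrArg (fun Φ => Φ ρ) hx.idem

/-- Self-adjointness of `x` moves Weyl operators across the Hilbert–Schmidt pairing and thereby
exchanges the two labels. -/
theorem leftRel_symm (hx : IsStabObj p x) {b a : Label p ι} (h : (b, a) ∈ leftRel x) :
    (a, b) ∈ leftRel x := by
  obtain ⟨c, hc, h⟩ := mem_leftRel.1 (neg_mem h : -(b, a) ∈ leftRel x)
  refine mem_leftRel.2 ⟨star c⁻¹, star_ne_zero.2 (inv_ne_zero hc), fun σ => ?_⟩
  refine eq_of_trace_conjTranspose_mul fun ρ => ?_
  have h1 : weyl (-b) * x ρ = c⁻¹ • x (weyl (-a) * ρ) := by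
    rw [h, smul_smul, inv_mul_cancel₀ hc, one_smul]
  have h2 : (x ρ)ᴴ * (weyl b * σ) = (weyl (-b) * x ρ)ᴴ * σ := by
    rw [Matrix.conjTranspose_mul, weyl_conjTranspose, neg_neg, Matrix.mul_assoc]
  rw [← hx.selfAdjoint, h2, h1, Matrix.conjTranspose_smul, Matrix.smul_mul, Matrix.trace_smul,
    hx.selfAdjoint, Matrix.conjTranspose_mul, weyl_conjTranspose, neg_neg, Matrix.mul_smul,
    Matrix.trace_smul, Matrix.mul_assoc]

theorem conjRel_symm (hx : IsStabObj p x) {b a : Label p ι} (h : (b, a) ∈ conjRel x) :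
    (a, b) ∈ conjRel x := by
  have h := mem_conjRel.1 (neg_mem h : -(b, a) ∈ conjRel x)
  simp only [neg_neg] at h
  refine mem_conjRel.2 fun σ => eq_of_trace_conjTranspose_mul fun ρ => ?_
  have h2 : ((x ρ)ᴴ * (weyl b * σ * weyl (-b))).trace = ((weyl (-b) * x ρ * weyl b)ᴴ * σ).trace := by
    rw [Matrix.conjTranspose_mul, Matrix.conjTranspose_mul, weyl_conjTranspose,
      weyl_conjTranspose, neg_neg, ← Matrix.mul_assoc, Matrix.trace_mul_comm]
    simp only [Matrix.mul_assoc]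
  rw [← hx.selfAdjoint, h2, ← h, hx.selfAdjoint, Matrix.conjTranspose_mul,
    Matrix.conjTranspose_mul, weyl_conjTranspose, weyl_conjTranspose, neg_neg, Matrix.mul_assoc,
    Matrix.trace_mul_comm]
  simp only [Matrix.mul_assoc]

theorem leftRel_trans (hx : IsStabObj p x) {c b a : Label p ι} (h : (c, b) ∈ leftRel x)
    (h' : (b, a) ∈ leftRel x) : (c, a) ∈ leftRel x := by
  obtain ⟨r, hr, h⟩ := mem_leftRel.1 h
  obtain ⟨s, hs, h'⟩ := mem_leftRel.1 h'
  refine mem_leftRel.2 ⟨s * r, mul_ne_zero hs hr, fun ρ => ?_⟩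
  rw [← hx.apply_apply, h', map_smul, h, hx.apply_apply, smul_smul]

theorem conjRel_trans (hx : IsStabObj p x) {c b a : Label p ι} (h : (c, b) ∈ conjRel x)
    (h' : (b, a) ∈ conjRel x) : (c, a) ∈ conjRel x :=
  mem_conjRel.2 fun ρ => by
    rw [← hx.apply_apply, mem_conjRel.1 h', mem_conjRel.1 h, hx.apply_apply]

/-- Labels `a` such that `x (W(a) ρ) = W(a) x(ρ)`. -/
def fixLabels (x : SuperOp p ι ι) : Submodule (ZMod p) (Label p ι) :=
  (leftRel x).comap (LinearMap.prod LinearMap.id LinearMap.id)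

/-- Labels `d` such that `W(d) x(ρ)` is proportional to `x(ρ)`. -/
def nullLabels (x : SuperOp p ι ι) : Submodule (ZMod p) (Label p ι) :=
  (leftRel x).comap (LinearMap.inl _ _ _)

/-- Membership only gives proportionality by a nonzero constant; idempotence forces its square to
equal itself. -/
theorem apply_weyl_mul (hx : IsStabObj p x) (h0 : x ≠ 0) {a : Label p ι} (ha : a ∈ fixLabels x)
    (ρ : Op p ι ι) : x (weyl a * ρ) = weyl a * x ρ := by
  obtain ⟨c, hc, h⟩ := mem_leftRel.1 (show (a, a) ∈ leftRel x from ha)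
  have hne : ∃ σ, x σ ≠ 0 := by
    by_contra! h'
    exact h0 (LinearMap.ext h')
  obtain ⟨σ, hσ⟩ := hne
  have h1 := hx.apply_apply (weyl a * σ)
  rw [h, map_smul, h, hx.apply_apply] at h1
  have h2 : c • (weyl a * x σ) ≠ 0 := smul_ne_zero hc (weyl_mul_ne_zero a hσ)
  have h3 : c = 1 := by
    have h4 : (c - 1) • (c • (weyl a * x σ)) = 0 := by
      rw [sub_smul, one_smul, h1, sub_self]
    exact sub_eq_zero.1 ((smul_eq_zero.1 h4).resolve_right h2)
  rw [h, h3, one_smul]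

/-- Some input conjugation by `W(e)` is invisible to `x` and yet multiplies `W(a)` by a phase
different from 1, so the image of `W(a)` vanishes. -/
theorem apply_weyl_of_notMem (hx : IsStabObj p x) {a : Label p ι} (ha : a ∉ fixLabels x) :
    x (weyl a) = 0 := by
  have h1 : ∃ e, ((0 : Label p ι), e) ∈ conjRel x ∧ symp e a ≠ 0 := by
    by_contra! h
    refine ha (hx.cpm.mem_leftRel ?_)
    rintro ⟨b', a'⟩ h'
    -- Symmetry and transitivity put `(a', a')` into the relation; subtracting it leaves a pair with
    -- trivial input label, whose reverse is an invisible input conjugation.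
    have h2 : (b' - a', (0 : Label p ι)) ∈ conjRel x := by
      have := sub_mem h' (hx.conjRel_trans (hx.conjRel_symm h') h')
      rwa [Prod.mk_sub_mk, sub_self] at this
    have h3 := h _ (hx.conjRel_symm h2)
    rw [symp_swap, map_sub, neg_eq_zero, sub_eq_zero] at h3
    exact h3
  obtain ⟨e, he, hne⟩ := h1
  have h2 := mem_conjRel.1 he (weyl a)
  rw [weyl_conj_weyl, map_smul, neg_zero, weyl_zero, Matrix.one_mul, Matrix.mul_one] at h2
  have h3 : ((ZMod.stdAddChar (symp e a) : ℂ) - 1) • x (weyl a) = 0 := by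
    rw [sub_smul, h2, one_smul, sub_self]
  refine (smul_eq_zero.1 h3).resolve_left fun h4 => hne (char_eq_one_iff.1 (sub_eq_zero.1 h4))

theorem nullLabels_le (hx : IsStabObj p x) : nullLabels x ≤ fixLabels x := fun _ hd =>
  hx.leftRel_trans hd (hx.leftRel_symm hd)

theorem exists_of_notMem_nullLabels (hx : IsStabObj p x) {d : Label p ι} (hd : d ∉ nullLabels x) :
    ∃ a, (a, a) ∈ conjRel x ∧ symp a d ≠ 0 := by
  by_contra! h
  refine hd (hx.cpm.mem_leftRel ?_)
  rintro ⟨b', a'⟩ h'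
  change symp d b' = symp 0 a'
  rw [symp_swap, h b' (hx.conjRel_trans h' (hx.conjRel_symm h'))]
  simp

theorem apply_one_ne_zero (hx : IsStabObj p x) (h0 : x ≠ 0) : x 1 ≠ 0 := by
  intro h
  refine h0 (linearMap_ext_weyl fun a => ?_)
  rw [LinearMap.zero_apply]
  by_cases ha : a ∈ fixLabels x
  · rw [← Matrix.mul_one (weyl a), hx.apply_weyl_mul h0 ha, h, Matrix.mul_zero]
  · exact hx.apply_weyl_of_notMem ha

/-- The Weyl operators with null labels act by scalars on the nonzero operator `x 1`, so they
commute there. Their labels are thus mutually orthogonal, the scalars multiply, and a multiplicative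
function is a symplectic character. -/
theorem exists_phase (hx : IsStabObj p x) (h0 : x ≠ 0) :
    ∃ τ : Label p ι, ∀ d ∈ nullLabels x, ∀ ρ,
      weyl d * x ρ = (ZMod.stdAddChar (symp τ d) : ℂ) • x ρ := by
  have h1 : ∀ d : nullLabels x, ∃ c : ℂ, ∀ ρ, weyl d.1 * x ρ = c • x ρ := by
    intro d
    obtain ⟨c, hc, h⟩ := mem_leftRel.1 (show (d.1, 0) ∈ leftRel x from d.2)
    refine ⟨c⁻¹, fun ρ => ?_⟩
    have := h ρ
    rw [weyl_zero, Matrix.one_mul] at this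
    conv_rhs => rw [this]
    rw [smul_smul, inv_mul_cancel₀ hc, one_smul]
  choose c hc using h1
  have hne := hx.apply_one_ne_zero h0
  have hsymp : ∀ a b : nullLabels x, symp a.1 b.1 = 0 := by
    intro a b
    have h2 := weyl_comm a.1 b.1
    have h3 : (ZMod.stdAddChar (symp a.1 b.1) : ℂ) • (weyl b.1 * weyl a.1 * x 1) =
        (weyl b.1 * weyl a.1 * x 1) := by
      rw [← Matrix.smul_mul, ← h2, Matrix.mul_assoc, Matrix.mul_assoc, hc, hc, Matrix.mul_smul,
        Matrix.mul_smul, hc, hc, smul_smul, smul_smul, mul_comm]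
    have h4 : weyl b.1 * weyl a.1 * x 1 ≠ 0 := by
      rw [Matrix.mul_assoc]
      exact weyl_mul_ne_zero _ (weyl_mul_ne_zero _ hne)
    have h5 : ((ZMod.stdAddChar (symp a.1 b.1) : ℂ) - 1) • (weyl b.1 * weyl a.1 * x 1) = 0 := by
      rw [sub_smul, h3, one_smul, sub_self]
    exact char_eq_one_iff.1 (sub_eq_zero.1 ((smul_eq_zero.1 h5).resolve_right h4))
  obtain ⟨τ, hτ⟩ := exists_char_symp_eq (nullLabels x) c
    (smul_left_injective ℂ hne (by
      simp only
      rw [← hc, ZeroMemClass.coe_zero, weyl_zero, Matrix.one_mul, one_smul]))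
    (fun a b => smul_left_injective ℂ hne (by
      simp only
      rw [← hc, Submodule.coe_add, ← weyl_mul_of_symp_eq_zero (hsymp a b), Matrix.mul_assoc, hc,
        Matrix.mul_smul, hc, smul_smul, mul_comm]))
  exact ⟨τ, fun d hd ρ => by rw [hc ⟨d, hd⟩, hτ]⟩

end IsStabObj

end Objects

/-! ### The image of the identity is a stabiliser projection. -/

section Projection

set_option linter.unusedSectionVars false

variable {p : ℕ} [Fact p.Prime] [Fact (p ≠ 2)]
variable {ι : Type u} [Fintype ι] [DecidableEq ι]

theorem ext_trace_weyl {A B : Op p ι ι} (h : ∀ b, (weyl (-b) * A).trace = (weyl (-b) * B).trace) :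
    A = B := by
  rw [Matrix.ext_iff_trace_mul_left]
  intro M
  have h1 : (Matrix.traceLinearMap (ι → ZMod p) ℂ ℂ) ∘ₗ (LinearMap.mulRight ℂ A) =
      (Matrix.traceLinearMap (ι → ZMod p) ℂ ℂ) ∘ₗ (LinearMap.mulRight ℂ B) :=
    linearMap_ext_weyl fun a => by
      have := h (-a)
      rw [neg_neg] at this
      exact this
  exact LinearMap.congr_fun h1 M

open Classical in
/-- The joint eigenprojection of the operators `W(d)`, `d ∈ K`, with eigenvalues `ξ(symp τ d)`. -/
noncomputable def stabProj (K : Submodule (ZMod p) (Label p ι)) (τ : Label p ι) : Op p ι ι :=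
  (Fintype.card K : ℂ)⁻¹ • ∑ d : K, (ZMod.stdAddChar (-symp τ d.1) : ℂ) • weyl d.1

open Classical in
theorem trace_weyl_mul_stabProj (K : Submodule (ZMod p) (Label p ι)) (τ b : Label p ι) :
    (weyl (-b) * stabProj K τ).trace = if b ∈ K then
      (Fintype.card K : ℂ)⁻¹ * (ZMod.stdAddChar (-symp τ b) * (p : ℂ) ^ Fintype.card ι) else 0 := by
  have h : ∀ d : Label p ι, (weyl (-b) * weyl d).trace =
      if d = b then (p : ℂ) ^ Fintype.card ι else 0 := by
    intro d
    rw [weyl_mul, Matrix.trace_smul, trace_weyl]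
    by_cases hd : d = b
    · subst hd
      simp
    · rw [if_neg hd, if_neg, smul_zero]
      intro h; apply hd
      rw [neg_add_eq_zero] at h; exact h.symm
  rw [stabProj, Matrix.mul_smul, Matrix.trace_smul, Matrix.mul_sum, Matrix.trace_sum, smul_eq_mul]
  simp only [Matrix.mul_smul, Matrix.trace_smul, h, smul_eq_mul, mul_ite, mul_zero]
  split_ifs with hb
  · congr 1
    rw [Finset.sum_eq_single (⟨b, hb⟩ : K)]
    · rw [if_pos rfl]
    · intro d _ hd; rw [if_neg]; exact fun h => hd (Subtype.ext h)
    · intro h; exact absurd (Finset.mem_univ _) h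
  · rw [Finset.sum_eq_zero, mul_zero]
    intro d _
    rw [if_neg]; rintro rfl; exact hb d.2

namespace IsStabObj

variable {x : SuperOp p ι ι}

/-- Both `x 1` and `weyl a * x 1 = x (weyl a)` lie in the range of `x`, so `weyl d` has the same
eigenvalue on them; the commutator phase must be 1. -/
theorem symp_nullLabels_fixLabels (hx : IsStabObj p x) (h0 : x ≠ 0) {d a : Label p ι}
    (hd : d ∈ nullLabels x) (ha : a ∈ fixLabels x) : symp d a = 0 := by
  obtain ⟨τ, hτ⟩ := hx.exists_phase h0
  have hne := weyl_mul_ne_zero a (hx.apply_one_ne_zero h0)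
  have h1 : weyl d * (weyl a * x 1) = (ZMod.stdAddChar (symp τ d) : ℂ) • (weyl a * x 1) := by
    rw [← hx.apply_weyl_mul h0 ha, hτ d hd]
  have h2 : weyl d * (weyl a * x 1) =
      (ZMod.stdAddChar (symp d a + symp τ d) : ℂ) • (weyl a * x 1) := by
    rw [← Matrix.mul_assoc, weyl_comm, Matrix.smul_mul, Matrix.mul_assoc, hτ d hd, Matrix.mul_smul,
      smul_smul, AddChar.map_add_eq_mul]
  have h3 := smul_left_injective ℂ hne (h1.symm.trans h2)
  rw [char_inj] at h3
  simpa using h3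

theorem exists_apply_one (hx : IsStabObj p x) (h0 : x ≠ 0) :
    ∃ τ, x 1 = stabProj (nullLabels x) τ := by
  classical
  obtain ⟨τ, hτ⟩ := hx.exists_phase h0
  refine ⟨τ, ?_⟩
  have hp : ((p : ℂ) ^ Fintype.card ι) ≠ 0 :=
    pow_ne_zero _ (Nat.cast_ne_zero.2 (Fact.out : p.Prime).ne_zero)
  have hK : (Fintype.card (nullLabels x) : ℂ) ≠ 0 := Nat.cast_ne_zero.2 Fintype.card_ne_zero
  -- Comparison of Weyl coefficients: on null labels they are fixed by the eigenvalues, and on any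
  -- other label they vanish because `x 1` is invariant under conjugation by a Weyl operator not
  -- commuting with that label.
  obtain ⟨r, hr⟩ : ∃ r : ℂ, x 1 = r • stabProj (nullLabels x) τ := by
    refine ⟨Fintype.card (nullLabels x) * ((p : ℂ) ^ Fintype.card ι)⁻¹ * (x 1).trace,
      ext_trace_weyl fun b => ?_⟩
    rw [Matrix.mul_smul, Matrix.trace_smul, trace_weyl_mul_stabProj]
    split_ifs with hb
    · rw [hτ _ (neg_mem hb), Matrix.trace_smul, map_neg, smul_eq_mul, smul_eq_mul]
      field_simp
    · obtain ⟨a, ha, hab⟩ := hx.exists_of_notMem_nullLabels hb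
      have h1 := mem_conjRel.1 ha 1
      rw [Matrix.mul_one, weyl_mul_weyl_neg] at h1
      have h2 : (weyl (-b) * x 1).trace =
          (ZMod.stdAddChar (symp a b) : ℂ) * (weyl (-b) * x 1).trace := by
        conv_lhs => rw [h1]
        rw [← Matrix.mul_assoc, Matrix.trace_mul_comm, ← Matrix.mul_assoc, ← Matrix.mul_assoc]
        have h3 := weyl_conj_weyl (-a) (-b)
        rw [neg_neg, show symp (-a) (-b) = symp a b by simp] at h3
        rw [h3, Matrix.smul_mul, Matrix.trace_smul, smul_eq_mul]
      have h3 : (1 - (ZMod.stdAddChar (symp a b) : ℂ)) * (weyl (-b) * x 1).trace = 0 := by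
        rw [sub_mul, one_mul, ← h2, sub_self]
      rw [smul_zero]
      refine (mul_eq_zero.1 h3).resolve_left fun h => hab (char_eq_one_iff.1 (sub_eq_zero.1 h).symm)
  -- Each summand of the projection is sent to `x 1`, so idempotence pins the scale `r` to 1.
  have h1 : x (stabProj (nullLabels x) τ) = x 1 := by
    rw [stabProj, map_smul, map_sum]
    have h2 : ∀ d : nullLabels x,
        x ((ZMod.stdAddChar (-symp τ d.1) : ℂ) • weyl d.1) = x 1 := by
      intro d
      rw [map_smul, ← Matrix.mul_one (weyl d.1), hx.apply_weyl_mul h0 (hx.nullLabels_le d.2),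
        hτ _ d.2, smul_smul, mul_comm, char_mul_neg, one_smul]
    rw [Finset.sum_congr rfl fun d _ => h2 d, Finset.sum_const, Finset.card_univ,
      ← Nat.cast_smul_eq_nsmul ℂ, smul_smul, inv_mul_cancel₀ hK, one_smul]
  have h2 : r • x 1 = (1 : ℂ) • x 1 := by
    conv_lhs => rw [← h1, ← map_smul, ← hr, hx.apply_apply]
    rw [one_smul]
  rw [hr, smul_left_injective ℂ (hx.apply_one_ne_zero h0) h2, one_smul]

end IsStabObj

end Projection

/-! ### Adapted symplectic bases and the normal form of an object. -/

section NormalForm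

set_option linter.unusedSectionVars false

variable {p : ℕ} [Fact p.Prime] [Fact (p ≠ 2)]
variable {ι : Type u} [Fintype ι] [DecidableEq ι]

theorem symp_stdLabel_swap_eq_zero_iff (k : ι ⊕ ι) (a : Label p ι) :
    symp (stdLabel p k.swap) a = 0 ↔ Sum.elim a.1 a.2 k = 0 := by
  rcases k with i | i <;> simp [stdLabel, symp_apply]

theorem IsFrame.frameMap_mem_span {v : ι ⊕ ι → Label p ι} (hv : IsFrame Finset.univ v)
    {s : Finset (ι ⊕ ι)} {a : Label p ι} :
    frameMap v a ∈ Submodule.span (ZMod p) (v '' s) ↔ ∀ k ∉ s, Sum.elim a.1 a.2 k = 0 := by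
  constructor
  · intro h k hk
    rw [← symp_stdLabel_swap_eq_zero_iff, ← hv.symp_frameMap, frameMap_stdLabel]
    refine symp_eq_zero_of_mem_span ?_ h
    rintro _ ⟨l, hl, rfl⟩
    rw [hv.form _ (Finset.mem_univ _) _ (Finset.mem_univ _), stdForm_of_ne]
    rw [Sum.swap_swap]; rintro rfl; exact hk hl
  · intro h
    rw [frameMap_apply]
    refine Submodule.sum_mem _ fun k _ => ?_
    by_cases hk : k ∈ s
    · exact Submodule.smul_mem _ _ (Submodule.subset_span ⟨k, hk, rfl⟩)
    · rw [h k hk, zero_smul]; exact zero_mem _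

/-- A symplectic basis adapted to a subspace and to a part of its radical. -/
theorem exists_adapted_frame (N K : Submodule (ZMod p) (Label p ι)) (hKN : K ≤ N)
    (hK : ∀ d ∈ K, ∀ a ∈ N, symp d a = 0) :
    ∃ (v : ι ⊕ ι → Label p ι) (Q R D : Finset ι), IsFrame Finset.univ v ∧
      Disjoint Q R ∧ Disjoint Q D ∧ Disjoint R D ∧
      (∀ a, frameMap v a ∈ N ↔ (∀ i ∉ Q, a.1 i = 0) ∧ ∀ i ∈ D, a.2 i = 0) ∧
      (∀ a, frameMap v a ∈ K ↔ (∀ i, a.1 i = 0) ∧ ∀ i ∉ R, a.2 i = 0) := by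
  -- The frame is built in layers: the symplectic part of `N`, then `K` as Z labels, then the
  -- remaining radical of `N` as further Z labels.
  obtain ⟨s, v, hv, hs, hvN, hiso⟩ := exists_frame_subspace N
  obtain ⟨s', v', hss', hvv', hv', hinl', hK', hKs'⟩ := hv.exists_isotropic (fun i h => hs _ h) K
    (fun x hx y hy => hK x hx y (hKN hy)) (fun x hx k hk => by
      rw [symp_swap, hK x hx _ (hvN k hk), neg_zero])
  have hvN' : ∀ k ∈ s', v' k ∈ N := fun k hk => by
    by_cases hks : k ∈ s
    · rw [← hvv' hks]; exact hvN k hks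
    · exact hKN (hK' k hk hks)
  -- The part of `N` orthogonal to its symplectic part; it is isotropic by maximality of `s`.
  let M : Submodule (ZMod p) (Label p ι) := N ⊓ ⨅ k ∈ s, LinearMap.ker (symp (v k))
  have hM : ∀ {x}, x ∈ M ↔ x ∈ N ∧ ∀ k ∈ s, symp (v k) x = 0 := by
    intro x; simp [M]
  obtain ⟨s'', v'', hss'', hvv'', hv'', hinl'', hK'', hKs''⟩ :=
    hv'.exists_isotropic (fun i h => hss' (hs _ (hinl' i h))) M
    (fun x hx y hy => hiso x (hM.1 hx).1 y (hM.1 hy).1 (hM.1 hx).2 (hM.1 hy).2)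
    (fun x hx k hk => by
      by_cases hks : k ∈ s
      · rw [← hvv' hks]; exact (hM.1 hx).2 k hks
      · exact hK _ (hK' k hk hks) _ (hM.1 hx).1)
  obtain ⟨w, hvw, hw⟩ := hv''.complete
  have hwv' : ∀ k ∈ s', w k = v' k := fun k hk => by rw [← hvw (hss'' hk), hvv'' hk]
  have hwv : ∀ k ∈ s, w k = v k := fun k hk => by rw [hwv' k (hss' hk), hvv' hk]
  have hwN : ∀ k ∈ s'', w k ∈ N := fun k hk => by
    by_cases hks : k ∈ s'
    · rw [hwv' k hks]; exact hvN' k hks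
    · rw [← hvw hk]; exact (hM.1 (hK'' k hk hks)).1
  have hN : N = Submodule.span (ZMod p) (w '' s'') := by
    refine le_antisymm (fun x hx => ?_) (Submodule.span_le.2 ?_)
    · obtain ⟨y, hy, hxy⟩ := hv.exists_proj hs x
      have hyw : y ∈ Submodule.span (ZMod p) (w '' s'') := by
        refine Submodule.span_mono ?_ hy
        rintro _ ⟨k, hk, rfl⟩
        exact ⟨k, hss'' (hss' hk), hwv k hk⟩
      have hyN : y ∈ N := Submodule.span_le.2 (by rintro _ ⟨k, hk, rfl⟩; exact hvN k hk) hy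
      have h1 : x - y ∈ Submodule.span (ZMod p) (v'' '' s'') := hKs'' (hM.2 ⟨sub_mem hx hyN, hxy⟩)
      rw [hvw.image_eq] at h1
      simpa using add_mem h1 hyw
    · rintro _ ⟨k, hk, rfl⟩; exact hwN k hk
  have hKspan : K = Submodule.span (ZMod p) (w '' (s' \ s : Finset (ι ⊕ ι))) := by
    refine le_antisymm (fun x hx => ?_) (Submodule.span_le.2 ?_)
    · obtain ⟨a, rfl⟩ := hw.frameMap_surjective x
      rw [hw.frameMap_mem_span]
      intro k hk
      by_cases hks : k ∈ s
      · rw [← symp_stdLabel_swap_eq_zero_iff, ← hw.symp_frameMap, frameMap_stdLabel,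
          hwv _ (hs k hks), symp_swap, hK _ hx _ (hvN _ (hs k hks)), neg_zero]
      · have h1 : frameMap w a ∈ Submodule.span (ZMod p) (w '' s') := by
          have := hKs' hx
          rwa [Set.EqOn.image_eq fun k hk => (hwv' k hk).symm] at this
        exact hw.frameMap_mem_span.1 h1 k fun h => hk (Finset.mem_sdiff.2 ⟨h, hks⟩)
    · rintro _ ⟨k, hk, rfl⟩
      obtain ⟨hk, hks⟩ := Finset.mem_sdiff.1 hk
      rw [hwv' k hk]; exact hK' k hk hks
  -- `Q` collects the slots with both labels in `N`, `R` those whose Z label lies in `K`, and `D`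
  -- those with no label in `N`; in the remaining slots only the Z label is in `N`.
  refine ⟨w, Finset.univ.filter fun i => Sum.inl i ∈ s, Finset.univ.filter fun i =>
    Sum.inr i ∈ s' \ s, Finset.univ.filter fun i => Sum.inr i ∉ s'', hw, ?_, ?_, ?_, fun a => ?_,
    fun a => ?_⟩
  · refine Finset.disjoint_left.2 fun i h1 h2 => ?_
    simp only [Finset.mem_filter, Finset.mem_sdiff, Finset.mem_univ, true_and] at h1 h2
    exact h2.2 (hs _ h1)
  · refine Finset.disjoint_left.2 fun i h1 h2 => ?_
    simp only [Finset.mem_filter, Finset.mem_univ, true_and] at h1 h2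
    exact h2 (hss'' (hss' (hs _ h1)))
  · refine Finset.disjoint_left.2 fun i h1 h2 => ?_
    simp only [Finset.mem_filter, Finset.mem_sdiff, Finset.mem_univ, true_and] at h1 h2
    exact h2 (hss'' h1.1)
  · conv_lhs => rw [hN, hw.frameMap_mem_span]
    have hl : ∀ i, Sum.inl i ∈ s'' ↔ Sum.inl i ∈ s := fun i =>
      ⟨fun h => hinl' i (hinl'' i h), fun h => hss'' (hss' h)⟩
    simp [hl]
  · conv_lhs => rw [hKspan, hw.frameMap_mem_span]
    have hl : ∀ i, Sum.inl i ∈ s' → Sum.inl i ∈ s := hinl'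
    simp only [Sum.forall, Sum.elim_inl, Sum.elim_inr, Finset.mem_filter, Finset.mem_univ, true_and]
    refine and_congr_left' (forall_congr' fun i => ⟨fun h => h ?_, fun h _ => h⟩)
    rw [Finset.mem_sdiff]
    exact fun h => h.2 (hl i h.1)

open Classical in
/-- Up to a Clifford unitary, a nonzero object is the identity on the qupits in `Q`, the projection
to `|0⟩` on those in `R`, complete depolarisation on those in `D`, and dephasing elsewhere. -/
theorem IsStabObj.exists_normal_form {x : SuperOp p ι ι} (hx : IsStabObj p x) (h0 : x ≠ 0) :
    ∃ U ∈ cliffordGroup p ι, ∃ Q R D : Finset ι, Disjoint Q R ∧ Disjoint Q D ∧ Disjoint R D ∧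
      ∀ a : Label p ι, Uᴴ * x (U * weyl a * Uᴴ) * U =
        if (∀ i ∉ Q, a.1 i = 0) ∧ ∀ i ∈ D, a.2 i = 0 then
          weyl a * Matrix.diagonal fun u => if ∀ i ∈ R, u i = 0 then 1 else 0
        else 0 := by
  obtain ⟨v, Q, R, D, hv, hQR, hQD, hRD, hN, hK⟩ := exists_adapted_frame (IsStabObj.fixLabels x)
    (IsStabObj.nullLabels x) hx.nullLabels_le fun d hd a ha => hx.symp_nullLabels_fixLabels h0 hd ha
  obtain ⟨V, hV1, hV2, hV⟩ := exists_metaplectic (frameMap v) hv.symp_frameMap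
  obtain ⟨τ, hτ⟩ := hx.exists_apply_one h0
  have hVc : V ∈ cliffordGroup p ι := mem_cliffordGroup_of hV1 hV2 fun a =>
    ⟨0, frameMap v a, by rw [hV, AddChar.map_zero_eq_one, one_smul]⟩
  have hU := mul_mem_cliffordGroup (weyl_mem_cliffordGroup (-τ)) hVc
  -- The translation by `-τ` removes the eigenvalue phases, so that the projection becomes the one
  -- onto |0⟩ rather than onto another basis state.
  set U := weyl (-τ) * V with hUdef
  have hUW : ∀ a, U * weyl a * Uᴴ =
      (ZMod.stdAddChar (-symp τ (frameMap v a)) : ℂ) • weyl (frameMap v a) := by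
    intro a
    rw [hUdef, Matrix.conjTranspose_mul, Matrix.mul_assoc (weyl (-τ)), hV, weyl_conjTranspose,
      neg_neg]
    have h := weyl_conj_weyl (-τ) (frameMap v a)
    rw [neg_neg] at h
    have h2 : weyl (-τ) * (weyl (frameMap v a) * V) * (Vᴴ * weyl τ) =
      weyl (-τ) * weyl (frameMap v a) * (V * Vᴴ) * weyl τ := by simp only [Matrix.mul_assoc]
    rw [h2, hV1, Matrix.mul_one, h, map_neg, LinearMap.neg_apply]
  refine ⟨U, hU, Q, R, D, hQR, hQD, hRD, fun a => ?_⟩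
  have hproj : Uᴴ * x 1 * U = Matrix.diagonal fun u => if ∀ i ∈ R, u i = 0 then 1 else 0 := by
    let K' := (IsStabObj.nullLabels x).comap (frameMap v)
    have hbij : Function.Bijective
        (fun d : K' => (⟨frameMap v d.1, d.2⟩ : IsStabObj.nullLabels x)) :=
      ⟨fun d e h => Subtype.ext (hv.frameMap_injective (congrArg Subtype.val h)), fun d => by
        obtain ⟨a, ha⟩ := hv.frameMap_surjective d.1
        exact ⟨⟨a, show frameMap v a ∈ _ from ha ▸ d.2⟩, Subtype.ext ha⟩⟩
    have hW : ∀ d : K', Uᴴ * ((ZMod.stdAddChar (-symp τ (frameMap v d.1)) : ℂ) •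
        weyl (frameMap v d.1)) * U = weyl d.1 := by
      intro d
      have h1 : Uᴴ * (U * weyl d.1 * Uᴴ) * U = (Uᴴ * U) * weyl d.1 * (Uᴴ * U) := by
        simp only [Matrix.mul_assoc]
      rw [← hUW, h1, hU.2.1, Matrix.one_mul, Matrix.mul_one]
    rw [hτ, stabProj, Matrix.mul_smul, Matrix.smul_mul, Matrix.mul_sum, Matrix.sum_mul,
      ← hbij.sum_comp, Finset.sum_congr rfl fun d _ => hW d, ← Fintype.card_of_bijective hbij]
    have hK' : ∀ d : Label p ι, d ∈ K' ↔ (∀ i, d.1 i = 0) ∧ ∀ i ∉ R, d.2 i = 0 := hK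
    ext w u
    rw [Matrix.smul_apply, Matrix.sum_apply, Matrix.diagonal_apply]
    have h1 : ∀ d : K', weyl d.1 w u =
        if w = u then (ZMod.stdAddChar (d.1.2 ⬝ᵥ u) : ℂ) else 0 := by
      intro d
      have h2 : d.1.1 = 0 := funext ((hK' _).1 d.2).1
      rw [weyl_apply, h2]
      simp
    rw [Finset.sum_congr rfl fun d _ => h1 d]
    by_cases hwu : w = u
    · simp only [if_pos hwu]
      subst hwu
      -- The diagonal entry at `w` is the average of a character over `K'`; the character is trivial
      -- exactly when `w` vanishes on `R`.
      let φ : K' →ₗ[ZMod p] ZMod p := ((dotProductBilin (ZMod p) (ZMod p) (A := ZMod p)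
        (m := ι)).flip w) ∘ₗ LinearMap.snd _ _ _ ∘ₗ K'.subtype
      have h2 : φ = 0 ↔ ∀ i ∈ R, w i = 0 := by
        constructor
        · intro h i hi
          have hmem : ((0, Pi.single i 1) : Label p ι) ∈ K' := (hK' _).2
            ⟨fun _ => rfl, fun j hj => Pi.single_eq_of_ne (by rintro rfl; exact hj hi) _⟩
          have := LinearMap.congr_fun h ⟨_, hmem⟩
          simpa [φ] using this
        · intro h
          ext d
          refine Finset.sum_eq_zero fun i _ => ?_
          by_cases hi : i ∈ R
          · change d.1.2 i * w i = 0; rw [h i hi, mul_zero]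
          · change d.1.2 i * w i = 0; rw [((hK' _).1 d.2).2 i hi, zero_mul]
      rw [show ∑ d : K', (ZMod.stdAddChar (d.1.2 ⬝ᵥ w) : ℂ) = _ from char_sum_linear φ]
      simp only [h2]
      split_ifs
      · rw [smul_eq_mul, inv_mul_cancel₀ (Nat.cast_ne_zero.2 Fintype.card_ne_zero)]
      · rw [smul_zero]
    · simp only [if_neg hwu, Finset.sum_const_zero, smul_zero]
  split_ifs with ha
  · rw [← hproj]
    have h1 : x (U * weyl a * Uᴴ) = U * weyl a * Uᴴ * x 1 := by
      rw [hUW, map_smul, ← Matrix.mul_one (weyl (frameMap v a)),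
        hx.apply_weyl_mul h0 ((hN a).2 ha), Matrix.mul_one, Matrix.smul_mul]
    have h2 : Uᴴ * (U * weyl a * Uᴴ * x 1) * U = (Uᴴ * U) * weyl a * (Uᴴ * x 1 * U) := by
      simp only [Matrix.mul_assoc]
    rw [h1, h2, hU.2.1, Matrix.one_mul]
  · rw [hUW, map_smul, hx.apply_weyl_of_notMem fun h => ha ((hN a).1 h), smul_zero, Matrix.mul_zero,
      Matrix.zero_mul]

end NormalForm

/-! ### Discarding and preparing qupits: the standard retract. -/

section Standard

set_option linter.unusedSectionVars false

variable {p : ℕ} [Fact p.Prime] [Fact (p ≠ 2)]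
variable {ι κ δ : Type u} [Fintype ι] [DecidableEq ι] [Fintype κ] [DecidableEq κ] [Fintype δ]
  [DecidableEq δ]

/-- Extension by zero of a basis vector along `e`. -/
noncomputable def emb (e : κ ⊕ δ → ι) (v : κ → ZMod p) (t : δ → ZMod p) : ι → ZMod p :=
  Function.extend e (Sum.elim v t) 0

/-- Basis vectors supported in the range of `e`. -/
def Supp (e : κ ⊕ δ → ι) (u : ι → ZMod p) : Prop := ∀ i ∉ Set.range e, u i = 0

section

variable {e : κ ⊕ δ → ι}

theorem emb_inl (he : Function.Injective e) (v : κ → ZMod p) (t : δ → ZMod p) (k : κ) :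
    emb e v t (e (Sum.inl k)) = v k := he.extend_apply _ _ _

theorem emb_inr (he : Function.Injective e) (v : κ → ZMod p) (t : δ → ZMod p) (d : δ) :
    emb e v t (e (Sum.inr d)) = t d := he.extend_apply _ _ _

theorem supp_emb (v : κ → ZMod p) (t : δ → ZMod p) : Supp e (emb e v t) :=
  fun _ hi => Function.extend_apply' _ _ _ hi

theorem eq_emb_iff (he : Function.Injective e) {u : ι → ZMod p} {v : κ → ZMod p}
    {t : δ → ZMod p} : u = emb e v t ↔
      (∀ k, u (e (Sum.inl k)) = v k) ∧ (∀ d, u (e (Sum.inr d)) = t d) ∧ Supp e u := by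
  constructor
  · rintro rfl
    exact ⟨emb_inl he v t, emb_inr he v t, supp_emb v t⟩
  · rintro ⟨h1, h2, h3⟩
    ext i
    by_cases hi : i ∈ Set.range e
    · obtain ⟨k | d, rfl⟩ := hi
      · rw [h1, emb_inl he]
      · rw [h2, emb_inr he]
    · rw [h3 i hi, supp_emb v t i hi]

open Classical in
theorem sum_emb {M : Type*} [AddCommMonoid M] (he : Function.Injective e)
    (F : (ι → ZMod p) → M) :
    ∑ u, (if Supp e u then F u else 0) = ∑ v : κ → ZMod p, ∑ t : δ → ZMod p, F (emb e v t) := by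
  rw [← Fintype.sum_prod_type']
  symm
  refine Fintype.sum_of_injective (fun w : (κ → ZMod p) × (δ → ZMod p) => emb e w.1 w.2) ?_ _ _
    (fun u hu => ?_) (fun w => ?_)
  · rintro ⟨v, t⟩ ⟨v', t'⟩ h
    obtain ⟨h1, h2, -⟩ := (eq_emb_iff he).1 h
    refine Prod.ext (funext fun k => ?_) (funext fun d => ?_)
    · exact (emb_inl he v t k).symm.trans (h1 k)
    · exact (emb_inr he v t d).symm.trans (h2 d)
  · rw [if_neg]
    intro h
    exact hu ⟨⟨fun k => u (e (Sum.inl k)), fun d => u (e (Sum.inr d))⟩,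
      ((eq_emb_iff he).2 ⟨fun _ => rfl, fun _ => rfl, h⟩).symm⟩
  · rw [if_pos (supp_emb _ _)]

end

/-- The graph of the Kraus operators of `stdDown`. -/
def StdRel (e : κ ⊕ δ → ι) (ct : κ → Prop) (v : κ → ZMod p) (s : δ ⊕ {k // ct k} → ZMod p)
    (u : ι → ZMod p) : Prop :=
  (∀ k, v k.1 = s (Sum.inr k)) ∧
    (∀ k, u (e (Sum.inl k)) = v k) ∧ (∀ d, u (e (Sum.inr d)) = s (Sum.inl d)) ∧ Supp e u

theorem StdRel.add {e : κ ⊕ δ → ι} {ct : κ → Prop} {v v' : κ → ZMod p}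
    {s s' : δ ⊕ {k // ct k} → ZMod p} {u u' : ι → ZMod p} (h : StdRel e ct v s u)
    (h' : StdRel e ct v' s' u') : StdRel e ct (v + v') (s + s') (u + u') :=
  ⟨fun k => congrArg₂ (· + ·) (h.1 k) (h'.1 k), fun k => congrArg₂ (· + ·) (h.2.1 k) (h'.2.1 k),
    fun d => congrArg₂ (· + ·) (h.2.2.1 d) (h'.2.2.1 d),
    fun i hi => by rw [Pi.add_apply, h.2.2.2 i hi, h'.2.2.2 i hi, add_zero]⟩

theorem StdRel.smul {e : κ ⊕ δ → ι} {ct : κ → Prop} {v : κ → ZMod p}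
    {s : δ ⊕ {k // ct k} → ZMod p} {u : ι → ZMod p} (c : ZMod p) (h : StdRel e ct v s u) :
    StdRel e ct (c • v) (c • s) (c • u) :=
  ⟨fun k => congrArg (c • ·) (h.1 k), fun k => congrArg (c • ·) (h.2.1 k),
    fun d => congrArg (c • ·) (h.2.2.1 d),
    fun i hi => by rw [Pi.smul_apply, h.2.2.2 i hi, smul_zero]⟩

theorem StdRel.zero {e : κ ⊕ δ → ι} {ct : κ → Prop} :
    StdRel e ct (0 : κ → ZMod p) 0 0 :=
  ⟨fun _ => rfl, fun _ => rfl, fun _ => rfl, fun _ _ => rfl⟩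

open Classical in
/-- Discard the qupits in `δ` and those outside the range of `e`, and dephase those satisfying
`ct`. -/
noncomputable def stdDown (p : ℕ) [Fact p.Prime] (e : κ ⊕ δ → ι) (ct : κ → Prop) :
    SuperOp p ι κ :=
  krausMap fun s : δ ⊕ {k // ct k} → ZMod p =>
    Matrix.of fun v u => if StdRel e ct v s u then 1 else 0

open Classical in
/-- Prepare the maximally mixed state on `δ` and `|0⟩` outside the range of `e`, and dephase the
qupits satisfying `ct`. -/
noncomputable def stdUp (p : ℕ) [Fact p.Prime] (e : κ ⊕ δ → ι) (ct : κ → Prop) :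
    SuperOp p κ ι :=
  krausMap fun s : δ ⊕ {k // ct k} → ZMod p =>
    -- The factor enters together with its conjugate, giving the weight `p ^ (-|δ|)` of the
    -- maximally mixed state.
    (((Real.sqrt p)⁻¹ : ℝ) : ℂ) ^ Fintype.card δ •
      Matrix.of fun u v => if StdRel e ct v s u then 1 else 0

theorem isCPMStab_stdDown (e : κ ⊕ δ → ι) (ct : κ → Prop) : IsCPMStab p (stdDown p e ct) := by
  classical
  exact isCPMStab_of_kraus (δ ⊕ {k // ct k}) (Equiv.refl _) _
    (isStab_rel (fun v w => StdRel e ct v (w ∘ Sum.inr) (w ∘ Sum.inl)) StdRel.zero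
      (fun _ _ _ _ h h' => h.add h') (fun c _ _ h => h.smul c))

theorem isCPMStab_stdUp (e : κ ⊕ δ → ι) (ct : κ → Prop) : IsCPMStab p (stdUp p e ct) := by
  classical
  refine isCPMStab_of_kraus (δ ⊕ {k // ct k}) (Equiv.refl _) _
    (((isStab_rel (fun u w => StdRel e ct (w ∘ Sum.inl) (w ∘ Sum.inr) u) StdRel.zero
      (fun _ _ _ _ h h' => h.add h') (fun c _ _ h => h.smul c)).invSqrt_pow_smul
      (Fintype.card δ)).congr fun u w => ?_)
  rw [Complex.ofReal_pow]
  rfl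

variable {e : κ ⊕ δ → ι} {ct : κ → Prop}

open Classical in
theorem stdDown_apply (he : Function.Injective e) (ρ : Op p ι ι) (v v' : κ → ZMod p) :
    stdDown p e ct ρ v v' =
      if ∀ k, ct k → v k = v' k then ∑ t, ρ (emb e v t) (emb e v' t) else 0 := by
  have h1 : ∀ (s : δ ⊕ {k // ct k} → ZMod p) v u, StdRel e ct v s u ↔
      u = emb e v (s ∘ Sum.inl) ∧ (fun k : {k // ct k} => v k) = s ∘ Sum.inr := by
    intro s v u
    rw [eq_emb_iff he, StdRel, funext_iff, and_comm]
    rfl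
  rw [stdDown, krausMap_apply, Matrix.sum_apply]
  simp only [Matrix.mul_apply, Matrix.conjTranspose_apply, Matrix.of_apply, h1, ite_and, ite_mul,
    one_mul, zero_mul, Finset.sum_ite_eq', Finset.mem_univ, if_true, apply_ite star, star_one,
    star_zero, mul_ite, mul_one, mul_zero]
  rw [← (Equiv.sumArrowEquivProdArrow δ {k // ct k} (ZMod p)).symm.sum_comp, Fintype.sum_prod_type]
  simp only [Equiv.sumArrowEquivProdArrow, Equiv.coe_fn_symm_mk, Sum.elim_comp_inl,
    Sum.elim_comp_inr]
  by_cases h : ∀ k, ct k → v k = v' k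
  · rw [if_pos h]
    have h2 : (fun k : {k // ct k} => v k.1) = fun k => v' k.1 := funext fun k => h k.1 k.2
    refine Finset.sum_congr rfl fun t _ => ?_
    rw [h2, Finset.sum_eq_single fun k => v' k.1]
    · simp
    · intro s _ hs
      exact if_neg hs.symm
    · intro h; exact absurd (Finset.mem_univ _) h
  · rw [if_neg h]
    refine Finset.sum_eq_zero fun t _ => Finset.sum_eq_zero fun s _ => ?_
    by_cases h2 : (fun k : {k // ct k} => v' k.1) = s
    · exact (if_pos h2).trans (if_neg fun h3 =>
        h fun k hk => congrFun (h3.trans h2.symm) ⟨k, hk⟩)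
    · exact if_neg h2

open Classical in
theorem stdUp_apply (ρ : Op p κ κ) (u u' : ι → ZMod p) :
    stdUp p e ct ρ u u' =
      if (Supp e u ∧ Supp e u') ∧ (∀ k, ct k → u (e (Sum.inl k)) = u' (e (Sum.inl k))) ∧
          ∀ d, u (e (Sum.inr d)) = u' (e (Sum.inr d)) then
        ((p : ℂ) ^ Fintype.card δ)⁻¹ *
          ρ (fun k => u (e (Sum.inl k))) (fun k => u' (e (Sum.inl k))) else 0 := by
  have h1 : ∀ (s : δ ⊕ {k // ct k} → ZMod p) v (u : ι → ZMod p), StdRel e ct v s u ↔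
      v = (fun k => u (e (Sum.inl k))) ∧ Supp e u ∧
        s = Sum.elim (fun d => u (e (Sum.inr d))) (fun k => u (e (Sum.inl k.1))) := by
    intro s v u
    constructor
    · rintro ⟨h1, h2, h3, h4⟩
      refine ⟨funext fun k => (h2 k).symm, h4, ?_⟩
      ext (d | k)
      · exact (h3 d).symm
      · exact ((h2 _).trans (h1 k)).symm
    · rintro ⟨rfl, h, rfl⟩
      exact ⟨fun _ => rfl, fun _ => rfl, fun _ => rfl, h⟩
  rw [stdUp, krausMap_apply, Matrix.sum_apply]
  simp only [Matrix.conjTranspose_smul, Matrix.smul_mul, Matrix.mul_smul, Matrix.smul_apply]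
  simp only [Matrix.mul_apply, Matrix.conjTranspose_apply, Matrix.of_apply, h1, ite_and, ite_mul,
    one_mul, zero_mul, Finset.sum_ite_eq', Finset.mem_univ, if_true, apply_ite star, star_one,
    star_zero, mul_ite, mul_one, mul_zero]
  by_cases hu : Supp e u
  · by_cases hu' : Supp e u'
    · simp only [if_pos hu, if_pos hu', smul_ite, smul_zero, Finset.sum_ite_eq', Finset.mem_univ,
        if_true]
      have h2 : (Sum.elim (fun d => u' (e (Sum.inr d))) (fun k : {k // ct k} =>
          u' (e (Sum.inl k.1))) = Sum.elim (fun d => u (e (Sum.inr d)))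
          (fun k : {k // ct k} => u (e (Sum.inl k.1)))) ↔
          (∀ k, ct k → u (e (Sum.inl k)) = u' (e (Sum.inl k))) ∧
          ∀ d, u (e (Sum.inr d)) = u' (e (Sum.inr d)) := by
        rw [funext_iff, Sum.forall, and_comm]
        simp only [Sum.elim_inl, Sum.elim_inr, Subtype.forall]
        exact and_congr (forall₂_congr fun _ _ => eq_comm) (forall_congr' fun _ => eq_comm)
      simp only [h2, ite_and, smul_eq_mul]
      have h3 : star ((((Real.sqrt p)⁻¹ : ℝ) : ℂ) ^ Fintype.card δ) *
          (((Real.sqrt p)⁻¹ : ℝ) : ℂ) ^ Fintype.card δ = ((p : ℂ) ^ Fintype.card δ)⁻¹ := by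
        rw [star_pow, ← mul_pow, ← inv_pow]
        congr 1
        rw [← starRingEnd_apply, Complex.conj_ofReal, ← Complex.ofReal_mul, ← mul_inv,
          Real.mul_self_sqrt (Nat.cast_nonneg p)]
        simp
      simp only [← mul_assoc, h3]
    · simp [hu']
  · simp [hu]

theorem stdUp_trace (he : Function.Injective e) (σ : Op p κ κ) :
    (stdUp p e ct σ).trace = σ.trace := by
  classical
  have hp : ((p : ℂ) ^ Fintype.card δ) ≠ 0 :=
    pow_ne_zero _ (Nat.cast_ne_zero.2 (Fact.out : p.Prime).ne_zero)
  simp only [Matrix.trace, Matrix.diag, stdUp_apply, and_self, implies_true, and_true]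
  rw [sum_emb he fun u => ((p : ℂ) ^ Fintype.card δ)⁻¹ *
    σ (fun k => u (e (Sum.inl k))) (fun k => u (e (Sum.inl k)))]
  refine Finset.sum_congr rfl fun v _ => ?_
  simp only [emb_inl he, Finset.sum_const, Finset.card_univ, Fintype.card_fun, ZMod.card,
    nsmul_eq_mul, Nat.cast_pow]
  rw [← mul_assoc, mul_inv_cancel₀ hp, one_mul]

open Classical in
theorem stdDown_stdUp (he : Function.Injective e) (σ : Op p κ κ) (v v' : κ → ZMod p) :
    stdDown p e ct (stdUp p e ct σ) v v' = if ∀ k, ct k → v k = v' k then σ v v' else 0 := by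
  have hp : ((p : ℂ) ^ Fintype.card δ) ≠ 0 :=
    pow_ne_zero _ (Nat.cast_ne_zero.2 (Fact.out : p.Prime).ne_zero)
  rw [stdDown_apply he]
  split_ifs with h
  · simp only [stdUp_apply, supp_emb, emb_inl he, emb_inr he, and_self, implies_true, and_true,
      true_and]
    rw [if_pos h, Finset.sum_const, Finset.card_univ, Fintype.card_fun, ZMod.card, nsmul_eq_mul,
      Nat.cast_pow, ← mul_assoc, mul_inv_cancel₀ hp, one_mul]
  · rfl

-- The sum over `t` is a full character sum in the Z component on `δ`, so only labels without that
-- component survive; the nonzero entries themselves exclude shifts on `δ` and outside the range of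
-- `e`.
open Classical in
theorem sum_weyl_emb (he : Function.Injective e) (a : Label p ι) (v v' : κ → ZMod p) :
    ∑ t, weyl a (emb e v t) (emb e v' t) =
      if (∀ d, a.2 (e (Sum.inr d)) = 0) ∧ (∀ d, a.1 (e (Sum.inr d)) = 0) ∧ Supp e a.1 ∧
          ∀ k, v k = v' k + a.1 (e (Sum.inl k)) then
        (p : ℂ) ^ Fintype.card δ * weyl a (emb e v 0) (emb e v' 0) else 0 := by
  have h1 : ∀ t : δ → ZMod p, emb e v t = emb e v' t + a.1 ↔ 
      (∀ d, a.1 (e (Sum.inr d)) = 0) ∧ Supp e a.1 ∧ ∀ k, v k = v' k + a.1 (e (Sum.inl k)) := by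
    intro t
    rw [eq_comm, eq_emb_iff he]
    constructor
    · rintro ⟨h1, h2, h3⟩
      refine ⟨fun d => ?_, fun i hi => ?_, fun k => ?_⟩
      · have := h2 d
        rw [Pi.add_apply, emb_inr he] at this
        simpa using this
      · have := h3 i hi
        rwa [Pi.add_apply, supp_emb _ _ i hi, zero_add] at this
      · rw [← h1, Pi.add_apply, emb_inl he]
    · rintro ⟨h1, h2, h3⟩
      refine ⟨fun k => ?_, fun d => ?_, fun i hi => ?_⟩
      · rw [h3, Pi.add_apply, emb_inl he]
      · rw [Pi.add_apply, emb_inr he, h1, add_zero]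
      · rw [Pi.add_apply, supp_emb _ _ i hi, h2 i hi, add_zero]
  have h2 : ∀ t : δ → ZMod p, emb e v' t = emb e v' 0 + emb e 0 t := by
    intro t
    symm
    rw [eq_emb_iff he]
    exact ⟨fun k => by rw [Pi.add_apply, emb_inl he, emb_inl he, Pi.zero_apply, add_zero],
      fun d => by rw [Pi.add_apply, emb_inr he, emb_inr he, Pi.zero_apply, zero_add],
      fun i hi => by rw [Pi.add_apply, supp_emb _ _ i hi, supp_emb _ _ i hi, add_zero]⟩
  have h3 : ∀ t : δ → ZMod p, a.2 ⬝ᵥ emb e 0 t = t ⬝ᵥ fun d => a.2 (e (Sum.inr d)) := by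
    intro t
    symm
    refine Fintype.sum_of_injective (fun d => e (Sum.inr d))
      (he.comp Sum.inr_injective) _ _ (fun i hi => ?_) fun d => ?_
    · have : emb e 0 t i = 0 := by
        by_cases hi' : i ∈ Set.range e
        · obtain ⟨k | d, rfl⟩ := hi'
          · rw [emb_inl he]; rfl
          · exact absurd ⟨d, rfl⟩ hi
        · exact supp_emb _ _ i hi'
      rw [this, mul_zero]
    · rw [emb_inr he, mul_comm]
  simp only [weyl_apply, h1, ite_and]
  by_cases hc : (∀ d, a.1 (e (Sum.inr d)) = 0) ∧ Supp e a.1 ∧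
      ∀ k, v k = v' k + a.1 (e (Sum.inl k))
  · simp only [if_pos hc.1, if_pos hc.2.1, if_pos hc.2.2]
    have h4 : ∀ t : δ → ZMod p,
        (ZMod.stdAddChar (2⁻¹ * (a.2 ⬝ᵥ a.1) + a.2 ⬝ᵥ emb e v' t) : ℂ) =
        ZMod.stdAddChar (2⁻¹ * (a.2 ⬝ᵥ a.1) + a.2 ⬝ᵥ emb e v' 0) *
          ZMod.stdAddChar (t ⬝ᵥ fun d => a.2 (e (Sum.inr d))) := fun t => by
      rw [h2, dotProduct_add, ← add_assoc, AddChar.map_add_eq_mul, h3]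
    rw [Finset.sum_congr rfl fun t _ => h4 t, ← Finset.mul_sum, char_sum_dotProduct]
    simp only [funext_iff, Pi.zero_apply, mul_ite, mul_zero]
    split_ifs
    exacts [mul_comm _ _, rfl]
  · have h5 : ∀ z : ℂ, (if ∀ d, a.1 (e (Sum.inr d)) = 0 then if Supp e a.1 then
        if ∀ k, v k = v' k + a.1 (e (Sum.inl k)) then z else 0 else 0 else 0) = 0 := fun z => by
      simp only [← ite_and]
      exact if_neg hc
    simp only [h5, Finset.sum_const_zero, ite_self]

-- This has the shape of `IsStabObj.exists_normal_form`: X components survive only on qupits that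
-- are kept and not dephased, Z components are excluded on `δ`, and the complement of the range is
-- projected to |0⟩.
open Classical in
theorem stdUp_stdDown_weyl (he : Function.Injective e) (a : Label p ι) :
    stdUp p e ct (stdDown p e ct (weyl a)) =
      if (∀ i, (∀ k, e (Sum.inl k) = i → ct k) → a.1 i = 0) ∧ ∀ d, a.2 (e (Sum.inr d)) = 0 then
        weyl a * Matrix.diagonal fun u => if Supp e u then 1 else 0
      else 0 := by
  have hp : ((p : ℂ) ^ Fintype.card δ) ≠ 0 :=
    pow_ne_zero _ (Nat.cast_ne_zero.2 (Fact.out : p.Prime).ne_zero)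
  ext u u'
  rw [stdUp_apply, stdDown_apply he, sum_weyl_emb he]
  by_cases ha : (∀ i, (∀ k, e (Sum.inl k) = i → ct k) → a.1 i = 0) ∧ ∀ d, a.2 (e (Sum.inr d)) = 0
  · rw [if_pos ha, Matrix.mul_diagonal]
    obtain ⟨ha1, ha2⟩ := ha
    have ha3 : ∀ d, a.1 (e (Sum.inr d)) = 0 := fun d =>
      ha1 _ fun k hk => absurd (he hk) (by simp)
    have ha4 : Supp e a.1 := fun i hi => ha1 i fun k hk => absurd ⟨_, hk⟩ hi
    have ha5 : ∀ k, ct k → a.1 (e (Sum.inl k)) = 0 := fun k hk => ha1 _ fun k' hk' => by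
      have := Sum.inl_injective (he hk')
      rwa [this]
    by_cases hu : u = u' + a.1 ∧ Supp e u'
    · obtain ⟨rfl, hu⟩ := hu
      have h0 : weyl a (emb e (fun k => (u' + a.1) (e (Sum.inl k))) 0)
          (emb e (fun k => u' (e (Sum.inl k))) 0) = weyl a (u' + a.1) u' := by
        rw [weyl_apply, weyl_apply, if_pos rfl, if_pos]
        · congr 2
          refine Finset.sum_congr rfl fun i _ => ?_
          by_cases hi : i ∈ Set.range e
          · obtain ⟨k | d, rfl⟩ := hi
            · rw [emb_inl he]
            · rw [ha2, zero_mul, zero_mul]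
          · rw [supp_emb _ _ i hi, hu i hi]
        · symm
          rw [eq_emb_iff he]
          exact ⟨fun k => by rw [Pi.add_apply, emb_inl he, Pi.add_apply],
            fun d => by rw [Pi.add_apply, emb_inr he, ha3, add_zero],
            fun i hi => by rw [Pi.add_apply, supp_emb _ _ i hi, ha4 i hi, add_zero]⟩
      have h1 : Supp e (u' + a.1) := fun i hi => by
        rw [Pi.add_apply, hu i hi, ha4 i hi, add_zero]
      have h2 : ∀ k, ct k → (u' + a.1) (e (Sum.inl k)) = u' (e (Sum.inl k)) := fun k hk => by
        rw [Pi.add_apply, ha5 k hk, add_zero]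
      rw [if_pos ⟨⟨h1, hu⟩, h2, fun d => by rw [Pi.add_apply, ha3, add_zero]⟩, if_pos h2,
        if_pos ⟨ha2, ha3, ha4, fun k => rfl⟩, h0, ← mul_assoc, inv_mul_cancel₀ hp, one_mul,
        if_pos hu, mul_one]
    · have h0 : weyl a u u' * (if Supp e u' then 1 else 0) = 0 := by
        rw [weyl_apply]
        split_ifs with h1 h2
        · exact absurd ⟨h1, h2⟩ hu
        all_goals simp
      rw [h0]
      split_ifs with h1 h2 h3
      · refine absurd ⟨?_, h1.1.2⟩ hu
        ext i
        by_cases hi : i ∈ Set.range e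
        · obtain ⟨k | d, rfl⟩ := hi
          · exact h3.2.2.2 k
          · rw [Pi.add_apply, ha3, add_zero, h1.2.2]
        · rw [Pi.add_apply, h1.1.1 i hi, h1.1.2 i hi, ha4 i hi, add_zero]
      all_goals simp
  · rw [if_neg ha, Matrix.zero_apply]
    split_ifs with h1 h2 h3
    · exfalso
      refine ha ⟨fun i hi => ?_, h3.1⟩
      by_cases hi' : i ∈ Set.range e
      · obtain ⟨k | d, rfl⟩ := hi'
        · have h4 := h3.2.2.2 k
          rw [h2 k (hi k rfl)] at h4
          simpa using h4
        · exact h3.2.1 d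
      · exact h3.2.2.1 i hi'
    all_goals simp

end Standard

/-! ### Nonzero objects are isomorphic to environments. -/

section Objects

set_option linter.unusedSectionVars false

variable {p : ℕ} [Fact p.Prime] [Fact (p ≠ 2)]
variable {Reg : Type u} [DecidableEq Reg]

theorem exists_env_of_finset [Infinite Reg] {ι : Type u} [Fintype ι] [DecidableEq ι]
    (A Q : Finset ι) :
    ∃ (Γ : Env Reg) (e : Γ.dom → ι), Function.Injective e ∧ (∀ i, i ∈ A ↔ ∃ r, e r = i) ∧
      ∀ r : Γ.dom, Γ.ty r = some .pit ↔ e r ∉ Q := by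
  classical
  obtain ⟨w, hw, -⟩ := exists_fresh (∅ : Finset Reg) ι
  let Γ : Env Reg :=
    { ty := fun r => if r ∈ (A ∩ Q).image w then some .qpit else
        if r ∈ A.image w then some .pit else none
      dom := A.image w
      mem_dom := fun r => by
        by_cases h1 : r ∈ (A ∩ Q).image w
        · have h2 := Finset.image_subset_image Finset.inter_subset_left h1
          simp only [if_pos h1, h2]; simp
        · by_cases h2 : r ∈ A.image w
          · simp only [if_neg h1, h2]; simp
          · simp only [if_neg h1, h2]; simp }
  have hΓ : ∀ r : Γ.dom, ∃ i ∈ A, w i = r.1 := fun r => Finset.mem_image.1 r.2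
  choose e heA hew using hΓ
  have hei : ∀ i (hi : i ∈ A), e ⟨w i, Finset.mem_image_of_mem w hi⟩ = i := fun i hi => hw (hew _)
  refine ⟨Γ, e, fun r s h => Subtype.ext (by rw [← hew, ← hew, h]),
    fun i => ⟨fun hi => ⟨_, hei i hi⟩, fun ⟨r, hr⟩ => hr ▸ heA r⟩, fun r => ?_⟩
  have h1 : r.1 ∈ (A ∩ Q).image w ↔ e r ∈ Q := by
    rw [Finset.mem_image]
    constructor
    · rintro ⟨i, hi, h⟩
      rw [← hew r] at h
      rw [← hw h]; exact (Finset.mem_inter.1 hi).2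
    · intro h; exact ⟨e r, Finset.mem_inter.2 ⟨heA r, h⟩, hew r⟩
  change (if r.1 ∈ (A ∩ Q).image w then some Ty.qpit else
    if r.1 ∈ A.image w then some Ty.pit else none) = _ ↔ _
  rw [if_congr h1 rfl (if_pos r.2)]
  by_cases h : e r ∈ Q <;> simp [h]

/-- A retract pair of completely positive stabiliser maps is an isomorphism of channels. -/
theorem isStabChan_of_inverse {ι κ : Type u} [Fintype ι] [DecidableEq ι] [Fintype κ]
    [DecidableEq κ] {x : SuperOp p ι ι} {y : SuperOp p κ κ} {Φ : SuperOp p ι κ}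
    {Ψ : SuperOp p κ ι} (hΦ : IsCPMStab p Φ) (hΨ : IsCPMStab p Ψ) (hx : Ψ ∘ₗ Φ = x)
    (hy : Φ ∘ₗ Ψ = y) (hyΦ : y ∘ₗ Φ = Φ) (hΨy : Ψ ∘ₗ y = Ψ)
    (hΨt : ∀ σ, (Ψ σ).trace = σ.trace) (hyt : ∀ σ, (y σ).trace = σ.trace) :
    IsStabChan p x y Φ ∧ IsStabChan p y x Ψ := by
  refine ⟨⟨hΦ, ?_, fun ρ => ?_⟩, ⟨hΨ, ?_, fun σ => ?_⟩⟩
  · rw [← hx, ← LinearMap.comp_assoc Φ Ψ Φ, hy, hyΦ, hyΦ]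
  · rw [← hx, LinearMap.comp_apply, hΨt]
  · rw [hΨy, ← hx, LinearMap.comp_assoc, hy, hΨy]
  · rw [hΨt, hyt]

/-- Every nonzero object of `StabChan_p` is isomorphic to the interpretation of an environment. -/
theorem IsStabObj.exists_iso_interp [Infinite Reg] {ι : Type u} [Fintype ι] [DecidableEq ι]
    {x : SuperOp p ι ι} (hx : IsStabObj p x) (h0 : x ≠ 0) :
    ∃ (Γ : Env Reg) (Φ : SuperOp p ι Γ.dom) (Ψ : SuperOp p Γ.dom ι),
        IsStabChan p x (Γ.interp p) Φ ∧ IsStabChan p (Γ.interp p) x Ψ ∧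
        Ψ ∘ₗ Φ = x ∧ Φ ∘ₗ Ψ = Γ.interp p := by
  classical
  obtain ⟨U, hU, Q, R, D, hQR, hQD, hRD, hnf⟩ := hx.exists_normal_form h0
  -- The environment keeps the qupits outside `R ∪ D`: those in `Q` as qpits, the others as pits.
  obtain ⟨Γ, e₀, he₀, hmem, hty⟩ := exists_env_of_finset (Reg := Reg) (R ∪ D)ᶜ Q
  let e : Γ.dom ⊕ {i // i ∈ D} → ι := Sum.elim e₀ Subtype.val
  let ct : Γ.dom → Prop := fun r => Γ.ty r = some .pit
  have he₀' : ∀ r, e₀ r ∉ R ∧ e₀ r ∉ D := fun r => by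
    have := (hmem _).2 ⟨r, rfl⟩
    simpa using this
  have he : Function.Injective e := he₀.sumElim Subtype.val_injective fun r d h =>
    (he₀' r).2 (h ▸ d.2)
  have hrange : ∀ i, i ∈ Set.range e ↔ i ∉ R := by
    intro i
    constructor
    · rintro ⟨r | d, rfl⟩
      · exact (he₀' r).1
      · exact Finset.disjoint_right.1 hRD d.2
    · intro hi
      by_cases hD : i ∈ D
      · exact ⟨Sum.inr ⟨i, hD⟩, rfl⟩
      · obtain ⟨r, hr⟩ := (hmem i).1 (by simp [hi, hD])
        exact ⟨Sum.inl r, hr⟩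
  have hsupp : ∀ u : ι → ZMod p, Supp e u ↔ ∀ i ∈ R, u i = 0 := fun u =>
    forall_congr' fun i => by rw [hrange, not_not]
  obtain ⟨A, hAc, hA⟩ : ∃ A : SuperOp p ι ι, IsCPMStab p A ∧ ∀ ρ, A ρ = U * ρ * Uᴴ :=
    ⟨_, isCPMStab_single (IsStab.clifford U hU), fun ρ => by simp [krausMap_apply]⟩
  obtain ⟨B, hBc, hB⟩ : ∃ B : SuperOp p ι ι, IsCPMStab p B ∧ ∀ ρ, B ρ = Uᴴ * ρ * U :=
    ⟨_, isCPMStab_single (IsStab.clifford U hU).adjoint, fun ρ => by simp [krausMap_apply]⟩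
  have hAB : A ∘ₗ B = LinearMap.id := by
    ext1 ρ
    rw [LinearMap.comp_apply, hA, hB, LinearMap.id_apply]
    have : U * (Uᴴ * ρ * U) * Uᴴ = (U * Uᴴ) * ρ * (U * Uᴴ) := by simp only [Matrix.mul_assoc]
    rw [this, hU.1, Matrix.one_mul, Matrix.mul_one]
  have hBA : B ∘ₗ A = LinearMap.id := by
    ext1 ρ
    rw [LinearMap.comp_apply, hA, hB, LinearMap.id_apply]
    have : Uᴴ * (U * ρ * Uᴴ) * U = (Uᴴ * U) * ρ * (Uᴴ * U) := by simp only [Matrix.mul_assoc]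
    rw [this, hU.2.1, Matrix.one_mul, Matrix.mul_one]
  -- After undoing the Clifford unitary, the normal form is compared with the standard retract on
  -- the Weyl basis.
  have hconj : B ∘ₗ x ∘ₗ A = stdUp p e ct ∘ₗ stdDown p e ct := by
    refine linearMap_ext_weyl fun a => ?_
    rw [LinearMap.comp_apply, LinearMap.comp_apply, hA, hB, hnf, LinearMap.comp_apply,
      stdUp_stdDown_weyl he]
    have h1 : (∀ i ∉ Q, a.1 i = 0) ↔ ∀ i, (∀ k, e (Sum.inl k) = i → ct k) → a.1 i = 0 := by
      refine forall_congr' fun i => imp_congr_left ⟨?_, fun h hi => ?_⟩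
      · rintro hi r rfl
        exact (hty r).2 hi
      · obtain ⟨r, rfl⟩ := (hmem i).1 (by
          simp [Finset.disjoint_left.1 hQR hi, Finset.disjoint_left.1 hQD hi])
        exact (hty r).1 (h r rfl) hi
    have h2 : (∀ i ∈ D, a.2 i = 0) ↔ ∀ d, a.2 (e (Sum.inr d)) = 0 := by
      rw [Subtype.forall]; rfl
    simp only [h1, h2, hsupp]
  have hdu : stdDown p e ct ∘ₗ stdUp p e ct = Γ.interp p := by
    ext ρ v u
    rw [LinearMap.comp_apply, stdDown_stdUp he, interp_apply]
    by_cases h : ∀ k, ct k → v k = u k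
    · exact (if_pos h).trans (if_pos h).symm
    · exact (if_neg h).trans (if_neg h).symm
  have hinterp : Γ.interp p ∘ₗ stdDown p e ct = stdDown p e ct := by
    ext ρ v u
    rw [LinearMap.comp_apply, interp_apply, stdDown_apply he]
    split_ifs <;> rfl
  have hup : stdUp p e ct ∘ₗ Γ.interp p = stdUp p e ct := by
    ext ρ v u
    rw [LinearMap.comp_apply, stdUp_apply, stdUp_apply]
    split_ifs with h
    · rw [interp_apply, if_pos h.2.1]
    · rfl
  have hdc := isCPMStab_stdDown (p := p) e ct
  have huc := isCPMStab_stdUp (p := p) e ct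
  have hut := stdUp_trace (p := p) (ct := ct) he
  generalize stdUp p e ct = F at *
  generalize stdDown p e ct = G at *
  have hx' : (A ∘ₗ F) ∘ₗ G ∘ₗ B = x := by
    rw [LinearMap.comp_assoc, ← LinearMap.comp_assoc B G F, ← hconj, LinearMap.comp_assoc,
      LinearMap.comp_assoc, hAB, LinearMap.comp_id, ← LinearMap.comp_assoc, hAB, LinearMap.id_comp]
  have hy' : (G ∘ₗ B) ∘ₗ A ∘ₗ F = Γ.interp p := by
    rw [LinearMap.comp_assoc, ← LinearMap.comp_assoc F A B, hBA, LinearMap.id_comp, hdu]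
  obtain ⟨h1, h2⟩ := isStabChan_of_inverse (hdc.comp hBc) (hAc.comp huc) hx' hy'
    (by rw [← LinearMap.comp_assoc, hinterp]) (by rw [LinearMap.comp_assoc, hup])
    (fun σ => by
      rw [LinearMap.comp_apply, hA, Matrix.mul_assoc, Matrix.trace_mul_comm, Matrix.mul_assoc,
        hU.2.1, Matrix.mul_one, hut])
    (interp_trace Γ)
  exact ⟨Γ, _, _, h1, h2, hx', hy'⟩

end Objects

end SPL

open SPL in
theorem mainTheorem9 (p : ℕ) [Fact p.Prime] (hp : p ≠ 2)
    (Reg : Type u) [DecidableEq Reg] [Infinite Reg] :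
    -- typed environments are interpreted as objects of `StabChan_p`
    (∀ Γ : Env Reg, IsStabObj p (Γ.interp p)) ∧
    -- soundness: every well-formed term yields a unique stabiliser channel, functorially
    (∀ (Γ Δ : Env Reg) (t : Term p Reg) (h : WF Γ t Δ),
      ∃! Φ : SuperOp p Γ.dom Δ.dom,
        IsStabChan p (Γ.interp p) (Δ.interp p) Φ ∧ Denotes h Φ) ∧
    (∀ Γ : Env Reg, Denotes (WF.atom (.skip Γ)) (Γ.interp p)) ∧
    (∀ (Γ Δ Θ : Env Reg) (c d : Term p Reg) (hc : WF Γ c Δ) (hd : WF Δ d Θ)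
      (Φ : SuperOp p Γ.dom Δ.dom) (Ψ : SuperOp p Δ.dom Θ.dom),
      Denotes hc Φ → Denotes hd Ψ → Denotes (WF.seq hc hd) (Ψ ∘ₗ Φ)) ∧
    -- soundness and completeness: observational equivalence is equality of stabiliser channels
    (∀ (Γ Δ : Env Reg) (c d : Term p Reg) (hc : WF Γ c Δ) (hd : WF Γ d Δ)
      (Φ Ψ : SuperOp p Γ.dom Δ.dom),
      IsStabChan p (Γ.interp p) (Δ.interp p) Φ → Denotes hc Φ →
      IsStabChan p (Γ.interp p) (Δ.interp p) Ψ → Denotes hd Ψ →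
      (ObsEquiv hc hd ↔ Φ = Ψ)) ∧
    -- universality: every stabiliser channel between environments is realised by a term
    (∀ (Γ Δ : Env Reg) (Φ : SuperOp p Γ.dom Δ.dom),
      IsStabChan p (Γ.interp p) (Δ.interp p) Φ →
      ∃ (t : Term p Reg) (h : WF Γ t Δ), Denotes h Φ) ∧
    -- and every nonzero object of `StabChan_p` is isomorphic to that of an environment
    (∀ (ι : Type u) [Fintype ι] [DecidableEq ι] (x : SuperOp p ι ι),
      IsStabObj p x → x ≠ 0 →
      ∃ (Γ : Env Reg) (Φ : SuperOp p ι Γ.dom) (Ψ : SuperOp p Γ.dom ι),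
        IsStabChan p x (Γ.interp p) Φ ∧ IsStabChan p (Γ.interp p) x Ψ ∧
        Ψ ∘ₗ Φ = x ∧ Φ ∘ₗ Ψ = Γ.interp p) := by
  have : Fact (p ≠ 2) := ⟨hp⟩
  exact ⟨isStabObj_interp, fun Γ Δ t h => exists_unique_denotes h, denotes_skip,
    fun Γ Δ Θ c d hc hd Φ Ψ hΦ hΨ => hΦ.seq hΨ,
    fun Γ Δ c d hc hd Φ Ψ hΦ hΦc hΨ hΨd => obsEquiv_iff hΦ hΦc hΨ hΨd,
    fun Γ Δ Φ hΦ => exists_denotes hΦ, fun ι _ _ x hx h0 => hx.exists_iso_interp h0⟩
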